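/- **Setting.** Let $X$ be a compact (Hausdorff) smooth manifold of real dimension $2n$, let $D\subset X$ be a closed smooth submanifold of dimension $k$, and let $(\omega',g',J')$ be a Kähler structure on $X\setminus D$. Let $s,t\in\mathbb R$ with $t>0$, and assume: 1. $g'$ and its Ricci tensor are bounded on $X\setminus D$ in the sup norm induced by $g'$ (so $|\mathrm{Ric}(u,u)|\le C\,g'(u,u)$ for a constant $C$). 2. Around each $p\in D$ there are local coordinates $(x_1,\dots,x_{2n})$ of $X$ in which $D=\{x_{k+1}=\dots=x_{2n}=0\}$ and, with $r=\big(\sum_{i>k}x_i^2\big)^{1/2}$, $\det(g'_{ij})=r^s+o(r^s)$ as $x\to p$, $x\notin D$. 3. Let $\mathcal S$ be the sphere bundle of the normal bundle $N=TX|_D/TD$, with projection $\pi$ to $D$. There are $\varepsilon>0$ and a smooth polar parametrization $T:\mathcal S\times[0,\varepsilon)\to U_\varepsilon$ onto an open neighbourhood $U_\varepsilon$ of $D$: the sets $T(\mathcal S\times[0,\delta))$, $0<\delta\le\varepsilon$, are open; $T(v,0)=\pi(v)$; $\partial_rT(v,0)$ represents a positive multiple of $v$ in $N$; and $T$ restricts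 to a diffeomorphism $\mathcal S\times(0,\varepsilon)\to U_\varepsilon\setminus D$. Moreover $T_*\frac{\partial}{\partial r}$ is $g'$-orthogonal to the hypersurfaces $D_r=T(\mathcal S\times\{r\})$, $0<r<\varepsilon$, and $\|T_*\frac{\partial}{\partial r}\|_{g'}=r^t+o(r^t)$ near each point of $D$. 4. $s>2t-2n+k+1$. Let $L_2'^{p,q}$ be the space of measurable complex $(p,q)$-forms $\alpha$ on $X\setminus D$ (for $J'$) with $\|\alpha\|_2'^2=\int_{X\setminus D}|\alpha|_{g'}^2\,d\Omega_{g'}<\infty$. Let $W_1'^{p,q}$ be the Sobolev space of $(p,q)$-forms on $X\setminus D$, i.e. the completion of the space of smooth $(p,q)$-forms on $X\setminus D$ of finite norm for $$\|\phi\|_{2,1}'=\|\phi\|_2'+\|\nabla_{g'}\phi\|_2',$$ where $\nabla_{g'}$ is the Levi-Civita connection; it is realized as the space of those $\alpha\in L_2'^{p,q}$ for which there are smooth $(p,q)$-forms $\phi_j$ on $X\setminus D$ such that $\phi_j\to\alpha$ and $\nabla_{g'}\phi_j\to\nabla_{g'}\alpha$ in $L^2$ with $\nabla_{g'}\alpha\in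 L^2$. **Lemma (compact Sobolev embedding).** For all $p,q\ge0$ the embedding $W_1'^{p,q}\hookrightarrow L_2'^{p,q}$ is bounded and compact: every sequence in $W_1'^{p,q}$ that is bounded in $\|\cdot\|_{2,1}'$ has a subsequence that converges in $L_2'^{p,q}$. -/

import Mathlib

open scoped Manifold ContDiff Topology ENNReal
open Set Filter MeasureTheory Bundle

noncomputable section

namespace SingularKahler

/-- The model space `ℝ^{2n}`. -/
abbrev E (n : ℕ) := EuclideanSpace ℝ (Fin (2 * n))

/-- The `i`-th standard basis vector of `ℝ^{2n}`. -/
def stdVec {n : ℕ} (i : Fin (2 * n)) : E n := EuclideanSpace.single i 1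

/-- Partial derivative `∂_i f (y)` of a function on `ℝ^{2n}`. -/
def pd {n : ℕ} {F : Type*} [NormedAddCommGroup F] [NormedSpace ℝ F]
    (i : Fin (2 * n)) (f : E n → F) (y : E n) : F := fderiv ℝ f y (stdVec i)

section Manifold

variable {n : ℕ} {X : Type*} [TopologicalSpace X] [ChartedSpace (E n) X]

/-- The part of the image of the chart `ψ` which corresponds to `X \ D`. -/
def chartDom (D : Set X) (ψ : OpenPartialHomeomorph X (E n)) : Set (E n) :=
  ψ.target ∩ ψ.symm ⁻¹' Dᶜ

/-- The coordinate vector field `∂/∂x_i` of the chart `ψ`, at the point with coordinates `y`. -/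
def frame (ψ : OpenPartialHomeomorph X (E n)) (y : E n) (i : Fin (2 * n)) :
    TangentSpace 𝓘(ℝ, E n) (ψ.symm y) :=
  mfderiv 𝓘(ℝ, E n) 𝓘(ℝ, E n) ψ.symm y (stdVec i : E n)

/-! ### Tensor calculus of a metric in a chart -/

variable (X) in
/-- A field of real bilinear forms on the tangent spaces. -/
abbrev BilinField :=
  ∀ x : X, TangentSpace 𝓘(ℝ, E n) x →L[ℝ] TangentSpace 𝓘(ℝ, E n) x →L[ℝ] ℝ

/-- The matrix `(h_{ij})` of a bilinear form in a chart. -/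
def coeff (h : BilinField (n := n) X) (ψ : OpenPartialHomeomorph X (E n)) (y : E n) :
    Matrix (Fin (2 * n)) (Fin (2 * n)) ℝ :=
  Matrix.of fun i j => h (ψ.symm y) (frame ψ y i) (frame ψ y j)

/-- Christoffel symbols of the Levi-Civita connection:
`Γ^a_{ij} = ½ g^{ab} (∂_i g_{bj} + ∂_j g_{bi} - ∂_b g_{ij})`. -/
def christoffel (g : BilinField (n := n) X) (ψ : OpenPartialHomeomorph X (E n))
    (a i j : Fin (2 * n)) (y : E n) : ℝ :=
  (1 / 2) * ∑ b, (coeff g ψ y)⁻¹ a b *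
    (pd i (fun z => coeff g ψ z b j) y + pd j (fun z => coeff g ψ z b i) y
      - pd b (fun z => coeff g ψ z i j) y)

/-- Ricci curvature in a chart:
`R_{ij} = ∂_a Γ^a_{ij} - ∂_j Γ^a_{ia} + Γ^a_{ab} Γ^b_{ij} - Γ^a_{jb} Γ^b_{ia}`. -/
def ricci (g : BilinField (n := n) X) (ψ : OpenPartialHomeomorph X (E n)) (y : E n) :
    Matrix (Fin (2 * n)) (Fin (2 * n)) ℝ :=
  Matrix.of fun i j =>
    (∑ a, (pd a (christoffel g ψ a i j) y - pd j (christoffel g ψ a i a) y))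
      + ∑ a, ∑ b, (christoffel g ψ a a b y * christoffel g ψ b i j y
          - christoffel g ψ a j b y * christoffel g ψ b i a y)

/-- A symmetric 2-tensor on `X \ D`, given by its matrices `A ψ y` in the charts `ψ`, is bounded in
the sup norm induced by `g`: `|A(u,u)| ≤ C g(u,u)`. -/
def SupBounded (g : BilinField (n := n) X) (D : Set X)
    (A : OpenPartialHomeomorph X (E n) → E n → Matrix (Fin (2 * n)) (Fin (2 * n)) ℝ) : Prop :=
  ∃ C : ℝ, ∀ ψ ∈ atlas (E n) X, ∀ y ∈ chartDom D ψ, ∀ u : Fin (2 * n) → ℝ,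
    |∑ i, ∑ j, A ψ y i j * u i * u j| ≤ C * ∑ i, ∑ j, coeff g ψ y i j * u i * u j

/-! ### Kähler structures on `X \ D` -/

variable (X) in
/-- A field of endomorphisms of the tangent spaces. -/
abbrev EndField :=
  ∀ x : X, TangentSpace 𝓘(ℝ, E n) x →L[ℝ] TangentSpace 𝓘(ℝ, E n) x

/-- `(g, J)` is a Kähler structure on `X \ D`, with Kähler form `ω(u,v) = g(Ju,v)`. The values of
`g` and `J` at the points of `D` play no role. -/
structure IsKahlerOff (D : Set X) (g : BilinField (n := n) X) (J : EndField (n := n) X) :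
    Prop where
  symm : ∀ x ∉ D, ∀ u v, g x u v = g x v u
  pos : ∀ x ∉ D, ∀ u, u ≠ 0 → 0 < g x u u
  smooth : ∀ ψ ∈ atlas (E n) X, ∀ i j,
    ContDiffOn ℝ ∞ (fun y => coeff g ψ y i j) (chartDom D ψ)
  sq : ∀ x ∉ D, ∀ u, J x (J x u) = -u
  hermitian : ∀ x ∉ D, ∀ u v, g x (J x u) (J x v) = g x u v
  /-- `J` is integrable: around each point of `X \ D` there are `J`-holomorphic coordinates. -/
  integrable : ∀ x ∉ D, ∃ z : OpenPartialHomeomorph X (Fin n → ℂ),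
    x ∈ z.source ∧ z.source ⊆ Dᶜ ∧
    ContMDiffOn 𝓘(ℝ, E n) 𝓘(ℝ, Fin n → ℂ) ∞ z z.source ∧
    ContMDiffOn 𝓘(ℝ, Fin n → ℂ) 𝓘(ℝ, E n) ∞ z.symm z.target ∧
    ∀ y ∈ z.source, ∀ u : TangentSpace 𝓘(ℝ, E n) y,
      mfderiv 𝓘(ℝ, E n) 𝓘(ℝ, Fin n → ℂ) z y (J y u) =
        Complex.I • @id (Fin n → ℂ) (mfderiv 𝓘(ℝ, E n) 𝓘(ℝ, Fin n → ℂ) z y u)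
  /-- `dω = 0`. -/
  closed : ∀ ψ ∈ atlas (E n) X, ∀ y ∈ chartDom D ψ, ∀ a i j,
    pd a (fun z => coeff (fun x => (g x).comp (J x)) ψ z i j) y
      + pd i (fun z => coeff (fun x => (g x).comp (J x)) ψ z j a) y
      + pd j (fun z => coeff (fun x => (g x).comp (J x)) ψ z a i) y = 0

/-! ### Submanifolds, the sphere bundle of the normal bundle, polar tubes -/

/-- `ψ` is a chart around `p` adapted to the `k`-dimensional submanifold `D`: inside its domain, `D`
is the zero set of the last `2n - k` coordinates. -/
def IsSliceChart (D : Set X) (k : ℕ) (p : X) (ψ : OpenPartialHomeomorph X (E n)) : Prop :=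
  ψ ∈ IsManifold.maximalAtlas 𝓘(ℝ, E n) ∞ X ∧ p ∈ ψ.source ∧
    ∀ x ∈ ψ.source, (x ∈ D ↔ ∀ i : Fin (2 * n), k ≤ i.val → ψ x i = 0)

/-- The distance `r` to `D` in the adapted chart: the Euclidean norm of the last `2n - k`
coordinates. -/
def normalRadius (k : ℕ) (y : E n) : ℝ :=
  Real.sqrt (∑ i : Fin (2 * n), if k ≤ i.val then y i ^ 2 else 0)

/-- The tangent space `T_p D`, as the set of velocities at `p` of curves in `D`. -/
def tangentTo (D : Set X) (p : X) : Set (E n) :=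
  {w | ∃ γ : ℝ → X, γ 0 = p ∧ (∀ᶠ τ in 𝓝 0, γ τ ∈ D) ∧
    MDifferentiableAt 𝓘(ℝ, ℝ) 𝓘(ℝ, E n) γ 0 ∧
    (mfderiv 𝓘(ℝ, ℝ) 𝓘(ℝ, E n) γ 0 (1 : ℝ) : E n) = w}

/-- The sphere bundle of the normal bundle of `D`, where the normal space `T_p X / T_p D` is
identified with the orthogonal complement of `T_p D` for the auxiliary smooth metric `g₀`. -/
def normalSphere [IsManifold 𝓘(ℝ, E n) ∞ X] (D : Set X)
    (g₀ : ContMDiffRiemannianMetric 𝓘(ℝ, E n) ∞ (E n)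
      (fun x : X => TangentSpace 𝓘(ℝ, E n) x)) :
    Set (TangentBundle 𝓘(ℝ, E n) X) :=
  {v | v.proj ∈ D ∧ g₀.inner v.proj v.snd v.snd = 1 ∧
    ∀ w ∈ tangentTo (n := n) D v.proj, g₀.inner v.proj v.snd w = 0}

/-- The vector `T_* (∂/∂r)` at the point `T (v, r)`; at `r = 0` the derivative is one-sided. -/
def radialVec (T : TangentBundle 𝓘(ℝ, E n) X → ℝ → X)
    (v : TangentBundle 𝓘(ℝ, E n) X) (r : ℝ) : E n :=
  mfderivWithin 𝓘(ℝ, ℝ) 𝓘(ℝ, E n) (T v) (Ici 0) r (1 : ℝ)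

/-- `T : S × [0, ε) → U` is a polar parametrization of a neighbourhood `U` of `D`, where `S` is the
sphere bundle of the normal bundle of `D`. The map `F` is the smooth inverse of the restriction
`S × (0, ε) → U \ D`; so `(F x).2` is the coordinate `r` at `x`. -/
structure IsPolarTube [IsManifold 𝓘(ℝ, E n) ∞ X] (D : Set X)
    (S : Set (TangentBundle 𝓘(ℝ, E n) X)) (ε : ℝ)
    (T : TangentBundle 𝓘(ℝ, E n) X → ℝ → X)
    (F : X → TangentBundle 𝓘(ℝ, E n) X × ℝ) (U : Set X) : Prop where
  eps_pos : 0 < ε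
  smooth : ContMDiffOn (𝓘(ℝ, E n).tangent.prod 𝓘(ℝ, ℝ)) 𝓘(ℝ, E n) ∞
    (fun q : TangentBundle 𝓘(ℝ, E n) X × ℝ => T q.1 q.2) (S ×ˢ Ico 0 ε)
  onto : (fun q : TangentBundle 𝓘(ℝ, E n) X × ℝ => T q.1 q.2) '' (S ×ˢ Ico 0 ε) = U
  /-- The sets `{r < δ}` are open neighbourhoods of `D`. -/
  isOpen : ∀ δ ∈ Ioc 0 ε,
    IsOpen ((fun q : TangentBundle 𝓘(ℝ, E n) X × ℝ => T q.1 q.2) '' (S ×ˢ Ico 0 δ))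
  subset : D ⊆ U
  zero : ∀ v ∈ S, T v 0 = v.proj
  /-- The ray `r ↦ T (v, r)` leaves `D` in the normal direction `v ∈ T_p X / T_p D`. -/
  direction : ∀ v ∈ S, ∃ c : ℝ, 0 < c ∧
    radialVec T v 0 - c • @id (E n) v.snd ∈ tangentTo (n := n) D v.proj
  left_inv : ∀ v ∈ S, ∀ r ∈ Ioo 0 ε, T v r ∈ U \ D ∧ F (T v r) = (v, r)
  right_inv : ∀ x ∈ U \ D, F x ∈ S ×ˢ Ioo 0 ε ∧ T (F x).1 (F x).2 = x
  smooth_inv : ContMDiffOn 𝓘(ℝ, E n) (𝓘(ℝ, E n).tangent.prod 𝓘(ℝ, ℝ)) ∞ F (U \ D)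

/-- A singular Kähler manifold: a smooth manifold `X` of dimension `2n`, a closed submanifold `D` of
dimension `k`, and a Kähler structure on `X \ D` with prescribed asymptotics (with exponents `s` and
`t`) along `D`. -/
structure IsSingularKahler [IsManifold 𝓘(ℝ, E n) ∞ X] (D : Set X) (k : ℕ) (s t : ℝ)
    (g : BilinField (n := n) X) (J : EndField (n := n) X) : Prop where
  isClosed : IsClosed D
  submanifold : ∀ p ∈ D, ∃ ψ : OpenPartialHomeomorph X (E n), IsSliceChart D k p ψ
  kahler : IsKahlerOff D g J
  metric_bounded : SupBounded g D (coeff g)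
  ricci_bounded : SupBounded g D (ricci g)
  /-- In suitable adapted coordinates around each `p ∈ D`, `det g = r^s + o(r^s)`. -/
  det_asymptotics : ∀ p ∈ D, ∃ ψ : OpenPartialHomeomorph X (E n), IsSliceChart D k p ψ ∧
    (fun x => (coeff g ψ (ψ x)).det - normalRadius k (ψ x) ^ s)
      =o[𝓝[Dᶜ] p] (fun x => normalRadius k (ψ x) ^ s)
  /-- There is a polar tube for which `∂/∂r` is orthogonal to the hypersurfaces `r = const` and has
  length `r^t + o(r^t)`. -/
  tube : ∃ (g₀ : ContMDiffRiemannianMetric 𝓘(ℝ, E n) ∞ (E n)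
        (fun x : X => TangentSpace 𝓘(ℝ, E n) x))
      (ε : ℝ) (T : TangentBundle 𝓘(ℝ, E n) X → ℝ → X)
      (F : X → TangentBundle 𝓘(ℝ, E n) X × ℝ) (U : Set X),
    IsPolarTube D (normalSphere D g₀) ε T F U ∧
    (∀ v ∈ normalSphere D g₀, ∀ r ∈ Ioo 0 ε, ∀ w : TangentSpace 𝓘(ℝ, E n) (T v r),
      mfderiv 𝓘(ℝ, E n) 𝓘(ℝ, ℝ) (fun x => (F x).2) (T v r) w = (0 : ℝ) →
        g (T v r) (radialVec T v r) w = 0) ∧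
    (∀ p ∈ D,
      (fun x => Real.sqrt (g (T (F x).1 (F x).2)
          (radialVec T (F x).1 (F x).2) (radialVec T (F x).1 (F x).2)) - (F x).2 ^ t)
        =o[𝓝[Dᶜ] p] (fun x => (F x).2 ^ t))
  t_pos : 0 < t
  exponents : 2 * t - 2 * n + k + 1 < s

/-! ### Volume -/

/-- The Riemannian volume of `(X \ D, g)` inside the domain of one chart: the image under `ψ⁻¹` of
`√(det g_{ij}) dx`. -/
def chartVolume [MeasurableSpace X] (D : Set X) (g : BilinField (n := n) X)
    (ψ : OpenPartialHomeomorph X (E n)) : Measure X :=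
  Measure.map ψ.symm ((volume.restrict (chartDom D ψ)).withDensity
    fun y => ENNReal.ofReal (Real.sqrt (coeff g ψ y).det))

/-- The Riemannian volume measure of `(X \ D, g)` (with `D` a null set): the least measure that
dominates the measures `chartVolume`, which are its restrictions to the chart domains. -/
def vol [MeasurableSpace X] (D : Set X) (g : BilinField (n := n) X) : Measure X :=
  ⨆ ψ ∈ atlas (E n) X, chartVolume D g ψ

/-! ### Differential forms -/

variable (n X) in
/-- Complex-valued differential forms of degree `m` (no regularity assumed). -/
abbrev Form (m : ℕ) := ∀ x : X, TangentSpace 𝓘(ℝ, E n) x [⋀^Fin m]→L[ℝ] ℂ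

variable (n X) in
/-- Sections of `T^*X ⊗ Λ^m` (no regularity assumed). -/
abbrev CoForm (m : ℕ) :=
  ∀ x : X, TangentSpace 𝓘(ℝ, E n) x →L[ℝ] (TangentSpace 𝓘(ℝ, E n) x [⋀^Fin m]→L[ℝ] ℂ)

/-- The complex subspace of `m`-forms of type `(p, q)`, `m = p + q`, at a point with complex
structure `J`: the span of the products `a_1 ∧ … ∧ a_p ∧ b_1 ∧ … ∧ b_q`, where the covectors `a_i`
are `J`-linear and the `b_j` are `J`-antilinear. -/
def IsTypeAt {V : Type*} [AddCommGroup V] [Module ℝ V] [TopologicalSpace V]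
    (J : V →L[ℝ] V) (p q : ℕ) (φ : V [⋀^Fin (p + q)]→L[ℝ] ℂ) : Prop :=
  (fun v => φ v) ∈ Submodule.span ℂ {f : (Fin (p + q) → V) → ℂ |
    ∃ (a : Fin p → V →L[ℝ] ℂ) (b : Fin q → V →L[ℝ] ℂ),
      (∀ i u, a i (J u) = Complex.I * a i u) ∧ (∀ j u, b j (J u) = -Complex.I * b j u) ∧
      f = fun v => Matrix.det (Matrix.of fun i j => Fin.append a b i (v j))}

/-- `φ` is of type `(p, q)` on `X \ D`. -/
def IsType (D : Set X) (J : EndField (n := n) X) (p q : ℕ) (φ : Form n X (p + q)) : Prop :=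
  ∀ x ∉ D, IsTypeAt (J x) p q (φ x)

/-- The components `φ_I` of a form in a chart. -/
def Form.comp {m : ℕ} (φ : Form n X m) (ψ : OpenPartialHomeomorph X (E n)) (I : Fin m → Fin (2 * n))
    (y : E n) : ℂ :=
  φ (ψ.symm y) fun l => frame ψ y (I l)

/-- The components `β_{i,I}` of a section of `T^*X ⊗ Λ^m` in a chart, indexed by the multi-index
`(i, I)`. -/
def CoForm.comp {m : ℕ} (β : CoForm n X m) (ψ : OpenPartialHomeomorph X (E n))
    (I : Fin (m + 1) → Fin (2 * n)) (y : E n) : ℂ :=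
  β (ψ.symm y) (frame ψ y (I 0)) fun l => frame ψ y (I l.succ)

/-- The components of the covariant derivative of a form for the Levi-Civita connection of `g`:
`(∇φ)_{i,I} = ∂_i φ_I - ∑_l Γ^a_{i I_l} φ_{I_1 … a … I_m}`. -/
def nablaComp (g : BilinField (n := n) X) {m : ℕ} (φ : Form n X m)
    (ψ : OpenPartialHomeomorph X (E n)) (I : Fin (m + 1) → Fin (2 * n)) (y : E n) : ℂ :=
  pd (I 0) (φ.comp ψ (Fin.tail I)) y
    - ∑ l : Fin m, ∑ a, (christoffel g ψ a (I 0) (I l.succ) y : ℂ) *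
        φ.comp ψ (Function.update (Fin.tail I) l a) y

/-- The squared norm `∑ g^{I_1 J_1} ⋯ g^{I_m J_m} A_I \bar A_J` of a covariant tensor with
components `A` with respect to a frame with Gram matrix `G`. -/
def tensorNormSq (G : Matrix (Fin (2 * n)) (Fin (2 * n)) ℝ) {m : ℕ}
    (A : (Fin m → Fin (2 * n)) → ℂ) : ℝ :=
  (∑ I, ∑ J, ((∏ l, G⁻¹ (I l) (J l) : ℝ) : ℂ) * (A I * (starRingEnd ℂ) (A J))).re

/-- The pointwise squared norm of an `m`-form, `|φ|² dvol = φ ∧ * \bar φ`; it is computed in the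
preferred chart at the point. -/
def Form.normSq (g : BilinField (n := n) X) {m : ℕ} (φ : Form n X m) (x : X) : ℝ :=
  tensorNormSq (coeff g (chartAt (E n) x) (chartAt (E n) x x))
    (fun I => φ.comp (chartAt (E n) x) I (chartAt (E n) x x)) / m.factorial

/-- The pointwise squared norm of a section of `T^*X ⊗ Λ^m`. -/
def CoForm.normSq (g : BilinField (n := n) X) {m : ℕ} (β : CoForm n X m) (x : X) : ℝ :=
  tensorNormSq (coeff g (chartAt (E n) x) (chartAt (E n) x x))
    (fun I => β.comp (chartAt (E n) x) I (chartAt (E n) x x)) / m.factorial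

/-- The pointwise squared norm of `∇φ - β`. -/
def nablaSubNormSq (g : BilinField (n := n) X) {m : ℕ} (φ : Form n X m) (β : CoForm n X m)
    (x : X) : ℝ :=
  tensorNormSq (coeff g (chartAt (E n) x) (chartAt (E n) x x))
    (fun I => nablaComp g φ (chartAt (E n) x) I (chartAt (E n) x x)
      - β.comp (chartAt (E n) x) I (chartAt (E n) x x)) / m.factorial

/-- `φ` is smooth on `X \ D`. -/
def Form.SmoothOff (D : Set X) {m : ℕ} (φ : Form n X m) : Prop :=
  ∀ ψ ∈ atlas (E n) X, ∀ I, ContDiffOn ℝ ∞ (φ.comp ψ I) (chartDom D ψ)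

/-- `φ` is measurable on `X \ D`. -/
def Form.MeasurableOff (D : Set X) {m : ℕ} (φ : Form n X m) : Prop :=
  ∀ ψ ∈ atlas (E n) X, ∀ I, AEStronglyMeasurable (φ.comp ψ I) (volume.restrict (chartDom D ψ))

/-- `β` is measurable on `X \ D`. -/
def CoForm.MeasurableOff (D : Set X) {m : ℕ} (β : CoForm n X m) : Prop :=
  ∀ ψ ∈ atlas (E n) X, ∀ I, AEStronglyMeasurable (β.comp ψ I) (volume.restrict (chartDom D ψ))

/-! ### The spaces `L'_2^{p,q}` and `W'_1^{p,q}` -/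

variable [MeasurableSpace X]

/-- The square root of the integral over `X \ D` of a nonnegative function. -/
def l2 (D : Set X) (g : BilinField (n := n) X) (f : X → ℝ) : ℝ≥0∞ :=
  (∫⁻ x, ENNReal.ofReal (f x) ∂(vol D g)) ^ (1 / 2 : ℝ)

/-- The norm of `L'_2` on forms. -/
def l2Norm (D : Set X) (g : BilinField (n := n) X) {m : ℕ} (φ : Form n X m) : ℝ≥0∞ :=
  l2 D g (φ.normSq g)

/-- The space `L'_2^{p,q}` of square integrable `(p,q)`-forms on `X \ D`. -/
def L2Forms (D : Set X) (g : BilinField (n := n) X) (J : EndField (n := n) X) (p q : ℕ) :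
    Set (Form n X (p + q)) :=
  {α | α.MeasurableOff D ∧ IsType D J p q α ∧ l2Norm D g α < ⊤}

/-- `β = ∇α` in the sense of Sobolev spaces: `β` is square integrable, and there are smooth
`(p,q)`-forms `φ_j` on `X \ D` such that `φ_j → α` and `∇φ_j → β` in `L²`. -/
def HasSobolevDeriv (D : Set X) (g : BilinField (n := n) X) (J : EndField (n := n) X) (p q : ℕ)
    (α : Form n X (p + q)) (β : CoForm n X (p + q)) : Prop :=
  β.MeasurableOff D ∧ l2 D g (β.normSq g) < ⊤ ∧
    ∃ φ : ℕ → Form n X (p + q),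
      (∀ j, (φ j).SmoothOff D ∧ IsType D J p q (φ j)) ∧
      Tendsto (fun j => l2Norm D g (φ j - α)) atTop (𝓝 0) ∧
      Tendsto (fun j => l2 D g (nablaSubNormSq g (φ j) β)) atTop (𝓝 0)

/-- The Sobolev space `W'_1^{p,q}` of `(p,q)`-forms on `X \ D`: the completion of the space of smooth
forms of finite norm `‖φ‖ + ‖∇φ‖`, realized as a space of square integrable forms. -/
def SobolevForms (D : Set X) (g : BilinField (n := n) X) (J : EndField (n := n) X) (p q : ℕ) :
    Set (Form n X (p + q)) :=
  {α | α ∈ L2Forms D g J p q ∧ ∃ β, HasSobolevDeriv D g J p q α β}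

/-- The norm `‖α‖ + ‖∇α‖` of `W'_1^{p,q}`. (The derivative `β = ∇α` is unique almost everywhere, so
that the infimum is over a single value.) -/
def sobolevNorm (D : Set X) (g : BilinField (n := n) X) (J : EndField (n := n) X) (p q : ℕ)
    (α : Form n X (p + q)) : ℝ≥0∞ :=
  l2Norm D g α + ⨅ (β : CoForm n X (p + q)) (_ : HasSobolevDeriv D g J p q α β),
    l2 D g (β.normSq g)

end Manifold

end SingularKahler

end

open scoped Manifold ContDiff Topology ENNReal
open Set Filter MeasureTheory Bundle

noncomputable section

namespace SingularKahler

set_option linter.unusedSectionVars false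
set_option linter.deprecated false

/-! Compactness is proved in the following quantitative form, `NormCompactOn`. For every `η > 0`
there are finitely many linear functionals `ℓ`, bounded in the Sobolev norm, such that `‖φ‖² ≤ A ∑
|ℓ φ|² + η (‖φ‖² + ‖∇φ‖²)` for all smooth `φ` on `X \ D`. If this holds with the `L²` norm taken
over all of `X`, then a sequence of smooth forms of bounded energy has a subsequence along which all
the countably many functionals belonging to `η = 1/(k+1)` converge, and the estimate makes that
subsequence Cauchy in `L²` (`NormCompactOn.exists_cauchy_subseq`). General Sobolev forms are
replaced by nearby smooth forms (`exists_smooth_approx`), and `L²` of `(p,q)`-forms is complete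
(`exists_l2_limit`).

On a compact subset of `X \ D` the estimate is Rellich's theorem: it is covered by small cubes in
charts, where the Riemannian and the Euclidean norms are comparable. The Poincaré inequality on the
cells of a fine grid then bounds the `L²` norm by the integrals of the components over the cells and
a small multiple of the energy (`normCompactOn_cube`, `normCompactOn_of_isCompact`).

Near `D` the `L²` norm on a thin tube `r < τ` is bounded by the `L²` norm outside the tube plus `C
τ` times the energy (`exists_tube_estimate`). Three facts carry this. Along a ray, `|d/dr |φ|²| ≤
|φ|² + |∂_r|² |∇φ|²`, because the Levi-Civita connection is metric (`hasDerivAt_normSq_comp`); and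
`|∂_r| ≤ 2 r^t ≤ 2` for small `r`, as `t > 0`. Next, in polar coordinates the volume is comparable
to `r^(s/2 + 2n - k - 1) dr dθ dx`, and the condition on `s` makes this exponent nonnegative in
positive codimension. The weight therefore increases with `r`, so that integrating the derivative of
`|φ|²` from `ρ` to `ρ + τ` moves the norm from `0 < r < τ` to `τ < r < 2τ`
(`lintegral_rpow_transport`). Since `C` does not depend on `τ`, a small `τ` makes the error small,
and what remains lives on the compact complement of the tube.

The comparison of volumes needs control of the tube at `r = 0`. In an adapted chart it becomes a map
`Z ((x, y), ρ)` that depends only on the direction of `y`, with `Z ((x, y), 0) = (x, 0)` and with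
initial velocity whose normal part is a positive multiple of an injective linear image of `y`. The
differential of `(x, y) ↦ Z ((x, y), ‖y‖)` has an injective limit as `y` tends to `0` in a fixed
direction (`exists_tendsto_polarDeriv`). Compactness of the sphere of directions then bounds its
Jacobian above and away from zero (`exists_bounds`). -/

/-! ### Linear algebra of covariant tensors in components -/

section TensorAlgebra

variable {n m : ℕ}

/-- The action of a matrix on all the slots of a covariant tensor. -/
def act (B : Matrix (Fin (2 * n)) (Fin (2 * n)) ℝ) (A : (Fin m → Fin (2 * n)) → ℂ) :
    (Fin m → Fin (2 * n)) → ℂ :=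
  fun K => ∑ I, ((∏ l, B (K l) (I l) : ℝ) : ℂ) * A I

lemma prod_mul_apply (B C : Matrix (Fin (2 * n)) (Fin (2 * n)) ℝ) (K J : Fin m → Fin (2 * n)) :
    ∏ l, (B * C) (K l) (J l) = ∑ I : Fin m → Fin (2 * n), (∏ l, B (K l) (I l)) * ∏ l, C (I l) (J l) := by
  simp only [Matrix.mul_apply, Finset.prod_univ_sum, Fintype.piFinset_univ, Finset.prod_mul_distrib]

lemma act_mul (B C : Matrix (Fin (2 * n)) (Fin (2 * n)) ℝ) (A : (Fin m → Fin (2 * n)) → ℂ) :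
    act (B * C) A = act B (act C A) := by
  ext K
  simp only [act, prod_mul_apply, Complex.ofReal_sum, Complex.ofReal_mul, Finset.sum_mul,
    Finset.mul_sum]
  rw [Finset.sum_comm]
  simp only [mul_assoc]

lemma prod_one_apply (K I : Fin m → Fin (2 * n)) :
    ∏ l, (1 : Matrix (Fin (2 * n)) (Fin (2 * n)) ℝ) (K l) (I l) = if K = I then 1 else 0 := by
  split_ifs with h
  · subst h; simp
  · obtain ⟨l, hl⟩ := Function.ne_iff.1 h
    exact Finset.prod_eq_zero (Finset.mem_univ l) (by simp [hl])

lemma act_one (A : (Fin m → Fin (2 * n)) → ℂ) : act 1 A = A := by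
  ext K
  simp only [act, prod_one_apply]
  rw [Finset.sum_eq_single K (fun b _ hb => by simp [hb.symm]) (by simp)]
  simp

lemma act_add (B : Matrix (Fin (2 * n)) (Fin (2 * n)) ℝ) (A A' : (Fin m → Fin (2 * n)) → ℂ) :
    act B (A + A') = act B A + act B A' := by
  ext K; simp [act, mul_add, Finset.sum_add_distrib]

-- The positive matrix `G⁻¹` has the form `B* B` in the C*-algebra of matrices. The matrix `B`
-- passes to an orthonormal frame, in which the norm of tensors is Euclidean.
open scoped MatrixOrder Matrix.Norms.L2Operator in
lemma inv_eq_of_posDef {G : Matrix (Fin (2 * n)) (Fin (2 * n)) ℝ} (hG : G.PosDef) :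
    ∃ B : Matrix (Fin (2 * n)) (Fin (2 * n)) ℝ, IsUnit B.det ∧ G⁻¹ = B.transpose * B := by
  obtain ⟨B, hB⟩ := CStarAlgebra.nonneg_iff_eq_star_mul_self.1 hG.inv.posSemidef.nonneg
  rw [Matrix.star_eq_conjTranspose, Matrix.conjTranspose_eq_transpose_of_trivial] at hB
  refine ⟨B, ?_, hB⟩
  have h := hG.inv.isUnit
  rw [hB, Matrix.isUnit_iff_isUnit_det, Matrix.det_mul, Matrix.det_transpose] at h
  exact isUnit_of_mul_isUnit_left h

/-- Positivity, definiteness, the quasi-triangle inequality and invariance under change of frame are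
all read off from this sum of squares. -/
lemma tensorNormSq_eq_sum {G B : Matrix (Fin (2 * n)) (Fin (2 * n)) ℝ}
    (hB : G⁻¹ = B.transpose * B) (A : (Fin m → Fin (2 * n)) → ℂ) :
    tensorNormSq G A = ∑ K, Complex.normSq (act B A K) := by
  have h : ∀ K, (Complex.normSq (act B A K) : ℝ) = (∑ I, ∑ J,
      (((∏ l, B (K l) (I l)) * (∏ l, B (K l) (J l)) : ℝ) : ℂ) *
        (A I * (starRingEnd ℂ) (A J))).re := by
    intro K
    rw [← Complex.ofReal_re (Complex.normSq _), ← Complex.mul_conj]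
    simp only [act, map_sum, map_mul, Complex.conj_ofReal, Finset.sum_mul_sum]
    congr 1
    refine Finset.sum_congr rfl fun I _ => Finset.sum_congr rfl fun J _ => ?_
    push_cast; ring
  simp only [h, tensorNormSq]
  rw [← Complex.re_sum]
  congr 1
  symm
  rw [Finset.sum_comm]
  refine Finset.sum_congr rfl fun I _ => ?_
  rw [Finset.sum_comm]
  refine Finset.sum_congr rfl fun J _ => ?_
  rw [← Finset.sum_mul]
  congr 1
  rw [hB, prod_mul_apply]
  push_cast [Matrix.transpose_apply]
  rfl

lemma tensorNormSq_nonneg {G : Matrix (Fin (2 * n)) (Fin (2 * n)) ℝ} (hG : G.PosDef)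
    (A : (Fin m → Fin (2 * n)) → ℂ) : 0 ≤ tensorNormSq G A := by
  obtain ⟨B, -, hB⟩ := inv_eq_of_posDef hG
  rw [tensorNormSq_eq_sum hB]
  exact Finset.sum_nonneg fun _ _ => Complex.normSq_nonneg _

lemma tensorNormSq_pos {G : Matrix (Fin (2 * n)) (Fin (2 * n)) ℝ} (hG : G.PosDef)
    {A : (Fin m → Fin (2 * n)) → ℂ} (hA : A ≠ 0) : 0 < tensorNormSq G A := by
  obtain ⟨B, hu, hB⟩ := inv_eq_of_posDef hG
  refine (tensorNormSq_nonneg hG A).lt_of_ne fun h => hA ?_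
  rw [tensorNormSq_eq_sum hB, eq_comm,
    Finset.sum_eq_zero_iff_of_nonneg fun _ _ => Complex.normSq_nonneg _] at h
  have h0 : act B A = 0 := by
    ext K; exact Complex.normSq_eq_zero.1 (h K (Finset.mem_univ _))
  rw [← act_one A, ← Matrix.nonsing_inv_mul B hu, act_mul, h0]
  ext K; simp [act]

lemma tensorNormSq_smul (G : Matrix (Fin (2 * n)) (Fin (2 * n)) ℝ) (c : ℂ)
    (A : (Fin m → Fin (2 * n)) → ℂ) :
    tensorNormSq G (c • A) = Complex.normSq c * tensorNormSq G A := by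
  have : ∀ z : ℂ, Complex.normSq c * z.re = ((Complex.normSq c : ℂ) * z).re := fun z => by simp
  simp only [tensorNormSq, this, ← Complex.mul_conj, Finset.mul_sum, Pi.smul_apply, smul_eq_mul,
    map_mul]
  congr 1
  exact Finset.sum_congr rfl fun I _ => Finset.sum_congr rfl fun J _ => by ring

lemma normSq_add_le_two (a b : ℂ) :
    Complex.normSq (a + b) ≤ 2 * Complex.normSq a + 2 * Complex.normSq b := by
  simp only [Complex.normSq_apply, Complex.add_re, Complex.add_im]
  nlinarith [sq_nonneg (a.re - b.re), sq_nonneg (a.im - b.im)]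

lemma tensorNormSq_add_le {G : Matrix (Fin (2 * n)) (Fin (2 * n)) ℝ} (hG : G.PosDef)
    (A A' : (Fin m → Fin (2 * n)) → ℂ) :
    tensorNormSq G (A + A') ≤ 2 * tensorNormSq G A + 2 * tensorNormSq G A' := by
  obtain ⟨B, -, hB⟩ := inv_eq_of_posDef hG
  simp only [tensorNormSq_eq_sum hB, act_add, Finset.mul_sum, ← Finset.sum_add_distrib]
  exact Finset.sum_le_sum fun K _ => normSq_add_le_two _ _

lemma tensorNormSq_neg (G : Matrix (Fin (2 * n)) (Fin (2 * n)) ℝ)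
    (A : (Fin m → Fin (2 * n)) → ℂ) : tensorNormSq G (-A) = tensorNormSq G A := by
  simp [tensorNormSq]

/-- Invariance of the norm under a change of frame. -/
lemma tensorNormSq_change {G P : Matrix (Fin (2 * n)) (Fin (2 * n)) ℝ} (hG : G.PosDef)
    (hP : IsUnit P.det) (A : (Fin m → Fin (2 * n)) → ℂ) :
    tensorNormSq (P.transpose * G * P) (act P.transpose A) = tensorNormSq G A := by
  obtain ⟨B, -, hB⟩ := inv_eq_of_posDef hG
  have hPt : IsUnit P.transpose.det := by rwa [Matrix.det_transpose]
  -- If `B` passes to an orthonormal frame for `G`, then `B (Pᵀ)⁻¹` does so for the new Gram matrix,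
  -- and it undoes the action of `Pᵀ` on components.
  have h : (P.transpose * G * P)⁻¹ =
      (B * (P.transpose)⁻¹).transpose * (B * (P.transpose)⁻¹) := by
    rw [Matrix.mul_inv_rev, Matrix.mul_inv_rev, hB, Matrix.transpose_mul,
      Matrix.transpose_nonsing_inv, Matrix.transpose_transpose]
    simp only [Matrix.mul_assoc]
  rw [tensorNormSq_eq_sum h, tensorNormSq_eq_sum hB, ← act_mul, Matrix.mul_assoc,
    Matrix.nonsing_inv_mul _ hPt, Matrix.mul_one]

/-- The contraction of the first slot of a tensor with a vector. -/
def contract (w : Fin (2 * n) → ℝ) (A : (Fin (m + 1) → Fin (2 * n)) → ℂ) :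
    (Fin m → Fin (2 * n)) → ℂ :=
  fun I => ∑ i, (w i : ℂ) * A (Fin.cons i I)

/-- The vector changes by the inverse of the matrix acting on the covariant slots, so that
contraction does not depend on the frame. -/
lemma act_contract (B : Matrix (Fin (2 * n)) (Fin (2 * n)) ℝ) (hB : IsUnit B.det)
    (w : Fin (2 * n) → ℝ) (A : (Fin (m + 1) → Fin (2 * n)) → ℂ) :
    act B (contract w A) = contract (Matrix.vecMul w B⁻¹) (act B A) := by
  ext K
  have h : ∀ i, w i = ∑ k, Matrix.vecMul w B⁻¹ k * B k i := fun i => by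
    have : Matrix.vecMul (Matrix.vecMul w B⁻¹) B i = w i := by
      rw [Matrix.vecMul_vecMul, Matrix.nonsing_inv_mul _ hB, Matrix.vecMul_one]
    rw [← this]; rfl
  have h2 : ∀ k, act B A (Fin.cons k K) =
      ∑ i, ∑ I : Fin m → Fin (2 * n), ((B k i : ℝ) : ℂ) * ((∏ l, B (K l) (I l) : ℝ) : ℂ) *
        A (Fin.cons i I) := by
    intro k
    rw [act, ← (Fin.consEquiv fun _ : Fin (m + 1) => Fin (2 * n)).sum_comp, Fintype.sum_prod_type]
    refine Finset.sum_congr rfl fun i _ => Finset.sum_congr rfl fun I _ => ?_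
    simp [Fin.consEquiv, Fin.prod_univ_succ]
  have h3 : ∀ I : Fin m → Fin (2 * n), (∑ i, (w i : ℂ) * A (Fin.cons i I)) =
      ∑ i, ∑ k, ((Matrix.vecMul w B⁻¹ k : ℝ) : ℂ) * (B k i : ℂ) * A (Fin.cons i I) := fun I =>
    Finset.sum_congr rfl fun i _ => by
      conv_lhs => rw [h i]
      push_cast
      rw [Finset.sum_mul]
  change ∑ I, ((∏ l, B (K l) (I l) : ℝ) : ℂ) * ∑ i, (w i : ℂ) * A (Fin.cons i I) =
    ∑ k, ((Matrix.vecMul w B⁻¹ k : ℝ) : ℂ) * act B A (Fin.cons k K)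
  simp only [h2, h3, Finset.mul_sum]
  rw [Finset.sum_comm, Finset.sum_congr rfl fun i _ => Finset.sum_comm, Finset.sum_comm]
  refine Finset.sum_congr rfl fun k _ => Finset.sum_congr rfl fun i _ =>
    Finset.sum_congr rfl fun I _ => by ring

/-- In an orthonormal frame this is the Cauchy–Schwarz inequality in the first slot, the factor
being the squared length of `w`. -/
lemma tensorNormSq_contract_le {G : Matrix (Fin (2 * n)) (Fin (2 * n)) ℝ} (hG : G.PosDef)
    (w : Fin (2 * n) → ℝ) (A : (Fin (m + 1) → Fin (2 * n)) → ℂ) :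
    tensorNormSq G (contract w A) ≤ (∑ i, ∑ j, G i j * w i * w j) * tensorNormSq G A := by
  obtain ⟨B, hu, hB⟩ := inv_eq_of_posDef hG
  set w' := Matrix.vecMul w B⁻¹ with hw'
  have hut : IsUnit B.transpose.det := by rwa [Matrix.det_transpose]
  have hGB : G = B⁻¹ * (B⁻¹).transpose := by
    rw [← Matrix.nonsing_inv_nonsing_inv G ((Matrix.isUnit_iff_isUnit_det _).1 hG.isUnit), hB,
      Matrix.mul_inv_rev, Matrix.transpose_nonsing_inv]
  have hw : ∑ i, ∑ j, G i j * w i * w j = ∑ k, w' k ^ 2 := by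
    have h1 : ∑ i, ∑ j, G i j * w i * w j = w ⬝ᵥ (G.mulVec w) := by
      simp only [dotProduct, Matrix.mulVec, Finset.mul_sum]
      exact Finset.sum_congr rfl fun i _ => Finset.sum_congr rfl fun j _ => by ring
    rw [h1, hGB, ← Matrix.mulVec_mulVec, Matrix.mulVec_transpose, Matrix.dotProduct_mulVec, ← hw']
    simp [dotProduct, sq]
  rw [hw, tensorNormSq_eq_sum hB, tensorNormSq_eq_sum hB, act_contract B hu,
    ← (Fin.consEquiv fun _ : Fin (m + 1) => Fin (2 * n)).sum_comp, Fintype.sum_prod_type,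
    Finset.sum_comm, Finset.mul_sum]
  refine Finset.sum_le_sum fun K _ => ?_
  simp only [contract, Complex.normSq_eq_norm_sq]
  calc ‖∑ i, (w' i : ℂ) * act B A (Fin.cons i K)‖ ^ 2
      ≤ (∑ i, |w' i| * ‖act B A (Fin.cons i K)‖) ^ 2 := by
        gcongr
        refine (norm_sum_le _ _).trans (le_of_eq ?_)
        simp
    _ ≤ (∑ i, |w' i| ^ 2) * ∑ i, ‖act B A (Fin.cons i K)‖ ^ 2 :=
        Finset.sum_mul_sq_le_sq_mul_sq _ _ _
    _ = _ := by simp [Fin.consEquiv]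

/-- The cross term of the squared norm. -/
def tensorCross (G : Matrix (Fin (2 * n)) (Fin (2 * n)) ℝ) (A A' : (Fin m → Fin (2 * n)) → ℂ) : ℝ :=
  tensorNormSq G (A + A') - tensorNormSq G A - tensorNormSq G A'

/-- The cross term is twice the real part of the inner product. Its upper bound is
`tensorNormSq_add_le`, its lower bound the nonnegativity of the norm of `A + A'`. -/
lemma abs_tensorCross_le {G : Matrix (Fin (2 * n)) (Fin (2 * n)) ℝ} (hG : G.PosDef)
    (A A' : (Fin m → Fin (2 * n)) → ℂ) :
    |tensorCross G A A'| ≤ tensorNormSq G A + tensorNormSq G A' := by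
  have h1 := tensorNormSq_add_le hG A A'
  have h2 := tensorNormSq_nonneg hG (A + A')
  rw [abs_le]
  constructor <;> unfold tensorCross <;> linarith

end TensorAlgebra

/-! ### Change of charts -/

section ChartChange

variable {n : ℕ} {X : Type*} [TopologicalSpace X] [ChartedSpace (E n) X]

/-- The derivative of the inverse of a chart, as an endomorphism of the model space. -/
def frameMap (ψ : OpenPartialHomeomorph X (E n)) (y : E n) : E n →L[ℝ] E n :=
  mfderiv 𝓘(ℝ, E n) 𝓘(ℝ, E n) ψ.symm y

/-- The derivative of a chart, as an endomorphism of the model space. -/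
def coframeMap (ψ : OpenPartialHomeomorph X (E n)) (x : X) : E n →L[ℝ] E n :=
  mfderiv 𝓘(ℝ, E n) 𝓘(ℝ, E n) ψ x

/-- A field of bilinear forms, read in the model space. -/
def bilinE (g : BilinField (n := n) X) : X → E n →L[ℝ] E n →L[ℝ] ℝ := g

/-- A differential form, read in the model space. -/
def formE {m : ℕ} (φ : Form n X m) : X → E n [⋀^Fin m]→L[ℝ] ℂ := φ

lemma coeff_apply (g : BilinField (n := n) X) (ψ : OpenPartialHomeomorph X (E n)) (y : E n)
    (i j : Fin (2 * n)) : coeff g ψ y i j =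
      bilinE g (ψ.symm y) (frameMap ψ y (stdVec i)) (frameMap ψ y (stdVec j)) := rfl

lemma comp_apply {m : ℕ} (φ : Form n X m) (ψ : OpenPartialHomeomorph X (E n)) (y : E n)
    (I : Fin m → Fin (2 * n)) : φ.comp ψ I y =
      formE φ (ψ.symm y) (fun l => frameMap ψ y (stdVec (I l))) := rfl

/-- The Jacobian matrix of a self-map of the model space. -/
def jac (τ : E n → E n) (y : E n) : Matrix (Fin (2 * n)) (Fin (2 * n)) ℝ :=
  Matrix.of fun j i => fderiv ℝ τ y (stdVec i) j

lemma eq_sum_stdVec (v : E n) : v = ∑ j, v j • (stdVec j : E n) := by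
  ext i
  simp [stdVec, Pi.single_apply]

lemma fderiv_stdVec_eq_sum (τ : E n → E n) (y : E n) (i : Fin (2 * n)) :
    fderiv ℝ τ y (stdVec i) = ∑ j, jac τ y j i • (stdVec j : E n) :=
  eq_sum_stdVec _

lemma fderiv_eq_mulVec (τ : E n → E n) (y w : E n) (j : Fin (2 * n)) :
    fderiv ℝ τ y w j = ∑ i, jac τ y j i * w i := by
  conv_lhs => rw [eq_sum_stdVec w]
  simp only [map_sum, map_smul, WithLp.ofLp_sum, WithLp.ofLp_smul, Finset.sum_apply,
    Pi.smul_apply, smul_eq_mul, jac, Matrix.of_apply]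
  exact Finset.sum_congr rfl fun i _ => mul_comm _ _

lemma det_jac (τ : E n → E n) (y : E n) : (jac τ y).det = (fderiv ℝ τ y).det := by
  have : jac τ y = LinearMap.toMatrix (EuclideanSpace.basisFun (Fin (2 * n)) ℝ).toBasis
      (EuclideanSpace.basisFun (Fin (2 * n)) ℝ).toBasis (fderiv ℝ τ y : E n →ₗ[ℝ] E n) := by
    ext i j
    simp [jac, LinearMap.toMatrix_apply, stdVec]
  rw [this, LinearMap.det_toMatrix]

variable [IsManifold 𝓘(ℝ, E n) ∞ X]

local notation "𝒜" => IsManifold.maximalAtlas 𝓘(ℝ, E n) ∞ X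

lemma contMDiffAt_chart {ψ : OpenPartialHomeomorph X (E n)} (hψ : ψ ∈ 𝒜) {x : X}
    (hx : x ∈ ψ.source) : ContMDiffAt 𝓘(ℝ, E n) 𝓘(ℝ, E n) ∞ ψ x :=
  (contMDiffOn_of_mem_maximalAtlas hψ).contMDiffAt (ψ.open_source.mem_nhds hx)

lemma contMDiffAt_chart_symm {ψ : OpenPartialHomeomorph X (E n)} (hψ : ψ ∈ 𝒜) {y : E n}
    (hy : y ∈ ψ.target) : ContMDiffAt 𝓘(ℝ, E n) 𝓘(ℝ, E n) ∞ ψ.symm y :=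
  (contMDiffOn_symm_of_mem_maximalAtlas hψ).contMDiffAt (ψ.open_target.mem_nhds hy)

lemma mdifferentiableAt_chart {ψ : OpenPartialHomeomorph X (E n)} (hψ : ψ ∈ 𝒜) {x : X}
    (hx : x ∈ ψ.source) : MDifferentiableAt 𝓘(ℝ, E n) 𝓘(ℝ, E n) ψ x :=
  (contMDiffAt_chart hψ hx).mdifferentiableAt (by simp)

lemma mdifferentiableAt_chart_symm {ψ : OpenPartialHomeomorph X (E n)} (hψ : ψ ∈ 𝒜) {y : E n}
    (hy : y ∈ ψ.target) : MDifferentiableAt 𝓘(ℝ, E n) 𝓘(ℝ, E n) ψ.symm y :=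
  (contMDiffAt_chart_symm hψ hy).mdifferentiableAt (by simp)

lemma coframeMap_frameMap {ψ : OpenPartialHomeomorph X (E n)} (hψ : ψ ∈ 𝒜) {y : E n}
    (hy : y ∈ ψ.target) (w : E n) : coframeMap ψ (ψ.symm y) (frameMap ψ y w) = w := by
  have h := mfderiv_comp y (mdifferentiableAt_chart hψ (ψ.map_target hy))
    (mdifferentiableAt_chart_symm hψ hy)
  have h2 : (ψ ∘ ψ.symm : E n → E n) =ᶠ[𝓝 y] id := by
    filter_upwards [ψ.open_target.mem_nhds hy] with z hz using ψ.right_inv hz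
  rw [h2.mfderiv_eq, mfderiv_id] at h
  exact (DFunLike.congr_fun h w).symm

lemma frameMap_coframeMap {ψ : OpenPartialHomeomorph X (E n)} (hψ : ψ ∈ 𝒜) {x : X}
    (hx : x ∈ ψ.source) (w : E n) : frameMap ψ (ψ x) (coframeMap ψ x w) = w := by
  have h := mfderiv_comp x (mdifferentiableAt_chart_symm hψ (ψ.map_source hx))
    (mdifferentiableAt_chart hψ hx)
  have h2 : (ψ.symm ∘ ψ : X → X) =ᶠ[𝓝 x] id := by
    filter_upwards [ψ.open_source.mem_nhds hx] with z hz using ψ.left_inv hz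
  rw [h2.mfderiv_eq, mfderiv_id] at h
  exact (DFunLike.congr_fun h w).symm

variable {ψ₁ ψ₂ : OpenPartialHomeomorph X (E n)}

lemma contDiffAt_transition (h₁ : ψ₁ ∈ 𝒜) (h₂ : ψ₂ ∈ 𝒜) {y : E n} (hy : y ∈ ψ₁.target)
    (hy' : ψ₁.symm y ∈ ψ₂.source) : ContDiffAt ℝ ∞ (ψ₂ ∘ ψ₁.symm) y :=
  ((contMDiffAt_chart h₂ hy').comp y (contMDiffAt_chart_symm h₁ hy)).contDiffAt

/-- The chain rule for `ψ₁⁻¹ = ψ₂⁻¹ ∘ (ψ₂ ∘ ψ₁⁻¹)`; all transformation laws of components derive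
from it. -/
lemma frameMap_change (h₁ : ψ₁ ∈ 𝒜) (h₂ : ψ₂ ∈ 𝒜) {y : E n} (hy : y ∈ ψ₁.target)
    (hy' : ψ₁.symm y ∈ ψ₂.source) (w : E n) :
    frameMap ψ₁ y w = frameMap ψ₂ (ψ₂ (ψ₁.symm y)) (fderiv ℝ (ψ₂ ∘ ψ₁.symm) y w) := by
  have hd : MDifferentiableAt 𝓘(ℝ, E n) 𝓘(ℝ, E n) (ψ₂ ∘ ψ₁.symm) y :=
    (mdifferentiableAt_chart h₂ hy').comp y (mdifferentiableAt_chart_symm h₁ hy)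
  have h := mfderiv_comp y (g := ψ₂.symm) (f := ψ₂ ∘ ψ₁.symm)
    (mdifferentiableAt_chart_symm h₂ (ψ₂.map_source hy')) hd
  have h3 : (ψ₂.symm ∘ (ψ₂ ∘ ψ₁.symm) : E n → X) =ᶠ[𝓝 y] ψ₁.symm := by
    have : ∀ᶠ z in 𝓝 y, ψ₁.symm z ∈ ψ₂.source :=
      (ψ₁.continuousAt_symm hy).preimage_mem_nhds (ψ₂.open_source.mem_nhds hy')
    filter_upwards [this] with z hz using ψ₂.left_inv hz
  rw [h3.mfderiv_eq, mfderiv_eq_fderiv] at h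
  exact DFunLike.congr_fun h w

lemma coeff_change (g : BilinField (n := n) X) (h₁ : ψ₁ ∈ 𝒜) (h₂ : ψ₂ ∈ 𝒜) {y : E n}
    (hy : y ∈ ψ₁.target) (hy' : ψ₁.symm y ∈ ψ₂.source) :
    coeff g ψ₁ y = (jac (ψ₂ ∘ ψ₁.symm) y).transpose * coeff g ψ₂ (ψ₂ (ψ₁.symm y)) *
      jac (ψ₂ ∘ ψ₁.symm) y := by
  ext i j
  rw [coeff_apply, frameMap_change h₁ h₂ hy hy', frameMap_change h₁ h₂ hy hy',
    fderiv_stdVec_eq_sum, fderiv_stdVec_eq_sum]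
  simp only [map_sum, map_smul, ContinuousLinearMap.sum_apply, ContinuousLinearMap.smul_apply,
    smul_eq_mul, Matrix.mul_apply, Matrix.transpose_apply, coeff_apply, ψ₂.left_inv hy',
    Finset.mul_sum, Finset.sum_mul]
  exact Finset.sum_congr rfl fun a _ => Finset.sum_congr rfl fun b _ => by ring

lemma comp_change {m : ℕ} (φ : Form n X m) (h₁ : ψ₁ ∈ 𝒜) (h₂ : ψ₂ ∈ 𝒜) {y : E n}
    (hy : y ∈ ψ₁.target) (hy' : ψ₁.symm y ∈ ψ₂.source) :
    (fun I => φ.comp ψ₁ I y) = act (jac (ψ₂ ∘ ψ₁.symm) y).transpose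
      (fun I => φ.comp ψ₂ I (ψ₂ (ψ₁.symm y))) := by
  ext I
  simp only [comp_apply, frameMap_change h₁ h₂ hy hy', fderiv_stdVec_eq_sum, act,
    Matrix.transpose_apply, ψ₂.left_inv hy', map_sum, map_smul]
  have h := (formE φ (ψ₁.symm y)).toMultilinearMap.map_sum (fun l j =>
    jac (ψ₂ ∘ ψ₁.symm) y j (I l) • frameMap ψ₂ (ψ₂ (ψ₁.symm y)) (stdVec j))
  refine h.trans (Finset.sum_congr rfl fun J _ => ?_)
  refine ((formE φ (ψ₁.symm y)).toMultilinearMap.map_smul_univ _ _).trans ?_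
  rw [Complex.real_smul]
  rfl

lemma isUnit_det_jac (h₁ : ψ₁ ∈ 𝒜) (h₂ : ψ₂ ∈ 𝒜) {y : E n} (hy : y ∈ ψ₁.target)
    (hy' : ψ₁.symm y ∈ ψ₂.source) : IsUnit (jac (ψ₂ ∘ ψ₁.symm) y).det := by
  rw [det_jac]
  have hinj : Function.Injective (fderiv ℝ (ψ₂ ∘ ψ₁.symm) y) := by
    intro v w hvw
    have := congrArg (frameMap ψ₂ (ψ₂ (ψ₁.symm y))) hvw
    rw [← frameMap_change h₁ h₂ hy hy', ← frameMap_change h₁ h₂ hy hy'] at this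
    rw [← coframeMap_frameMap h₁ hy v, this, coframeMap_frameMap h₁ hy]
  exact LinearEquiv.isUnit_det' (LinearEquiv.ofInjectiveEndo
    (fderiv ℝ (ψ₂ ∘ ψ₁.symm) y : E n →ₗ[ℝ] E n) hinj)

variable {D : Set X} {g : BilinField (n := n) X} {J : EndField (n := n) X}

lemma bilinE_frameMap (g : BilinField (n := n) X) (ψ : OpenPartialHomeomorph X (E n)) (y u v : E n) :
    bilinE g (ψ.symm y) (frameMap ψ y u) (frameMap ψ y v) =
      u.ofLp ⬝ᵥ (coeff g ψ y).mulVec v.ofLp := by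
  conv_lhs => rw [eq_sum_stdVec u, eq_sum_stdVec v]
  simp only [map_sum, map_smul, ContinuousLinearMap.sum_apply, ContinuousLinearMap.smul_apply,
    smul_eq_mul, dotProduct, Matrix.mulVec, coeff_apply, Finset.mul_sum]
  rw [Finset.sum_comm]
  exact Finset.sum_congr rfl fun a _ => Finset.sum_congr rfl fun b _ => by ring

lemma posDef_coeff {ψ : OpenPartialHomeomorph X (E n)} (hψ : ψ ∈ 𝒜) {y : E n} (hy : y ∈ ψ.target)
    (hs : ∀ u v, bilinE g (ψ.symm y) u v = bilinE g (ψ.symm y) v u)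
    (hp : ∀ u, u ≠ 0 → 0 < bilinE g (ψ.symm y) u u) : (coeff g ψ y).PosDef := by
  have hinj : Function.Injective (frameMap ψ y) := fun v w hvw => by
    rw [← coframeMap_frameMap hψ hy v, hvw, coframeMap_frameMap hψ hy]
  refine Matrix.PosDef.of_dotProduct_mulVec_pos ?_ fun v hv => ?_
  · ext i j
    simp only [Matrix.conjTranspose_apply, star_trivial]
    exact hs _ _
  · have h := bilinE_frameMap g ψ y (WithLp.toLp 2 v) (WithLp.toLp 2 v)
    rw [star_trivial, ← h]
    refine hp _ fun h0 => hv ?_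
    have h1 : (WithLp.toLp 2 v : E n) = 0 := hinj (by rw [h0, map_zero])
    simpa using congrArg WithLp.ofLp h1

lemma IsKahlerOff.posDef_coeff (hK : IsKahlerOff D g J) {ψ : OpenPartialHomeomorph X (E n)}
    (hψ : ψ ∈ 𝒜) {y : E n} (hy : y ∈ chartDom D ψ) : (coeff g ψ y).PosDef :=
  SingularKahler.posDef_coeff hψ hy.1 (hK.symm _ hy.2) (hK.pos _ hy.2)

lemma isOpen_chartDom (hD : IsClosed D) (ψ : OpenPartialHomeomorph X (E n)) :
    IsOpen (chartDom D ψ) :=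
  ψ.isOpen_inter_preimage_symm hD.isOpen_compl

lemma chartAt_mem_chartDom {x : X} (hx : x ∉ D) :
    chartAt (E n) x x ∈ chartDom D (chartAt (E n) x) :=
  ⟨mem_chart_target _ _, by
    rw [mem_preimage, (chartAt (E n) x).left_inv (mem_chart_source _ _)]; exact hx⟩

lemma chartAt_mem (x : X) : chartAt (E n) x ∈ 𝒜 := IsManifold.chart_mem_maximalAtlas x

lemma transition_mem_chartDom {y : E n} (hy : y ∈ chartDom D ψ₁)
    (hy' : ψ₁.symm y ∈ ψ₂.source) : ψ₂ (ψ₁.symm y) ∈ chartDom D ψ₂ :=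
  ⟨ψ₂.map_source hy', by rw [mem_preimage, ψ₂.left_inv hy']; exact hy.2⟩

lemma contDiffAt_jac {τ : E n → E n} {y : E n} (h : ContDiffAt ℝ ∞ τ y) (i j : Fin (2 * n)) :
    ContDiffAt ℝ ∞ (fun z => jac τ z i j) y := by
  have h1 : ContDiffAt ℝ ∞ (fun z => fderiv ℝ τ z (stdVec j)) y :=
    (h.fderiv_right (m := ∞) (by simp)).clm_apply contDiffAt_const
  exact (contDiffAt_euclidean.1 h1) i

lemma eventually_transition {y : E n} (hy : y ∈ ψ₁.target) (hy' : ψ₁.symm y ∈ ψ₂.source) :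
    ∀ᶠ z in 𝓝 y, z ∈ ψ₁.target ∧ ψ₁.symm z ∈ ψ₂.source :=
  (ψ₁.open_target.eventually_mem hy).and
    ((ψ₁.continuousAt_symm hy).preimage_mem_nhds (ψ₂.open_source.mem_nhds hy'))

/-- Smoothness of the metric is assumed in the charts of the atlas, whereas slice charts lie only in
the maximal atlas. The transformation law carries it over. -/
lemma IsKahlerOff.contDiffAt_coeff (hK : IsKahlerOff D g J) (hD : IsClosed D)
    {ψ : OpenPartialHomeomorph X (E n)} (hψ : ψ ∈ 𝒜) {y : E n} (hy : y ∈ chartDom D ψ)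
    (i j : Fin (2 * n)) : ContDiffAt ℝ ∞ (fun z => coeff g ψ z i j) y := by
  set ψ₂ := chartAt (E n) (ψ.symm y) with h₂
  have hs : ψ.symm y ∈ ψ₂.source := mem_chart_source _ _
  have hτ := contDiffAt_transition hψ (chartAt_mem (ψ.symm y)) hy.1 hs
  have h : (fun z => coeff g ψ z i j) =ᶠ[𝓝 y] fun z =>
      ∑ b, (∑ a, jac (ψ₂ ∘ ψ.symm) z a i * coeff g ψ₂ ((ψ₂ ∘ ψ.symm) z) a b) *
        jac (ψ₂ ∘ ψ.symm) z b j := by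
    filter_upwards [eventually_transition hy.1 hs] with z hz
    rw [coeff_change g hψ (chartAt_mem (ψ.symm y)) hz.1 hz.2]
    simp [Matrix.mul_apply, h₂]
  refine ContDiffAt.congr_of_eventuallyEq ?_ h
  refine ContDiffAt.sum fun b _ => (ContDiffAt.sum fun a _ => (contDiffAt_jac hτ a i).mul ?_).mul
    (contDiffAt_jac hτ b j)
  have hG : ContDiffAt ℝ ∞ (fun z => coeff g ψ₂ z a b) ((ψ₂ ∘ ψ.symm) y) :=
    (hK.smooth ψ₂ (chart_mem_atlas _ _) a b).contDiffAt
      ((isOpen_chartDom hD ψ₂).mem_nhds (transition_mem_chartDom hy hs))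
  exact hG.comp y hτ

/-- The pointwise norm is defined through the preferred chart at the point; by invariance any chart
of the maximal atlas computes it. -/
lemma IsKahlerOff.normSq_symm (hK : IsKahlerOff D g J) {m : ℕ} (φ : Form n X m)
    {ψ : OpenPartialHomeomorph X (E n)} (hψ : ψ ∈ 𝒜) {y : E n} (hy : y ∈ chartDom D ψ) :
    φ.normSq g (ψ.symm y) = tensorNormSq (coeff g ψ y) (fun I => φ.comp ψ I y) / m.factorial := by
  set x := ψ.symm y with hx
  have hxs : x ∈ (chartAt (E n) x).source := mem_chart_source _ _
  rw [Form.normSq, coeff_change g hψ (chartAt_mem x) hy.1 hxs,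
    comp_change φ hψ (chartAt_mem x) hy.1 hxs, tensorNormSq_change
      (hK.posDef_coeff (chartAt_mem x) (transition_mem_chartDom hy hxs))
      (isUnit_det_jac hψ (chartAt_mem x) hy.1 hxs)]

end ChartChange

/-! ### Calculus with matrices and tensors in components -/

section TensorCalculus

variable {n m : ℕ}

local notation "Mat" => Matrix (Fin (2 * n)) (Fin (2 * n)) ℝ

section Smooth

variable {F : Type*} [NormedAddCommGroup F] [NormedSpace ℝ F]

lemma contDiffAt_det {M : F → Mat} {x : F} (h : ∀ i j, ContDiffAt ℝ ∞ (fun z => M z i j) x) :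
    ContDiffAt ℝ ∞ (fun z => (M z).det) x := by
  simp only [Matrix.det_apply']
  exact ContDiffAt.sum fun σ _ => contDiffAt_const.mul (contDiffAt_prod fun i _ => h _ _)

lemma contDiffAt_inv_apply {M : F → Mat} {x : F} (h : ∀ i j, ContDiffAt ℝ ∞ (fun z => M z i j) x)
    (hx : (M x).det ≠ 0) (i j : Fin (2 * n)) : ContDiffAt ℝ ∞ (fun z => (M z)⁻¹ i j) x := by
  simp only [Matrix.inv_def, Matrix.smul_apply, Ring.inverse_eq_inv', smul_eq_mul,
    Matrix.adjugate_apply]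
  refine ((contDiffAt_det h).inv hx).mul (contDiffAt_det fun a b => ?_)
  simp only [Matrix.updateRow_apply]
  split_ifs
  exacts [contDiffAt_const, h a b]

lemma tensorNormSq_eq_re (G : Mat) (A : (Fin m → Fin (2 * n)) → ℂ) :
    tensorNormSq G A = ∑ I, ∑ J, (∏ l, G⁻¹ (I l) (J l)) * (A I * (starRingEnd ℂ) (A J)).re := by
  simp only [tensorNormSq, Complex.re_sum, Complex.re_ofReal_mul]

lemma contDiffAt_tensorNormSq {G : F → Mat} {A : F → (Fin m → Fin (2 * n)) → ℂ} {x : F}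
    (hG : ∀ i j, ContDiffAt ℝ ∞ (fun z => G z i j) x) (hx : (G x).det ≠ 0)
    (hA : ∀ I, ContDiffAt ℝ ∞ (fun z => A z I) x) :
    ContDiffAt ℝ ∞ (fun z => tensorNormSq (G z) (A z)) x := by
  simp only [tensorNormSq_eq_re]
  refine ContDiffAt.sum fun I _ => ContDiffAt.sum fun J _ =>
    (contDiffAt_prod fun l _ => contDiffAt_inv_apply hG hx _ _).mul ?_
  have h1 : ContDiffAt ℝ ∞ (fun z => A z I * (starRingEnd ℂ) (A z J)) x :=
    (hA I).mul (Complex.conjCLE.contDiff.contDiffAt.comp x (hA J))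
  exact Complex.reCLM.contDiff.contDiffAt.comp x h1

end Smooth

/-- `M'` is the entrywise derivative of the matrix function `M` at `0`. -/
def EntryDeriv (M : ℝ → Mat) (M' : Mat) : Prop :=
  ∀ i j, HasDerivAt (fun s => M s i j) (M' i j) 0

lemma EntryDeriv.mul {M N : ℝ → Mat} {M' N' : Mat} (hM : EntryDeriv M M') (hN : EntryDeriv N N') :
    EntryDeriv (fun s => M s * N s) (M' * N 0 + M 0 * N') := by
  intro i j
  simp only [Matrix.mul_apply, Matrix.add_apply, ← Finset.sum_add_distrib]
  exact HasDerivAt.fun_sum fun k _ => (hM i k).mul (hN k j)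

lemma EntryDeriv.transpose {M : ℝ → Mat} {M' : Mat} (hM : EntryDeriv M M') :
    EntryDeriv (fun s => (M s).transpose) M'.transpose := fun i j => hM j i

lemma EntryDeriv.const (M : Mat) : EntryDeriv (fun _ => M) 0 := fun _ _ => hasDerivAt_const _ _

lemma EntryDeriv.one_sub_smul (Γ : Mat) : EntryDeriv (fun s => 1 - s • Γ) (-Γ) := by
  intro i j
  simp only [Matrix.sub_apply, Matrix.smul_apply, smul_eq_mul, Matrix.neg_apply]
  simpa using ((hasDerivAt_id (0 : ℝ)).mul_const (Γ i j)).const_sub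
    ((1 : Mat) i j)

/-- The derivative of `act M A` when `M`, `A` vary with velocities `M'`, `A'`. -/
def actDeriv (M M' : Mat) (A A' : (Fin m → Fin (2 * n)) → ℂ) : (Fin m → Fin (2 * n)) → ℂ :=
  fun K => ∑ I, (((∑ l, (∏ l' ∈ Finset.univ.erase l, M (K l') (I l')) * M' (K l) (I l) : ℝ) : ℂ)
    * A I + ((∏ l, M (K l) (I l) : ℝ) : ℂ) * A' I)

lemma EntryDeriv.act {M : ℝ → Mat} {M' : Mat} {A : ℝ → (Fin m → Fin (2 * n)) → ℂ}
    {A' : (Fin m → Fin (2 * n)) → ℂ} (hM : EntryDeriv M M')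
    (hA : ∀ I, HasDerivAt (fun s => A s I) (A' I) 0) (K : Fin m → Fin (2 * n)) :
    HasDerivAt (fun s => act (M s) (A s) K) (actDeriv (M 0) M' (A 0) A' K) 0 := by
  unfold SingularKahler.act actDeriv
  refine HasDerivAt.fun_sum fun I _ => HasDerivAt.mul ?_ (hA I)
  have h := HasDerivAt.fun_finset_prod (u := Finset.univ) (x := (0 : ℝ))
    (f := fun l s => M s (K l) (I l)) (f' := fun l => M' (K l) (I l)) fun l _ => hM _ _
  simpa using h.ofReal_comp

/-- At the identity matrix only the multi-indices that differ from `K` in at most the slot `l`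
survive. The sum over `l` becomes the Christoffel correction in `nablaComp`. -/
lemma actDeriv_one (M' : Mat) (A A' : (Fin m → Fin (2 * n)) → ℂ) (K : Fin m → Fin (2 * n)) :
    actDeriv 1 M' A A' K =
      A' K + ∑ l, ∑ a, (M' (K l) a : ℂ) * A (Function.update K l a) := by
  unfold actDeriv
  rw [Finset.sum_add_distrib, add_comm]
  congr 1
  · exact congrFun (act_one A') K
  · simp only [Complex.ofReal_sum, Finset.sum_mul]
    rw [Finset.sum_comm]
    refine Finset.sum_congr rfl fun l _ => ?_
    refine (Finset.sum_of_injOn (fun a => Function.update K l a) ?_ (by simp) ?_ ?_).symm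
    · intro a _ b _ hab
      simpa using congrFun hab l
    · intro I _ hI
      have : ∃ l' ∈ Finset.univ.erase l, K l' ≠ I l' := by
        by_contra! h
        refine hI ⟨I l, by simp, ?_⟩
        funext l'
        by_cases hl : l' = l
        · subst hl; simp
        · dsimp only
          rw [Function.update_of_ne hl, h l' (by simp [hl])]
      obtain ⟨l', hl', hne⟩ := this
      rw [Finset.prod_eq_zero hl' (by simp [hne])]
      simp
    · intro a _
      rw [Finset.prod_eq_one]
      · simp
      · intro l' hl'
        rw [Function.update_of_ne (Finset.ne_of_mem_erase hl')]
        simp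

/-- When the Gram matrix is stationary to first order, only the components move, and the derivative
of a quadratic form is its polarization. -/
lemma hasDerivAt_tensorNormSq {G : ℝ → Mat} {A : ℝ → (Fin m → Fin (2 * n)) → ℂ}
    {A' : (Fin m → Fin (2 * n)) → ℂ} (hG : EntryDeriv G 0) (hdet : (G 0).det ≠ 0)
    (hA : ∀ I, HasDerivAt (fun s => A s I) (A' I) 0) :
    HasDerivAt (fun s => tensorNormSq (G s) (A s)) (tensorCross (G 0) (A 0) A') 0 := by
  have hinv : ∀ i j, HasDerivAt (fun s => (G s)⁻¹ i j) 0 0 := by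
    intro i j
    have h1 : ContDiffAt ℝ ∞ (fun M : Fin (2 * n) → Fin (2 * n) → ℝ => (Matrix.of M)⁻¹ i j)
        (G 0) := by
      refine contDiffAt_inv_apply (M := fun M : Fin (2 * n) → Fin (2 * n) → ℝ => Matrix.of M)
        (fun a b => ?_) hdet i j
      exact ((contDiff_apply ℝ ℝ b).comp (contDiff_apply ℝ (Fin (2 * n) → ℝ) a)).contDiffAt
    have h2 : HasDerivAt (fun s => (G s : Fin (2 * n) → Fin (2 * n) → ℝ)) 0 0 :=
      hasDerivAt_pi.2 fun a => hasDerivAt_pi.2 fun b => hG a b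
    have h3 := (h1.differentiableAt (by simp)).hasFDerivAt.comp_hasDerivAt (0 : ℝ) h2
    exact h3.congr_deriv (ContinuousLinearMap.map_zero _)
  have hprod : ∀ I J : Fin m → Fin (2 * n),
      HasDerivAt (fun s => ∏ l, (G s)⁻¹ (I l) (J l)) 0 0 := by
    intro I J
    have h := HasDerivAt.fun_finset_prod (u := Finset.univ) (x := (0 : ℝ))
      (f := fun l s => (G s)⁻¹ (I l) (J l)) (f' := fun _ => 0) fun l _ => hinv _ _
    simpa using h
  have hre : ∀ I J, HasDerivAt (fun s => (A s I * (starRingEnd ℂ) (A s J)).re)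
      (A' I * (starRingEnd ℂ) (A 0 J) + A 0 I * (starRingEnd ℂ) (A' J)).re 0 := by
    intro I J
    have h1 : HasDerivAt (fun s => (starRingEnd ℂ) (A s J)) ((starRingEnd ℂ) (A' J)) 0 :=
      Complex.conjCLE.hasFDerivAt.comp_hasDerivAt (0 : ℝ) (hA J)
    exact Complex.reCLM.hasFDerivAt.comp_hasDerivAt (0 : ℝ) ((hA I).mul h1)
  simp only [tensorNormSq_eq_re, tensorCross, ← Finset.sum_sub_distrib]
  have h := HasDerivAt.fun_sum (u := Finset.univ) fun I _ => HasDerivAt.fun_sum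
    (u := Finset.univ) fun J _ => (hprod I J).mul (hre I J)
  refine h.congr_deriv ?_
  refine Finset.sum_congr rfl fun I _ => Finset.sum_congr rfl fun J _ => ?_
  simp
  ring

end TensorCalculus

/-! ### The Levi-Civita connection in charts -/

section Connection

variable {n : ℕ} {X : Type*} [TopologicalSpace X] [ChartedSpace (E n) X]
  [IsManifold 𝓘(ℝ, E n) ∞ X]

local notation "𝒜" => IsManifold.maximalAtlas 𝓘(ℝ, E n) ∞ X

variable {D : Set X} {g : BilinField (n := n) X} {J : EndField (n := n) X}
  {ψ ψ₁ ψ₂ : OpenPartialHomeomorph X (E n)}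

lemma fderiv_eq_sum_pd {F : Type*} [NormedAddCommGroup F] [NormedSpace ℝ F] (f : E n → F)
    (y w : E n) : fderiv ℝ f y w = ∑ i, w i • pd i f y := by
  conv_lhs => rw [eq_sum_stdVec w]
  simp [pd]

/-- The connection matrix in the direction `w`. -/
def connMat (g : BilinField (n := n) X) (ψ : OpenPartialHomeomorph X (E n)) (y : E n)
    (w : Fin (2 * n) → ℝ) : Matrix (Fin (2 * n)) (Fin (2 * n)) ℝ :=
  Matrix.of fun a b => ∑ i, w i * christoffel g ψ a i b y

lemma IsKahlerOff.coeff_symm (hK : IsKahlerOff D g J) {y : E n}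
    (hy : y ∈ chartDom D ψ) (i j : Fin (2 * n)) : coeff g ψ y i j = coeff g ψ y j i :=
  hK.symm _ hy.2 _ _

lemma IsKahlerOff.det_ne_zero (hK : IsKahlerOff D g J) (hψ : ψ ∈ 𝒜) {y : E n}
    (hy : y ∈ chartDom D ψ) : (coeff g ψ y).det ≠ 0 :=
  (hK.posDef_coeff hψ hy).det_pos.ne'

/-- Lowering the index cancels the inverse matrix. In this form the symbols are linear in the first
derivatives of the metric, and identities can be checked term by term. -/
lemma IsKahlerOff.lower_christoffel (hK : IsKahlerOff D g J) (hψ : ψ ∈ 𝒜) {y : E n}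
    (hy : y ∈ chartDom D ψ) (c i j : Fin (2 * n)) :
    ∑ a, coeff g ψ y c a * christoffel g ψ a i j y =
      (1 / 2) * (pd i (fun z => coeff g ψ z c j) y + pd j (fun z => coeff g ψ z c i) y
        - pd c (fun z => coeff g ψ z i j) y) := by
  simp only [christoffel, Finset.mul_sum]
  rw [Finset.sum_comm]
  have h : ∀ b, ∑ a, coeff g ψ y c a * (coeff g ψ y)⁻¹ a b = if c = b then 1 else 0 := fun b => by
    rw [← Matrix.mul_apply, Matrix.mul_nonsing_inv _ (hK.det_ne_zero hψ hy).isUnit,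
      Matrix.one_apply]
  have h2 : ∀ b, ∑ a, coeff g ψ y c a * (1 / 2 * ((coeff g ψ y)⁻¹ a b *
      (pd i (fun z => coeff g ψ z b j) y + pd j (fun z => coeff g ψ z b i) y
        - pd b (fun z => coeff g ψ z i j) y))) = (if c = b then 1 else 0) * (1 / 2 *
      (pd i (fun z => coeff g ψ z b j) y + pd j (fun z => coeff g ψ z b i) y
        - pd b (fun z => coeff g ψ z i j) y)) := fun b => by
    rw [← h, Finset.sum_mul]
    exact Finset.sum_congr rfl fun a _ => by ring
  simp only [h2]
  simp

lemma IsKahlerOff.pd_coeff_symm (hK : IsKahlerOff D g J) (hD : IsClosed D)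
    {y : E n} (hy : y ∈ chartDom D ψ) (c i j : Fin (2 * n)) :
    pd c (fun z => coeff g ψ z i j) y = pd c (fun z => coeff g ψ z j i) y := by
  unfold pd
  rw [Filter.EventuallyEq.fderiv_eq]
  filter_upwards [(isOpen_chartDom hD ψ).mem_nhds hy] with z hz using hK.coeff_symm hz i j

/-- Metric compatibility of the Levi-Civita connection. -/
lemma IsKahlerOff.fderiv_coeff (hK : IsKahlerOff D g J) (hD : IsClosed D) (hψ : ψ ∈ 𝒜) {y : E n}
    (hy : y ∈ chartDom D ψ) (w : E n) (c b : Fin (2 * n)) :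
    fderiv ℝ (fun z => coeff g ψ z c b) y w =
      (coeff g ψ y * connMat g ψ y w + (connMat g ψ y w).transpose * coeff g ψ y) c b := by
  have h1 : ∀ c b, (coeff g ψ y * connMat g ψ y w) c b =
      ∑ i, w i * ∑ a, coeff g ψ y c a * christoffel g ψ a i b y := by
    intro c b
    simp only [Matrix.mul_apply, connMat, Matrix.of_apply, Finset.mul_sum]
    rw [Finset.sum_comm]
    exact Finset.sum_congr rfl fun i _ => Finset.sum_congr rfl fun a _ => by ring
  have h2 : ((connMat g ψ y w).transpose * coeff g ψ y) c b =
      (coeff g ψ y * connMat g ψ y w) b c := by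
    simp only [Matrix.mul_apply, Matrix.transpose_apply]
    exact Finset.sum_congr rfl fun a _ => by rw [hK.coeff_symm hy a b, mul_comm]
  rw [Matrix.add_apply, h2, h1, h1, fderiv_eq_sum_pd, ← Finset.sum_add_distrib]
  refine Finset.sum_congr rfl fun i _ => ?_
  rw [hK.lower_christoffel hψ hy, hK.lower_christoffel hψ hy, hK.pd_coeff_symm hD hy i b c,
    hK.pd_coeff_symm hD hy b i c, hK.pd_coeff_symm hD hy c b i, smul_eq_mul,
    hK.pd_coeff_symm hD hy b c i, hK.pd_coeff_symm hD hy c i b]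
  ring

lemma hasDerivAt_line {F : Type*} [NormedAddCommGroup F] [NormedSpace ℝ F] {f : E n → F}
    {y : E n} (hf : DifferentiableAt ℝ f y) (w : E n) :
    HasDerivAt (fun s : ℝ => f (y + s • w)) (fderiv ℝ f y w) 0 := by
  have h1 : HasDerivAt (fun s : ℝ => y + s • w) w 0 := by
    simpa using ((hasDerivAt_id (0 : ℝ)).smul_const w).const_add y
  have h2 : HasFDerivAt f (fderiv ℝ f y) (y + (0 : ℝ) • w) := by simpa using hf.hasFDerivAt
  exact h2.comp_hasDerivAt (0 : ℝ) h1

/-- The right side is the derivative at `s = 0` of the components of the form at `y + s w` in the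
frame `1 - s Γ`, which is parallel to first order along this line. The Leibniz rule then replaces
manipulations of Christoffel symbols. -/
lemma contract_nablaComp {m : ℕ} (φ : Form n X m) (y w : E n) :
    contract w (fun I => nablaComp g φ ψ I y) =
      actDeriv 1 (-(connMat g ψ y w)).transpose (fun I => φ.comp ψ I y)
        (fun I => fderiv ℝ (φ.comp ψ I) y w) := by
  ext I
  simp only [contract, nablaComp, actDeriv_one, Fin.cons_zero, Fin.tail_cons, Fin.cons_succ,
    Matrix.transpose_apply, Matrix.neg_apply, connMat, Matrix.of_apply, mul_sub,
    Finset.sum_sub_distrib, fderiv_eq_sum_pd, Complex.real_smul]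
  rw [sub_eq_add_neg]
  congr 1
  rw [← Finset.sum_neg_distrib]
  simp only [Finset.mul_sum, Complex.ofReal_neg, Complex.ofReal_sum, neg_mul,
    Finset.sum_mul, Complex.ofReal_mul, ← Finset.sum_neg_distrib]
  rw [Finset.sum_comm]
  refine Finset.sum_congr rfl fun l _ => ?_
  rw [Finset.sum_comm]
  refine Finset.sum_congr rfl fun a _ => Finset.sum_congr rfl fun i _ => by ring

lemma Form.SmoothOff.contDiffAt {m : ℕ} {φ : Form n X m} (hφ : φ.SmoothOff D) (hD : IsClosed D)
    (hψ : ψ ∈ atlas (E n) X) {y : E n} (hy : y ∈ chartDom D ψ) (I : Fin m → Fin (2 * n)) :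
    ContDiffAt ℝ ∞ (φ.comp ψ I) y :=
  (hφ ψ hψ I).contDiffAt ((isOpen_chartDom hD ψ).mem_nhds hy)

/-- In a chart, the differential of `|φ|²` is the cross term of `φ` and `∇φ`. -/
lemma IsKahlerOff.fderiv_tensorNormSq (hK : IsKahlerOff D g J) (hD : IsClosed D)
    (hψ : ψ ∈ atlas (E n) X) {m : ℕ} {φ : Form n X m} (hφ : φ.SmoothOff D) {y : E n}
    (hy : y ∈ chartDom D ψ) (w : E n) :
    fderiv ℝ (fun z => tensorNormSq (coeff g ψ z) (fun I => φ.comp ψ I z)) y w =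
      tensorCross (coeff g ψ y) (fun I => φ.comp ψ I y)
        (contract w (fun I => nablaComp g φ ψ I y)) := by
  have hψ' : ψ ∈ 𝒜 := IsManifold.subset_maximalAtlas hψ
  have hdet := hK.det_ne_zero hψ' hy
  set Γ := connMat g ψ y w with hΓ
  have hd : DifferentiableAt ℝ (fun z => tensorNormSq (coeff g ψ z) (fun I => φ.comp ψ I z)) y :=
    (contDiffAt_tensorNormSq (fun i j => hK.contDiffAt_coeff hD hψ' hy i j) hdet
      (fun I => hφ.contDiffAt hD hψ hy I)).differentiableAt (by simp)
  refine (hasDerivAt_line hd w).unique ?_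
  have hG : EntryDeriv (fun s : ℝ => coeff g ψ (y + s • w))
      (coeff g ψ y * Γ + Γ.transpose * coeff g ψ y) := by
    intro i j
    rw [hΓ, ← hK.fderiv_coeff hD hψ' hy w i j]
    exact hasDerivAt_line ((hK.contDiffAt_coeff hD hψ' hy i j).differentiableAt (by simp)) w
  have hP := EntryDeriv.one_sub_smul Γ
  -- Metric compatibility: the Gram matrix of the frame `1 - s Γ` is stationary at `s = 0`.
  have hGt : EntryDeriv (fun s : ℝ => (1 - s • Γ).transpose * coeff g ψ (y + s • w) *
      (1 - s • Γ)) 0 := by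
    have h := (hP.transpose.mul hG).mul hP
    simp only [zero_smul, sub_zero, Matrix.transpose_one, one_mul, mul_one, add_zero] at h
    convert h using 1
    simp
  have hA : ∀ I, HasDerivAt (fun s : ℝ => act (1 - s • Γ).transpose
      (fun I => φ.comp ψ I (y + s • w)) I)
      (contract w (fun I => nablaComp g φ ψ I y) I) 0 := by
    intro I
    rw [contract_nablaComp]
    have h := EntryDeriv.act hP.transpose (A := fun s : ℝ => fun I => φ.comp ψ I (y + s • w))
      (fun I => hasDerivAt_line ((hφ.contDiffAt hD hψ hy I).differentiableAt (by simp)) w) I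
    simpa using h
  have h := hasDerivAt_tensorNormSq hGt (by simpa using hdet) hA
  simp only [zero_smul, sub_zero, Matrix.transpose_one, one_mul, mul_one, add_zero,
    act_one] at h
  refine h.congr_of_eventuallyEq ?_
  have hev1 : ∀ᶠ s : ℝ in 𝓝 0, y + s • w ∈ chartDom D ψ := by
    have : ContinuousAt (fun s : ℝ => y + s • w) 0 := by fun_prop
    exact this.preimage_mem_nhds (by simpa using (isOpen_chartDom hD ψ).mem_nhds hy)
  -- For small `s` the matrix `1 - s Γ` is still invertible, so the norm may be computed in this
  -- frame.
  have hev2 : ∀ᶠ s : ℝ in 𝓝 0, (1 - s • Γ).det ≠ 0 := by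
    have : ContinuousAt (fun s : ℝ => (1 - s • Γ).det) 0 := by fun_prop
    exact this.eventually_ne (by simp)
  filter_upwards [hev1, hev2] with s hs1 hs2
  exact (tensorNormSq_change (hK.posDef_coeff hψ' hs1) hs2.isUnit _).symm

end Connection

/-! ### The covariant derivative as a tensor, and the derivative of `|φ|²` along curves -/

section Covariance

variable {n : ℕ} {X : Type*} [TopologicalSpace X] [ChartedSpace (E n) X]
  [IsManifold 𝓘(ℝ, E n) ∞ X]

local notation "𝒜" => IsManifold.maximalAtlas 𝓘(ℝ, E n) ∞ X

variable {D : Set X} {g : BilinField (n := n) X} {J : EndField (n := n) X}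
  {ψ ψ₁ ψ₂ : OpenPartialHomeomorph X (E n)}

/-- Symmetry of the second derivative of `τ`. It makes the terms with second derivatives collapse in
the Koszul combination of `pd_jac_eq`. -/
lemma pd_jac_symm {τ : E n → E n} {y : E n} (h : ContDiffAt ℝ ∞ τ y) (a i l : Fin (2 * n)) :
    pd i (fun z => jac τ z a l) y = pd l (fun z => jac τ z a i) y := by
  have hd : DifferentiableAt ℝ (fderiv ℝ τ) y :=
    (h.fderiv_right (m := ∞) (by simp)).differentiableAt (by simp)
  have key : ∀ i l : Fin (2 * n), pd i (fun z => jac τ z a l) y =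
      (fderiv ℝ (fderiv ℝ τ) y (stdVec i) (stdVec l) : E n) a := by
    intro i l
    have h1 := ((hd.hasFDerivAt.clm_apply (hasFDerivAt_const (stdVec l : E n) y)))
    have h2 := (EuclideanSpace.proj (𝕜 := ℝ) a).hasFDerivAt.comp y h1
    have h3 : (fun z => jac τ z a l) =
        (EuclideanSpace.proj (𝕜 := ℝ) a) ∘ fun z => fderiv ℝ τ z (stdVec l) := rfl
    rw [pd, h3, h2.fderiv]
    simp
  rw [key, key]
  have hs := h.isSymmSndFDerivAt (by
    rw [minSmoothness_of_isRCLikeNormedField]; exact WithTop.coe_le_coe.2 (le_top : (2 : ℕ∞) ≤ ⊤))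
  rw [hs.eq]

lemma pd_coeff_change (hK : IsKahlerOff D g J) (hD : IsClosed D) (h₁ : ψ₁ ∈ 𝒜) (h₂ : ψ₂ ∈ 𝒜)
    {y : E n} (hy : y ∈ chartDom D ψ₁) (hy' : ψ₁.symm y ∈ ψ₂.source) (i j l : Fin (2 * n)) :
    pd i (fun z => coeff g ψ₁ z j l) y = ∑ a, ∑ b,
      (pd i (fun z => jac (ψ₂ ∘ ψ₁.symm) z a j) y *
          coeff g ψ₂ (ψ₂ (ψ₁.symm y)) a b * jac (ψ₂ ∘ ψ₁.symm) y b l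
        + jac (ψ₂ ∘ ψ₁.symm) y a j * (∑ c, jac (ψ₂ ∘ ψ₁.symm) y c i *
          pd c (fun z => coeff g ψ₂ z a b) (ψ₂ (ψ₁.symm y))) * jac (ψ₂ ∘ ψ₁.symm) y b l
        + jac (ψ₂ ∘ ψ₁.symm) y a j * coeff g ψ₂ (ψ₂ (ψ₁.symm y)) a b *
          pd i (fun z => jac (ψ₂ ∘ ψ₁.symm) z b l) y) := by
  set τ := ψ₂ ∘ ψ₁.symm with hτ
  have hτs := contDiffAt_transition h₁ h₂ hy.1 hy'
  have hev : (fun z => coeff g ψ₁ z j l) =ᶠ[𝓝 y] fun z =>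
      ∑ a, ∑ b, jac τ z a j * coeff g ψ₂ (τ z) a b * jac τ z b l := by
    filter_upwards [eventually_transition hy.1 hy'] with z hz
    rw [coeff_change g h₁ h₂ hz.1 hz.2]
    simp only [Matrix.mul_apply, Matrix.transpose_apply, Finset.sum_mul]
    rw [Finset.sum_comm]
    rfl
  have hjac : ∀ a b, HasDerivAt (fun s : ℝ => jac τ (y + s • stdVec i) a b)
      (pd i (fun z => jac τ z a b) y) 0 := fun a b =>
    hasDerivAt_line ((contDiffAt_jac hτs a b).differentiableAt (by simp)) _
  have hco : ∀ a b, HasDerivAt (fun s : ℝ => coeff g ψ₂ (τ (y + s • stdVec i)) a b)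
      (∑ c, jac τ y c i * pd c (fun z => coeff g ψ₂ z a b) (τ y)) 0 := by
    intro a b
    have hd : DifferentiableAt ℝ (fun z => coeff g ψ₂ z a b) (τ y) :=
      (hK.contDiffAt_coeff hD h₂ (transition_mem_chartDom hy hy') a b).differentiableAt (by simp)
    have h := hasDerivAt_line (hd.comp y (hτs.differentiableAt (by simp))) (stdVec i)
    rw [fderiv_comp y hd (hτs.differentiableAt (by simp)), ContinuousLinearMap.comp_apply,
      fderiv_eq_sum_pd] at h
    exact h
  have hsum := HasDerivAt.fun_sum (u := Finset.univ) fun a _ => HasDerivAt.fun_sum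
    (u := Finset.univ) fun b _ => ((hjac a j).mul (hco a b)).mul (hjac b l)
  have hl := hasDerivAt_line
    ((hK.contDiffAt_coeff hD h₁ hy j l).differentiableAt (by simp)) (stdVec i)
  have hc : Tendsto (fun s : ℝ => y + s • (stdVec i : E n)) (𝓝 0) (𝓝 y) := by
    have : ContinuousAt (fun s : ℝ => y + s • (stdVec i : E n)) 0 := by fun_prop
    simpa [ContinuousAt] using this
  have h := hl.unique (hsum.congr_of_eventuallyEq (hc.eventually hev))
  rw [pd, h]
  refine Finset.sum_congr rfl fun a _ => Finset.sum_congr rfl fun b _ => ?_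
  simp only [zero_smul, add_zero, Pi.mul_apply]
  simp only [hτ, Function.comp_apply]
  ring

/-- The transformation law of the Christoffel symbols. -/
lemma pd_jac_eq (hK : IsKahlerOff D g J) (hD : IsClosed D) (h₁ : ψ₁ ∈ 𝒜) (h₂ : ψ₂ ∈ 𝒜)
    {y : E n} (hy : y ∈ chartDom D ψ₁) (hy' : ψ₁.symm y ∈ ψ₂.source) (b i l : Fin (2 * n)) :
    pd i (fun z => jac (ψ₂ ∘ ψ₁.symm) z b l) y =
      ∑ c, jac (ψ₂ ∘ ψ₁.symm) y b c * christoffel g ψ₁ c i l y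
      - ∑ c, ∑ d, jac (ψ₂ ∘ ψ₁.symm) y c i * christoffel g ψ₂ b c d (ψ₂ (ψ₁.symm y)) *
          jac (ψ₂ ∘ ψ₁.symm) y d l := by
  set τ := ψ₂ ∘ ψ₁.symm with hτ
  have hty : ψ₂ (ψ₁.symm y) = τ y := rfl
  rw [hty]
  have hτs : ContDiffAt ℝ ∞ τ y := contDiffAt_transition h₁ h₂ hy.1 hy'
  have hy2 : τ y ∈ chartDom D ψ₂ := transition_mem_chartDom hy hy'
  set P := jac τ y with hP
  set G := coeff g ψ₂ (τ y) with hG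
  set H : Fin (2 * n) → Fin (2 * n) → Fin (2 * n) → ℝ :=
    fun b i l => pd i (fun z => jac τ z b l) y with hH
  set dg : Fin (2 * n) → Fin (2 * n) → Fin (2 * n) → ℝ :=
    fun c a b => pd c (fun z => coeff g ψ₂ z a b) (τ y) with hdg
  set S : Fin (2 * n) → Fin (2 * n) → Fin (2 * n) → ℝ :=
    fun j i l => ∑ a, ∑ b, P a j * G a b * H b i l with hS
  set K : Fin (2 * n) → Fin (2 * n) → Fin (2 * n) → ℝ :=
    fun i j l => ∑ a, ∑ b, ∑ c, P a j * P b l * P c i * dg c a b with hKd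
  have hHs : ∀ b i l, H b i l = H b l i := fun b i l => pd_jac_symm hτs b i l
  have hSs : ∀ j i l, S j i l = S j l i := fun j i l => by simp only [hS, hHs _ i l]
  -- The derivatives of the metric in the first chart split into `K`, the pulled-back derivatives of
  -- the metric in the second chart, and two terms `S`, which contain the second derivatives of the
  -- transition map.
  have hdG : ∀ i j l, pd i (fun z => coeff g ψ₁ z j l) y = S l i j + K i j l + S j i l := by
    intro i j l
    rw [pd_coeff_change hK hD h₁ h₂ hy hy' i j l]
    simp only [Finset.sum_add_distrib]
    congr 1
    · congr 1
      · simp only [hS]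
        rw [Finset.sum_comm]
        refine Finset.sum_congr rfl fun a _ => Finset.sum_congr rfl fun b _ => ?_
        rw [show G a b = G b a from hK.coeff_symm hy2 a b]
        change H b i j * G b a * P a l = _
        ring
      · simp only [hKd, Finset.mul_sum, Finset.sum_mul]
        refine Finset.sum_congr rfl fun a _ => Finset.sum_congr rfl fun b _ =>
          Finset.sum_congr rfl fun c _ => ?_
        change P a j * (P c i * dg c a b) * P b l = _
        ring
  -- In the Koszul combination four of the six terms `S` cancel by symmetry, and the other two are
  -- both `S j i l`.
  have hlow1 : ∀ j i, ∑ c, coeff g ψ₁ y j c * christoffel g ψ₁ c i l y =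
      S j i l + (1 / 2) * (K i j l + K l j i - K j i l) := by
    intro j i
    rw [hK.lower_christoffel h₁ hy, hdG, hdG, hdG, hSs j l i, hSs i l j, hSs l i j]
    ring
  have hlow2 : ∀ j i, ∑ a, ∑ b, ∑ c, P a j * P c i * P b l *
      (∑ d, G a d * christoffel g ψ₂ d c b (τ y)) =
      (1 / 2) * (K i j l + K l j i - K j i l) := by
    intro j i
    have e1 : K l j i = ∑ a, ∑ b, ∑ c, P a j * P c i * P b l * dg b a c := by
      simp only [hKd]
      refine Finset.sum_congr rfl fun a _ => ?_
      rw [Finset.sum_comm]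
    have e2 : K j i l = ∑ a, ∑ b, ∑ c, P a j * P c i * P b l * dg a c b := by
      simp only [hKd]
      rw [Finset.sum_congr rfl fun a _ => Finset.sum_comm, Finset.sum_comm]
      refine Finset.sum_congr rfl fun a _ => ?_
      rw [Finset.sum_comm]
      exact Finset.sum_congr rfl fun b _ => Finset.sum_congr rfl fun c _ => by ring
    rw [e1, e2]
    simp only [hKd, Finset.mul_sum, ← Finset.sum_add_distrib, ← Finset.sum_sub_distrib]
    refine Finset.sum_congr rfl fun a _ => Finset.sum_congr rfl fun b _ =>
      Finset.sum_congr rfl fun c _ => ?_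
    rw [← Finset.mul_sum, hK.lower_christoffel h₂ hy2]
    change P a j * P c i * P b l * (1 / 2 * (dg c a b + dg b a c - dg a c b)) = _
    ring
  set R : Fin (2 * n) → ℝ := fun b => ∑ c, P b c * christoffel g ψ₁ c i l y
      - ∑ c, ∑ d, P c i * christoffel g ψ₂ b c d (τ y) * P d l with hR
  -- The two sides are compared after multiplication by `Pᵀ G`, which lowers the index and is
  -- invertible.
  have hu : IsUnit (P.transpose * G) := by
    rw [Matrix.isUnit_iff_isUnit_det, Matrix.det_mul, Matrix.det_transpose]
    exact (isUnit_det_jac h₁ h₂ hy.1 hy').mul (hK.det_ne_zero h₂ hy2).isUnit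
  have hmv : (P.transpose * G).mulVec (fun b => H b i l) = (P.transpose * G).mulVec R := by
    ext j
    have hl : (P.transpose * G).mulVec (fun b => H b i l) j = S j i l := by
      simp only [Matrix.mulVec, dotProduct, Matrix.mul_apply, Matrix.transpose_apply, hS,
        Finset.sum_mul]
      exact Finset.sum_comm
    have hr : (P.transpose * G).mulVec R j =
        ∑ c, coeff g ψ₁ y j c * christoffel g ψ₁ c i l y -
        ∑ a, ∑ b, ∑ c, P a j * P c i * P b l *
          (∑ d, G a d * christoffel g ψ₂ d c b (τ y)) := by
      have hR' : R = P.mulVec (fun c => christoffel g ψ₁ c i l y) -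
          fun b => ∑ c, ∑ d, P c i * christoffel g ψ₂ b c d (τ y) * P d l := rfl
      rw [hR', Matrix.mulVec_sub, Matrix.mulVec_mulVec, Pi.sub_apply,
        ← show coeff g ψ₁ y = P.transpose * G * P from coeff_change g h₁ h₂ hy.1 hy']
      congr 1
      rw [← Matrix.mulVec_mulVec]
      simp only [Matrix.mulVec, dotProduct, Matrix.transpose_apply, Finset.mul_sum]
      refine Finset.sum_congr rfl fun a _ => ?_
      rw [Finset.sum_comm, Finset.sum_congr rfl fun c _ => Finset.sum_comm, Finset.sum_comm]
      refine Finset.sum_congr rfl fun b _ => Finset.sum_congr rfl fun c _ =>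
        Finset.sum_congr rfl fun d _ => by ring
    rw [hl, hr, hlow1, hlow2]
    ring
  exact congrFun (Matrix.mulVec_injective_of_isUnit hu hmv) b

lemma fderiv_jac_eq (hK : IsKahlerOff D g J) (hD : IsClosed D) (h₁ : ψ₁ ∈ 𝒜) (h₂ : ψ₂ ∈ 𝒜)
    {y : E n} (hy : y ∈ chartDom D ψ₁) (hy' : ψ₁.symm y ∈ ψ₂.source) (w : E n)
    (a l : Fin (2 * n)) :
    fderiv ℝ (fun z => jac (ψ₂ ∘ ψ₁.symm) z a l) y w =
      (jac (ψ₂ ∘ ψ₁.symm) y * connMat g ψ₁ y w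
        - connMat g ψ₂ (ψ₂ (ψ₁.symm y)) (fderiv ℝ (ψ₂ ∘ ψ₁.symm) y w) *
          jac (ψ₂ ∘ ψ₁.symm) y) a l := by
  rw [fderiv_eq_sum_pd]
  simp only [pd_jac_eq hK hD h₁ h₂ hy hy', smul_eq_mul, mul_sub, Finset.sum_sub_distrib,
    Matrix.sub_apply, Matrix.mul_apply, connMat, Matrix.of_apply, Finset.mul_sum,
    Finset.sum_mul, fderiv_eq_mulVec]
  congr 1
  · rw [Finset.sum_comm]
    exact Finset.sum_congr rfl fun b _ => Finset.sum_congr rfl fun c _ => by ring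
  · rw [Finset.sum_comm, Finset.sum_congr rfl fun c _ => Finset.sum_comm, Finset.sum_comm]
    exact Finset.sum_congr rfl fun b _ => Finset.sum_congr rfl fun c _ =>
      Finset.sum_congr rfl fun d _ => by ring

lemma actDeriv_zero_left {m : ℕ} (M : Matrix (Fin (2 * n)) (Fin (2 * n)) ℝ)
    (A A' : (Fin m → Fin (2 * n)) → ℂ) : actDeriv M 0 A A' = act M A' := by
  ext K
  simp [actDeriv, act]

/-- Both covariant derivatives are derivatives of components in frames parallel to first order. By
`fderiv_jac_eq` the curves of matrices `P(s) (1 - s Γ₁)` and `(1 - s Γ₂) P(0)` have the same value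
and the same derivative at `s = 0`, hence so do the resulting components. -/
lemma contract_nablaComp_change (hK : IsKahlerOff D g J) (hD : IsClosed D)
    (h₁ : ψ₁ ∈ atlas (E n) X) (h₂ : ψ₂ ∈ atlas (E n) X) {m : ℕ} {φ : Form n X m}
    (hφ : φ.SmoothOff D) {y : E n} (hy : y ∈ chartDom D ψ₁) (hy' : ψ₁.symm y ∈ ψ₂.source)
    (w : E n) :
    contract w (fun I => nablaComp g φ ψ₁ I y) = act (jac (ψ₂ ∘ ψ₁.symm) y).transpose
      (contract (fderiv ℝ (ψ₂ ∘ ψ₁.symm) y w)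
        (fun I => nablaComp g φ ψ₂ I (ψ₂ (ψ₁.symm y)))) := by
  have h₁' : ψ₁ ∈ 𝒜 := IsManifold.subset_maximalAtlas h₁
  have h₂' : ψ₂ ∈ 𝒜 := IsManifold.subset_maximalAtlas h₂
  have hfd := fun a l => fderiv_jac_eq hK hD h₁' h₂' hy hy' w a l
  set τ := ψ₂ ∘ ψ₁.symm with hτ
  have hty : ψ₂ (ψ₁.symm y) = τ y := rfl
  rw [hty] at hfd ⊢
  have hτs : ContDiffAt ℝ ∞ τ y := contDiffAt_transition h₁' h₂' hy.1 hy'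
  have hy2 : τ y ∈ chartDom D ψ₂ := transition_mem_chartDom hy hy'
  have hτd : DifferentiableAt ℝ τ y := hτs.differentiableAt (by simp)
  set w₂ := fderiv ℝ τ y w with hw₂
  set Γ₁ := connMat g ψ₁ y w
  set Γ₂ := connMat g ψ₂ (τ y) w₂
  set P := jac τ y with hP
  have hφ₂ : ∀ I, DifferentiableAt ℝ (φ.comp ψ₂ I) (τ y) := fun I =>
    (hφ.contDiffAt hD h₂ hy2 I).differentiableAt (by simp)
  ext K
  rw [contract_nablaComp, contract_nablaComp]
  have hleft : HasDerivAt (fun s : ℝ => act (1 - s • Γ₁).transpose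
      (fun I => φ.comp ψ₁ I (y + s • w)) K) (actDeriv 1 (-Γ₁).transpose (fun I => φ.comp ψ₁ I y)
        (fun I => fderiv ℝ (φ.comp ψ₁ I) y w) K) 0 := by
    have h := EntryDeriv.act (EntryDeriv.one_sub_smul Γ₁).transpose
      (A := fun s : ℝ => fun I => φ.comp ψ₁ I (y + s • w))
      (fun I => hasDerivAt_line ((hφ.contDiffAt hD h₁ hy I).differentiableAt (by simp)) w) K
    simpa using h
  have hPd : EntryDeriv (fun s : ℝ => jac τ (y + s • w)) (P * Γ₁ - Γ₂ * P) := by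
    intro a l
    rw [← hfd]
    exact hasDerivAt_line ((contDiffAt_jac hτs a l).differentiableAt (by simp)) w
  have hA2 : ∀ I, HasDerivAt (fun s : ℝ => φ.comp ψ₂ I (τ (y + s • w)))
      (fderiv ℝ (φ.comp ψ₂ I) (τ y) w₂) 0 := by
    intro I
    have h := hasDerivAt_line ((hφ₂ I).comp y hτd) w
    rw [fderiv_comp y (hφ₂ I) hτd] at h
    exact h
  have hmid := ((hPd.mul (EntryDeriv.one_sub_smul Γ₁)).transpose).act hA2 K
  simp only [zero_smul, add_zero, sub_zero, mul_one, mul_neg] at hmid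
  have hright := (EntryDeriv.const P.transpose).act (fun I =>
    ((EntryDeriv.one_sub_smul Γ₂).transpose).act
      (fun I => hasDerivAt_line (hφ₂ I) w₂) I) K
  have hright2 := (((EntryDeriv.one_sub_smul Γ₂).mul (EntryDeriv.const P)).transpose).act
      (fun I => hasDerivAt_line (hφ₂ I) w₂) K
  simp only [zero_smul, add_zero, sub_zero, mul_zero, one_mul, Matrix.transpose_one,
    actDeriv_zero_left] at hright hright2
  simp only [Matrix.transpose_mul, act_mul] at hright2
  have e1 := hright.unique hright2
  have hev : (fun s : ℝ => act (jac τ (y + s • w) * (1 - s • Γ₁)).transpose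
      (fun I => φ.comp ψ₂ I (τ (y + s • w))) K) =ᶠ[𝓝 0] fun s : ℝ => act (1 - s • Γ₁).transpose
      (fun I => φ.comp ψ₁ I (y + s • w)) K := by
    have hc : Tendsto (fun s : ℝ => y + s • w) (𝓝 0) (𝓝 y) := by
      have : ContinuousAt (fun s : ℝ => y + s • w) 0 := by fun_prop
      simpa [ContinuousAt] using this
    filter_upwards [hc.eventually (eventually_transition hy.1 hy')] with s hs
    rw [comp_change φ h₁' h₂' hs.1 hs.2, ← act_mul, Matrix.transpose_mul]
    rfl
  have e2 := hleft.unique (hmid.congr_of_eventuallyEq hev.symm)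
  have hM : P * Γ₁ - Γ₂ * P + -(jac τ y * Γ₁) = -Γ₂ * P := by
    rw [neg_mul]
    abel
  rw [e2, e1, hM, Matrix.transpose_mul]

/-- Reduces a transformation law for tensors of degree `m + 1` to that of their contractions with
the basis vectors. -/
lemma act_cons {m : ℕ} (B : Matrix (Fin (2 * n)) (Fin (2 * n)) ℝ)
    (A : (Fin (m + 1) → Fin (2 * n)) → ℂ) (k : Fin (2 * n)) (K : Fin m → Fin (2 * n)) :
    act B A (Fin.cons k K) = act B (contract (B k) A) K := by
  rw [act, ← (Fin.consEquiv fun _ : Fin (m + 1) => Fin (2 * n)).sum_comp, Fintype.sum_prod_type,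
    Finset.sum_comm, act]
  refine Finset.sum_congr rfl fun I _ => ?_
  rw [contract, Finset.mul_sum]
  refine Finset.sum_congr rfl fun i _ => ?_
  simp [Fin.consEquiv, Fin.prod_univ_succ]
  ring

/-- The covariant derivative is a tensor. -/
lemma nablaComp_change (hK : IsKahlerOff D g J) (hD : IsClosed D)
    (h₁ : ψ₁ ∈ atlas (E n) X) (h₂ : ψ₂ ∈ atlas (E n) X) {m : ℕ} {φ : Form n X m}
    (hφ : φ.SmoothOff D) {y : E n} (hy : y ∈ chartDom D ψ₁) (hy' : ψ₁.symm y ∈ ψ₂.source) :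
    (fun I => nablaComp g φ ψ₁ I y) = act (jac (ψ₂ ∘ ψ₁.symm) y).transpose
      (fun I => nablaComp g φ ψ₂ I (ψ₂ (ψ₁.symm y))) := by
  ext I
  obtain ⟨i, I, rfl⟩ : ∃ i K, I = Fin.cons i K := ⟨I 0, Fin.tail I, (Fin.cons_self_tail I).symm⟩
  have h := congrFun (contract_nablaComp_change hK hD h₁ h₂ hφ hy hy' (stdVec i)) I
  rw [act_cons]
  refine Eq.trans ?_ h
  simp [contract, stdVec, apply_ite]

/-- The pointwise squared norm of `∇φ`. -/
def gradSq (g : BilinField (n := n) X) {m : ℕ} (φ : Form n X m) (x : X) : ℝ :=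
  tensorNormSq (coeff g (chartAt (E n) x) (chartAt (E n) x x))
    (fun I => nablaComp g φ (chartAt (E n) x) I (chartAt (E n) x x)) / m.factorial

lemma IsKahlerOff.gradSq_symm (hK : IsKahlerOff D g J) (hD : IsClosed D) {m : ℕ}
    {φ : Form n X m} (hφ : φ.SmoothOff D) (hψ : ψ ∈ atlas (E n) X) {y : E n}
    (hy : y ∈ chartDom D ψ) : gradSq g φ (ψ.symm y) =
      tensorNormSq (coeff g ψ y) (fun I => nablaComp g φ ψ I y) / m.factorial := by
  set x := ψ.symm y with hx
  have hψ' : ψ ∈ 𝒜 := IsManifold.subset_maximalAtlas hψ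
  have hxs : x ∈ (chartAt (E n) x).source := mem_chart_source _ _
  rw [gradSq, coeff_change g hψ' (chartAt_mem x) hy.1 hxs,
    nablaComp_change hK hD hψ (chart_mem_atlas _ _) hφ hy hxs, tensorNormSq_change
      (hK.posDef_coeff (chartAt_mem x) (transition_mem_chartDom hy hxs))
      (isUnit_det_jac hψ' (chartAt_mem x) hy.1 hxs)]

lemma IsKahlerOff.normSq_nonneg (hK : IsKahlerOff D g J) {m : ℕ} (φ : Form n X m) {x : X}
    (hx : x ∉ D) : 0 ≤ φ.normSq g x :=
  div_nonneg (tensorNormSq_nonneg (hK.posDef_coeff (chartAt_mem x) (chartAt_mem_chartDom hx)) _)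
    (Nat.cast_nonneg _)

lemma IsKahlerOff.gradSq_nonneg (hK : IsKahlerOff D g J) {m : ℕ} (φ : Form n X m) {x : X}
    (hx : x ∉ D) : 0 ≤ gradSq g φ x :=
  div_nonneg (tensorNormSq_nonneg (hK.posDef_coeff (chartAt_mem x) (chartAt_mem_chartDom hx)) _)
    (Nat.cast_nonneg _)

lemma IsKahlerOff.contDiffAt_christoffel (hK : IsKahlerOff D g J) (hD : IsClosed D)
    (hψ : ψ ∈ 𝒜) {y : E n} (hy : y ∈ chartDom D ψ) (a i j : Fin (2 * n)) :
    ContDiffAt ℝ ∞ (christoffel g ψ a i j) y := by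
  have hpd : ∀ c a b, ContDiffAt ℝ ∞ (pd c (fun z => coeff g ψ z a b)) y := fun c a b =>
    ((hK.contDiffAt_coeff hD hψ hy a b).fderiv_right (m := ∞) (by simp)).clm_apply
      contDiffAt_const
  unfold christoffel
  exact contDiffAt_const.mul (ContDiffAt.sum fun b _ => (contDiffAt_inv_apply
    (fun i j => hK.contDiffAt_coeff hD hψ hy i j) (hK.det_ne_zero hψ hy) a b).mul
      (((hpd _ _ _).add (hpd _ _ _)).sub (hpd _ _ _)))

lemma IsKahlerOff.contDiffAt_nablaComp (hK : IsKahlerOff D g J) (hD : IsClosed D)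
    (hψ : ψ ∈ atlas (E n) X) {m : ℕ} {φ : Form n X m} (hφ : φ.SmoothOff D) {y : E n}
    (hy : y ∈ chartDom D ψ) (I : Fin (m + 1) → Fin (2 * n)) :
    ContDiffAt ℝ ∞ (nablaComp g φ ψ I) y := by
  unfold nablaComp
  refine (((hφ.contDiffAt hD hψ hy _).fderiv_right (m := ∞) (by simp)).clm_apply
    contDiffAt_const).sub (ContDiffAt.sum fun l _ => ContDiffAt.sum fun a _ =>
    (Complex.ofRealCLM.contDiff.contDiffAt.comp y (hK.contDiffAt_christoffel hD
      (IsManifold.subset_maximalAtlas hψ) hy _ _ _)).mul (hφ.contDiffAt hD hψ hy _))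

lemma continuousAt_of_chart {Y : Type*} [TopologicalSpace Y] {f : X → Y} {x : X}
    (h : ContinuousAt (f ∘ (chartAt (E n) x).symm) (chartAt (E n) x x)) : ContinuousAt f x := by
  have h1 := h.comp ((chartAt (E n) x).continuousAt (mem_chart_source _ x))
  refine h1.congr ?_
  filter_upwards [(chartAt (E n) x).open_source.mem_nhds (mem_chart_source _ x)] with z hz
  simp [(chartAt (E n) x).left_inv hz]

lemma IsKahlerOff.contDiffAt_normSq_symm (hK : IsKahlerOff D g J) (hD : IsClosed D)
    (hψ : ψ ∈ atlas (E n) X) {m : ℕ} {φ : Form n X m} (hφ : φ.SmoothOff D) {y : E n}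
    (hy : y ∈ chartDom D ψ) : ContDiffAt ℝ ∞ (φ.normSq g ∘ ψ.symm) y := by
  have hψ' : ψ ∈ 𝒜 := IsManifold.subset_maximalAtlas hψ
  have h := (contDiffAt_tensorNormSq (fun i j => hK.contDiffAt_coeff hD hψ' hy i j)
    (hK.det_ne_zero hψ' hy) (fun I => hφ.contDiffAt hD hψ hy I)).div_const (m.factorial : ℝ)
  refine h.congr_of_eventuallyEq ?_
  filter_upwards [(isOpen_chartDom hD ψ).mem_nhds hy] with z hz using hK.normSq_symm φ hψ' hz

lemma IsKahlerOff.continuousOn_normSq (hK : IsKahlerOff D g J) (hD : IsClosed D) {m : ℕ}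
    {φ : Form n X m} (hφ : φ.SmoothOff D) : ContinuousOn (φ.normSq g) Dᶜ := fun _ hx =>
  (continuousAt_of_chart (hK.contDiffAt_normSq_symm hD (chart_mem_atlas _ _) hφ
    (chartAt_mem_chartDom hx)).continuousAt).continuousWithinAt

lemma IsKahlerOff.continuousOn_gradSq (hK : IsKahlerOff D g J) (hD : IsClosed D) {m : ℕ}
    {φ : Form n X m} (hφ : φ.SmoothOff D) : ContinuousOn (gradSq g φ) Dᶜ := by
  intro x hx
  refine (continuousAt_of_chart (n := n) ?_).continuousWithinAt
  have hy := chartAt_mem_chartDom (n := n) hx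
  have hm : chartAt (E n) x ∈ 𝒜 := chartAt_mem (n := n) x
  have h := (contDiffAt_tensorNormSq (fun i j => hK.contDiffAt_coeff hD hm hy i j)
    (hK.det_ne_zero hm hy) (fun I => hK.contDiffAt_nablaComp hD
      (chart_mem_atlas (E n) x) hφ hy I)).div_const (m.factorial : ℝ)
  refine (h.congr_of_eventuallyEq ?_).continuousAt
  filter_upwards [(isOpen_chartDom hD _).mem_nhds hy] with z hz using
    hK.gradSq_symm hD hφ (chart_mem_atlas _ _) hz

/-- Along a curve, the derivative of `|φ|²` is controlled by `|φ|²` and `|∇φ|²`. -/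
lemma IsKahlerOff.hasDerivAt_normSq_comp (hK : IsKahlerOff D g J) (hD : IsClosed D) {m : ℕ}
    {φ : Form n X m} (hφ : φ.SmoothOff D) {γ : ℝ → X} {r : ℝ}
    (hγ : MDifferentiableAt 𝓘(ℝ, ℝ) 𝓘(ℝ, E n) γ r) (hr : γ r ∉ D) (v : E n)
    (hv : v = mfderiv 𝓘(ℝ, ℝ) 𝓘(ℝ, E n) γ r (1 : ℝ)) :
    ∃ u', HasDerivAt (fun ρ => φ.normSq g (γ ρ)) u' r ∧
      |u'| ≤ φ.normSq g (γ r) + bilinE g (γ r) v v * gradSq g φ (γ r) := by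
  set x := γ r with hx
  set ψ := chartAt (E n) x with hψ
  have hs : x ∈ ψ.source := mem_chart_source _ _
  have hy : ψ x ∈ chartDom D ψ := chartAt_mem_chartDom hr
  have hψ' : ψ ∈ 𝒜 := chartAt_mem x
  set w : E n := coframeMap ψ x v with hw
  have hγd : HasDerivAt (ψ ∘ γ) w r := by
    have h1 := (mdifferentiableAt_chart hψ' hs).hasMFDerivAt.comp r hγ.hasMFDerivAt
    have h2 : HasFDerivAt (ψ ∘ γ) ((coframeMap ψ x).comp
        (mfderiv 𝓘(ℝ, ℝ) 𝓘(ℝ, E n) γ r : ℝ →L[ℝ] E n)) r := h1.hasFDerivAt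
    rw [hw, hv]
    exact h2.hasDerivAt
  have hU := hK.contDiffAt_normSq_symm hD (chart_mem_atlas (E n) x) hφ hy
  have hUd : HasFDerivAt (φ.normSq g ∘ ψ.symm) (fderiv ℝ (φ.normSq g ∘ ψ.symm) (ψ x))
    ((ψ ∘ γ) r) := (hU.differentiableAt (by simp)).hasFDerivAt
  have hcomp := hUd.comp_hasDerivAt r hγd
  refine ⟨_, hcomp.congr_of_eventuallyEq ?_, ?_⟩
  · have : ∀ᶠ ρ in 𝓝 r, γ ρ ∈ ψ.source :=
      hγ.continuousAt.preimage_mem_nhds (ψ.open_source.mem_nhds hs)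
    filter_upwards [this] with ρ hρ
    simp [ψ.left_inv hρ]
  · have hfd : fderiv ℝ (φ.normSq g ∘ ψ.symm) (ψ x) w =
        tensorCross (coeff g ψ (ψ x)) (fun I => φ.comp ψ I (ψ x))
          (contract w (fun I => nablaComp g φ ψ I (ψ x))) / m.factorial := by
      rw [← hK.fderiv_tensorNormSq hD (chart_mem_atlas _ _) hφ hy]
      have hev : (φ.normSq g ∘ ψ.symm) =ᶠ[𝓝 (ψ x)] fun z => (m.factorial : ℝ)⁻¹ •
          tensorNormSq (coeff g ψ z) (fun I => φ.comp ψ I z) := by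
        filter_upwards [(isOpen_chartDom hD ψ).mem_nhds hy] with z hz
        rw [Function.comp_apply, hK.normSq_symm φ hψ' hz, smul_eq_mul, div_eq_inv_mul]
      rw [hev.fderiv_eq, fderiv_fun_const_smul, ContinuousLinearMap.smul_apply, smul_eq_mul,
        div_eq_inv_mul]
      exact (contDiffAt_tensorNormSq (fun i j => hK.contDiffAt_coeff hD hψ' hy i j)
        (hK.det_ne_zero hψ' hy) (fun I => hφ.contDiffAt hD (chart_mem_atlas (E n) x)
          hy I)).differentiableAt (by simp)
    have hgv : bilinE g x v v = ∑ i, ∑ j, coeff g ψ (ψ x) i j * w i * w j := by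
      have hvw : v = ∑ i, w i • frameMap ψ (ψ x) (stdVec i) := by
        conv_lhs => rw [← frameMap_coframeMap hψ' hs v, ← hw, eq_sum_stdVec w]
        simp
      conv_lhs => rw [hvw]
      simp only [map_sum, map_smul, ContinuousLinearMap.sum_apply,
        ContinuousLinearMap.smul_apply, smul_eq_mul, coeff_apply, ψ.left_inv hs,
        Finset.mul_sum]
      exact Finset.sum_congr rfl fun a _ => Finset.sum_congr rfl fun b _ => by
        rw [show bilinE g x (frameMap ψ (ψ x) (stdVec a)) (frameMap ψ (ψ x) (stdVec b)) =
          bilinE g x (frameMap ψ (ψ x) (stdVec b)) (frameMap ψ (ψ x) (stdVec a)) from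
          hK.symm _ hr _ _]
        ring
    have hpos := hK.posDef_coeff hψ' hy
    rw [hfd, abs_div, Nat.abs_cast, hgv, Form.normSq, gradSq, ← hψ, mul_div_assoc', ← add_div]
    gcongr
    -- The cross term of `φ` and `∇_w φ` is at most `|φ|² + |∇_w φ|²`, and contraction with `w`
    -- costs the factor `g(v, v)`.
    exact (abs_tensorCross_le hpos _ _).trans
      (add_le_add_right (tensorNormSq_contract_le hpos _ _) _)

end Covariance

/-! ### The Riemannian volume measure -/

section Volume

variable {n : ℕ} {X : Type*} [TopologicalSpace X] [ChartedSpace (E n) X]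
  [IsManifold 𝓘(ℝ, E n) ∞ X] [MeasurableSpace X] [BorelSpace X]

local notation "𝒜" => IsManifold.maximalAtlas 𝓘(ℝ, E n) ∞ X

variable {D : Set X} {g : BilinField (n := n) X} {J : EndField (n := n) X}
  {ψ ψ₁ ψ₂ : OpenPartialHomeomorph X (E n)}

/-- The density of the Riemannian volume in a chart. -/
def dens (g : BilinField (n := n) X) (ψ : OpenPartialHomeomorph X (E n)) (y : E n) : ℝ≥0∞ :=
  ENNReal.ofReal (Real.sqrt (coeff g ψ y).det)

/-- The Riemannian volume in a chart, as a measure on the model space. -/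
def modelVolume (D : Set X) (g : BilinField (n := n) X) (ψ : OpenPartialHomeomorph X (E n)) :
    Measure (E n) :=
  (volume.restrict (chartDom D ψ)).withDensity (dens g ψ)

lemma chartVolume_eq_map : chartVolume D g ψ = Measure.map ψ.symm (modelVolume D g ψ) := rfl

lemma continuousOn_dens (hK : IsKahlerOff D g J) (hD : IsClosed D) (hψ : ψ ∈ 𝒜) :
    ContinuousOn (dens g ψ) (chartDom D ψ) := fun _ hy =>
  (ENNReal.continuous_ofReal.continuousAt.comp (Real.continuous_sqrt.continuousAt.comp
    (contDiffAt_det fun i j => hK.contDiffAt_coeff hD hψ hy i j).continuousAt)).continuousWithinAt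

lemma aemeasurable_dens (hK : IsKahlerOff D g J) (hD : IsClosed D) (hψ : ψ ∈ 𝒜) :
    AEMeasurable (dens g ψ) (volume.restrict (chartDom D ψ)) :=
  (continuousOn_dens hK hD hψ).aemeasurable (isOpen_chartDom hD ψ).measurableSet

lemma dens_pos (hK : IsKahlerOff D g J) (hψ : ψ ∈ 𝒜) {y : E n} (hy : y ∈ chartDom D ψ) :
    0 < dens g ψ y := by
  rw [dens, ENNReal.ofReal_pos, Real.sqrt_pos]
  exact (hK.posDef_coeff hψ hy).det_pos

lemma modelVolume_absolutelyContinuous :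
    modelVolume D g ψ ≪ volume.restrict (chartDom D ψ) :=
  withDensity_absolutelyContinuous _ _

lemma absolutelyContinuous_modelVolume (hK : IsKahlerOff D g J) (hD : IsClosed D) (hψ : ψ ∈ 𝒜) :
    volume.restrict (chartDom D ψ) ≪ modelVolume D g ψ := by
  refine withDensity_absolutelyContinuous' (aemeasurable_dens hK hD hψ) ?_
  filter_upwards [ae_restrict_mem (isOpen_chartDom hD ψ).measurableSet] with y hy
  exact (dens_pos hK hψ hy).ne'

lemma ae_mem_chartDom (hD : IsClosed D) : ∀ᵐ y ∂(modelVolume D g ψ), y ∈ chartDom D ψ :=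
  modelVolume_absolutelyContinuous.ae_le (ae_restrict_mem (isOpen_chartDom hD ψ).measurableSet)

lemma aemeasurable_chart_symm (hD : IsClosed D) : AEMeasurable ψ.symm (modelVolume D g ψ) :=
  ((ψ.continuousOn_symm.mono inter_subset_left).aemeasurable
    (isOpen_chartDom hD ψ).measurableSet).mono_ac modelVolume_absolutelyContinuous

/-- The inverse of a chart, defined on its target. -/
def chartEmb (ψ : OpenPartialHomeomorph X (E n)) : ψ.target → X := fun y => ψ.symm y

/-- Off its target `ψ.symm` has arbitrary values. On the target it is a homeomorphism onto the open
source, which transfers integrals and measurability in both directions. -/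
lemma measurableEmbedding_chartEmb : MeasurableEmbedding (chartEmb ψ) := by
  have h := (MeasurableEmbedding.subtype_coe ψ.open_source.measurableSet).comp
    ψ.toHomeomorphSourceTarget.symm.measurableEmbedding
  exact h

lemma chartVolume_eq_map_emb (hD : IsClosed D) : chartVolume D g ψ =
    Measure.map (chartEmb ψ) (Measure.comap (↑) (modelVolume D g ψ)) := by
  ext A hA
  rw [chartVolume_eq_map, Measure.map_apply_of_aemeasurable (aemeasurable_chart_symm hD) hA,
    measurableEmbedding_chartEmb.map_apply,
    (MeasurableEmbedding.subtype_coe ψ.open_target.measurableSet).comap_apply]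
  refine measure_congr ?_
  filter_upwards [ae_mem_chartDom hD] with y hy
  refine propext ⟨fun h => ⟨⟨y, hy.1⟩, h, rfl⟩, ?_⟩
  rintro ⟨z, hz, rfl⟩
  exact hz

lemma modelVolume_restrict_target (hD : IsClosed D) :
    (modelVolume D g ψ).restrict ψ.target = modelVolume D g ψ :=
  Measure.restrict_eq_self_of_ae_mem ((ae_mem_chartDom hD).mono fun _ h => h.1)

/-- No measurability of `F` is needed: the chart is a measurable embedding and the density is
finite. -/
lemma lintegral_chartVolume (hK : IsKahlerOff D g J) (hD : IsClosed D) (hψ : ψ ∈ 𝒜)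
    (F : X → ℝ≥0∞) : ∫⁻ x, F x ∂(chartVolume D g ψ) =
      ∫⁻ y in chartDom D ψ, dens g ψ y * F (ψ.symm y) := by
  rw [chartVolume_eq_map_emb hD, measurableEmbedding_chartEmb.lintegral_map]
  have h := lintegral_subtype_comap (μ := modelVolume D g ψ) ψ.open_target.measurableSet
    (fun y => F (ψ.symm y))
  rw [modelVolume_restrict_target hD] at h
  refine h.trans ?_
  rw [modelVolume, lintegral_withDensity_eq_lintegral_mul_non_measurable₀ _
    (aemeasurable_dens hK hD hψ) (by simp [dens])]
  rfl

lemma aemeasurable_chartVolume (hD : IsClosed D) {F : X → ℝ≥0∞}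
    (h : AEMeasurable (fun y => F (ψ.symm y)) (volume.restrict (chartDom D ψ))) :
    AEMeasurable F (chartVolume D g ψ) := by
  rw [chartVolume_eq_map_emb hD, measurableEmbedding_chartEmb.aemeasurable_map_iff]
  have h2 := (aemeasurable_restrict_iff_comap_subtype (μ := modelVolume D g ψ)
    ψ.open_target.measurableSet (f := fun y => F (ψ.symm y))).1 (by
      rw [modelVolume_restrict_target hD]; exact h.mono_ac modelVolume_absolutelyContinuous)
  exact h2

lemma chartVolume_restrict_source (hD : IsClosed D) :
    (chartVolume D g ψ).restrict ψ.source = chartVolume D g ψ := by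
  refine Measure.restrict_eq_self_of_ae_mem ?_
  rw [chartVolume_eq_map]
  refine (ae_map_iff (p := fun x => x ∈ ψ.source) (aemeasurable_chart_symm hD)
    ψ.open_source.measurableSet).2 ?_
  filter_upwards [ae_mem_chartDom hD] with y hy using ψ.map_target hy.1

lemma chartVolume_apply (hK : IsKahlerOff D g J) (hD : IsClosed D) (hψ : ψ ∈ 𝒜) {A : Set X}
    (hA : MeasurableSet A) : chartVolume D g ψ A =
      ∫⁻ y in ψ.symm ⁻¹' A ∩ chartDom D ψ, dens g ψ y := by
  have hm : MeasurableSet (ψ.symm ⁻¹' A ∩ ψ.target) := by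
    have := (MeasurableEmbedding.subtype_coe ψ.open_target.measurableSet).measurableSet_image.2
      (measurableEmbedding_chartEmb (ψ := ψ).measurable hA)
    convert this using 1
    ext y
    constructor
    · rintro ⟨h1, h2⟩; exact ⟨⟨y, h2⟩, h1, rfl⟩
    · rintro ⟨z, hz, rfl⟩; exact ⟨hz, z.2⟩
  have hm2 : ψ.symm ⁻¹' A ∩ chartDom D ψ = (ψ.symm ⁻¹' A ∩ ψ.target) ∩ chartDom D ψ := by
    ext y; constructor
    · rintro ⟨h1, h2⟩; exact ⟨⟨h1, h2.1⟩, h2⟩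
    · rintro ⟨h1, h2⟩; exact ⟨h1.1, h2⟩
  rw [← lintegral_indicator_one hA, lintegral_chartVolume hK hD hψ, hm2,
    ← Measure.restrict_restrict hm, ← lintegral_indicator hm]
  refine setLIntegral_congr_fun (isOpen_chartDom hD ψ).measurableSet fun y hy => ?_
  by_cases h : ψ.symm y ∈ A
  · simp [h, indicator_of_mem (show y ∈ ψ.symm ⁻¹' A ∩ ψ.target from ⟨h, hy.1⟩)]
  · simp [h]

lemma dens_change (h₁ : ψ₁ ∈ 𝒜) (h₂ : ψ₂ ∈ 𝒜) {y : E n}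
    (hy : y ∈ chartDom D ψ₁) (hy' : ψ₁.symm y ∈ ψ₂.source) :
    dens g ψ₁ y = ENNReal.ofReal |(fderiv ℝ (ψ₂ ∘ ψ₁.symm) y).det| *
      dens g ψ₂ (ψ₂ (ψ₁.symm y)) := by
  rw [dens, dens, ← ENNReal.ofReal_mul (abs_nonneg _), coeff_change g h₁ h₂ hy.1 hy',
    Matrix.det_mul, Matrix.det_mul, Matrix.det_transpose, ← det_jac, ← Real.sqrt_sq_eq_abs,
    ← Real.sqrt_mul (sq_nonneg _)]
  ring_nf

/-- The change of variables formula for the transition map; by `dens_change` its Jacobian is the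
quotient of the densities. -/
lemma chartVolume_eq_of_subset (hK : IsKahlerOff D g J) (hD : IsClosed D) (h₁ : ψ₁ ∈ 𝒜)
    (h₂ : ψ₂ ∈ 𝒜) {A : Set X} (hA : MeasurableSet A) (hA₁ : A ⊆ ψ₁.source)
    (hA₂ : A ⊆ ψ₂.source) : chartVolume D g ψ₁ A = chartVolume D g ψ₂ A := by
  rw [chartVolume_apply hK hD h₁ hA, chartVolume_apply hK hD h₂ hA]
  set S := ψ₁.symm ⁻¹' A ∩ chartDom D ψ₁ with hS
  have hSm : MeasurableSet S := by
    have : S = Subtype.val '' (chartEmb ψ₁ ⁻¹' A) ∩ chartDom D ψ₁ := by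
      ext y; constructor
      · rintro ⟨h, h'⟩; exact ⟨⟨⟨y, h'.1⟩, h, rfl⟩, h'⟩
      · rintro ⟨⟨z, hz, rfl⟩, h'⟩; exact ⟨hz, h'⟩
    rw [this]
    exact ((MeasurableEmbedding.subtype_coe ψ₁.open_target.measurableSet).measurableSet_image.2
      (measurableEmbedding_chartEmb.measurable hA)).inter (isOpen_chartDom hD ψ₁).measurableSet
  have himg : ψ₂.symm ⁻¹' A ∩ chartDom D ψ₂ = (ψ₂ ∘ ψ₁.symm) '' S := by
    ext z; constructor
    · rintro ⟨h, h'⟩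
      have hz : ψ₁.symm (ψ₁ (ψ₂.symm z)) = ψ₂.symm z := ψ₁.left_inv (hA₁ h)
      refine ⟨ψ₁ (ψ₂.symm z), ⟨?_, transition_mem_chartDom h' (hA₁ h)⟩, ?_⟩
      · rw [mem_preimage, hz]; exact h
      · rw [Function.comp_apply, hz, ψ₂.right_inv h'.1]
    · rintro ⟨y, ⟨hy, hy'⟩, rfl⟩
      refine ⟨?_, transition_mem_chartDom hy' (hA₂ hy)⟩
      rw [mem_preimage, Function.comp_apply, ψ₂.left_inv (hA₂ hy)]; exact hy
  rw [himg, lintegral_image_eq_lintegral_abs_det_fderiv_mul volume hSm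
    (f' := fun y => fderiv ℝ (ψ₂ ∘ ψ₁.symm) y)]
  · exact setLIntegral_congr_fun hSm fun y hy => dens_change h₁ h₂ hy.2 (hA₂ hy.1)
  · intro y hy
    exact ((contDiffAt_transition h₁ h₂ hy.2.1 (hA₂ hy.1)).differentiableAt
      (by simp)).hasFDerivAt.hasFDerivWithinAt
  · intro y hy z hz hyz
    have := ψ₂.injOn (hA₂ hy.1) (hA₂ hz.1) hyz
    exact ψ₁.symm.injOn hy.2.1 hz.2.1 this

lemma chartVolume_inter_source (hD : IsClosed D) {A : Set X} (hA : MeasurableSet A) :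
    chartVolume D g ψ A = chartVolume D g ψ (A ∩ ψ.source) := by
  conv_lhs => rw [← chartVolume_restrict_source hD]
  rw [Measure.restrict_apply hA]

lemma chartVolume_restrict_comm (hK : IsKahlerOff D g J) (hD : IsClosed D) (h₁ : ψ₁ ∈ 𝒜)
    (h₂ : ψ₂ ∈ 𝒜) : (chartVolume D g ψ₁).restrict ψ₂.source =
      (chartVolume D g ψ₂).restrict ψ₁.source := by
  ext A hA
  have m1 := ψ₁.open_source.measurableSet
  have m2 := ψ₂.open_source.measurableSet
  rw [Measure.restrict_apply hA, Measure.restrict_apply hA,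
    chartVolume_inter_source hD (hA.inter m2), chartVolume_inter_source hD (hA.inter m1),
    show A ∩ ψ₁.source ∩ ψ₂.source = A ∩ ψ₂.source ∩ ψ₁.source by ac_rfl]
  exact chartVolume_eq_of_subset hK hD h₁ h₂ ((hA.inter m2).inter m1)
    (fun x hx => hx.2) (fun x hx => hx.1.2)

/-- The supremum in `vol` does not exceed the volume in one chart. Indeed the volume in `ψ` plus the
part of `vol` off the source of `ψ` already dominates the volume in each chart, as these agree on
overlaps. -/
lemma vol_restrict_le (hK : IsKahlerOff D g J) (hD : IsClosed D) (hψ : ψ ∈ 𝒜) :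
    (vol D g).restrict ψ.source ≤ chartVolume D g ψ := by
  have m := ψ.open_source.measurableSet
  have h : vol D g ≤ chartVolume D g ψ + (vol D g).restrict ψ.sourceᶜ := by
    refine iSup₂_le fun ψ' hψ' => ?_
    have hle : chartVolume D g ψ' ≤ vol D g := le_iSup₂_of_le ψ' hψ' le_rfl
    calc chartVolume D g ψ'
        = (chartVolume D g ψ').restrict ψ.source + (chartVolume D g ψ').restrict ψ.sourceᶜ :=
          (Measure.restrict_add_restrict_compl m).symm
      _ ≤ _ := by
          refine add_le_add ?_ (Measure.restrict_mono le_rfl hle)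
          rw [chartVolume_restrict_comm hK hD (IsManifold.subset_maximalAtlas hψ') hψ]
          exact Measure.restrict_le_self
  calc (vol D g).restrict ψ.source
      ≤ (chartVolume D g ψ + (vol D g).restrict ψ.sourceᶜ).restrict ψ.source :=
        Measure.restrict_mono le_rfl h
    _ = (chartVolume D g ψ).restrict ψ.source := by
        rw [Measure.restrict_add, Measure.restrict_restrict m, inter_compl_self]
        simp
    _ ≤ _ := Measure.restrict_le_self

lemma vol_restrict_of_mem_atlas (hK : IsKahlerOff D g J) (hD : IsClosed D)
    (hψ : ψ ∈ atlas (E n) X) : (vol D g).restrict ψ.source = chartVolume D g ψ := by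
  refine le_antisymm (vol_restrict_le hK hD (IsManifold.subset_maximalAtlas hψ)) ?_
  rw [← chartVolume_restrict_source hD]
  exact Measure.restrict_mono le_rfl (le_iSup₂_of_le ψ hψ le_rfl)

lemma exists_finite_cover [CompactSpace X] :
    ∃ S : Finset X, ⋃ x ∈ (S : Set X), (chartAt (E n) x).source = univ := by
  obtain ⟨S, -, hS⟩ := isCompact_univ.elim_nhds_subcover
    (fun x : X => (chartAt (E n) x).source) fun x _ => chart_source_mem_nhds _ x
  exact ⟨S, univ_subset_iff.1 hS⟩

/-- The definition of `vol` involves only charts of the atlas. For a chart of the maximal atlas the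
two measures are compared on a finite cover by such charts. -/
lemma vol_restrict [CompactSpace X] (hK : IsKahlerOff D g J) (hD : IsClosed D) (hψ : ψ ∈ 𝒜) :
    (vol D g).restrict ψ.source = chartVolume D g ψ := by
  obtain ⟨S, hS⟩ := exists_finite_cover (n := n) (X := X)
  refine Measure.ext_of_biUnion_eq_univ S.countable_toSet hS fun x _ => ?_
  have hx := chartAt_mem (n := n) x
  have m := (chartAt (E n) x).open_source.measurableSet
  rw [Measure.restrict_restrict m, inter_comm, ← Measure.restrict_restrict
    ψ.open_source.measurableSet, vol_restrict_of_mem_atlas hK hD (chart_mem_atlas _ x),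
    chartVolume_restrict_comm hK hD hx hψ]

/-- Integration over a chart domain. -/
lemma lintegral_vol_source [CompactSpace X] (hK : IsKahlerOff D g J) (hD : IsClosed D)
    (hψ : ψ ∈ 𝒜) (F : X → ℝ≥0∞) : ∫⁻ x in ψ.source, F x ∂(vol D g) =
      ∫⁻ y in chartDom D ψ, dens g ψ y * F (ψ.symm y) := by
  rw [vol_restrict hK hD hψ, lintegral_chartVolume hK hD hψ]

lemma aemeasurable_vol [CompactSpace X] (hK : IsKahlerOff D g J) (hD : IsClosed D)
    {F : X → ℝ≥0∞} (h : ∀ ψ ∈ atlas (E n) X,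
      AEMeasurable (fun y => F (ψ.symm y)) (volume.restrict (chartDom D ψ))) :
    AEMeasurable F (vol D g) := by
  obtain ⟨S, hS⟩ := exists_finite_cover (n := n) (X := X)
  rw [← Measure.restrict_univ (μ := vol D g), ← hS, biUnion_eq_iUnion, aemeasurable_iUnion_iff]
  intro x
  rw [vol_restrict_of_mem_atlas hK hD (chart_mem_atlas _ _)]
  exact aemeasurable_chartVolume hD (h _ (chart_mem_atlas _ _))

lemma ae_vol_notMem [CompactSpace X] (hK : IsKahlerOff D g J) (hD : IsClosed D) :
    ∀ᵐ x ∂(vol D g), x ∉ D := by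
  obtain ⟨S, hS⟩ := exists_finite_cover (n := n) (X := X)
  rw [← Measure.restrict_univ (μ := vol D g), ← hS, ae_restrict_biUnion_iff _ S.countable_toSet]
  intro x _
  rw [vol_restrict_of_mem_atlas hK hD (chart_mem_atlas _ _), chartVolume_eq_map,
    ae_map_iff (aemeasurable_chart_symm hD) hD.isOpen_compl.measurableSet]
  filter_upwards [ae_mem_chartDom hD] with y hy using hy.2

/-- The density is positive, so null sets of the Riemannian volume are Lebesgue null sets in the
chart. -/
lemma ae_chartDom_of_ae_vol [CompactSpace X] (hK : IsKahlerOff D g J) (hD : IsClosed D)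
    (hψ : ψ ∈ 𝒜) {p : X → Prop} (h : ∀ᵐ x ∂(vol D g), p x) :
    ∀ᵐ y ∂(volume.restrict (chartDom D ψ)), p (ψ.symm y) := by
  have h1 : ∀ᵐ x ∂(Measure.map ψ.symm (modelVolume D g ψ)), p x := by
    rw [← chartVolume_eq_map, ← vol_restrict hK hD hψ]
    exact ae_restrict_of_ae h
  exact (absolutelyContinuous_modelVolume hK hD hψ).ae_le
    (ae_of_ae_map (aemeasurable_chart_symm hD) h1)

end Volume

/-! ### Completeness of the space of square integrable forms -/

section Complete

variable {n : ℕ} {X : Type*} [TopologicalSpace X] [ChartedSpace (E n) X]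
  [IsManifold 𝓘(ℝ, E n) ∞ X]

local notation "𝒜" => IsManifold.maximalAtlas 𝓘(ℝ, E n) ∞ X

variable {D : Set X} {g : BilinField (n := n) X} {J : EndField (n := n) X}
  {ψ : OpenPartialHomeomorph X (E n)} {m : ℕ}

/-- On compact sets, the norm of tensors is comparable to the norm of their components. -/
lemma IsKahlerOff.tensorNormSq_bounds (hK : IsKahlerOff D g J) (hD : IsClosed D) (hψ : ψ ∈ 𝒜)
    {K : Set (E n)} (hKc : IsCompact K) (hKD : K ⊆ chartDom D ψ) (m : ℕ) :
    ∃ c C : ℝ, 0 < c ∧ 0 < C ∧ ∀ y ∈ K, ∀ A : (Fin m → Fin (2 * n)) → ℂ,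
      c * ‖A‖ ^ 2 ≤ tensorNormSq (coeff g ψ y) A ∧ tensorNormSq (coeff g ψ y) A ≤ C * ‖A‖ ^ 2 := by
  have hcont : ContinuousOn (fun q : E n × ((Fin m → Fin (2 * n)) → ℂ) =>
      tensorNormSq (coeff g ψ q.1) q.2) (K ×ˢ Metric.sphere 0 1) := by
    intro q hq
    have hq1 := hKD hq.1
    have h1 : ∀ i j, ContDiffAt ℝ ∞
        (fun q : E n × ((Fin m → Fin (2 * n)) → ℂ) => coeff g ψ q.1 i j) q := fun i j =>
      ContDiffAt.comp (g := fun z => coeff g ψ z i j) q (hK.contDiffAt_coeff hD hψ hq1 i j)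
        contDiffAt_fst
    have h2 : ∀ I, ContDiffAt ℝ ∞
        (fun q : E n × ((Fin m → Fin (2 * n)) → ℂ) => q.2 I) q := fun I =>
      (contDiffAt_pi.1 contDiffAt_snd) I
    exact (contDiffAt_tensorNormSq h1 (hK.det_ne_zero hψ hq1) h2).continuousAt.continuousWithinAt
  -- The norm is homogeneous of degree two in `A`. It therefore suffices to bound a positive
  -- continuous function on the compact, possibly empty, product of `K` with the unit sphere.
  have hcomp : IsCompact (K ×ˢ Metric.sphere (0 : (Fin m → Fin (2 * n)) → ℂ) 1) :=
    hKc.prod (isCompact_sphere _ _)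
  obtain ⟨c, C, hc, hC, hb⟩ : ∃ c C : ℝ, 0 < c ∧ 0 < C ∧
      ∀ q ∈ K ×ˢ Metric.sphere (0 : (Fin m → Fin (2 * n)) → ℂ) 1,
        c ≤ tensorNormSq (coeff g ψ q.1) q.2 ∧ tensorNormSq (coeff g ψ q.1) q.2 ≤ C := by
    rcases (K ×ˢ Metric.sphere (0 : (Fin m → Fin (2 * n)) → ℂ) 1).eq_empty_or_nonempty with h | h
    · exact ⟨1, 1, one_pos, one_pos, fun q hq => by simp [h] at hq⟩
    · obtain ⟨q₀, hq₀, hmin⟩ := hcomp.exists_isMinOn h hcont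
      obtain ⟨q₁, hq₁, hmax⟩ := hcomp.exists_isMaxOn h hcont
      have hpos : ∀ q ∈ K ×ˢ Metric.sphere (0 : (Fin m → Fin (2 * n)) → ℂ) 1,
          0 < tensorNormSq (coeff g ψ q.1) q.2 := fun q hq =>
        tensorNormSq_pos (hK.posDef_coeff hψ (hKD hq.1)) (by
          rintro h0; have := hq.2; simp [h0] at this)
      exact ⟨_, _, hpos _ hq₀, hpos _ hq₁, fun q hq => ⟨hmin hq, hmax hq⟩⟩
  refine ⟨c, C, hc, hC, fun y hy A => ?_⟩
  rcases eq_or_ne A 0 with rfl | hA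
  · have : tensorNormSq (coeff g ψ y) (0 : (Fin m → Fin (2 * n)) → ℂ) = 0 := by
      simp [tensorNormSq]
    simp [this]
  · have hn : ‖A‖ ≠ 0 := norm_ne_zero_iff.2 hA
    have hb' := hb (y, ((‖A‖⁻¹ : ℝ) : ℂ) • A) ⟨hy, by
      rw [mem_sphere_zero_iff_norm, norm_smul, Complex.norm_real, norm_inv, norm_norm,
        inv_mul_cancel₀ hn]⟩
    simp only [tensorNormSq_smul, Complex.normSq_ofReal] at hb'
    have hp : 0 < ‖A‖ ^ 2 := by positivity
    have he : ‖A‖⁻¹ * ‖A‖⁻¹ * tensorNormSq (coeff g ψ y) A =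
        tensorNormSq (coeff g ψ y) A / ‖A‖ ^ 2 := by field_simp
    rw [he, le_div_iff₀ hp, div_le_iff₀ hp] at hb'
    exact hb'

/-- The components of an alternating form on the model space in a frame. -/
def compMap (B : E n →L[ℝ] E n) (m : ℕ) :
    (E n [⋀^Fin m]→L[ℝ] ℂ) →ₗ[ℝ] ((Fin m → Fin (2 * n)) → ℂ) where
  toFun φ := fun I => φ fun l => B (stdVec (I l))
  map_add' _ _ := rfl
  map_smul' _ _ := rfl

lemma compMap_injective {B : E n →L[ℝ] E n} (hB : Function.Surjective B) :
    Function.Injective (compMap B m) := by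
  rw [← LinearMap.ker_eq_bot, LinearMap.ker_eq_bot']
  intro φ hφ
  ext v
  choose w hw using fun l => hB (v l)
  have hv : v = fun l => ∑ j, w l j • B (stdVec j) := by
    funext l
    conv_lhs => rw [← hw l, eq_sum_stdVec (w l)]
    simp
  rw [hv]
  refine (φ.toMultilinearMap.map_sum (fun l j => w l j • B (stdVec j))).trans ?_
  refine Finset.sum_eq_zero fun I _ => ?_
  refine (φ.toMultilinearMap.map_smul_univ _ _).trans ?_
  have : φ.toMultilinearMap (fun l => B (stdVec (I l))) = 0 := congrFun hφ I
  rw [this, smul_zero]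

/-- Finite-dimensionality of the fibre makes its linear maps continuous and the subspace of forms of
type `(p, q)` closed. Pointwise limits rest on both. -/
instance finiteDimensional_alternating : FiniteDimensional ℝ (E n [⋀^Fin m]→L[ℝ] ℂ) :=
  FiniteDimensional.of_injective (compMap (ContinuousLinearMap.id ℝ (E n)) m)
    (compMap_injective Function.surjective_id)

lemma frameMap_surjective (hψ : ψ ∈ 𝒜) {x : X} (hx : x ∈ ψ.source) :
    Function.Surjective (frameMap ψ (ψ x)) := fun w => ⟨_, frameMap_coframeMap hψ hx w⟩

/-- The pointwise squared norm, as a function on the fibre. -/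
def fibreNormSq (g : BilinField (n := n) X) (m : ℕ) (x : X) (φ : E n [⋀^Fin m]→L[ℝ] ℂ) : ℝ :=
  tensorNormSq (coeff g (chartAt (E n) x) (chartAt (E n) x x))
    (compMap (frameMap (chartAt (E n) x) (chartAt (E n) x x)) m φ) / m.factorial

lemma normSq_eq_fibreNormSq (φ : Form n X m) (x : X) (hx : x ∈ (chartAt (E n) x).source) :
    φ.normSq g x = fibreNormSq g m x (formE φ x) := by
  have h : (chartAt (E n) x).symm (chartAt (E n) x x) = x := (chartAt (E n) x).left_inv hx
  rw [Form.normSq, fibreNormSq]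
  congr 2
  funext I
  rw [comp_apply, h]
  rfl

lemma continuous_fibreNormSq (x : X) : Continuous (fibreNormSq g m x) := by
  unfold fibreNormSq
  simp only [tensorNormSq_eq_re]
  have hc : Continuous (compMap (frameMap (chartAt (E n) x) (chartAt (E n) x x)) m) :=
    LinearMap.continuous_of_finiteDimensional _
  refine (continuous_finset_sum _ fun I _ => continuous_finset_sum _ fun J _ =>
    continuous_const.mul (Complex.continuous_re.comp ?_)).div_const _
  exact ((continuous_apply I).comp hc).mul (Complex.continuous_conj.comp
    ((continuous_apply J).comp hc))

/-- The constant depends on `x`, which is harmless: the comparison serves to show convergence at a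
fixed point. -/
lemma IsKahlerOff.exists_norm_le (hK : IsKahlerOff D g J) (hD : IsClosed D) {x : X} (hx : x ∉ D) :
    ∃ C : ℝ, 0 ≤ C ∧ ∀ φ : Form n X m, ‖formE φ x‖ ≤ C * √(φ.normSq g x) := by
  have hm : chartAt (E n) x ∈ 𝒜 := chartAt_mem (n := n) x
  have hs : x ∈ (chartAt (E n) x).source := mem_chart_source _ _
  obtain ⟨c, _, hc, _, hb⟩ := hK.tensorNormSq_bounds hD hm (K := {chartAt (E n) x x})
    isCompact_singleton (singleton_subset_iff.2 (chartAt_mem_chartDom hx)) m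
  obtain ⟨L, hL, hanti⟩ := (compMap (frameMap (chartAt (E n) x) (chartAt (E n) x x))
    m).exists_antilipschitzWith (LinearMap.ker_eq_bot.2
      (compMap_injective (frameMap_surjective hm hs)))
  refine ⟨L * √(m.factorial / c), by positivity, fun φ => ?_⟩
  have h1 := hanti.le_mul_norm_sub (formE φ x) 0
  simp only [map_zero, neg_add_eq_sub, zero_sub, norm_neg] at h1
  have h2 := (hb _ rfl (compMap (frameMap (chartAt (E n) x) (chartAt (E n) x x)) m
    (formE φ x))).1
  refine h1.trans ?_
  rw [mul_assoc, ← Real.sqrt_mul (by positivity)]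
  gcongr
  refine Real.le_sqrt_of_sq_le ?_
  rw [normSq_eq_fibreNormSq φ x hs, fibreNormSq]
  have hf : (0 : ℝ) < m.factorial := Nat.cast_pos.2 m.factorial_pos
  rw [div_mul_div_cancel₀' hf.ne', le_div_iff₀' hc]
  exact h2

lemma IsKahlerOff.normSq_add_le (hK : IsKahlerOff D g J) (φ φ' : Form n X m) {x : X}
    (hx : x ∉ D) : (φ + φ').normSq g x ≤ 2 * φ.normSq g x + 2 * φ'.normSq g x := by
  have hpos := hK.posDef_coeff (chartAt_mem (n := n) x) (chartAt_mem_chartDom hx)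
  simp only [Form.normSq, mul_div_assoc', ← add_div]
  gcongr
  exact tensorNormSq_add_le hpos _ _

lemma normSq_neg (φ : Form n X m) (x : X) : (-φ).normSq g x = φ.normSq g x := by
  simp only [Form.normSq]
  congr 1
  exact tensorNormSq_neg _ _

lemma ofReal_le_two_add_two {a b c : ℝ} (hb : 0 ≤ b) (hc : 0 ≤ c) (h : a ≤ 2 * b + 2 * c) :
    ENNReal.ofReal a ≤ 2 * ENNReal.ofReal b + 2 * ENNReal.ofReal c := by
  refine (ENNReal.ofReal_le_ofReal h).trans ?_
  rw [ENNReal.ofReal_add (by positivity) (by positivity), ENNReal.ofReal_mul (by norm_num),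
    ENNReal.ofReal_mul (by norm_num)]
  simp

/-- The function underlying an alternating form. -/
def formFun (m : ℕ) : (E n [⋀^Fin m]→L[ℝ] ℂ) →ₗ[ℝ] ((Fin m → E n) → ℂ) where
  toFun φ := fun v => φ v
  map_add' _ _ := rfl
  map_smul' _ _ := rfl

/-- The real subspace of forms of type `(p, q)`. -/
def typeSubmodule (j : E n →L[ℝ] E n) (p q : ℕ) : Submodule ℝ (E n [⋀^Fin (p + q)]→L[ℝ] ℂ) :=
  ((Submodule.span ℂ {f : (Fin (p + q) → E n) → ℂ |
    ∃ (a : Fin p → E n →L[ℝ] ℂ) (b : Fin q → E n →L[ℝ] ℂ),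
      (∀ i u, a i (j u) = Complex.I * a i u) ∧ (∀ i u, b i (j u) = -Complex.I * b i u) ∧
      f = fun v => Matrix.det (Matrix.of fun i l => Fin.append a b i (v l))}).restrictScalars
    ℝ).comap (formFun (p + q))

lemma isClosed_typeSubmodule (j : E n →L[ℝ] E n) (p q : ℕ) :
    IsClosed (typeSubmodule j p q : Set (E n [⋀^Fin (p + q)]→L[ℝ] ℂ)) :=
  Submodule.closed_of_finiteDimensional _

variable [MeasurableSpace X] [BorelSpace X] [CompactSpace X]

lemma aestronglyMeasurable_inv_coeff (hK : IsKahlerOff D g J) (hD : IsClosed D) (hψ : ψ ∈ 𝒜)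
    (i j : Fin (2 * n)) :
    AEMeasurable (fun y => (coeff g ψ y)⁻¹ i j) (volume.restrict (chartDom D ψ)) :=
  ContinuousOn.aemeasurable (fun _ hy => (contDiffAt_inv_apply
    (fun i j => hK.contDiffAt_coeff hD hψ hy i j)
    (hK.det_ne_zero hψ hy) i j).continuousAt.continuousWithinAt)
    (isOpen_chartDom hD ψ).measurableSet

lemma aemeasurable_tensorNormSq (hK : IsKahlerOff D g J) (hD : IsClosed D) (hψ : ψ ∈ 𝒜)
    {A : E n → (Fin m → Fin (2 * n)) → ℂ}
    (hA : ∀ I, AEStronglyMeasurable (fun y => A y I) (volume.restrict (chartDom D ψ))) :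
    AEMeasurable (fun y => tensorNormSq (coeff g ψ y) (A y)) (volume.restrict (chartDom D ψ)) := by
  simp only [tensorNormSq_eq_re]
  refine Finset.aemeasurable_fun_sum _ fun I _ => Finset.aemeasurable_fun_sum _ fun J _ =>
    (Finset.aemeasurable_fun_prod _ fun l _ => aestronglyMeasurable_inv_coeff hK hD hψ _ _).mul ?_
  exact Complex.measurable_re.comp_aemeasurable ((hA I).aemeasurable.mul
    (Complex.continuous_conj.measurable.comp_aemeasurable (hA J).aemeasurable))

lemma aemeasurable_of_ae_eq_chart {F : X → ℝ} (hK : IsKahlerOff D g J) (hD : IsClosed D)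
    (h : ∀ ψ ∈ atlas (E n) X, ∃ f : E n → ℝ, AEMeasurable f (volume.restrict (chartDom D ψ)) ∧
      ∀ y ∈ chartDom D ψ, F (ψ.symm y) = f y) :
    AEMeasurable (fun x => ENNReal.ofReal (F x)) (vol D g) := by
  refine aemeasurable_vol hK hD fun ψ hψ => ?_
  obtain ⟨f, hf, he⟩ := h ψ hψ
  refine (hf.ennreal_ofReal).congr ?_
  filter_upwards [ae_restrict_mem (isOpen_chartDom hD ψ).measurableSet] with y hy
  rw [he y hy]

lemma Form.MeasurableOff.aemeasurable_normSq (hK : IsKahlerOff D g J) (hD : IsClosed D)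
    {φ : Form n X m} (hφ : φ.MeasurableOff D) :
    AEMeasurable (fun x => ENNReal.ofReal (φ.normSq g x)) (vol D g) :=
  aemeasurable_of_ae_eq_chart hK hD fun ψ hψ =>
    have hψ' : ψ ∈ 𝒜 := IsManifold.subset_maximalAtlas hψ
    ⟨_, (aemeasurable_tensorNormSq hK hD hψ' (A := fun y I => φ.comp ψ I y)
      (hφ ψ hψ)).div_const _, fun _ hy => hK.normSq_symm φ hψ' hy⟩

lemma Form.MeasurableOff.sub {φ φ' : Form n X m} (hφ : φ.MeasurableOff D)
    (hφ' : φ'.MeasurableOff D) : (φ - φ').MeasurableOff D := fun ψ hψ I =>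
  (hφ ψ hψ I).sub (hφ' ψ hψ I)

lemma lintegral_normSq_add_le (hK : IsKahlerOff D g J) (hD : IsClosed D) {φ φ' : Form n X m}
    (hφ : φ.MeasurableOff D) :
    ∫⁻ x, ENNReal.ofReal ((φ + φ').normSq g x) ∂(vol D g) ≤
      2 * ∫⁻ x, ENNReal.ofReal (φ.normSq g x) ∂(vol D g) +
      2 * ∫⁻ x, ENNReal.ofReal (φ'.normSq g x) ∂(vol D g) := by
  rw [← lintegral_const_mul' _ _ (by simp), ← lintegral_const_mul' _ _ (by simp),
    ← lintegral_add_left' ((hφ.aemeasurable_normSq hK hD).const_mul _)]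
  refine lintegral_mono_ae ?_
  filter_upwards [ae_vol_notMem hK hD] with x hx
  exact ofReal_le_two_add_two (hK.normSq_nonneg _ hx) (hK.normSq_nonneg _ hx)
    (hK.normSq_add_le _ _ hx)

/-- Almost everywhere convergence of a fast Cauchy sequence of forms. -/
lemma ae_exists_tendsto (hK : IsKahlerOff D g J) (hD : IsClosed D) {β : ℕ → Form n X m}
    (hm : ∀ k, (β k).MeasurableOff D)
    (hβ : ∀ k, ∫⁻ x, ENNReal.ofReal ((β k - β (k + 1)).normSq g x) ∂(vol D g) ≤
      (1 / 16 : ℝ≥0∞) ^ k) :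
    ∀ᵐ x ∂(vol D g), ∃ a, Tendsto (fun k => formE (β k) x) atTop (𝓝 a) := by
  -- The weights `4^k` keep the series summable, since `4^k 16^(-k) = 4^(-k)`. Where the sum is
  -- finite, consecutive terms differ in norm by at most a constant times `2^(-k)`.
  have hint : ∫⁻ x, ∑' k, (4 : ℝ≥0∞) ^ k * ENNReal.ofReal ((β k - β (k + 1)).normSq g x)
      ∂(vol D g) ≠ ⊤ := by
    rw [lintegral_tsum fun k => ((((hm k).sub (hm (k + 1))).aemeasurable_normSq hK hD).const_mul _)]
    have hle : ∀ k, ∫⁻ x, (4 : ℝ≥0∞) ^ k * ENNReal.ofReal ((β k - β (k + 1)).normSq g x)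
        ∂(vol D g) ≤ (1 / 4 : ℝ≥0∞) ^ k := by
      intro k
      rw [lintegral_const_mul' _ _ (by simp)]
      refine (mul_le_mul_right (hβ k) _).trans (le_of_eq ?_)
      rw [← mul_pow]
      congr 1
      rw [show (16 : ℝ≥0∞) = 4 * 4 by norm_num, one_div, one_div,
        ENNReal.mul_inv (by simp) (by simp), ← mul_assoc, ENNReal.mul_inv_cancel (by simp)
        (by simp), one_mul]
    refine ((ENNReal.tsum_le_tsum hle).trans_lt ?_).ne
    rw [ENNReal.tsum_geometric]
    refine ENNReal.inv_lt_top.2 (tsub_pos_of_lt ?_)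
    rw [one_div]
    exact ENNReal.inv_lt_one.2 (by norm_num)
  have hae := ae_lt_top' (AEMeasurable.ennreal_tsum fun k =>
    ((((hm k).sub (hm (k + 1))).aemeasurable_normSq hK hD).const_mul _)) hint
  filter_upwards [hae, ae_vol_notMem hK hD] with x hx hxD
  obtain ⟨C, hC, hb⟩ := hK.exists_norm_le hD (m := m) hxD
  set M := (∑' k, (4 : ℝ≥0∞) ^ k * ENNReal.ofReal ((β k - β (k + 1)).normSq g x)).toReal with hM
  have hterm : ∀ k, (β k - β (k + 1)).normSq g x ≤ M * ((1 / 2) ^ k) ^ 2 := by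
    intro k
    have h1 : (4 : ℝ≥0∞) ^ k * ENNReal.ofReal ((β k - β (k + 1)).normSq g x) ≤
      ENNReal.ofReal M := by
      rw [hM, ENNReal.ofReal_toReal hx.ne]
      exact ENNReal.le_tsum k
    have h4 : (4 : ℝ≥0∞) ^ k = ENNReal.ofReal (4 ^ k) := by
      rw [ENNReal.ofReal_pow (by norm_num)]; simp
    rw [h4, ← ENNReal.ofReal_mul (by positivity),
      ENNReal.ofReal_le_ofReal_iff ENNReal.toReal_nonneg] at h1
    have h5 : ((1 / 2 : ℝ) ^ k) ^ 2 = (4 ^ k)⁻¹ := by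
      rw [← pow_mul, mul_comm, pow_mul, ← inv_pow]; norm_num
    rw [h5, ← div_eq_mul_inv, le_div_iff₀' (by positivity)]
    exact h1
  refine cauchySeq_tendsto_of_complete (cauchySeq_of_le_geometric (1 / 2) (C * √M)
    (by norm_num) fun k => ?_)
  rw [dist_eq_norm]
  have h2 : formE (β k) x - formE (β (k + 1)) x = formE (β k - β (k + 1)) x := rfl
  rw [h2, mul_assoc]
  refine (hb _).trans (mul_le_mul_of_nonneg_left ?_ hC)
  refine (Real.sqrt_le_sqrt (hterm k)).trans (le_of_eq ?_)
  rw [Real.sqrt_mul' _ (sq_nonneg _), Real.sqrt_sq (by positivity)]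

/-- The space of square integrable forms is complete. -/
theorem exists_l2_limit (hK : IsKahlerOff D g J) (hD : IsClosed D) {p q : ℕ}
    {α : ℕ → Form n X (p + q)} (hα : ∀ j, α j ∈ L2Forms D g J p q)
    (hc : ∀ ε : ℝ≥0∞, 0 < ε → ∃ N, ∀ i ≥ N, ∀ j ≥ N,
      ∫⁻ x, ENNReal.ofReal ((α i - α j).normSq g x) ∂(vol D g) ≤ ε) :
    ∃ α' ∈ L2Forms D g J p q, Tendsto (fun j => l2Norm D g (α j - α')) atTop (𝓝 0) := by
  -- A subsequence whose consecutive squared distances are at most `16^(-k)`, as `ae_exists_tendsto`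
  -- requires.
  obtain ⟨τ, hτ, hτc⟩ := extraction_forall_of_eventually (P := fun k N => ∀ i ≥ N, ∀ j ≥ N,
      ∫⁻ x, ENNReal.ofReal ((α i - α j).normSq g x) ∂(vol D g) ≤ (1 / 16 : ℝ≥0∞) ^ k)
    (fun k => by
      obtain ⟨N, hN⟩ := hc ((1 / 16 : ℝ≥0∞) ^ k) (ENNReal.pow_pos (by simp) _)
      filter_upwards [eventually_ge_atTop N] with M hM i hi j hj
      exact hN i (le_trans hM hi) j (le_trans hM hj))
  have hlim := ae_exists_tendsto hK hD (β := fun k => α (τ k)) (fun k => (hα _).1)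
    fun k => hτc k _ le_rfl _ (hτ (Nat.lt_succ_self k)).le
  classical
  -- The limit is set to zero where there is no convergence. Then the type `(p, q)` holds at every
  -- point off `D`, as `IsType` demands, and not just almost everywhere.
  set αE : X → E n [⋀^Fin (p + q)]→L[ℝ] ℂ := fun x =>
    if h : x ∉ D ∧ ∃ a, Tendsto (fun k => formE (α (τ k)) x) atTop (𝓝 a) then h.2.choose else 0
    with hαE
  set α' : Form n X (p + q) := αE with hα'
  have hconv : ∀ᵐ x ∂(vol D g), Tendsto (fun k => formE (α (τ k)) x) atTop (𝓝 (formE α' x)) := by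
    filter_upwards [hlim, ae_vol_notMem hK hD] with x hx hxD
    have h : x ∉ D ∧ ∃ a, Tendsto (fun k => formE (α (τ k)) x) atTop (𝓝 a) := ⟨hxD, hx⟩
    have : formE α' x = h.2.choose := dif_pos h
    rw [this]
    exact h.2.choose_spec
  have hmeas : α'.MeasurableOff D := by
    intro ψ hψ I
    refine aestronglyMeasurable_of_tendsto_ae atTop (fun k => (hα (τ k)).1 ψ hψ I) ?_
    filter_upwards [ae_chartDom_of_ae_vol hK hD (IsManifold.subset_maximalAtlas hψ) hconv] with y hy
    have hc : Continuous (compMap (frameMap ψ y) (p + q)) :=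
      LinearMap.continuous_of_finiteDimensional _
    exact ((continuous_apply I).tendsto _).comp ((hc.tendsto _).comp hy)
  have htype : IsType D J p q α' := by
    intro x hx
    by_cases h : x ∉ D ∧ ∃ a, Tendsto (fun k => formE (α (τ k)) x) atTop (𝓝 a)
    · have he : αE x = h.2.choose := dif_pos h
      have hmem : h.2.choose ∈ typeSubmodule (J x) p q :=
        (isClosed_typeSubmodule (J x) p q).mem_of_tendsto h.2.choose_spec
          (Eventually.of_forall fun k => (hα (τ k)).2.1 x hx)
      rw [← he] at hmem
      exact hmem
    · have he : αE x = 0 := dif_neg h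
      have hmem : αE x ∈ typeSubmodule (J x) p q := by rw [he]; exact Submodule.zero_mem _
      exact hmem
  -- Fatou's lemma along the subsequence turns the Cauchy bound of the full sequence into a bound
  -- for its distance to the limit.
  have hfatou : ∀ (ε : ℝ≥0∞) (N : ℕ), (∀ i ≥ N, ∀ j ≥ N,
      ∫⁻ x, ENNReal.ofReal ((α i - α j).normSq g x) ∂(vol D g) ≤ ε) → ∀ i ≥ N,
      ∫⁻ x, ENNReal.ofReal ((α i - α').normSq g x) ∂(vol D g) ≤ ε := by
    intro ε N hN i hi
    have h1 : ∀ᵐ x ∂(vol D g), ENNReal.ofReal ((α i - α').normSq g x) ≤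
        liminf (fun k => ENNReal.ofReal ((α i - α (τ k)).normSq g x)) atTop := by
      filter_upwards [hconv] with x hx
      refine le_of_eq (Tendsto.liminf_eq ?_).symm
      refine (ENNReal.continuous_ofReal.tendsto _).comp ?_
      simp only [normSq_eq_fibreNormSq _ x (mem_chart_source _ _)]
      exact ((continuous_fibreNormSq x).tendsto _).comp (tendsto_const_nhds.sub hx)
    refine (lintegral_mono_ae h1).trans ((lintegral_liminf_le' fun k =>
      ((hα i).1.sub (hα (τ k)).1).aemeasurable_normSq hK hD).trans ?_)
    refine liminf_le_of_frequently_le' (Eventually.frequently ?_)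
    filter_upwards [eventually_ge_atTop N] with k hk
    exact hN i hi _ (hk.trans (hτ.id_le k))
  refine ⟨α', ⟨hmeas, htype, ?_⟩, ?_⟩
  · obtain ⟨N, hN⟩ := hc 1 one_pos
    have h1 := hfatou 1 N hN N le_rfl
    have h2 : ∫⁻ x, ENNReal.ofReal ((α N).normSq g x) ∂(vol D g) < ⊤ := by
      have h := (hα N).2.2
      rw [l2Norm, l2, ENNReal.rpow_lt_top_iff_of_pos (by norm_num)] at h
      exact h
    rw [l2Norm, l2, ENNReal.rpow_lt_top_iff_of_pos (by norm_num)]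
    have h3 := lintegral_normSq_add_le hK hD (φ := α N) (φ' := -(α N - α')) (hα N).1
    rw [show α N + -(α N - α') = α' by abel] at h3
    simp only [normSq_neg] at h3
    refine h3.trans_lt (ENNReal.add_lt_top.2 ⟨ENNReal.mul_lt_top (by simp) h2,
      ENNReal.mul_lt_top (by simp) (h1.trans_lt (by simp))⟩)
  · have h0 : Tendsto (fun j => ∫⁻ x, ENNReal.ofReal ((α j - α').normSq g x) ∂(vol D g))
        atTop (𝓝 0) := by
      rw [ENNReal.tendsto_atTop_zero]
      intro ε hε
      obtain ⟨N, hN⟩ := hc ε hε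
      exact ⟨N, hfatou ε N hN⟩
    have h1 := ((ENNReal.continuous_rpow_const (y := (1 / 2 : ℝ))).tendsto 0).comp h0
    rw [ENNReal.zero_rpow_of_pos (by norm_num)] at h1
    exact h1

end Complete

/-! ### The Poincaré inequality on cubes -/

section Poincare

open scoped NNReal

/-- The Cauchy–Schwarz inequality against the constant function `1`. -/
lemma sq_lintegral_le {α : Type*} [MeasurableSpace α] (μ : Measure α) {u : α → ℝ≥0∞}
    (hu : AEMeasurable u μ) : (∫⁻ a, u a ∂μ) ^ 2 ≤ μ univ * ∫⁻ a, u a ^ 2 ∂μ := by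
  have h := ENNReal.lintegral_mul_le_Lp_mul_Lq μ (p := 2) (q := 2)
    Real.HolderConjugate.two_two hu (aemeasurable_const (b := (1 : ℝ≥0∞)))
  simp only [Pi.mul_apply, mul_one, lintegral_const, one_mul, ENNReal.rpow_two, one_pow] at h
  calc (∫⁻ a, u a ∂μ) ^ 2 ≤ ((∫⁻ a, u a ^ 2 ∂μ) ^ (1 / 2 : ℝ) * μ univ ^ (1 / 2 : ℝ)) ^ 2 := by
        gcongr
    _ = μ univ * ∫⁻ a, u a ^ 2 ∂μ := by
        rw [mul_pow, ← ENNReal.rpow_two, ← ENNReal.rpow_two, ← ENNReal.rpow_mul,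
          ← ENNReal.rpow_mul]
        norm_num
        rw [mul_comm]

variable {V : Type*} [NormedAddCommGroup V] [NormedSpace ℝ V] [FiniteDimensional ℝ V]
  [MeasurableSpace V] [BorelSpace V]

/-- The fundamental theorem of calculus on the segment from `x` to `x + h`, followed by
Cauchy–Schwarz on the unit interval. -/
lemma enorm_sub_sq_le_lintegral {f : V → ℂ} {x h : V}
    (hf : ∀ s ∈ Icc (0 : ℝ) 1, ContDiffAt ℝ 1 f (x + s • h)) :
    ‖f (x + h) - f x‖ₑ ^ 2 ≤
      ‖h‖ₑ ^ 2 * ∫⁻ s in Icc (0 : ℝ) 1, ‖fderiv ℝ f (x + s • h)‖ₑ ^ 2 := by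
  have hderiv : ∀ s ∈ uIcc (0 : ℝ) 1,
      HasDerivAt (fun s : ℝ => f (x + s • h)) (fderiv ℝ f (x + s • h) h) s := by
    intro s hs
    rw [uIcc_of_le zero_le_one] at hs
    have h1 : HasDerivAt (fun s : ℝ => x + s • h) h s := by
      simpa using ((hasDerivAt_id s).smul_const h).const_add x
    exact ((hf s hs).differentiableAt (by simp)).hasFDerivAt.comp_hasDerivAt s h1
  have hcont0 : ContinuousOn (fun s : ℝ => fderiv ℝ f (x + s • h)) (Icc 0 1) := by
    intro s hs
    have h1 : ContinuousAt (fderiv ℝ f) (x + s • h) :=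
      ((hf s hs).fderiv_right (m := 0) (by simp)).continuousAt
    exact (h1.comp (f := fun s : ℝ => x + s • h) (by fun_prop)).continuousWithinAt
  have hcont : ContinuousOn (fun s : ℝ => fderiv ℝ f (x + s • h) h) (uIcc 0 1) := by
    rw [uIcc_of_le zero_le_one]
    exact hcont0.clm_apply continuousOn_const
  have hftc := intervalIntegral.integral_eq_sub_of_hasDerivAt hderiv hcont.intervalIntegrable
  simp only [one_smul, zero_smul, add_zero] at hftc
  rw [← hftc, intervalIntegral.integral_of_le zero_le_one, ← integral_Icc_eq_integral_Ioc]
  have hm : AEMeasurable (fun s : ℝ => ‖fderiv ℝ f (x + s • h)‖ₑ)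
      (volume.restrict (Icc (0 : ℝ) 1)) :=
    (hcont0.aestronglyMeasurable measurableSet_Icc).enorm
  calc ‖∫ s in Icc (0 : ℝ) 1, fderiv ℝ f (x + s • h) h‖ₑ ^ 2
      ≤ (∫⁻ s in Icc (0 : ℝ) 1, ‖fderiv ℝ f (x + s • h) h‖ₑ) ^ 2 := by
        gcongr; exact enorm_integral_le_lintegral_enorm _
    _ ≤ (∫⁻ s in Icc (0 : ℝ) 1, ‖fderiv ℝ f (x + s • h)‖ₑ * ‖h‖ₑ) ^ 2 := by
        gcongr with s; exact ContinuousLinearMap.le_opENorm _ _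
    _ = ‖h‖ₑ ^ 2 * (∫⁻ s in Icc (0 : ℝ) 1, ‖fderiv ℝ f (x + s • h)‖ₑ) ^ 2 := by
        rw [lintegral_mul_const' _ _ (by simp), mul_pow, mul_comm]
    _ ≤ ‖h‖ₑ ^ 2 * ∫⁻ s in Icc (0 : ℝ) 1, ‖fderiv ℝ f (x + s • h)‖ₑ ^ 2 := by
        gcongr
        refine (sq_lintegral_le _ hm).trans ?_
        simp

lemma measurable_indicator_of_continuousOn {α β : Type*} [TopologicalSpace α] [MeasurableSpace α]
    [OpensMeasurableSpace α] [TopologicalSpace β] [MeasurableSpace β] [BorelSpace β] [Zero β]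
    {Q : Set α} (hQ : MeasurableSet Q) {f : α → β} (hf : ContinuousOn f Q) :
    Measurable (Q.indicator f) := by
  classical
  rw [← piecewise_eq_indicator]
  exact hf.measurable_piecewise continuousOn_const hQ

/-- The Poincaré inequality on a convex set `Q`, whose difference set is contained in `B`. -/
lemma lintegral_lintegral_enorm_sub_le (μ : Measure V) [μ.IsAddHaarMeasure] {Q B : Set V}
    (hQ : Convex ℝ Q) (hQm : MeasurableSet Q) (hBm : MeasurableSet B)
    (hB : ∀ x ∈ Q, ∀ y ∈ Q, y - x ∈ B) {d : ℝ≥0∞} (hd : ∀ h ∈ B, ‖h‖ₑ ≤ d) {f : V → ℂ}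
    (hf : ∀ x ∈ Q, ContDiffAt ℝ 1 f x) :
    ∫⁻ x in Q, ∫⁻ y in Q, ‖f y - f x‖ₑ ^ 2 ∂μ ∂μ ≤
      μ B * d ^ 2 * ∫⁻ x in Q, ‖fderiv ℝ f x‖ₑ ^ 2 ∂μ := by
  set f₀ : V → ℂ := Q.indicator f with hf₀
  have hfc : ContinuousOn f Q := fun x hx => (hf x hx).continuousAt.continuousWithinAt
  have hf₀m : Measurable f₀ := measurable_indicator_of_continuousOn hQm hfc
  set G : V → ℝ≥0∞ := Q.indicator fun x => ‖fderiv ℝ f x‖ₑ ^ 2 with hG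
  have hGm : Measurable G := by
    have hc : ContinuousOn (fun x => ‖fderiv ℝ f x‖ₑ ^ 2) Q := fun x hx =>
      ((ENNReal.continuous_pow 2).continuousAt.comp
        (continuous_enorm.continuousAt.comp
          ((hf x hx).fderiv_right (m := 0) (by simp)).continuousAt)).continuousWithinAt
    exact measurable_indicator_of_continuousOn hQm hc
  -- With indicator functions all integrals extend over the whole space, where `y = x + h` may be
  -- substituted and translation invariance applies. By convexity the segment stays in `Q`.
  have hpt : ∀ x h, Q.indicator (fun _ => (1 : ℝ≥0∞)) x * (Q.indicator (fun _ => (1 : ℝ≥0∞)) (x + h)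
      * ‖f₀ (x + h) - f₀ x‖ₑ ^ 2) ≤
      B.indicator (fun _ => d ^ 2) h * ∫⁻ s in Icc (0 : ℝ) 1, G (x + s • h) := by
    intro x h
    by_cases hx : x ∈ Q
    · by_cases hxh : x + h ∈ Q
      · have hseg : ∀ s ∈ Icc (0 : ℝ) 1, x + s • h ∈ Q := fun s hs =>
          hQ.add_smul_mem hx hxh hs
        have hBh : h ∈ B := by simpa using hB x hx _ hxh
        have e := enorm_sub_sq_le_lintegral (f := f) (x := x) (h := h) fun s hs => hf _ (hseg s hs)
        simp only [hx, hxh, hBh, hf₀, indicator_of_mem, one_mul]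
        refine e.trans (mul_le_mul' (by gcongr; exact hd h hBh) (le_of_eq ?_))
        refine setLIntegral_congr_fun measurableSet_Icc fun s hs => ?_
        simp [hG, hseg s hs]
      · simp [hxh]
    · simp [hx]
  have hshift : ∀ x, ∫⁻ y in Q, ‖f y - f x‖ₑ ^ 2 ∂μ =
      ∫⁻ h, Q.indicator (fun _ => (1 : ℝ≥0∞)) (x + h) * ‖f₀ (x + h) - f x‖ₑ ^ 2 ∂μ := by
    intro x
    rw [lintegral_add_left_eq_self (fun y => Q.indicator (fun _ => (1 : ℝ≥0∞)) y *
      ‖f₀ y - f x‖ₑ ^ 2) x, ← lintegral_indicator hQm]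
    refine lintegral_congr fun y => ?_
    by_cases hy : y ∈ Q <;> simp [hy, hf₀]
  have hGs : Measurable fun q : (V × V) × ℝ => G (q.1.1 + q.2 • q.1.2) :=
    hGm.comp (by fun_prop)
  have hmI : Measurable (Q.indicator fun _ => (1 : ℝ≥0∞)) := measurable_const.indicator hQm
  calc ∫⁻ x in Q, ∫⁻ y in Q, ‖f y - f x‖ₑ ^ 2 ∂μ ∂μ
      = ∫⁻ x, ∫⁻ h, Q.indicator (fun _ => (1 : ℝ≥0∞)) x * (Q.indicator (fun _ => (1 : ℝ≥0∞)) (x + h)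
          * ‖f₀ (x + h) - f₀ x‖ₑ ^ 2) ∂μ ∂μ := by
        rw [← lintegral_indicator hQm]
        refine lintegral_congr fun x => ?_
        by_cases hx : x ∈ Q
        · rw [indicator_of_mem hx, hshift x]
          simp [hx, hf₀]
        · simp [hx]
    _ ≤ ∫⁻ x, ∫⁻ h, B.indicator (fun _ => d ^ 2) h * (∫⁻ s in Icc (0 : ℝ) 1, G (x + s • h)) ∂μ ∂μ :=
        lintegral_mono fun x => lintegral_mono fun h => hpt x h
    _ = ∫⁻ h, ∫⁻ x, B.indicator (fun _ => d ^ 2) h * (∫⁻ s in Icc (0 : ℝ) 1, G (x + s • h)) ∂μ ∂μ := by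
        refine lintegral_lintegral_swap (Measurable.aemeasurable ?_)
        refine Measurable.mul ((measurable_const.indicator hBm).comp measurable_snd) ?_
        exact Measurable.lintegral_prod_right' (f := fun q : (V × V) × ℝ => G (q.1.1 + q.2 • q.1.2))
          hGs
    _ = ∫⁻ h, B.indicator (fun _ => d ^ 2 * ∫⁻ x in Q, ‖fderiv ℝ f x‖ₑ ^ 2 ∂μ) h ∂μ := by
        refine lintegral_congr fun h => ?_
        have hm1 : Measurable fun q : V × ℝ => G (q.1 + q.2 • h) := hGm.comp (by fun_prop)
        rw [lintegral_const_mul _ (Measurable.lintegral_prod_right' hm1),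
          lintegral_lintegral_swap hm1.aemeasurable]
        -- After exchanging the integrals, translation by `s h` leaves the integral over `x`
        -- unchanged; what remains is constant in `s` and in `h ∈ B`.
        have : ∀ s : ℝ, ∫⁻ x, G (x + s • h) ∂μ = ∫⁻ x in Q, ‖fderiv ℝ f x‖ₑ ^ 2 ∂μ := by
          intro s
          rw [lintegral_add_right_eq_self G (s • h), hG, lintegral_indicator hQm]
        simp only [this, lintegral_const, MeasurableSet.univ, Measure.restrict_apply, univ_inter,
          Real.volume_Icc, sub_zero, ENNReal.ofReal_one, mul_one]
        by_cases hh : h ∈ B <;> simp [hh]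
    _ = μ B * d ^ 2 * ∫⁻ x in Q, ‖fderiv ℝ f x‖ₑ ^ 2 ∂μ := by
        rw [lintegral_indicator hBm, lintegral_const, Measure.restrict_apply .univ, univ_inter]
        ring

lemma enorm_add_sq_le (a b : ℂ) : ‖a + b‖ₑ ^ 2 ≤ 2 * ‖a‖ₑ ^ 2 + 2 * ‖b‖ₑ ^ 2 := by
  have h : ‖a + b‖ ^ 2 ≤ 2 * ‖a‖ ^ 2 + 2 * ‖b‖ ^ 2 := by
    have := norm_add_le a b
    nlinarith [sq_nonneg (‖a‖ - ‖b‖), norm_nonneg (a + b), norm_nonneg a, norm_nonneg b]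
  have h2 := ofReal_le_two_add_two (sq_nonneg ‖a‖) (sq_nonneg ‖b‖) h
  simpa only [ENNReal.ofReal_pow (norm_nonneg _), ofReal_norm_eq_enorm] using h2

/-- The mean value and the gradient control the `L²` norm on a convex set. -/
lemma lintegral_enorm_sq_le_of_convex (μ : Measure V) [μ.IsAddHaarMeasure] {Q B : Set V}
    (hQ : Convex ℝ Q) (hQm : MeasurableSet Q) (hBm : MeasurableSet B)
    (hB : ∀ x ∈ Q, ∀ y ∈ Q, y - x ∈ B) {d : ℝ≥0∞} (hd : ∀ h ∈ B, ‖h‖ₑ ≤ d) {f : V → ℂ}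
    (hf : ∀ x ∈ Q, ContDiffAt ℝ 1 f x) (hfi : IntegrableOn f Q μ) (hQ0 : μ Q ≠ 0)
    (hQt : μ Q ≠ ⊤) :
    ∫⁻ x in Q, ‖f x‖ₑ ^ 2 ∂μ ≤ 2 * (μ Q)⁻¹ * ‖∫ y in Q, f y ∂μ‖ₑ ^ 2 +
      2 * ((μ Q)⁻¹ * μ B) * d ^ 2 * ∫⁻ x in Q, ‖fderiv ℝ f x‖ₑ ^ 2 ∂μ := by
  have hfc : ContinuousOn f Q := fun x hx => (hf x hx).continuousAt.continuousWithinAt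
  -- From `μ(Q) f(x) = ∫ f - ∫ (f(y) - f(x)) dy`, with Cauchy–Schwarz for the second integral.
  have hpt : ∀ x, μ Q ^ 2 * ‖f x‖ₑ ^ 2 ≤ 2 * ‖∫ y in Q, f y ∂μ‖ₑ ^ 2 +
      2 * (μ Q * ∫⁻ y in Q, ‖f y - f x‖ₑ ^ 2 ∂μ) := by
    intro x
    have h1 : ∫ y in Q, (f y - f x) ∂μ = (∫ y in Q, f y ∂μ) - (μ.real Q : ℂ) * f x := by
      rw [integral_sub hfi (integrableOn_const hQt)]
      simp
    have h2 : (μ.real Q : ℂ) * f x = (∫ y in Q, f y ∂μ) + -∫ y in Q, (f y - f x) ∂μ := by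
      rw [h1]; ring
    have h3 : μ Q ^ 2 * ‖f x‖ₑ ^ 2 = ‖(μ.real Q : ℂ) * f x‖ₑ ^ 2 := by
      rw [enorm_mul, mul_pow]
      congr 2
      rw [← ofReal_norm_eq_enorm, Complex.norm_real, Real.norm_of_nonneg measureReal_nonneg,
        measureReal_def, ENNReal.ofReal_toReal hQt]
    rw [h3, h2]
    refine (enorm_add_sq_le _ _).trans ?_
    rw [enorm_neg]
    gcongr
    refine (pow_le_pow_left' (enorm_integral_le_lintegral_enorm _) 2).trans ?_
    refine (sq_lintegral_le _ ?_).trans (by simp)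
    exact ((hfc.sub continuousOn_const).aestronglyMeasurable hQm).enorm
  have hint : μ Q ^ 2 * ∫⁻ x in Q, ‖f x‖ₑ ^ 2 ∂μ ≤ 2 * μ Q * ‖∫ y in Q, f y ∂μ‖ₑ ^ 2 +
      2 * μ Q * (μ B * d ^ 2 * ∫⁻ x in Q, ‖fderiv ℝ f x‖ₑ ^ 2 ∂μ) := by
    rw [← lintegral_const_mul' _ _ (by simp [hQt])]
    refine (lintegral_mono hpt).trans ?_
    rw [lintegral_add_left measurable_const, lintegral_const, Measure.restrict_apply .univ,
      univ_inter, lintegral_const_mul' _ _ (by simp), lintegral_const_mul' _ _ hQt]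
    refine add_le_add (le_of_eq (by ring)) ?_
    rw [← mul_assoc]
    gcongr
    exact lintegral_lintegral_enorm_sub_le μ hQ hQm hBm hB hd hf
  have hi : (μ Q)⁻¹ * μ Q = 1 := ENNReal.inv_mul_cancel hQ0 hQt
  calc ∫⁻ x in Q, ‖f x‖ₑ ^ 2 ∂μ
      = ((μ Q)⁻¹ * μ Q) ^ 2 * ∫⁻ x in Q, ‖f x‖ₑ ^ 2 ∂μ := by rw [hi]; simp
    _ = (μ Q)⁻¹ ^ 2 * (μ Q ^ 2 * ∫⁻ x in Q, ‖f x‖ₑ ^ 2 ∂μ) := by ring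
    _ ≤ (μ Q)⁻¹ ^ 2 * (2 * μ Q * ‖∫ y in Q, f y ∂μ‖ₑ ^ 2 +
      2 * μ Q * (μ B * d ^ 2 * ∫⁻ x in Q, ‖fderiv ℝ f x‖ₑ ^ 2 ∂μ)) := by gcongr
    _ = ((μ Q)⁻¹ * μ Q) * (2 * (μ Q)⁻¹ * ‖∫ y in Q, f y ∂μ‖ₑ ^ 2 +
      2 * ((μ Q)⁻¹ * μ B) * d ^ 2 * ∫⁻ x in Q, ‖fderiv ℝ f x‖ₑ ^ 2 ∂μ) := by ring
    _ = _ := by rw [hi, one_mul]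

end Poincare

/-! ### Cubes -/

section Cubes

variable {n : ℕ}

/-- The half-open cube with corner `a` and side `L`. -/
def cube (a : Fin (2 * n) → ℝ) (L : ℝ) : Set (E n) := {y | ∀ i, a i ≤ y i ∧ y i < a i + L}

lemma cube_eq_preimage (a : Fin (2 * n) → ℝ) (L : ℝ) :
    cube a L = (MeasurableEquiv.toLp 2 (Fin (2 * n) → ℝ)).symm ⁻¹'
      (univ.pi fun i => Ico (a i) (a i + L)) := by
  ext y; simp [cube, Set.mem_pi]

lemma measurableSet_cube (a : Fin (2 * n) → ℝ) (L : ℝ) : MeasurableSet (cube a L) := by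
  rw [cube_eq_preimage]
  exact (MeasurableEquiv.toLp 2 _).symm.measurable
    (MeasurableSet.univ_pi fun i => measurableSet_Ico)

lemma volume_cube (a : Fin (2 * n) → ℝ) (L : ℝ) :
    volume (cube a L) = ENNReal.ofReal L ^ (2 * n) := by
  rw [cube_eq_preimage, (EuclideanSpace.volume_preserving_symm_measurableEquiv_toLp _).measure_preimage
    (MeasurableSet.univ_pi fun i => measurableSet_Ico).nullMeasurableSet, Real.volume_pi_Ico]
  simp

lemma convex_cube (a : Fin (2 * n) → ℝ) (L : ℝ) : Convex ℝ (cube a L) := by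
  intro x hx y hy s t hs ht hst i
  have h := (convex_Ico (𝕜 := ℝ) (a i) (a i + L)) (hx i) (hy i) hs ht hst
  simpa using h

lemma enorm_le_of_abs_le {L : ℝ} (hL : 0 ≤ L) {h : E n} (hh : ∀ i, |h i| ≤ L) :
    ‖h‖ₑ ≤ ENNReal.ofReal (L * √(2 * n)) := by
  rw [← ofReal_norm_eq_enorm]
  refine ENNReal.ofReal_le_ofReal ?_
  rw [EuclideanSpace.norm_eq]
  refine Real.sqrt_le_iff.2 ⟨by positivity, ?_⟩
  rw [mul_pow, Real.sq_sqrt (by positivity)]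
  calc ∑ i, ‖h i‖ ^ 2 ≤ ∑ _i : Fin (2 * n), L ^ 2 := by
        gcongr with i; exact hh i
    _ = _ := by simp; ring

/-- On a cube of side `L`, the mean value and the gradient control the `L²` norm. -/
lemma lintegral_cube_le {a : Fin (2 * n) → ℝ} {L : ℝ} (hL : 0 < L) {f : E n → ℂ}
    (hf : ∀ x ∈ cube a L, ContDiffAt ℝ 1 f x) (hfi : IntegrableOn f (cube a L)) :
    ∫⁻ x in cube a L, ‖f x‖ₑ ^ 2 ≤
      2 * (volume (cube a L))⁻¹ * ‖∫ y in cube a L, f y‖ₑ ^ 2 +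
      2 * 2 ^ (2 * n) * ENNReal.ofReal (L * √(2 * n)) ^ 2 *
        ∫⁻ x in cube a L, ‖fderiv ℝ f x‖ₑ ^ 2 := by
  have hv : volume (cube a L) ≠ 0 := by
    rw [volume_cube]; exact pow_ne_zero _ (by simpa using hL)
  have hv' : volume (cube a L) ≠ ⊤ := by rw [volume_cube]; simp
  -- Differences of points of the cube lie in the centred cube of side `2 L`, whose volume is `2 ^
  -- (2 n)` times that of the cube.
  have h := lintegral_enorm_sq_le_of_convex volume (B := cube (fun _ => -L) (2 * L))
    (d := ENNReal.ofReal (L * √(2 * n))) (convex_cube a L)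
    (measurableSet_cube a L) (measurableSet_cube _ _) (fun x hx y hy i => ?_) (fun h hh => ?_)
    hf hfi hv hv'
  · refine h.trans (le_of_eq ?_)
    have : (volume (cube a L))⁻¹ * volume (cube (fun _ => -L) (2 * L) : Set (E n)) =
        2 ^ (2 * n) := by
      rw [volume_cube, volume_cube, ENNReal.ofReal_mul (by norm_num), mul_pow, mul_left_comm,
        ← volume_cube a L, ENNReal.inv_mul_cancel hv hv']
      simp
    rw [this]
  · have h1 := hx i; have h2 := hy i
    simp only [PiLp.sub_apply]
    constructor <;> linarith [h1.1, h1.2, h2.1, h2.2]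
  · refine enorm_le_of_abs_le hL.le fun i => abs_le.2 ?_
    have := hh i
    constructor <;> linarith [this.1, this.2]

/-- The cubes are half-open so that the cells of the grid form an exact partition. -/
lemma cube_eq_iUnion (a : Fin (2 * n) → ℝ) {L : ℝ} (hL : 0 < L) {M : ℕ} (hM : 0 < M) :
    cube a L = ⋃ κ : Fin (2 * n) → Fin M, cube (fun i => a i + L / M * (κ i : ℕ)) (L / M) := by
  have hM' : (0 : ℝ) < M := Nat.cast_pos.2 hM
  have hLM : 0 < L / M := by positivity
  ext y
  simp only [mem_iUnion]
  constructor
  · intro hy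
    have hnn : ∀ i, 0 ≤ (y i - a i) / (L / M) := fun i =>
      div_nonneg (by linarith [(hy i).1]) hLM.le
    refine ⟨fun i => ⟨⌊(y i - a i) / (L / M)⌋₊, ?_⟩, fun i => ?_⟩
    · rw [Nat.floor_lt (hnn i), div_lt_iff₀ hLM]
      have := (hy i).2
      rw [mul_div_cancel₀ _ hM'.ne']
      linarith
    · have h1 := Nat.floor_le (hnn i)
      have h2 := Nat.lt_floor_add_one ((y i - a i) / (L / M))
      rw [le_div_iff₀ hLM] at h1
      rw [div_lt_iff₀ hLM] at h2
      dsimp only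
      constructor <;> nlinarith
  · rintro ⟨κ, hκ⟩ i
    have h1 := hκ i
    have h2 : ((κ i : ℕ) : ℝ) + 1 ≤ M := by exact_mod_cast (κ i).2
    have h3 : L / M * (((κ i : ℕ) : ℝ) + 1) ≤ L := by
      calc L / M * (((κ i : ℕ) : ℝ) + 1) ≤ L / M * M := by gcongr
        _ = L := div_mul_cancel₀ _ hM'.ne'
    have h4 : 0 ≤ L / M * ((κ i : ℕ) : ℝ) := by positivity
    constructor <;> linarith [h1.1, h1.2]

lemma pairwise_disjoint_cube (a : Fin (2 * n) → ℝ) {h : ℝ} (hh : 0 < h) {M : ℕ} :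
    Pairwise (Function.onFun Disjoint
      fun κ : Fin (2 * n) → Fin M => cube (n := n) (fun i => a i + h * (κ i : ℕ)) h) := by
  intro κ κ' hne
  obtain ⟨i, hi⟩ := Function.ne_iff.1 hne
  rw [Function.onFun, Set.disjoint_left]
  intro y hy hy'
  have h1 := hy i; have h2 := hy' i
  apply hi
  ext
  have e1 : h * ((κ i : ℕ) : ℝ) < h * (((κ' i : ℕ) : ℝ) + 1) := by linarith [h1.1, h2.2]
  have e2 : h * ((κ' i : ℕ) : ℝ) < h * (((κ i : ℕ) : ℝ) + 1) := by linarith [h2.1, h1.2]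
  have e3 := lt_of_mul_lt_mul_left e1 hh.le
  have e4 := lt_of_mul_lt_mul_left e2 hh.le
  have e5 : (κ i : ℕ) < (κ' i : ℕ) + 1 := by exact_mod_cast e3
  have e6 : (κ' i : ℕ) < (κ i : ℕ) + 1 := by exact_mod_cast e4
  omega

/-- On a cube, the mean values over the cells of a fine grid control the `L²` norm up to a small
multiple of the norm of the gradient. -/
lemma lintegral_cube_le_grid {a : Fin (2 * n) → ℝ} {L : ℝ} (hL : 0 < L) {M : ℕ} (hM : 0 < M)
    {f : E n → ℂ} (hf : ∀ x ∈ cube a L, ContDiffAt ℝ 1 f x) (hfi : IntegrableOn f (cube a L)) :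
    ∫⁻ x in cube a L, ‖f x‖ₑ ^ 2 ≤
      ∑ κ : Fin (2 * n) → Fin M, 2 * (ENNReal.ofReal (L / M) ^ (2 * n))⁻¹ *
        ‖∫ y in cube (fun i => a i + L / M * (κ i : ℕ)) (L / M), f y‖ₑ ^ 2 +
      2 * 2 ^ (2 * n) * ENNReal.ofReal (L / M * √(2 * n)) ^ 2 *
        ∫⁻ x in cube a L, ‖fderiv ℝ f x‖ₑ ^ 2 := by
  have hLM : 0 < L / M := div_pos hL (Nat.cast_pos.2 hM)
  have hU := cube_eq_iUnion a hL hM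
  have hsub : ∀ κ : Fin (2 * n) → Fin M,
      cube (fun i => a i + L / M * (κ i : ℕ)) (L / M) ⊆ cube a L := fun κ => by
    rw [hU]; exact subset_iUnion (fun κ : Fin (2 * n) → Fin M =>
      cube (n := n) (fun i => a i + L / M * (κ i : ℕ)) (L / M)) κ
  have hsplit : ∀ F : E n → ℝ≥0∞, ∫⁻ x in cube a L, F x =
      ∑ κ : Fin (2 * n) → Fin M,
        ∫⁻ x in cube (fun i => a i + L / M * (κ i : ℕ)) (L / M), F x := by
    intro F
    conv_lhs => rw [hU]
    rw [lintegral_iUnion (fun κ => measurableSet_cube _ _) (pairwise_disjoint_cube a hLM),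
      tsum_fintype]
  rw [hsplit, hsplit, Finset.mul_sum, ← Finset.sum_add_distrib]
  refine Finset.sum_le_sum fun κ _ => ?_
  rw [← volume_cube (fun i => a i + L / M * (κ i : ℕ)) (L / M)]
  exact lintegral_cube_le hLM (fun x hx => hf x (hsub κ hx)) (hfi.mono_set (hsub κ))

end Cubes

/-! ### Interior estimates -/

section Interior

variable {n : ℕ} {X : Type*} [TopologicalSpace X] [ChartedSpace (E n) X]
  [IsManifold 𝓘(ℝ, E n) ∞ X] {D : Set X} {g : BilinField (n := n) X} {J : EndField (n := n) X}
  {ψ : OpenPartialHomeomorph X (E n)} {m : ℕ}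

local notation "𝒜" => IsManifold.maximalAtlas 𝓘(ℝ, E n) ∞ X

/-- The density `|φ|² + |∇φ|²`. -/
def graphNormSq (g : BilinField (n := n) X) {m : ℕ} (φ : Form n X m) (x : X) : ℝ :=
  φ.normSq g x + gradSq g φ x

lemma norm_fderiv_le_sum_pd {F : Type*} [NormedAddCommGroup F] [NormedSpace ℝ F] (f : E n → F)
    (y : E n) : ‖fderiv ℝ f y‖ ≤ ∑ i, ‖pd i f y‖ := by
  refine ContinuousLinearMap.opNorm_le_bound _ (by positivity) fun w => ?_
  rw [fderiv_eq_sum_pd, Finset.sum_mul]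
  refine (norm_sum_le _ _).trans (Finset.sum_le_sum fun i _ => ?_)
  rw [norm_smul, mul_comm]
  gcongr
  exact PiLp.norm_apply_le w i

/-- The definition of `∇φ` is solved for the partial derivative. Bounded Christoffel symbols thus
turn bounds for `φ` and `∇φ` into bounds for Euclidean derivatives. -/
lemma norm_pd_comp_le (φ : Form n X m) {y : E n} {B : ℝ}
    (hB : ∀ a i j, |christoffel g ψ a i j y| ≤ B) (I : Fin m → Fin (2 * n)) (i : Fin (2 * n)) :
    ‖pd i (φ.comp ψ I) y‖ ≤ ‖fun I => nablaComp g φ ψ I y‖ +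
      m * (2 * n) * B * ‖fun I => φ.comp ψ I y‖ := by
  have h : pd i (φ.comp ψ I) y = nablaComp g φ ψ (Fin.cons i I) y +
      ∑ l : Fin m, ∑ a, (christoffel g ψ a i (I l) y : ℂ) *
        φ.comp ψ (Function.update I l a) y := by
    simp [nablaComp]
  rw [h]
  refine (norm_add_le _ _).trans (add_le_add ?_ ?_)
  · exact norm_le_pi_norm (fun I => nablaComp g φ ψ I y) (Fin.cons i I)
  · refine (norm_sum_le _ _).trans ?_
    calc ∑ l : Fin m, ‖∑ a, (christoffel g ψ a i (I l) y : ℂ) *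
          φ.comp ψ (Function.update I l a) y‖
        ≤ ∑ _l : Fin m, ∑ _a : Fin (2 * n), B * ‖fun I => φ.comp ψ I y‖ := by
          refine Finset.sum_le_sum fun l _ => (norm_sum_le _ _).trans
            (Finset.sum_le_sum fun a _ => ?_)
          rw [norm_mul, Complex.norm_real]
          have h1 := hB a i (I l)
          exact mul_le_mul h1 (norm_le_pi_norm (fun I => φ.comp ψ I y) _) (norm_nonneg _)
            ((abs_nonneg _).trans h1)
      _ = _ := by simp; ring

lemma pi_norm_sq_le_sum {ι : Type*} [Fintype ι] (A : ι → ℂ) : ‖A‖ ^ 2 ≤ ∑ i, ‖A i‖ ^ 2 := by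
  have h0 : 0 ≤ ∑ i, ‖A i‖ ^ 2 := by positivity
  rw [← Real.le_sqrt (norm_nonneg _) h0, pi_norm_le_iff_of_nonneg (Real.sqrt_nonneg _)]
  intro i
  rw [Real.le_sqrt (norm_nonneg _) h0]
  exact Finset.single_le_sum (f := fun i => ‖A i‖ ^ 2) (fun _ _ => by positivity)
    (Finset.mem_univ i)

/-- On compact subsets of a chart domain, the Euclidean and the Riemannian norms of a form and of
its first derivatives are comparable. -/
lemma IsKahlerOff.exists_chart_bounds (hK : IsKahlerOff D g J) (hD : IsClosed D)
    (hψ : ψ ∈ atlas (E n) X) {K : Set (E n)} (hKc : IsCompact K) (hKD : K ⊆ chartDom D ψ)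
    (m : ℕ) : ∃ C : ℝ, 0 < C ∧ ∀ φ : Form n X m, φ.SmoothOff D → ∀ y ∈ K,
      (∀ I, ‖φ.comp ψ I y‖ ^ 2 ≤ C * graphNormSq g φ (ψ.symm y)) ∧
      (∀ I, ‖fderiv ℝ (φ.comp ψ I) y‖ ^ 2 ≤ C * graphNormSq g φ (ψ.symm y)) ∧
      φ.normSq g (ψ.symm y) ≤ C * ∑ I, ‖φ.comp ψ I y‖ ^ 2 := by
  have hψ' : ψ ∈ 𝒜 := IsManifold.subset_maximalAtlas hψ
  obtain ⟨c₀, C₀, hc₀, hC₀, h₀⟩ := hK.tensorNormSq_bounds hD hψ' hKc hKD m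
  obtain ⟨c₁, C₁, hc₁, hC₁, h₁⟩ := hK.tensorNormSq_bounds hD hψ' hKc hKD (m + 1)
  have hΓ : ∃ B : ℝ, 0 ≤ B ∧ ∀ y ∈ K, ∀ a i j, |christoffel g ψ a i j y| ≤ B := by
    have hc : ContinuousOn (fun y => fun q : Fin (2 * n) × Fin (2 * n) × Fin (2 * n) =>
        christoffel g ψ q.1 q.2.1 q.2.2 y) K := continuousOn_pi.2 fun q y hy =>
      (contDiffAt_christoffel hK hD hψ' (hKD hy) _ _ _).continuousAt.continuousWithinAt
    obtain ⟨B, hB⟩ := hKc.exists_bound_of_continuousOn hc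
    refine ⟨max B 0, le_max_right _ _, fun y hy a i j => le_max_of_le_left ?_⟩
    exact (norm_le_pi_norm (fun q : Fin (2 * n) × Fin (2 * n) × Fin (2 * n) =>
        christoffel g ψ q.1 q.2.1 q.2.2 y) (a, i, j)).trans (hB y hy)
  obtain ⟨B, hB0, hB⟩ := hΓ
  set P : ℝ := m * (2 * n) * B with hP
  set N : ℝ := ((2 * n : ℕ) : ℝ) with hN
  set f : ℝ := (m.factorial : ℝ) with hf
  have hf0 : 0 < f := by positivity
  -- One constant serves all three estimates, being the sum of their constants; `f = m!` comes from
  -- the normalization of the norm of forms.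
  refine ⟨f / c₀ + N ^ 2 * (2 * (f / c₁) + 2 * P ^ 2 * (f / c₀)) + C₀, by positivity,
    fun φ hφ y hy => ?_⟩
  set A : (Fin m → Fin (2 * n)) → ℂ := fun I => φ.comp ψ I y with hA
  set A' : (Fin (m + 1) → Fin (2 * n)) → ℂ := fun I => nablaComp g φ ψ I y with hA'
  have e₀ := hK.normSq_symm φ hψ' (hKD hy)
  have e₁ := hK.gradSq_symm hD hφ hψ (hKD hy)
  have hx : ψ.symm y ∉ D := (hKD hy).2
  have n₀ := normSq_nonneg hK φ hx
  have n₁ := gradSq_nonneg hK φ hx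
  set u := φ.normSq g (ψ.symm y) with hu
  set v := gradSq g φ (ψ.symm y) with hv
  have b₀ : ‖A‖ ^ 2 ≤ f / c₀ * u := by
    have := (h₀ y hy A).1
    rw [e₀, div_mul_div_comm, mul_comm c₀, mul_div_mul_left _ _ hf0.ne', le_div_iff₀ hc₀]
    linarith
  have b₁ : ‖A'‖ ^ 2 ≤ f / c₁ * v := by
    have := (h₁ y hy A').1
    rw [e₁, div_mul_div_comm, mul_comm c₁, mul_div_mul_left _ _ hf0.ne', le_div_iff₀ hc₁]
    linarith
  have hW : graphNormSq g φ (ψ.symm y) = u + v := rfl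
  have p₀ : 0 ≤ f / c₀ := by positivity
  have p₁ : 0 ≤ f / c₁ := by positivity
  refine ⟨fun I => ?_, fun I => ?_, ?_⟩
  · calc ‖φ.comp ψ I y‖ ^ 2 ≤ ‖A‖ ^ 2 := by
          gcongr; exact norm_le_pi_norm A I
      _ ≤ f / c₀ * u := b₀
      _ ≤ f / c₀ * (u + v) := by gcongr; linarith
      _ ≤ _ := by
          rw [hW]
          refine mul_le_mul_of_nonneg_right ?_ (by positivity)
          have : 0 ≤ N ^ 2 * (2 * (f / c₁) + 2 * P ^ 2 * (f / c₀)) := by positivity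
          linarith
  · have hd : ‖fderiv ℝ (φ.comp ψ I) y‖ ≤ N * (‖A'‖ + P * ‖A‖) := by
      refine (norm_fderiv_le_sum_pd _ _).trans ?_
      calc ∑ i, ‖pd i (φ.comp ψ I) y‖ ≤ ∑ _i : Fin (2 * n), (‖A'‖ + P * ‖A‖) :=
            Finset.sum_le_sum fun i _ => norm_pd_comp_le φ (hB y hy) I i
        _ = _ := by simp [hN]; ring
    calc ‖fderiv ℝ (φ.comp ψ I) y‖ ^ 2 ≤ (N * (‖A'‖ + P * ‖A‖)) ^ 2 := by gcongr
      _ ≤ N ^ 2 * (2 * ‖A'‖ ^ 2 + 2 * P ^ 2 * ‖A‖ ^ 2) := by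
          rw [mul_pow]
          gcongr
          nlinarith [sq_nonneg (‖A'‖ - P * ‖A‖)]
      _ ≤ N ^ 2 * (2 * (f / c₁ * v) + 2 * P ^ 2 * (f / c₀ * u)) := by gcongr
      _ ≤ N ^ 2 * (2 * (f / c₁ * (u + v)) + 2 * P ^ 2 * (f / c₀ * (u + v))) := by
          gcongr <;> linarith
      _ = N ^ 2 * (2 * (f / c₁) + 2 * P ^ 2 * (f / c₀)) * (u + v) := by ring
      _ ≤ _ := by
          rw [hW]
          refine mul_le_mul_of_nonneg_right ?_ (by positivity)
          linarith
  · have hs := pi_norm_sq_le_sum A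
    have hs0 : 0 ≤ ∑ I, ‖A I‖ ^ 2 := by positivity
    have hf1 : (1 : ℝ) ≤ f := by
      rw [hf]; exact_mod_cast Nat.one_le_iff_ne_zero.2 (Nat.factorial_ne_zero m)
    have ht := (h₀ y hy A).2
    calc u ≤ C₀ * ‖A‖ ^ 2 := by
          rw [e₀, div_le_iff₀ hf0]
          refine ht.trans (le_mul_of_one_le_right (by positivity) hf1)
      _ ≤ C₀ * ∑ I, ‖A I‖ ^ 2 := by gcongr
      _ ≤ _ := by
          refine mul_le_mul_of_nonneg_right ?_ hs0
          have : 0 ≤ N ^ 2 * (2 * (f / c₁) + 2 * P ^ 2 * (f / c₀)) := by positivity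
          linarith

variable [MeasurableSpace X]

/-- The squared norm `‖φ‖² + ‖∇φ‖²`. -/
def energy (D : Set X) (g : BilinField (n := n) X) {m : ℕ} (φ : Form n X m) : ℝ≥0∞ :=
  ∫⁻ x, ENNReal.ofReal (graphNormSq g φ x) ∂(vol D g)

/-- A functional which is additive on smooth forms and bounded for the norm `energy`. -/
def IsBddFunctional (D : Set X) (g : BilinField (n := n) X) {m : ℕ} (ℓ : Form n X m → ℂ) : Prop :=
  (∀ φ φ' : Form n X m, φ.SmoothOff D → φ'.SmoothOff D → ℓ (φ - φ') = ℓ φ - ℓ φ') ∧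
  ∃ C : ℝ≥0∞, C ≠ ⊤ ∧ ∀ φ : Form n X m, φ.SmoothOff D → ‖ℓ φ‖ₑ ^ 2 ≤ C * energy D g φ

/-- Up to a small multiple of `energy`, the `L²` norm on `O` is controlled by finitely many
functionals. -/
def NormCompactOn (D : Set X) (g : BilinField (n := n) X) (m : ℕ) (O : Set X) : Prop :=
  ∀ η : ℝ≥0∞, η ≠ 0 → ∃ (L : List (Form n X m → ℂ)) (A : ℝ≥0∞), A ≠ ⊤ ∧
    (∀ ℓ ∈ L, IsBddFunctional D g ℓ) ∧ ∀ φ : Form n X m, φ.SmoothOff D →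
      ∫⁻ x in O, ENNReal.ofReal (φ.normSq g x) ∂(vol D g) ≤
        A * (L.map fun ℓ => ‖ℓ φ‖ₑ ^ 2).sum + η * energy D g φ

lemma normCompactOn_empty : NormCompactOn D g m ∅ := fun _ _ =>
  ⟨[], 0, by simp, by simp, by simp⟩

lemma NormCompactOn.mono {O O' : Set X} (h : NormCompactOn D g m O') (hO : O ⊆ O') :
    NormCompactOn D g m O := fun η hη => by
  obtain ⟨L, A, hA, hL, hb⟩ := h η hη
  exact ⟨L, A, hA, hL, fun φ hφ => (lintegral_mono_set hO).trans (hb φ hφ)⟩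

lemma NormCompactOn.union {O O' : Set X} (h : NormCompactOn D g m O)
    (h' : NormCompactOn D g m O') : NormCompactOn D g m (O ∪ O') := fun η hη => by
  have hη2 : η / 2 ≠ 0 := by simpa using hη
  obtain ⟨L, A, hA, hL, hb⟩ := h _ hη2
  obtain ⟨L', A', hA', hL', hb'⟩ := h' _ hη2
  refine ⟨L ++ L', A + A', by simp [hA, hA'], fun ℓ hℓ => ?_, fun φ hφ => ?_⟩
  · rcases List.mem_append.1 hℓ with h | h
    · exact hL _ h
    · exact hL' _ h
  · refine (lintegral_union_le _ _ _).trans ((add_le_add (hb φ hφ) (hb' φ hφ)).trans ?_)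
    rw [List.map_append, List.sum_append]
    set S := (L.map fun ℓ => ‖ℓ φ‖ₑ ^ 2).sum
    set S' := (L'.map fun ℓ => ‖ℓ φ‖ₑ ^ 2).sum
    calc A * S + η / 2 * energy D g φ + (A' * S' + η / 2 * energy D g φ)
        = A * S + A' * S' + (η / 2 + η / 2) * energy D g φ := by ring
      _ = A * S + A' * S' + η * energy D g φ := by rw [ENNReal.add_halves]
      _ ≤ A * S + A' * S' + (A * S' + A' * S) + η * energy D g φ := by
          exact add_le_add le_self_add le_rfl
      _ = _ := by ring

lemma closure_cube_subset {a : Fin (2 * n) → ℝ} {L R : ℝ} {y₀ : E n} (hL : 0 ≤ L)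
    (ha : ∀ i, a i = y₀ i - L / 2) (hR : L * √(2 * n) ≤ R) :
    cube a L ⊆ Metric.closedBall y₀ R := by
  intro y hy
  rw [mem_closedBall_iff_norm]
  refine le_trans ?_ hR
  have h := enorm_le_of_abs_le hL (h := y - y₀) fun i => by
    have h1 := hy i
    rw [ha i] at h1
    simp only [PiLp.sub_apply]
    rw [abs_le]
    constructor <;> linarith [h1.1, h1.2]
  rw [← ofReal_norm_eq_enorm] at h
  exact (ENNReal.ofReal_le_ofReal_iff (by positivity)).1 h

lemma ball_subset_cube {a : Fin (2 * n) → ℝ} {L : ℝ} {y₀ : E n} 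
    (ha : ∀ i, a i = y₀ i - L / 2) : Metric.ball y₀ (L / 2) ⊆ cube a L := by
  intro y hy i
  rw [mem_ball_iff_norm] at hy
  have h := (PiLp.norm_apply_le (y - y₀) i).trans_lt hy
  rw [PiLp.sub_apply, Real.norm_eq_abs, abs_lt] at h
  rw [ha i]
  constructor <;> linarith [h.1, h.2]

lemma lintegral_ofReal_sq_le {α : Type*} [MeasurableSpace α] {μ : Measure α} {F : Type*}
    [NormedAddCommGroup F] {Q : Set α} (hQ : MeasurableSet Q) {f : α → F} {u : α → ℝ} {C : ℝ}
    (h : ∀ y ∈ Q, ‖f y‖ ^ 2 ≤ C * u y) (hC : 0 ≤ C) :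
    ∫⁻ y in Q, ‖f y‖ₑ ^ 2 ∂μ ≤ ENNReal.ofReal C * ∫⁻ y in Q, ENNReal.ofReal (u y) ∂μ := by
  rw [← lintegral_const_mul' _ _ ENNReal.ofReal_ne_top]
  refine setLIntegral_mono' hQ fun y hy => ?_
  rw [← ENNReal.ofReal_mul hC, ← ofReal_norm_eq_enorm, ← ENNReal.ofReal_pow (norm_nonneg _)]
  exact ENNReal.ofReal_le_ofReal (h y hy)

variable [BorelSpace X] [CompactSpace X]

/-- On the compact set `K` the continuous positive density has a positive minimum, whose inverse is
the constant. -/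
lemma lintegral_model_le_energy (hK : IsKahlerOff D g J) (hD : IsClosed D)
    (hψ : ψ ∈ 𝒜) {K : Set (E n)} (hKc : IsCompact K) (hKD : K ⊆ chartDom D ψ) :
    ∃ C : ℝ≥0∞, C ≠ ⊤ ∧ ∀ F : X → ℝ≥0∞, ∫⁻ y in K, F (ψ.symm y) ≤ C * ∫⁻ x, F x ∂(vol D g) := by
  rcases K.eq_empty_or_nonempty with rfl | hne
  · exact ⟨0, by simp, by simp⟩
  obtain ⟨z, hz, hmin⟩ := hKc.exists_isMinOn hne ((continuousOn_dens hK hD hψ).mono hKD)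
  have hz0 : dens g ψ z ≠ 0 := (dens_pos hK hψ (hKD hz)).ne'
  have hzt : dens g ψ z ≠ ⊤ := ENNReal.ofReal_ne_top
  refine ⟨(dens g ψ z)⁻¹, by simpa using hz0, fun F => ?_⟩
  calc ∫⁻ y in K, F (ψ.symm y)
      ≤ ∫⁻ y in K, (dens g ψ z)⁻¹ * (dens g ψ y * F (ψ.symm y)) := by
        refine setLIntegral_mono' hKc.measurableSet fun y hy => ?_
        rw [← mul_assoc]
        refine le_mul_of_one_le_left' ?_
        rw [← ENNReal.inv_mul_cancel hz0 hzt]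
        gcongr
        exact hmin hy
    _ = (dens g ψ z)⁻¹ * ∫⁻ y in K, dens g ψ y * F (ψ.symm y) :=
        lintegral_const_mul' _ _ (by simpa using hz0)
    _ ≤ (dens g ψ z)⁻¹ * ∫⁻ x, F x ∂(vol D g) := by
        gcongr
        refine (lintegral_mono_set hKD).trans ?_
        rw [← lintegral_vol_source hK hD hψ]
        exact setLIntegral_le_lintegral _ _

/-- On a small cube in a chart, finitely many mean values control the `L²` norm. -/
lemma normCompactOn_cube (hK : IsKahlerOff D g J) (hD : IsClosed D) (hψ : ψ ∈ atlas (E n) X)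
    {K : Set (E n)} (hKc : IsCompact K) (hKD : K ⊆ chartDom D ψ) {a : Fin (2 * n) → ℝ} {L : ℝ}
    (hL : 0 < L) (hQK : cube a L ⊆ K) :
    NormCompactOn D g m (ψ.source ∩ ψ ⁻¹' cube a L) := by
  have hψ' : ψ ∈ 𝒜 := IsManifold.subset_maximalAtlas hψ
  set Q := cube a L with hQ
  have hQm : MeasurableSet Q := measurableSet_cube a L
  obtain ⟨C, hC, hb⟩ := hK.exists_chart_bounds hD hψ hKc hKD m
  obtain ⟨C₁, hC₁, hE⟩ := lintegral_model_le_energy hK hD hψ' hKc hKD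
  have hM : ∃ M : ℝ≥0∞, M ≠ ⊤ ∧ ∀ y ∈ K, dens g ψ y ≤ M := by
    rcases K.eq_empty_or_nonempty with rfl | hne
    · exact ⟨0, by simp, by simp⟩
    obtain ⟨z, hz, hmax⟩ := hKc.exists_isMaxOn hne ((continuousOn_dens hK hD hψ').mono hKD)
    exact ⟨dens g ψ z, ENNReal.ofReal_ne_top, fun y hy => hmax hy⟩
  obtain ⟨M, hMt, hM⟩ := hM
  set Cr := ENNReal.ofReal C with hCr
  have hCrt : Cr ≠ ⊤ := ENNReal.ofReal_ne_top
  -- the norms on `Q`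
  have hE' : ∀ φ : Form n X m, ∫⁻ y in Q, ENNReal.ofReal (graphNormSq g φ (ψ.symm y)) ≤
      C₁ * energy D g φ := fun φ => (lintegral_mono_set hQK).trans (hE _)
  have hcomp : ∀ φ : Form n X m, φ.SmoothOff D → ∀ I,
      ∫⁻ y in Q, ‖φ.comp ψ I y‖ₑ ^ 2 ≤ Cr * (C₁ * energy D g φ) := fun φ hφ I =>
    (lintegral_ofReal_sq_le hQm (fun y hy => (hb φ hφ y (hQK hy)).1 I) hC.le).trans
      (by gcongr; exact hE' φ)
  have hder : ∀ φ : Form n X m, φ.SmoothOff D → ∀ I,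
      ∫⁻ y in Q, ‖fderiv ℝ (φ.comp ψ I) y‖ₑ ^ 2 ≤ Cr * (C₁ * energy D g φ) := fun φ hφ I =>
    (lintegral_ofReal_sq_le hQm (fun y hy => (hb φ hφ y (hQK hy)).2.1 I) hC.le).trans
      (by gcongr; exact hE' φ)
  have hnorm : ∀ φ : Form n X m, φ.SmoothOff D →
      ∫⁻ x in ψ.source ∩ ψ ⁻¹' Q, ENNReal.ofReal (φ.normSq g x) ∂(vol D g) ≤
        M * Cr * ∑ I, ∫⁻ y in Q, ‖φ.comp ψ I y‖ₑ ^ 2 := by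
    intro φ hφ
    have hcm : ∀ I, AEMeasurable (fun y => ‖φ.comp ψ I y‖ₑ ^ 2) (volume.restrict Q) := fun I =>
      (ContinuousOn.aemeasurable (fun y hy => ((hφ.contDiffAt hD hψ
        (hKD (hQK hy)) I).continuousAt.continuousWithinAt)) hQm).enorm.pow_const 2
    have hi : MeasurableSet (ψ.source ∩ ψ ⁻¹' Q) := by
      have := (MeasurableEmbedding.subtype_coe ψ.open_source.measurableSet).measurableSet_image.2
        (ψ.continuousOn.domRestrict.measurable hQm)
      convert this using 1
      ext x
      simp [and_comm]
    calc ∫⁻ x in ψ.source ∩ ψ ⁻¹' Q, ENNReal.ofReal (φ.normSq g x) ∂(vol D g)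
        = ∫⁻ x in ψ.source, (ψ.source ∩ ψ ⁻¹' Q).indicator
            (fun x => ENNReal.ofReal (φ.normSq g x)) x ∂(vol D g) := by
          rw [lintegral_indicator hi, Measure.restrict_restrict hi,
            inter_eq_left.2 inter_subset_left]
      _ = ∫⁻ y in chartDom D ψ, dens g ψ y * (ψ.source ∩ ψ ⁻¹' Q).indicator
            (fun x => ENNReal.ofReal (φ.normSq g x)) (ψ.symm y) :=
          lintegral_vol_source hK hD hψ' _
      _ ≤ ∫⁻ y in chartDom D ψ, Q.indicator
            (fun y => M * (Cr * ∑ I, ‖φ.comp ψ I y‖ₑ ^ 2)) y := by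
          refine setLIntegral_mono' (isOpen_chartDom hD ψ).measurableSet fun y hy => ?_
          by_cases hyQ : y ∈ Q
          · have hmem : ψ.symm y ∈ ψ.source ∩ ψ ⁻¹' Q :=
              ⟨ψ.map_target hy.1, by rw [mem_preimage, ψ.right_inv hy.1]; exact hyQ⟩
            rw [indicator_of_mem hmem, indicator_of_mem hyQ]
            gcongr
            · exact hM y (hQK hyQ)
            · refine (ENNReal.ofReal_le_ofReal (hb φ hφ y (hQK hyQ)).2.2).trans ?_
              rw [ENNReal.ofReal_mul hC.le, ENNReal.ofReal_sum_of_nonneg fun _ _ => by positivity]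
              gcongr with I
              rw [ENNReal.ofReal_pow (norm_nonneg _), ofReal_norm_eq_enorm]
          · have hmem : ψ.symm y ∉ ψ.source ∩ ψ ⁻¹' Q := fun h => hyQ (by
              have := h.2
              rwa [mem_preimage, ψ.right_inv hy.1] at this)
            rw [indicator_of_notMem hmem]
            simp
      _ ≤ ∫⁻ y, Q.indicator (fun y => M * (Cr * ∑ I, ‖φ.comp ψ I y‖ₑ ^ 2)) y :=
          setLIntegral_le_lintegral _ _
      _ = M * Cr * ∑ I, ∫⁻ y in Q, ‖φ.comp ψ I y‖ₑ ^ 2 := by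
          rw [lintegral_indicator hQm, lintegral_const_mul' _ _ hMt,
            lintegral_const_mul' _ _ hCrt, lintegral_finsetSum' _ fun I _ => hcm I, mul_assoc]
  intro η hη
  -- the size of the grid
  set c₀ : ℝ≥0∞ := M * Cr * (Fintype.card (Fin m → Fin (2 * n)) : ℝ≥0∞) *
    (2 * 2 ^ (2 * n)) * (Cr * C₁) with hc₀
  have hc₀t : c₀ ≠ ⊤ := by
    simp only [hc₀]
    exact ENNReal.mul_ne_top (ENNReal.mul_ne_top (ENNReal.mul_ne_top (ENNReal.mul_ne_top hMt hCrt)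
      (ENNReal.natCast_ne_top _)) (by finiteness)) (ENNReal.mul_ne_top hCrt hC₁)
  obtain ⟨N, hN0, hN⟩ : ∃ N : ℕ, 0 < N ∧ c₀ * ENNReal.ofReal (L / N * √(2 * n)) ^ 2 ≤ η := by
    have h1 : Tendsto (fun N : ℕ => L / N * √(2 * n)) atTop (𝓝 0) := by
      simpa using (tendsto_const_div_atTop_nhds_zero_nat L).mul_const (√(2 * n))
    have h2 : Tendsto (fun N : ℕ => c₀ * ENNReal.ofReal (L / N * √(2 * n)) ^ 2) atTop (𝓝 0) := by
      have := ENNReal.Tendsto.const_mul (((ENNReal.continuous_pow 2).tendsto _).comp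
        (ENNReal.tendsto_ofReal h1)) (Or.inr hc₀t)
      simpa using this
    obtain ⟨N, h, hN⟩ := ((h2.eventually (ge_mem_nhds (pos_iff_ne_zero.2 hη))).and
      (eventually_gt_atTop 0)).exists
    exact ⟨N, hN, h⟩
  set cell : (Fin (2 * n) → Fin N) → Set (E n) :=
    fun κ => cube (fun i => a i + L / N * (κ i : ℕ)) (L / N) with hcell
  have hcQ : ∀ κ, cell κ ⊆ Q := fun κ => by
    rw [hQ, cube_eq_iUnion a hL hN0]
    exact subset_iUnion (fun κ : Fin (2 * n) → Fin N =>
      cube (n := n) (fun i => a i + L / N * (κ i : ℕ)) (L / N)) κ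
  have hint : ∀ φ : Form n X m, φ.SmoothOff D → ∀ I, IntegrableOn (φ.comp ψ I) Q := by
    intro φ hφ I
    refine IntegrableOn.mono_set ?_ hQK
    exact ContinuousOn.integrableOn_compact hKc fun y hy =>
      (hφ.contDiffAt hD hψ (hKD hy) I).continuousAt.continuousWithinAt
  set ind := (Fin m → Fin (2 * n)) × (Fin (2 * n) → Fin N) with hind
  -- The functionals are the integrals of the components over the cells of the grid; by
  -- Cauchy–Schwarz they are bounded in the energy norm.
  refine ⟨(Finset.univ : Finset ind).toList.map fun q φ => ∫ y in cell q.2, φ.comp ψ q.1 y,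
    M * Cr * (2 * (ENNReal.ofReal (L / N) ^ (2 * n))⁻¹), ?_, ?_, ?_⟩
  · have : (ENNReal.ofReal (L / N) ^ (2 * n))⁻¹ ≠ ⊤ := by
      simp only [ne_eq, ENNReal.inv_eq_top, pow_eq_zero_iff', ENNReal.ofReal_eq_zero, not_and_or,
        not_le]
      exact Or.inl (by positivity)
    exact ENNReal.mul_ne_top (ENNReal.mul_ne_top hMt hCrt) (ENNReal.mul_ne_top (by simp) this)
  · intro ℓ hℓ
    obtain ⟨q, -, rfl⟩ := List.mem_map.1 hℓ
    refine ⟨fun φ φ' hφ hφ' => ?_, volume (cell q.2) * (Cr * C₁), ?_, fun φ hφ => ?_⟩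
    · exact integral_sub ((hint φ hφ q.1).mono_set (hcQ q.2)) ((hint φ' hφ' q.1).mono_set (hcQ q.2))
    · refine ENNReal.mul_ne_top ?_ (ENNReal.mul_ne_top hCrt hC₁)
      simp only [hcell, volume_cube]
      finiteness
    · refine (pow_le_pow_left' (enorm_integral_le_lintegral_enorm _) 2).trans ?_
      refine (sq_lintegral_le _
        ((hint φ hφ q.1).mono_set (hcQ q.2)).aestronglyMeasurable.enorm).trans ?_
      rw [Measure.restrict_apply .univ, univ_inter, mul_assoc, mul_assoc]
      gcongr
      exact (lintegral_mono_set (hcQ q.2)).trans (hcomp φ hφ q.1)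
  · intro φ hφ
    refine (hnorm φ hφ).trans ?_
    rw [List.map_map, Finset.sum_map_toList]
    calc M * Cr * ∑ I, ∫⁻ y in Q, ‖φ.comp ψ I y‖ₑ ^ 2
        ≤ M * Cr * ∑ I, (∑ κ, 2 * (ENNReal.ofReal (L / N) ^ (2 * n))⁻¹ *
            ‖∫ y in cell κ, φ.comp ψ I y‖ₑ ^ 2 +
            2 * 2 ^ (2 * n) * ENNReal.ofReal (L / N * √(2 * n)) ^ 2 *
              (Cr * (C₁ * energy D g φ))) := by
          gcongr with I
          refine (lintegral_cube_le_grid hL hN0 (fun y hy => ((hφ.contDiffAt hD hψ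
            (hKD (hQK hy)) I)).of_le (by simp)) (hint φ hφ I)).trans ?_
          gcongr
          exact hder φ hφ I
      _ = M * Cr * (2 * (ENNReal.ofReal (L / N) ^ (2 * n))⁻¹) *
            ∑ q : ind, ‖∫ y in cell q.2, φ.comp ψ q.1 y‖ₑ ^ 2 +
          c₀ * ENNReal.ofReal (L / N * √(2 * n)) ^ 2 * energy D g φ := by
          rw [Finset.sum_add_distrib, Finset.sum_const, Finset.card_univ, nsmul_eq_mul,
            Fintype.sum_prod_type]
          simp only [← Finset.mul_sum]
          rw [hc₀]
          ring
      _ ≤ _ := by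
          gcongr
          exact le_rfl

/-- On compact subsets of `X \ D`, finitely many functionals control the `L²` norm. -/
theorem normCompactOn_of_isCompact (hK : IsKahlerOff D g J) (hD : IsClosed D) {K : Set X}
    (hKc : IsCompact K) (hKD : K ⊆ Dᶜ) : NormCompactOn D g m K := by
  refine hKc.induction_on normCompactOn_empty (fun s t h ht => ht.mono h)
    (fun s t hs ht => hs.union ht) fun x hx => ?_
  set ψ := chartAt (E n) x with hψ
  have hy := chartAt_mem_chartDom (n := n) (hKD hx)
  obtain ⟨R, hR, hball⟩ := Metric.nhds_basis_closedBall.mem_iff.1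
    ((isOpen_chartDom hD ψ).mem_nhds hy)
  -- Chosen so that the cube of side `L` centred at `ψ x` lies in the closed ball of radius `R`. The
  -- summand `1` keeps the denominator positive when `n = 0`.
  set L : ℝ := R / (1 + √(2 * n)) with hL
  have hL0 : 0 < L := by positivity
  have hLR : L * √(2 * n) ≤ R := by
    rw [hL, div_mul_eq_mul_div, div_le_iff₀ (by positivity)]
    nlinarith [Real.sqrt_nonneg (2 * (n : ℝ))]
  have hcube := normCompactOn_cube (m := m) hK hD (chart_mem_atlas (E n) x)
    (isCompact_closedBall _ _) hball (a := fun i => ψ x i - L / 2) hL0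
    (closure_cube_subset hL0.le (fun _ => rfl) hLR)
  refine ⟨_, mem_nhdsWithin_of_mem_nhds ?_, hcube⟩
  refine Filter.inter_mem (chart_source_mem_nhds _ _) ?_
  refine (ψ.continuousAt (mem_chart_source _ _)).preimage_mem_nhds ?_
  exact mem_of_superset (Metric.ball_mem_nhds _ (half_pos hL0)) (ball_subset_cube fun _ => rfl)

end Interior

/-! ### Polar maps -/

section Hadamard

variable {W F : Type*} [NormedAddCommGroup W] [NormedSpace ℝ W] [NormedAddCommGroup F]
  [NormedSpace ℝ F]

lemma uniqueDiffOn_prod_Ico {A : Set W} (hA : IsOpen A) (ε : ℝ) :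
    UniqueDiffOn ℝ (A ×ˢ Ico (0 : ℝ) ε) := hA.uniqueDiffOn.prod (uniqueDiffOn_Ico 0 ε)

/-- The difference quotient at the boundary of a half space converges to the derivative. -/
lemma tendsto_inv_smul_of_contDiffOn {A : Set W} (hA : IsOpen A) {ε : ℝ} (hε : 0 < ε)
    {G : W × ℝ → F} (hG : ContDiffOn ℝ 1 G (A ×ˢ Ico 0 ε)) (h0 : ∀ a ∈ A, G (a, 0) = 0) {a₀ : W}
    (ha₀ : a₀ ∈ A) :
    Tendsto (fun q : W × ℝ => q.2⁻¹ • G q) (𝓝 a₀ ×ˢ 𝓝[>] 0)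
      (𝓝 (fderivWithin ℝ G (A ×ˢ Ico 0 ε) (a₀, 0) (0, 1))) := by
  set Ω := A ×ˢ Ico (0 : ℝ) ε with hΩ
  have hU := uniqueDiffOn_prod_Ico hA ε
  have hq₀ : (a₀, (0 : ℝ)) ∈ Ω := ⟨ha₀, le_rfl, hε⟩
  set L := fderivWithin ℝ G Ω (a₀, 0) with hL
  have hc : ContinuousWithinAt (fderivWithin ℝ G Ω) Ω (a₀, 0) :=
    (hG.continuousOn_fderivWithin hU le_rfl) _ hq₀
  rw [Metric.tendsto_nhds]
  intro e he
  obtain ⟨δ, hδ, hb⟩ := Metric.continuousWithinAt_iff.1 hc (e / 2) (half_pos he)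
  obtain ⟨δ', hδ', hA'⟩ := Metric.isOpen_iff.1 hA a₀ ha₀
  set r := min (min δ δ') ε with hr
  have hr0 : 0 < r := lt_min (lt_min hδ hδ') hε
  have hrδ : r ≤ δ := (min_le_left _ _).trans (min_le_left _ _)
  set s := Metric.ball a₀ r ×ˢ Ico (0 : ℝ) r with hs
  have hsΩ : s ⊆ Ω := prod_mono ((Metric.ball_subset_ball
    ((min_le_left _ _).trans (min_le_right _ _))).trans hA') (Ico_subset_Ico_right (min_le_right _ _))
  have hsc : Convex ℝ s := (convex_ball _ _).prod (convex_Ico _ _)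
  have key : ∀ a ∈ Metric.ball a₀ r, ∀ ρ ∈ Ioo (0 : ℝ) r, dist (ρ⁻¹ • G (a, ρ)) (L (0, 1)) < e := by
    intro a ha ρ hρ
    have ha0 : (a, (0 : ℝ)) ∈ s := ⟨ha, le_rfl, hr0⟩
    have haρ : (a, ρ) ∈ s := ⟨ha, hρ.1.le, hρ.2⟩
    -- The mean value inequality for `G - L` on a convex set that reaches the boundary `ρ = 0`,
    -- where the derivative stays within `e / 2` of `L`.
    have h := hsc.norm_image_sub_le_of_norm_hasFDerivWithin_le' (f := G)
      (f' := fderivWithin ℝ G Ω) (φ := L) (C := e / 2)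
      (fun x hx => ((hG.differentiableOn one_ne_zero x (hsΩ hx)).hasFDerivWithinAt).mono hsΩ)
      (fun x hx => ?_) ha0 haρ
    · have e1 : (a, ρ) - (a, (0 : ℝ)) = ρ • ((0 : W), (1 : ℝ)) := by simp
      rw [h0 a (hsΩ ha0).1, e1, map_smul, sub_zero, norm_smul, Prod.norm_mk, norm_zero, norm_one,
        max_eq_right zero_le_one, mul_one, Real.norm_of_nonneg hρ.1.le] at h
      rw [dist_eq_norm]
      have e2 : ρ⁻¹ • G (a, ρ) - L (0, 1) = ρ⁻¹ • (G (a, ρ) - ρ • L (0, 1)) := by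
        rw [smul_sub, inv_smul_smul₀ hρ.1.ne']
      rw [e2, norm_smul, norm_inv, Real.norm_of_nonneg hρ.1.le, inv_mul_lt_iff₀ hρ.1]
      have : 0 < ρ * (e / 2) := mul_pos hρ.1 (half_pos he)
      nlinarith
    · rw [← dist_eq_norm]
      refine (hb (hsΩ hx) ?_).le
      rw [Prod.dist_eq, max_lt_iff]
      refine ⟨(Metric.mem_ball.1 hx.1).trans_le hrδ, ?_⟩
      rw [Real.dist_eq, sub_zero, abs_of_nonneg hx.2.1]
      exact hx.2.2.trans_le hrδ
  filter_upwards [prod_mem_prod (Metric.ball_mem_nhds a₀ hr0) (Ioo_mem_nhdsGT hr0)] with q hq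
  exact key q.1 hq.1 q.2 hq.2

lemma tendsto_smulRight {ι : Type*} {l : Filter ι} {f : ι → W →L[ℝ] ℝ} {v : ι → F}
    {f₀ : W →L[ℝ] ℝ} {v₀ : F} (hf : Tendsto f l (𝓝 f₀)) (hv : Tendsto v l (𝓝 v₀)) :
    Tendsto (fun i => (f i).smulRight (v i)) l (𝓝 (f₀.smulRight v₀)) :=
  ((ContinuousLinearMap.smulRightL ℝ W F).isBoundedBilinearMap.continuous.tendsto (f₀, v₀)).comp
    (hf.prodMk_nhds hv)

end Hadamard

/-! ### Jacobians of polar parametrizations near the base -/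

section PolarMap

variable {V' V'' : Type*} [NormedAddCommGroup V'] [NormedSpace ℝ V'] [FiniteDimensional ℝ V']
  [NormedAddCommGroup V''] [InnerProductSpace ℝ V''] [FiniteDimensional ℝ V'']

/-- A map, homogeneous of degree zero, that takes each vector to a positive multiple of itself. -/
lemma eq_zero_of_homogeneous_id {h : V'' → V''} {h' : V'' →L[ℝ] V''} {θ : V''} (hθ : ‖θ‖ = 1)
    (hh : HasFDerivAt h h' θ) (hpos : ∀ y, y ≠ 0 → ∃ c : ℝ, 0 < c ∧ h y = c • y)
    (hhom : ∀ y, ∀ r : ℝ, 0 < r → h (r • y) = h y) {η : V''}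
    (hη : h' η + (inner ℝ θ η : ℝ) • h θ = 0) : η = 0 := by
  have hθ0 : θ ≠ 0 := fun h => by simp [h] at hθ
  obtain ⟨c, hc, hhθ⟩ := hpos θ hθ0
  -- This identity expresses that `h y` is parallel to `y` in a form that can be differentiated.
  have hid : ∀ y, (inner ℝ y y : ℝ) • h y = (inner ℝ (h y) y : ℝ) • y := by
    intro y
    by_cases hy : y = 0
    · simp [hy]
    obtain ⟨d, -, hd⟩ := hpos y hy
    rw [hd, inner_smul_left, smul_smul, mul_comm]
    rfl
  have hi : HasFDerivAt (id : V'' → V'') (ContinuousLinearMap.id ℝ V'') θ := hasFDerivAt_id θ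
  have d1 := ((hi.inner ℝ hi).smul hh)
  have d2 := ((hh.inner ℝ hi).smul hi)
  have e := d1.unique (d2.congr_of_eventuallyEq (Eventually.of_forall fun y => hid y))
  have e' := congrArg (fun L => L η) e
  have hθθ : (inner ℝ θ θ : ℝ) = 1 := by rw [real_inner_self_eq_norm_sq, hθ]; norm_num
  set l : ℝ := inner ℝ θ η with hl
  have hl' : (inner ℝ η θ : ℝ) = l := real_inner_comm _ _
  have hh'η : h' η = -(c * l) • θ := by
    rw [hhθ, smul_smul] at hη
    rw [eq_neg_of_add_eq_zero_left hη, neg_smul, mul_comm]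
  simp only [ContinuousLinearMap.add_apply, ContinuousLinearMap.smul_apply,
    ContinuousLinearMap.smulRight_apply, fderivInnerCLM_apply, ContinuousLinearMap.comp_apply,
    ContinuousLinearMap.prod_apply, ContinuousLinearMap.id_apply, id, hhθ, hh'η, hθθ, ← hl, hl',
    inner_smul_left, map_neg, RCLike.conj_to_real] at e'
  -- Put `h θ = c θ` and `l = ⟨θ, η⟩`. The hypothesis gives `h' η = -c l θ`, and the differentiated
  -- identity then shows that `η` is radial.
  have e3 : (c * l) • θ = c • η := by
    have : c • η - (c * l) • θ = 0 := by
      linear_combination (norm := module) -e'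
    exact (sub_eq_zero.1 this).symm
  have e4 : η = l • θ := by
    rw [mul_smul] at e3
    exact (smul_right_injective V'' hc.ne' e3).symm
  -- Homogeneity of degree zero makes the radial derivative vanish. Thus `h' η = 0` for the radial
  -- vector `η`, which forces `c l = 0` and so `l = 0`.
  have e5 : h' θ = 0 := by
    have hline : HasDerivAt (fun s : ℝ => h (θ + s • θ)) (h' θ) 0 := by
      have hg : HasDerivAt (fun s : ℝ => θ + s • θ) θ 0 := by
        simpa using ((hasDerivAt_id (0 : ℝ)).smul_const θ).const_add θ
      have hh0 : HasFDerivAt h h' (θ + (0 : ℝ) • θ) := by simpa using hh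
      exact hh0.comp_hasDerivAt 0 hg
    have hconst : (fun s : ℝ => h (θ + s • θ)) =ᶠ[𝓝 0] fun _ => h θ := by
      filter_upwards [lt_mem_nhds (show (-1 : ℝ) < 0 by norm_num)] with s hs
      have : θ + s • θ = (1 + s) • θ := by module
      rw [this, hhom θ _ (by linarith)]
    exact hline.unique ((hasDerivAt_const (0 : ℝ) (h θ)).congr_of_eventuallyEq hconst)
  rw [e4, map_smul, e5, smul_zero] at hh'η
  have : c * l = 0 := by
    by_contra hne
    exact hθ0 ((smul_eq_zero.1 (by rw [hh'η.symm] : (-(c * l)) • θ = 0)).resolve_left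
      (neg_ne_zero.2 hne))
  rw [e4, (mul_eq_zero.1 this).resolve_left hc.ne', zero_smul]

/-- Composition with `Q⁻¹` reduces to `eq_zero_of_homogeneous_id`. The expression assumed to vanish
is the derivative of `y ↦ ‖y‖ h y` at `θ` in the direction `η`. -/
lemma eq_zero_of_homogeneous {h : V'' → V''} {h' : V'' →L[ℝ] V''} {θ : V''} (hθ : ‖θ‖ = 1)
    {Q : V'' →L[ℝ] V''} (hQ : Function.Injective Q)
    (hh : HasFDerivAt h h' θ) (hpos : ∀ y, y ≠ 0 → ∃ c : ℝ, 0 < c ∧ h y = c • Q y)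
    (hhom : ∀ y, ∀ r : ℝ, 0 < r → h (r • y) = h y) {η : V''}
    (hη : h' η + (inner ℝ θ η : ℝ) • h θ = 0) : η = 0 := by
  set e := (LinearEquiv.ofInjectiveEndo (Q : V'' →ₗ[ℝ] V'') hQ).toContinuousLinearEquiv with he
  have heQ : ∀ y, e.symm (Q y) = y := fun y => e.symm_apply_apply y
  refine eq_zero_of_homogeneous_id hθ (h := fun y => e.symm (h y))
    (h' := (e.symm : V'' →L[ℝ] V'') ∘L h') ((e.symm : V'' →L[ℝ] V'').hasFDerivAt.comp θ hh)
    (fun y hy => ?_) (fun y r hr => by rw [hhom y r hr]) (η := η) ?_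
  · obtain ⟨c, hc, hcy⟩ := hpos y hy
    exact ⟨c, hc, by rw [hcy, map_smul, heQ]⟩
  · have := congrArg e.symm hη
    rw [map_add, map_smul, map_zero] at this
    exact this

/-- The domain of a polar parametrization. -/
def polarDomain (N : Set V') (ε : ℝ) : Set ((V' × V'') × ℝ) := (N ×ˢ {0}ᶜ) ×ˢ Ico 0 ε

/-- A polar parametrization `Z ((x, y), ρ)` of a neighbourhood of `V' × 0`; it depends only on the
direction of `y`. -/
structure IsPolarParam (N : Set V') (ε : ℝ) (Z : (V' × V'') × ℝ → V' × V'')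
    (Q : V' → V'' →L[ℝ] V'') : Prop where
  isOpen : IsOpen N
  eps_pos : 0 < ε
  smooth : ContDiffOn ℝ 2 Z (polarDomain N ε)
  zero : ∀ x ∈ N, ∀ y, y ≠ 0 → Z ((x, y), 0) = (x, 0)
  hom : ∀ x y, ∀ r : ℝ, 0 < r → ∀ ρ, Z ((x, r • y), ρ) = Z ((x, y), ρ)
  injective : ∀ x ∈ N, Function.Injective (Q x)
  radial : ∀ x ∈ N, ∀ y, y ≠ 0 → ∃ c : ℝ, 0 < c ∧
    (fderivWithin ℝ Z (polarDomain N ε) ((x, y), 0) (0, 1)).2 = c • Q x y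

/-- The map `(x, y) ↦ Z ((x, y), ‖y‖)`. -/
def polarMap (Z : (V' × V'') × ℝ → V' × V'') (w : V' × V'') : V' × V'' := Z (w, ‖w.2‖)

variable (V' V'') in
/-- The inclusion `(ξ, η) ↦ ((ξ, 0), 0)`. -/
def inclBase : (V' × V'') →L[ℝ] (V' × V'') × ℝ :=
  ((ContinuousLinearMap.fst ℝ V' V'').prod 0).prod 0

variable (V' V'') in
/-- The inclusion `(ξ, η) ↦ ((0, η), 0)`. -/
def inclNormal : (V' × V'') →L[ℝ] (V' × V'') × ℝ :=
  ((0 : (V' × V'') →L[ℝ] V').prod (ContinuousLinearMap.snd ℝ V' V'')).prod 0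

/-- The derivative of `polarMap Z` at `(x, ρ θ)`, for a unit vector `θ`. -/
def polarDeriv (Z : (V' × V'') × ℝ → V' × V'') (Ω : Set ((V' × V'') × ℝ)) (q : (V' × V'') × ℝ) :
    (V' × V'') →L[ℝ] (V' × V'') :=
  (fderivWithin ℝ Z Ω q ∘L inclBase V' V'' + q.2⁻¹ • (fderivWithin ℝ Z Ω q ∘L inclNormal V' V'')) +
    ((innerSL ℝ q.1.2) ∘L ContinuousLinearMap.snd ℝ V' V'').smulRight (fderivWithin ℝ Z Ω q (0, 1))

variable {N : Set V'} {ε : ℝ} {Z : (V' × V'') × ℝ → V' × V''} {Q : V' → V'' →L[ℝ] V''}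

namespace IsPolarParam

lemma isOpen_base (hZ : IsPolarParam N ε Z Q) : IsOpen (N ×ˢ ({0}ᶜ : Set V'')) :=
  hZ.isOpen.prod isOpen_compl_singleton

lemma uniqueDiffOn (hZ : IsPolarParam N ε Z Q) : UniqueDiffOn ℝ (polarDomain (V'' := V'') N ε) :=
  uniqueDiffOn_prod_Ico hZ.isOpen_base ε

lemma mem_domain (hZ : IsPolarParam N ε Z Q) {w : V' × V''} (hw : w ∈ N ×ˢ ({0}ᶜ : Set V'')) :
    (w, (0 : ℝ)) ∈ polarDomain N ε := ⟨hw, le_rfl, hZ.eps_pos⟩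

lemma hasFDerivWithinAt (hZ : IsPolarParam N ε Z Q) {q : (V' × V'') × ℝ}
    (hq : q ∈ polarDomain N ε) :
    HasFDerivWithinAt Z (fderivWithin ℝ Z (polarDomain N ε) q) (polarDomain N ε) q :=
  (hZ.smooth.differentiableOn two_ne_zero q hq).hasFDerivWithinAt

/-- Obtained by differentiating `Z ((x, y), 0) = (x, 0)`. In particular the derivative in `y`
vanishes at `ρ = 0`, which makes the term divided by `ρ` in `polarDeriv` converge. -/
lemma fderivWithin_base (hZ : IsPolarParam N ε Z Q) {w : V' × V''}
    (hw : w ∈ N ×ˢ ({0}ᶜ : Set V'')) (v : V' × V'') :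
    fderivWithin ℝ Z (polarDomain N ε) (w, 0) (v, 0) = (v.1, 0) := by
  have hA := hZ.isOpen_base.mem_nhds hw
  have h1 : HasFDerivWithinAt (fun w : V' × V'' => Z (w, 0))
      (fderivWithin ℝ Z (polarDomain N ε) (w, 0) ∘L ContinuousLinearMap.inl ℝ (V' × V'') ℝ)
      (N ×ˢ {0}ᶜ) w :=
    HasFDerivWithinAt.comp (f := fun w : V' × V'' => (w, (0 : ℝ))) w
      (hZ.hasFDerivWithinAt (hZ.mem_domain hw))
      ((ContinuousLinearMap.inl ℝ (V' × V'') ℝ).hasFDerivAt.hasFDerivWithinAt)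
      (fun w hw => hZ.mem_domain hw)
  have h2 : HasFDerivAt (fun w : V' × V'' => ((w.1, 0) : V' × V''))
      ((ContinuousLinearMap.fst ℝ V' V'').prod 0) w :=
    ((ContinuousLinearMap.fst ℝ V' V'').prod (0 : (V' × V'') →L[ℝ] V'')).hasFDerivAt
  have h3 : (fun w : V' × V'' => Z (w, 0)) =ᶠ[𝓝 w] fun w => ((w.1, 0) : V' × V'') := by
    filter_upwards [hA] with w hw
    exact hZ.zero w.1 hw.1 w.2 hw.2
  have h4 := (h1.hasFDerivAt hA).unique (h2.congr_of_eventuallyEq h3)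
  exact congrArg (fun L => L v) h4

lemma hasDerivWithinAt_radial (hZ : IsPolarParam N ε Z Q) {w : V' × V''}
    (hw : w ∈ N ×ˢ ({0}ᶜ : Set V'')) :
    HasDerivWithinAt (fun ρ => Z (w, ρ)) (fderivWithin ℝ Z (polarDomain N ε) (w, 0) (0, 1))
      (Ico 0 ε) 0 := by
  refine HasFDerivWithinAt.comp_hasDerivWithinAt (f := fun ρ : ℝ => (w, ρ)) (0 : ℝ)
    (hZ.hasFDerivWithinAt (hZ.mem_domain hw)) ?_ (fun ρ hρ => ⟨hw, hρ⟩)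
  exact (hasDerivWithinAt_const (0 : ℝ) _ w).prodMk (hasDerivWithinAt_id (0 : ℝ) _)

lemma radial_hom (hZ : IsPolarParam N ε Z Q) {x : V'} (hx : x ∈ N) (y : V'') {r : ℝ} (hr : 0 < r) :
    fderivWithin ℝ Z (polarDomain N ε) ((x, r • y), 0) (0, 1) =
      fderivWithin ℝ Z (polarDomain N ε) ((x, y), 0) (0, 1) := by
  by_cases hy : y = 0
  · simp [hy]
  have h1 := hZ.hasDerivWithinAt_radial (w := (x, r • y)) ⟨hx, smul_ne_zero hr.ne' hy⟩
  have h2 := hZ.hasDerivWithinAt_radial (w := (x, y)) ⟨hx, hy⟩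
  have h3 : (fun ρ => Z ((x, r • y), ρ)) = fun ρ => Z ((x, y), ρ) :=
    funext fun ρ => hZ.hom x y r hr ρ
  rw [h3] at h1
  exact ((uniqueDiffOn_Ico 0 ε) 0 ⟨le_rfl, hZ.eps_pos⟩).eq_deriv _ h1 h2

lemma hasFDerivAt_norm_smul {θ : V''} (hθ : ‖θ‖ = 1) {ρ : ℝ} (hρ : 0 < ρ) :
    HasFDerivAt (fun y : V'' => ‖y‖) (innerSL ℝ θ) (ρ • θ) := by
  have h := ((hasFDerivAt_id (ρ • θ)).norm_sq).sqrt (by simp [norm_smul, hθ, hρ.ne'])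
  simp only [id, Real.sqrt_sq (norm_nonneg _)] at h
  refine h.congr_fderiv ?_
  ext η
  simp only [norm_smul, hθ, Real.norm_of_nonneg hρ.le, map_smul]
  simp
  field_simp

/-- As `Z` depends only on the direction of `y`, its argument may be rescaled by the fixed factor
`ρ⁻¹`. The derivative of `Z` is then taken at a unit vector, and the directions in `V''` acquire a
factor `ρ⁻¹`. -/
lemma hasFDerivAt_polarMap (hZ : IsPolarParam N ε Z Q) {x : V'} {θ : V''} {ρ : ℝ} (hx : x ∈ N)
    (hθ : ‖θ‖ = 1) (hρ : ρ ∈ Ioo 0 ε) :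
    HasFDerivAt (polarMap Z) (polarDeriv Z (polarDomain N ε) ((x, θ), ρ)) (x, ρ • θ) := by
  have hθ0 : θ ≠ 0 := fun h => by simp [h] at hθ
  set Ω := polarDomain (V'' := V'') N ε with hΩ
  have hq : ((x, θ), ρ) ∈ Ω := ⟨⟨hx, hθ0⟩, hρ.1.le, hρ.2⟩
  have hn : Ω ∈ 𝓝 ((x, θ), ρ) :=
    prod_mem_nhds (hZ.isOpen_base.mem_nhds ⟨hx, hθ0⟩) (Ico_mem_nhds hρ.1 hρ.2)
  have hD : HasFDerivAt Z (fderivWithin ℝ Z Ω ((x, θ), ρ)) ((x, θ), ρ) :=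
    (hZ.hasFDerivWithinAt hq).hasFDerivAt hn
  set k : V' × V'' → (V' × V'') × ℝ := fun w => ((w.1, ρ⁻¹ • w.2), ‖w.2‖) with hk
  have hk0 : k (x, ρ • θ) = ((x, θ), ρ) := by
    simp [hk, inv_smul_smul₀ hρ.1.ne', norm_smul, hθ, abs_of_pos hρ.1]
  have hfst : HasFDerivAt (fun w : V' × V'' => w.1) (ContinuousLinearMap.fst ℝ V' V'') (x, ρ • θ) :=
    hasFDerivAt_fst
  have hsnd : HasFDerivAt (fun w : V' × V'' => w.2) (ContinuousLinearMap.snd ℝ V' V'') (x, ρ • θ) :=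
    hasFDerivAt_snd
  have hnorm : HasFDerivAt (fun w : V' × V'' => ‖w.2‖)
      (innerSL ℝ θ ∘L ContinuousLinearMap.snd ℝ V' V'') (x, ρ • θ) :=
    (hasFDerivAt_norm_smul hθ hρ.1).comp (x, ρ • θ) hsnd
  have hk' := (hfst.prodMk (hsnd.const_smul ρ⁻¹)).prodMk hnorm
  have hcomp : HasFDerivAt (Z ∘ k) _ (x, ρ • θ) :=
    HasFDerivAt.comp (g := Z) (x, ρ • θ) (by rw [hk0]; exact hD) hk'
  have heq : polarMap Z = Z ∘ k := by
    funext w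
    simp only [polarMap, Function.comp, hk]
    rw [hZ.hom w.1 w.2 ρ⁻¹ (inv_pos.2 hρ.1)]
  rw [heq]
  refine hcomp.congr_fderiv ?_
  refine ContinuousLinearMap.ext fun v => ?_
  have hsplit : (((v.1, ρ⁻¹ • v.2), (inner ℝ θ v.2 : ℝ)) : (V' × V'') × ℝ) =
      inclBase V' V'' v + ρ⁻¹ • inclNormal V' V'' v + (inner ℝ θ v.2 : ℝ) • (0, 1) := by
    simp [inclBase, inclNormal]
  have : (fderivWithin ℝ Z Ω ((x, θ), ρ)) ((v.1, ρ⁻¹ • v.2), (inner ℝ θ v.2 : ℝ)) =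
      polarDeriv Z Ω ((x, θ), ρ) v := by
    rw [hsplit, map_add, map_add, map_smul, map_smul]
    rfl
  exact this

lemma nhds_prod_nhdsGT_le (hZ : IsPolarParam N ε Z Q) {w : V' × V''}
    (hw : w ∈ N ×ˢ ({0}ᶜ : Set V'')) :
    𝓝 w ×ˢ 𝓝[>] (0 : ℝ) ≤ 𝓝[polarDomain N ε] (w, 0) := by
  rw [polarDomain, nhdsWithin_prod_eq, hZ.isOpen_base.nhdsWithin_eq hw,
    ← nhdsWithin_Ioo_eq_nhdsGT hZ.eps_pos]
  exact Filter.prod_mono le_rfl (nhdsWithin_mono _ Ioo_subset_Ico_self)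

set_option synthInstance.maxHeartbeats 400000 in
set_option maxHeartbeats 1000000 in
/-- The derivative of a polar map converges to an isomorphism as `ρ → 0`. -/
lemma exists_tendsto_polarDeriv (hZ : IsPolarParam N ε Z Q) {x₀ : V'} {θ₀ : V''} (hx₀ : x₀ ∈ N)
    (hθ₀ : ‖θ₀‖ = 1) : ∃ L : (V' × V'') →L[ℝ] (V' × V''), Function.Injective L ∧
      Tendsto (polarDeriv Z (polarDomain N ε)) (𝓝 (x₀, θ₀) ×ˢ 𝓝[>] (0 : ℝ)) (𝓝 L) := by
  have hθ0 : θ₀ ≠ 0 := fun h => by simp [h] at hθ₀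
  set Ω := polarDomain (V'' := V'') N ε with hΩ
  have hU : UniqueDiffOn ℝ Ω := hZ.uniqueDiffOn
  have hw : (x₀, θ₀) ∈ N ×ˢ ({0}ᶜ : Set V'') := ⟨hx₀, hθ0⟩
  have hq := hZ.mem_domain hw
  set DZ := fderivWithin ℝ Z Ω with hDZ
  -- `G` is the part of the derivative in the directions of `V''`. It vanishes at `ρ = 0`, so `ρ⁻¹
  -- G` tends to the mixed second derivative of `Z` there.
  set G : (V' × V'') × ℝ → (V' × V'') →L[ℝ] (V' × V'') := fun q => DZ q ∘L inclNormal V' V'' with hG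
  have hDZc : ContDiffOn ℝ 1 DZ Ω := hZ.smooth.fderivWithin hU (by norm_num)
  have hGc : ContDiffOn ℝ 1 G Ω := hDZc.clm_comp contDiffOn_const
  have hG0 : ∀ a ∈ N ×ˢ ({0}ᶜ : Set V''), G (a, 0) = 0 := fun a ha => by
    refine ContinuousLinearMap.ext fun v => ?_
    exact (hZ.fderivWithin_base ha (0, v.2)).trans rfl
  have hle := hZ.nhds_prod_nhdsGT_le hw
  have t1 : Tendsto DZ (𝓝 (x₀, θ₀) ×ˢ 𝓝[>] (0 : ℝ)) (𝓝 (DZ ((x₀, θ₀), 0))) :=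
    (hDZc.continuousOn _ hq).tendsto.mono_left hle
  have t2 := tendsto_inv_smul_of_contDiffOn hZ.isOpen_base hZ.eps_pos hGc hG0 hw
  set D2 := fderivWithin ℝ DZ Ω ((x₀, θ₀), 0) with hD2
  have hD2' : HasFDerivWithinAt DZ D2 Ω ((x₀, θ₀), 0) :=
    (hDZc.differentiableOn one_ne_zero _ hq).hasFDerivWithinAt
  set G1 := fderivWithin ℝ G Ω ((x₀, θ₀), 0) (0, 1) with hG1
  -- By symmetry of second derivatives, valid at this boundary point, the limit is the derivative of
  -- the initial velocity `∂_ρ Z` with respect to the direction `y`.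
  have hG1' : ∀ v, G1 v = D2 (inclNormal V' V'' v) (0, 1) := by
    intro v
    have h1 : HasFDerivWithinAt G
        (((ContinuousLinearMap.compL ℝ (V' × V'') ((V' × V'') × ℝ) (V' × V'')).flip
          (inclNormal V' V'')) ∘L D2) Ω ((x₀, θ₀), 0) :=
      ((ContinuousLinearMap.compL ℝ (V' × V'') ((V' × V'') × ℝ) (V' × V'')).flip
        (inclNormal V' V'')).hasFDerivAt.comp_hasFDerivWithinAt _ hD2'
    rw [hG1, h1.fderivWithin (hU _ hq)]
    have hsymm : IsSymmSndFDerivWithinAt ℝ Z Ω ((x₀, θ₀), 0) := by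
      refine (hZ.smooth _ hq).isSymmSndFDerivWithinAt (by simp) hU ?_ hq
      rw [polarDomain, interior_prod_eq, hZ.isOpen_base.interior_eq, interior_Ico,
        closure_prod_eq, closure_Ioo hZ.eps_pos.ne]
      exact ⟨subset_closure hw, le_rfl, hZ.eps_pos.le⟩
    exact hsymm (0, 1) (inclNormal V' V'' v)
  refine ⟨(DZ ((x₀, θ₀), 0) ∘L inclBase V' V'' + G1) +
    ((innerSL ℝ θ₀) ∘L ContinuousLinearMap.snd ℝ V' V'').smulRight (DZ ((x₀, θ₀), 0) (0, 1)),
    ?_, ?_⟩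
  -- For a kernel vector `(ξ, η)` the normal component involves only `η`, and
  -- `eq_zero_of_homogeneous` applies to the normal part of the initial velocity. With `η = 0` the
  -- tangential component is `ξ`.
  · rw [injective_iff_map_eq_zero]
    rintro ⟨ξ, η⟩ hv
    have hb : DZ ((x₀, θ₀), 0) (inclBase V' V'' (ξ, η)) = (ξ, 0) :=
      (hZ.fderivWithin_base hw (ξ, 0)).trans rfl
    have hv' : DZ ((x₀, θ₀), 0) (inclBase V' V'' (ξ, η)) + G1 (ξ, η) +
        (inner ℝ θ₀ η : ℝ) • DZ ((x₀, θ₀), 0) (0, 1) = 0 := hv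
    rw [hb] at hv'
    have hη : η = 0 := by
      refine eq_zero_of_homogeneous hθ₀ (hZ.injective x₀ hx₀)
        (h := fun y => (DZ ((x₀, y), 0) (0, 1)).2)
        (h' := ContinuousLinearMap.snd ℝ V' V'' ∘L
          ((ContinuousLinearMap.apply ℝ (V' × V'') (((0 : V' × V''), (1 : ℝ)))) ∘L
            (D2 ∘L (ContinuousLinearMap.inl ℝ (V' × V'') ℝ ∘L
              ContinuousLinearMap.inr ℝ V' V'')))) ?_
        (fun y hy => hZ.radial x₀ hx₀ y hy) (fun y r hr => by
          simp only [hDZ]; rw [hZ.radial_hom hx₀ y hr]) (η := η) ?_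
      · have h1 : HasFDerivAt (fun y : V'' => (((x₀, y), 0) : (V' × V'') × ℝ))
            (ContinuousLinearMap.inl ℝ (V' × V'') ℝ ∘L ContinuousLinearMap.inr ℝ V' V'') θ₀ :=
          (((hasFDerivAt_const x₀ θ₀).prodMk (hasFDerivAt_id θ₀)).prodMk
            (hasFDerivAt_const (0 : ℝ) θ₀)).congr_fderiv rfl
        have h2 : HasFDerivWithinAt (fun y : V'' => DZ ((x₀, y), 0)) _ {0}ᶜ θ₀ :=
          HasFDerivWithinAt.comp (g := DZ) (t := Ω)
            (f := fun y : V'' => (((x₀, y), 0) : (V' × V'') × ℝ)) θ₀ hD2'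
            h1.hasFDerivWithinAt (fun y hy => hZ.mem_domain ⟨hx₀, hy⟩)
        have h3 := h2.hasFDerivAt (isOpen_compl_singleton.mem_nhds hθ0)
        exact (ContinuousLinearMap.snd ℝ V' V'').hasFDerivAt.comp θ₀
          ((ContinuousLinearMap.apply ℝ (V' × V'')
            (((0 : V' × V''), (1 : ℝ)))).hasFDerivAt.comp θ₀ h3)
      · have h2 := congrArg Prod.snd hv'
        rw [hG1'] at h2
        simpa [inclNormal] using h2
    have h1 := congrArg Prod.fst hv'
    rw [hG1', hη] at h1
    have hz : inclNormal V' V'' (ξ, 0) = 0 := by simp [inclNormal]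
    rw [hz] at h1
    have hξ : ξ = 0 := by simpa using h1
    rw [hξ, hη]; rfl
  · refine Tendsto.add (Tendsto.add ?_ t2) ?_
    · exact ((ContinuousLinearMap.compL ℝ (V' × V'') ((V' × V'') × ℝ) (V' × V'')).flip
        (inclBase V' V'')).continuous.continuousAt.tendsto.comp t1
    · have c1 : Tendsto (fun q : (V' × V'') × ℝ => innerSL ℝ q.1.2 ∘L
          ContinuousLinearMap.snd ℝ V' V'') (𝓝 (x₀, θ₀) ×ˢ 𝓝[>] (0 : ℝ))
          (𝓝 (innerSL ℝ θ₀ ∘L ContinuousLinearMap.snd ℝ V' V'')) := by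
        have : Continuous fun w : V' × V'' => innerSL ℝ w.2 ∘L
          ContinuousLinearMap.snd ℝ V' V'' := by fun_prop
        exact (this.tendsto (x₀, θ₀)).comp tendsto_fst
      have c2 : Tendsto (fun q => DZ q (0, 1)) (𝓝 (x₀, θ₀) ×ˢ 𝓝[>] (0 : ℝ))
          (𝓝 (DZ ((x₀, θ₀), 0) (0, 1))) :=
        (ContinuousLinearMap.apply ℝ (V' × V'')
          (((0 : V' × V''), (1 : ℝ)))).continuous.continuousAt.tendsto.comp t1
      exact tendsto_smulRight c1 c2

/-- The distance of a polar map to the base is comparable to the radius. -/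
lemma exists_tendsto_snd (hZ : IsPolarParam N ε Z Q) {x₀ : V'} {θ₀ : V''} (hx₀ : x₀ ∈ N)
    (hθ₀ : θ₀ ≠ 0) : ∃ a : V'', a ≠ 0 ∧
      Tendsto (fun q => q.2⁻¹ • (Z q).2) (𝓝 (x₀, θ₀) ×ˢ 𝓝[>] (0 : ℝ)) (𝓝 a) := by
  have hw : (x₀, θ₀) ∈ N ×ˢ ({0}ᶜ : Set V'') := ⟨hx₀, hθ₀⟩
  have hq := hZ.mem_domain hw
  have h := tendsto_inv_smul_of_contDiffOn hZ.isOpen_base hZ.eps_pos (G := fun q => (Z q).2)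
    ((hZ.smooth.snd).of_le (by norm_num)) (fun a ha => by simp [hZ.zero a.1 ha.1 a.2 ha.2]) hw
  refine ⟨_, ?_, h⟩
  have h1 : HasFDerivWithinAt (fun q => (Z q).2)
      (ContinuousLinearMap.snd ℝ V' V'' ∘L fderivWithin ℝ Z (polarDomain N ε) ((x₀, θ₀), 0))
      (polarDomain N ε) ((x₀, θ₀), 0) :=
    (ContinuousLinearMap.snd ℝ V' V'').hasFDerivAt.comp_hasFDerivWithinAt _
      (hZ.hasFDerivWithinAt hq)
  have h2 := h1.fderivWithin (hZ.uniqueDiffOn _ hq)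
  rw [polarDomain] at h2
  rw [h2]
  obtain ⟨c, hc, hcQ⟩ := hZ.radial x₀ hx₀ θ₀ hθ₀
  have h3 : (ContinuousLinearMap.snd ℝ V' V'' ∘L
      fderivWithin ℝ Z (polarDomain N ε) ((x₀, θ₀), 0)) (0, 1) = c • Q x₀ θ₀ := hcQ
  rw [polarDomain] at h3
  rw [h3]
  exact smul_ne_zero hc.ne' fun h0 => hθ₀ (hZ.injective x₀ hx₀ (by rw [h0, map_zero]))

lemma det_ne_zero_of_injective {V : Type*} [NormedAddCommGroup V] [NormedSpace ℝ V]
    [FiniteDimensional ℝ V] {L : V →L[ℝ] V} (hL : Function.Injective L) : L.det ≠ 0 := by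
  have := (LinearEquiv.ofInjectiveEndo (L : V →ₗ[ℝ] V) hL).isUnit_det'
  exact this.ne_zero

/-- Bounds for a polar map at `(x, ρ θ)`, with constants `c` and `C`. -/
def Bounds (N : Set V') (ε : ℝ) (Z : (V' × V'') × ℝ → V' × V'') (O : Set (V' × V'')) (c C : ℝ)
    (q : (V' × V'') × ℝ) : Prop :=
  Z q ∈ O ∧ c * q.2 ≤ ‖(Z q).2‖ ∧ ‖(Z q).2‖ ≤ C * q.2 ∧
    c ≤ |(polarDeriv Z (polarDomain N ε) q).det| ∧ |(polarDeriv Z (polarDomain N ε) q).det| ≤ C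

lemma Bounds.mono {O : Set (V' × V'')} {c C c' C' : ℝ} {q : (V' × V'') × ℝ}
    (h : Bounds N ε Z O c C q) (hc : c' ≤ c) (hC : C ≤ C') (hq : 0 ≤ q.2) :
    Bounds N ε Z O c' C' q :=
  ⟨h.1, le_trans (by gcongr) h.2.1, h.2.2.1.trans (by gcongr), hc.trans h.2.2.2.1,
    h.2.2.2.2.trans hC⟩

/-- The Jacobian and `ρ⁻¹ ‖(Z q).2‖` have positive limits; up to a factor `2` these limits serve as
bounds. -/
lemma eventually_bounds (hZ : IsPolarParam N ε Z Q) {x₀ : V'} {θ₀ : V''} (hx₀ : x₀ ∈ N)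
    (hθ₀ : ‖θ₀‖ = 1) {O : Set (V' × V'')} (hO : O ∈ 𝓝 (x₀, (0 : V''))) :
    ∃ c C : ℝ, 0 < c ∧ 0 < C ∧ ∀ᶠ q in 𝓝 (x₀, θ₀) ×ˢ 𝓝[>] (0 : ℝ), Bounds N ε Z O c C q := by
  have hθ0 : θ₀ ≠ 0 := fun h => by simp [h] at hθ₀
  obtain ⟨L, hL, tL⟩ := hZ.exists_tendsto_polarDeriv hx₀ hθ₀
  obtain ⟨a, ha, ta⟩ := hZ.exists_tendsto_snd hx₀ hθ0
  have hw : (x₀, θ₀) ∈ N ×ˢ ({0}ᶜ : Set V'') := ⟨hx₀, hθ0⟩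
  have tZ : Tendsto Z (𝓝 (x₀, θ₀) ×ˢ 𝓝[>] (0 : ℝ)) (𝓝 (x₀, 0)) := by
    have h := ((hZ.smooth.continuousOn _ (hZ.mem_domain hw)).tendsto).mono_left
      (hZ.nhds_prod_nhdsGT_le hw)
    rwa [hZ.zero x₀ hx₀ θ₀ hθ0] at h
  have tdet : Tendsto (fun q => |(polarDeriv Z (polarDomain N ε) q).det|)
      (𝓝 (x₀, θ₀) ×ˢ 𝓝[>] (0 : ℝ)) (𝓝 |L.det|) :=
    ((continuous_abs.comp ContinuousLinearMap.continuous_det).tendsto L).comp tL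
  have hd : 0 < |L.det| := abs_pos.2 (det_ne_zero_of_injective hL)
  have hn : 0 < ‖a‖ := norm_pos_iff.2 ha
  have tn := ta.norm
  set c := min (|L.det| / 2) (‖a‖ / 2) with hc
  set C := max (|L.det| * 2) (‖a‖ * 2) with hC
  refine ⟨c, C, by positivity, lt_max_of_lt_left (by positivity), ?_⟩
  have hpos : ∀ᶠ q in 𝓝 (x₀, θ₀) ×ˢ 𝓝[>] (0 : ℝ), 0 < q.2 :=
    tendsto_snd.eventually self_mem_nhdsWithin
  filter_upwards [tZ.eventually hO, tdet.eventually (Icc_mem_nhds (half_lt_self hd)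
    (show |L.det| < |L.det| * 2 by linarith)), tn.eventually (Icc_mem_nhds (half_lt_self hn)
    (show ‖a‖ < ‖a‖ * 2 by linarith)), hpos] with q h1 h2 h3 h4
  rw [norm_smul, norm_inv, Real.norm_of_nonneg h4.le] at h3
  have e1 := (le_inv_mul_iff₀ h4).1 h3.1
  have e2 := (inv_mul_le_iff₀ h4).1 h3.2
  refine ⟨h1, le_trans ?_ e1, e2.trans ?_, (min_le_left _ _).trans h2.1,
    h2.2.trans (le_max_left _ _)⟩
  · rw [mul_comm]; gcongr; exact min_le_right _ _
  · rw [mul_comm]; gcongr; exact le_max_right _ _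

/-- A polar map has a bounded Jacobian with bounded inverse, uniformly near a point of the base. -/
theorem exists_bounds (hZ : IsPolarParam N ε Z Q) {x₀ : V'} (hx₀ : x₀ ∈ N) {O : Set (V' × V'')}
    (hO : O ∈ 𝓝 (x₀, (0 : V''))) :
    ∃ c C δ : ℝ, 0 < c ∧ 0 < C ∧ 0 < δ ∧ δ ≤ ε ∧ Metric.ball x₀ δ ⊆ N ∧
      ∀ x ∈ Metric.ball x₀ δ, ∀ θ : V'', ‖θ‖ = 1 → ∀ ρ ∈ Ioo 0 δ,
        Bounds N ε Z O c C ((x, θ), ρ) := by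
  have key : ∃ c C : ℝ, 0 < c ∧ 0 < C ∧ ∀ᶠ q in 𝓝 x₀ ×ˢ 𝓝[>] (0 : ℝ),
      ∀ θ ∈ Metric.sphere (0 : V'') 1, Bounds N ε Z O c C ((q.1, θ), q.2) := by
    -- The local constants depend on the direction; compactness of the unit sphere makes them
    -- uniform.
    refine (isCompact_sphere (0 : V'') 1).induction_on
      (p := fun s => ∃ c C : ℝ, 0 < c ∧ 0 < C ∧ ∀ᶠ q in 𝓝 x₀ ×ˢ 𝓝[>] (0 : ℝ),
        ∀ θ ∈ s, Bounds N ε Z O c C ((q.1, θ), q.2)) ?_ ?_ ?_ ?_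
    · exact ⟨1, 1, one_pos, one_pos, by simp⟩
    · rintro s t hst ⟨c, C, hc, hC, h⟩
      exact ⟨c, C, hc, hC, h.mono fun q hq θ hθ => hq θ (hst hθ)⟩
    · rintro s t ⟨c, C, hc, hC, h⟩ ⟨c', C', hc', hC', h'⟩
      refine ⟨min c c', max C C', lt_min hc hc', lt_max_of_lt_left hC, ?_⟩
      have hpos : ∀ᶠ q in 𝓝 x₀ ×ˢ 𝓝[>] (0 : ℝ), 0 < q.2 :=
        tendsto_snd.eventually self_mem_nhdsWithin
      filter_upwards [h, h', hpos] with q h1 h2 h3 θ hθ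
      rcases hθ with hθ | hθ
      · exact (h1 θ hθ).mono (min_le_left _ _) (le_max_left _ _) h3.le
      · exact (h2 θ hθ).mono (min_le_right _ _) (le_max_right _ _) h3.le
    · intro θ₀ hθ₀
      obtain ⟨c, C, hc, hC, h⟩ := hZ.eventually_bounds hx₀ (by simpa using hθ₀) hO
      obtain ⟨P, hP, R, hR, hPR⟩ := Filter.eventually_prod_iff.1 h
      rw [nhds_prod_eq] at hP
      obtain ⟨P₁, hP₁, P₂, hP₂, hPP⟩ := Filter.eventually_prod_iff.1 hP
      refine ⟨{θ | P₂ θ}, mem_nhdsWithin_of_mem_nhds hP₂, c, C, hc, hC, ?_⟩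
      refine Filter.eventually_prod_iff.2 ⟨P₁, hP₁, R, hR, fun hx ρ hρ θ hθ => ?_⟩
      exact hPR (hPP hx hθ) hρ
  obtain ⟨c, C, hc, hC, h⟩ := key
  obtain ⟨P, hP, R, hR, hPR⟩ := Filter.eventually_prod_iff.1 h
  obtain ⟨δ₁, hδ₁, h₁⟩ := Metric.eventually_nhds_iff_ball.1 hP
  obtain ⟨δ₂, hδ₂, h₂⟩ := mem_nhdsGT_iff_exists_Ioo_subset.1 hR
  obtain ⟨δ₃, hδ₃, h₃⟩ := Metric.isOpen_iff.1 hZ.isOpen x₀ hx₀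
  have hδ₂' : 0 < δ₂ := hδ₂
  refine ⟨c, C, min (min δ₁ δ₂) (min δ₃ ε), hc, hC,
    lt_min (lt_min hδ₁ hδ₂') (lt_min hδ₃ hZ.eps_pos), (min_le_right _ _).trans (min_le_right _ _),
    (Metric.ball_subset_ball ((min_le_right _ _).trans (min_le_left _ _))).trans h₃,
    fun x hx θ hθ ρ hρ => ?_⟩
  refine hPR (h₁ x (Metric.ball_subset_ball ((min_le_left _ _).trans (min_le_left _ _)) hx))
    (h₂ ⟨hρ.1, hρ.2.trans_le ((min_le_left _ _).trans (min_le_right _ _))⟩) θ (by simpa using hθ)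

end IsPolarParam

end PolarMap

/-! ### Transport along rays -/

section Transport

/-- Transport along an interval with the weight `ρ ^ a`. -/
lemma lintegral_rpow_transport {a τ : ℝ} (ha : 0 ≤ a) (hτ : 0 < τ) {f h : ℝ → ℝ≥0∞}
    (hfh : ∀ ρ ∈ Ioo 0 τ, f ρ ≤ f (ρ + τ) + ∫⁻ σ in Ioo ρ (ρ + τ), h σ) :
    ∫⁻ ρ in Ioo 0 τ, ENNReal.ofReal (ρ ^ a) * f ρ ≤
      (∫⁻ ρ in Ioo τ (2 * τ), ENNReal.ofReal (ρ ^ a) * f ρ) +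
        ENNReal.ofReal τ * ∫⁻ ρ in Ioo 0 (2 * τ), ENNReal.ofReal (ρ ^ a) * h ρ := by
  set H := ∫⁻ ρ in Ioo 0 (2 * τ), ENNReal.ofReal (ρ ^ a) * h ρ with hH
  have hshift : ∫⁻ ρ in Ioo 0 τ, ENNReal.ofReal ((ρ + τ) ^ a) * f (ρ + τ) =
      ∫⁻ ρ in Ioo τ (2 * τ), ENNReal.ofReal (ρ ^ a) * f ρ := by
    have h1 := (measurePreserving_add_right (volume : Measure ℝ) τ).setLIntegral_comp_preimage_emb
      (measurableEmbedding_addRight τ) (fun ρ => ENNReal.ofReal (ρ ^ a) * f ρ) (Ioo τ (2 * τ))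
    rw [← h1]
    congr 2
    ext ρ
    simp only [mem_Ioo, mem_preimage]
    constructor <;> rintro ⟨h1, h2⟩ <;> constructor <;> linarith
  calc ∫⁻ ρ in Ioo 0 τ, ENNReal.ofReal (ρ ^ a) * f ρ
      ≤ ∫⁻ ρ in Ioo 0 τ, (ENNReal.ofReal ((ρ + τ) ^ a) * f (ρ + τ) + H) := by
        refine setLIntegral_mono' measurableSet_Ioo fun ρ hρ => ?_
        -- Since `a ≥ 0` the weight is increasing: `ρ ^ a` is at most `(ρ + τ) ^ a`, and at most `σ
        -- ^ a` for `σ > ρ`.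
        refine (mul_le_mul_right (hfh ρ hρ) _).trans ?_
        rw [mul_add]
        refine add_le_add ?_ ?_
        · gcongr
          · exact hρ.1.le
          · linarith
        · rw [← lintegral_const_mul' _ _ ENNReal.ofReal_ne_top, hH]
          refine (setLIntegral_mono' measurableSet_Ioo fun σ hσ => ?_).trans
            (lintegral_mono_set (Ioo_subset_Ioo hρ.1.le (by linarith [hρ.2])))
          gcongr
          · exact hρ.1.le
          · exact hσ.1.le
    _ = _ := by
        rw [lintegral_add_right _ measurable_const, hshift, lintegral_const,
          Measure.restrict_apply .univ, univ_inter, Real.volume_Ioo, sub_zero, mul_comm H]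

variable {V : Type*} [NormedAddCommGroup V] [InnerProductSpace ℝ V] [FiniteDimensional ℝ V]
  [MeasurableSpace V] [BorelSpace V]

/-- The shell `r < ‖y‖ < R`. -/
def shell (V : Type*) [NormedAddCommGroup V] (r R : ℝ) : Set V := {y | ‖y‖ ∈ Ioo r R}

lemma isOpen_shell (r R : ℝ) : IsOpen (shell V r R) := isOpen_Ioo.preimage continuous_norm

lemma shell_subset_shell {r R r' R' : ℝ} (hr : r' ≤ r) (hR : R ≤ R') :
    shell V r R ⊆ shell V r' R' := fun _ hy => Ioo_subset_Ioo hr hR hy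

/-- Integration in polar coordinates. -/
lemma lintegral_polar {F : V → ℝ≥0∞} (hF : Measurable F) [Nontrivial V] :
    ∫⁻ y, F y = ∫⁻ θ : Metric.sphere (0 : V) 1, (∫⁻ ρ in Ioi (0 : ℝ),
      ENNReal.ofReal (ρ ^ (Module.finrank ℝ V - 1)) * F (ρ • (θ : V)))
        ∂(volume : Measure V).toSphere := by
  have h0 : ∫⁻ y, F y = ∫⁻ y in ({0}ᶜ : Set V), F y := by
    rw [restrict_compl_singleton]
  have hm := (volume : Measure V).measurePreserving_homeomorphUnitSphereProd
  have h1 : ∫⁻ y in ({0}ᶜ : Set V), F y = ∫⁻ p, F (((homeomorphUnitSphereProd V).symm p : _) : V)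
      ∂((volume : Measure V).toSphere.prod
        (Measure.volumeIoiPow (Module.finrank ℝ V - 1))) := by
    have h2 := hm.lintegral_comp (f := fun p => F (((homeomorphUnitSphereProd V).symm p : _) : V))
      (hF.comp (measurable_subtype_coe.comp (homeomorphUnitSphereProd V).symm.measurable))
    rw [← lintegral_subtype_comap (measurableSet_singleton _).compl, ← h2]
    simp only [Homeomorph.symm_apply_apply]
  have hFm : Measurable fun p => F (((homeomorphUnitSphereProd V).symm p : _) : V) :=
    hF.comp (measurable_subtype_coe.comp (homeomorphUnitSphereProd V).symm.measurable)
  rw [h0, h1, lintegral_prod _ hFm.aemeasurable]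
  refine lintegral_congr fun θ => ?_
  simp only [homeomorphUnitSphereProd_symm_apply_coe]
  have hc : Measurable fun ρ : Ioi (0 : ℝ) => F ((ρ : ℝ) • (θ : V)) :=
    hF.comp (by fun_prop)
  rw [Measure.volumeIoiPow, lintegral_withDensity_eq_lintegral_mul _ (by fun_prop) hc,
    ← lintegral_subtype_comap measurableSet_Ioi]
  rfl

lemma lintegral_shell [Nontrivial V] {F : V → ℝ≥0∞} (hF : Measurable F) {r R : ℝ} (hr : 0 ≤ r) :
    ∫⁻ y in shell V r R, F y = ∫⁻ θ : Metric.sphere (0 : V) 1, (∫⁻ ρ in Ioo r R,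
      ENNReal.ofReal (ρ ^ (Module.finrank ℝ V - 1)) * F (ρ • (θ : V)))
        ∂(volume : Measure V).toSphere := by
  have hS := (isOpen_shell (V := V) r R).measurableSet
  rw [← lintegral_indicator hS, lintegral_polar (hF.indicator hS)]
  refine lintegral_congr fun θ => ?_
  have hθ : ‖(θ : V)‖ = 1 := by simp
  have hsub : Ioo r R ⊆ Ioi 0 := fun ρ hρ => hr.trans_lt hρ.1
  rw [← inter_eq_left.2 hsub, ← Measure.restrict_restrict measurableSet_Ioo,
    ← lintegral_indicator measurableSet_Ioo]
  refine setLIntegral_congr_fun measurableSet_Ioi fun ρ hρ => ?_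
  have hn : ‖ρ • (θ : V)‖ = ρ := by
    rw [norm_smul, hθ, mul_one, Real.norm_of_nonneg (le_of_lt hρ)]
  by_cases h : ρ ∈ Ioo r R
  · have h' : ρ • (θ : V) ∈ shell V r R := by rw [shell, mem_setOf_eq, hn]; exact h
    simp [h, h']
  · have h' : ρ • (θ : V) ∉ shell V r R := by rw [shell, mem_setOf_eq, hn]; exact h
    simp [h, h']

/-- Transport along rays with the weight `‖y‖ ^ b`. -/
lemma lintegral_shell_transport [Nontrivial V] {b τ : ℝ} (hb : 0 ≤ b + (Module.finrank ℝ V - 1))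
    (hτ : 0 < τ) {f h : V → ℝ≥0∞} (hf : Measurable f) (hh : Measurable h)
    (hfh : ∀ θ : V, ‖θ‖ = 1 → ∀ ρ ∈ Ioo 0 τ,
      f (ρ • θ) ≤ f ((ρ + τ) • θ) + ∫⁻ σ in Ioo ρ (ρ + τ), h (σ • θ)) :
    ∫⁻ y in shell V 0 τ, ENNReal.ofReal (‖y‖ ^ b) * f y ≤
      (∫⁻ y in shell V τ (2 * τ), ENNReal.ofReal (‖y‖ ^ b) * f y) +
        ENNReal.ofReal τ * ∫⁻ y in shell V 0 (2 * τ), ENNReal.ofReal (‖y‖ ^ b) * h y := by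
  have hw : Measurable fun y : V => ENNReal.ofReal (‖y‖ ^ b) := by fun_prop
  -- The polar factor `ρ ^ (d - 1)` and the weight `ρ ^ b` combine to a real power. The natural
  -- subtraction is exact because `d ≥ 1`.
  have hd : ((Module.finrank ℝ V - 1 : ℕ) : ℝ) = Module.finrank ℝ V - 1 := by
    rw [Nat.cast_sub (Module.finrank_pos (R := ℝ) (M := V)), Nat.cast_one]
  have hint : ∀ F : V → ℝ≥0∞, ∀ θ : V, ‖θ‖ = 1 → ∀ r R : ℝ, 0 ≤ r →
      ∫⁻ ρ in Ioo r R, ENNReal.ofReal (ρ ^ (Module.finrank ℝ V - 1)) *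
        (ENNReal.ofReal (‖ρ • θ‖ ^ b) * F (ρ • θ)) =
      ∫⁻ ρ in Ioo r R, ENNReal.ofReal (ρ ^ (b + (Module.finrank ℝ V - 1))) * F (ρ • θ) := by
    intro F θ hθ r R hr
    refine setLIntegral_congr_fun measurableSet_Ioo fun ρ hρ => ?_
    have hρ0 : 0 < ρ := hr.trans_lt hρ.1
    rw [norm_smul, hθ, mul_one, Real.norm_of_nonneg hρ0.le, ← mul_assoc,
      ← ENNReal.ofReal_mul (by positivity), ← Real.rpow_natCast, hd, ← Real.rpow_add hρ0, add_comm b]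
  have hwf : Measurable fun y : V => ENNReal.ofReal (‖y‖ ^ b) * f y := hw.mul hf
  have hwh : Measurable fun y : V => ENNReal.ofReal (‖y‖ ^ b) * h y := hw.mul hh
  rw [lintegral_shell hwf le_rfl, lintegral_shell hwf hτ.le, lintegral_shell hwh le_rfl, ← lintegral_const_mul' _ _ ENNReal.ofReal_ne_top,
    ← lintegral_add_left']
  · refine lintegral_mono fun θ => ?_
    have hθ : ‖(θ : V)‖ = 1 := by simp
    simp only [hint _ _ hθ _ _ le_rfl, hint _ _ hθ _ _ hτ.le]
    exact lintegral_rpow_transport (f := fun ρ => f (ρ • (θ : V))) (h := fun ρ => h (ρ • (θ : V))) hb hτ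
      (hfh θ hθ)
  · refine Measurable.aemeasurable ?_
    refine Measurable.lintegral_prod_right' (f := fun q : Metric.sphere (0 : V) 1 × ℝ =>
      ENNReal.ofReal (q.2 ^ (Module.finrank ℝ V - 1)) *
        (ENNReal.ofReal (‖q.2 • (q.1 : V)‖ ^ b) * f (q.2 • (q.1 : V)))) ?_
    have hm : Measurable fun q : Metric.sphere (0 : V) 1 × ℝ => q.2 • (q.1 : V) := by fun_prop
    exact Measurable.mul (by fun_prop) ((hw.comp hm).mul (hf.comp hm))

variable {V' : Type*} [MeasureSpace V'] [SigmaFinite (volume : Measure V')]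

/-- Transport along rays, with parameters. -/
theorem lintegral_prod_shell_transport {b τ : ℝ}
    (hb : 0 < Module.finrank ℝ V → 0 ≤ b + (Module.finrank ℝ V - 1)) (hτ : 0 < τ) {N : Set V'}
    (hN : MeasurableSet N) {f h : V' × V → ℝ≥0∞} (hf : Measurable f) (hh : Measurable h)
    (hfh : ∀ x ∈ N, ∀ θ : V, ‖θ‖ = 1 → ∀ ρ ∈ Ioo 0 τ,
      f (x, ρ • θ) ≤ f (x, (ρ + τ) • θ) + ∫⁻ σ in Ioo ρ (ρ + τ), h (x, σ • θ)) :
    ∫⁻ w in N ×ˢ shell V 0 τ, ENNReal.ofReal (‖w.2‖ ^ b) * f w ≤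
      (∫⁻ w in N ×ˢ shell V τ (2 * τ), ENNReal.ofReal (‖w.2‖ ^ b) * f w) +
        ENNReal.ofReal τ * ∫⁻ w in N ×ˢ shell V 0 (2 * τ), ENNReal.ofReal (‖w.2‖ ^ b) * h w := by
  rcases subsingleton_or_nontrivial V with hV | hV
  -- For a trivial normal space, that is in codimension zero, the shell is empty and there is
  -- nothing to transport.
  · have : shell V 0 τ = ∅ := by
      ext y
      simp [shell, Subsingleton.elim y 0]
    simp [this]
  have hb' := hb Module.finrank_pos
  have hw : Measurable fun w : V' × V => ENNReal.ofReal (‖w.2‖ ^ b) := by fun_prop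
  simp only [Measure.volume_eq_prod, ← Measure.prod_restrict]
  have hwf : Measurable fun w : V' × V => ENNReal.ofReal (‖w.2‖ ^ b) * f w := hw.mul hf
  have hwh : Measurable fun w : V' × V => ENNReal.ofReal (‖w.2‖ ^ b) * h w := hw.mul hh
  rw [lintegral_prod _ hwf.aemeasurable, lintegral_prod _ hwf.aemeasurable,
    lintegral_prod _ hwh.aemeasurable, ← lintegral_const_mul' _ _ ENNReal.ofReal_ne_top,
    ← lintegral_add_left hwf.lintegral_prod_right']
  refine setLIntegral_mono' hN fun x hx => ?_
  exact lintegral_shell_transport (f := fun y => f (x, y)) (h := fun y => h (x, y)) hb' hτ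
    (hf.comp measurable_prodMk_left) (hh.comp measurable_prodMk_left) (hfh x hx)

end Transport

/-! ### Tangential and normal coordinates -/

section Split

variable {n : ℕ} (k : ℕ)

/-- The first `k` coordinates. -/
abbrev Tang (n k : ℕ) := EuclideanSpace ℝ {i : Fin (2 * n) // i.val < k}

/-- The last `2n - k` coordinates. -/
abbrev Norm (n k : ℕ) := EuclideanSpace ℝ {i : Fin (2 * n) // ¬ i.val < k}

/-- The splitting of the model space into tangential and normal coordinates. -/
def split : E n ≃L[ℝ] Tang n k × Norm n k :=
  LinearEquiv.toContinuousLinearEquiv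
    { toFun := fun y => (WithLp.toLp 2 fun i => y i, WithLp.toLp 2 fun i => y i)
      invFun := fun w => WithLp.toLp 2 fun i =>
        if h : i.val < k then w.1 ⟨i, h⟩ else w.2 ⟨i, h⟩
      map_add' := fun _ _ => rfl
      map_smul' := fun _ _ => rfl
      left_inv := fun y => by
        ext i
        by_cases h : i.val < k <;> simp [h]
      right_inv := fun w => by
        refine Prod.ext ?_ ?_
        · ext i; simp [i.2]
        · ext i; simp [i.2] }

variable {k}

lemma split_fst_apply (y : E n) (i) : (split k y).1 i = y i := rfl

lemma split_snd_apply (y : E n) (i) : (split k y).2 i = y i := rfl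

lemma split_snd_eq_zero_iff (y : E n) :
    (split k y).2 = 0 ↔ ∀ i : Fin (2 * n), k ≤ i.val → y i = 0 := by
  constructor
  · intro h i hi
    have := congrArg (fun z : Norm n k => z ⟨i, not_lt.2 hi⟩) h
    exact this
  · intro h
    ext i
    exact h i (not_lt.1 i.2)

lemma sum_eq_split (f : Fin (2 * n) → ℝ) : ∑ i, f i =
    (∑ i : {i : Fin (2 * n) // i.val < k}, f i) + ∑ i : {i : Fin (2 * n) // ¬ i.val < k}, f i :=
  (Fintype.sum_subtype_add_sum_subtype (fun i : Fin (2 * n) => i.val < k) f).symm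

lemma norm_split_snd (y : E n) : ‖(split k y).2‖ = normalRadius k y := by
  rw [EuclideanSpace.norm_eq, normalRadius, sum_eq_split (k := k)]
  congr 1
  have h1 : ∑ i : {i : Fin (2 * n) // i.val < k}, (if k ≤ i.1.val then y i ^ 2 else 0) = 0 :=
    Finset.sum_eq_zero fun i _ => if_neg (not_le.2 i.2)
  rw [h1, zero_add]
  refine Finset.sum_congr rfl fun i _ => ?_
  rw [if_pos (not_lt.1 i.2), Real.norm_eq_abs, sq_abs]
  rfl

lemma inner_split (u v : E n) : u.ofLp ⬝ᵥ v.ofLp =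
    inner ℝ (split k u).1 (split k v).1 + inner ℝ (split k u).2 (split k v).2 := by
  rw [dotProduct, sum_eq_split (k := k)]
  simp only [PiLp.inner_apply, split_fst_apply, split_snd_apply]
  simp [mul_comm]

lemma measurePreserving_split : MeasurePreserving (split k : E n → Tang n k × Norm n k) := by
  have h1 := PiLp.volume_preserving_ofLp (Fin (2 * n))
  have h2 := volume_preserving_piEquivPiSubtypeProd (fun _ : Fin (2 * n) => ℝ) (fun i => i.val < k)
  have h3 := (PiLp.volume_preserving_toLp {i : Fin (2 * n) // i.val < k}).prod
    (PiLp.volume_preserving_toLp {i : Fin (2 * n) // ¬ i.val < k})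
  exact h3.comp (h2.comp h1)

lemma finrank_norm : Module.finrank ℝ (Norm n k) = 2 * n - k := by
  rw [finrank_euclideanSpace, Fintype.card_subtype_compl, Fintype.card_fin]
  rcases le_total k (2 * n) with h | h
  · have : Fintype.card {i : Fin (2 * n) // i.val < k} = k := by
      rw [Fintype.card_subtype]
      have : (Finset.univ.filter fun i : Fin (2 * n) => i.val < k).card = k := by
        rw [Fin.card_filter_val_lt]; omega
      exact this
    rw [this]
  · have : Fintype.card {i : Fin (2 * n) // i.val < k} = 2 * n := by
      rw [Fintype.card_subtype]
      rw [Fin.card_filter_val_lt]; omega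
    rw [this]; omega

end Split

/-! ### Normal vectors -/

section NormalVectors

variable {n : ℕ} {X : Type*} [TopologicalSpace X] [ChartedSpace (E n) X]
  [IsManifold 𝓘(ℝ, E n) ∞ X] {D : Set X} {k : ℕ} {ψ : OpenPartialHomeomorph X (E n)}

local notation "𝒜" => IsManifold.maximalAtlas 𝓘(ℝ, E n) ∞ X

/-- The tangent vector with components `a` in the chart `ψ`. -/
def frameVec (ψ : OpenPartialHomeomorph X (E n)) (z a : E n) : TangentBundle 𝓘(ℝ, E n) X :=
  ⟨ψ.symm z, frameMap ψ z a⟩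

/-- Locally `frameVec` is the tangent map of `ψ⁻¹` applied to the vector `a` at `z`. -/
lemma contMDiffAt_frameVec {W : Type*} [NormedAddCommGroup W] [NormedSpace ℝ W] (hψ : ψ ∈ 𝒜)
    {z a : W → E n} {w : W} (hz : ContDiffAt ℝ ∞ z w) (ha : ContDiffAt ℝ ∞ a w)
    (hw : z w ∈ ψ.target) :
    ContMDiffAt 𝓘(ℝ, W) 𝓘(ℝ, E n).tangent ∞ (fun w => frameVec ψ (z w) (a w)) w := by
  have h1 : ContMDiffAt 𝓘(ℝ, W) 𝓘(ℝ, E n).tangent ∞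
      (fun w => (⟨z w, a w⟩ : TangentBundle 𝓘(ℝ, E n) (E n))) w := by
    rw [contMDiffAt_totalSpace]
    refine ⟨hz.contMDiffAt, ?_⟩
    simpa using ha.contMDiffAt
  have h2 : ContMDiffOn 𝓘(ℝ, E n).tangent 𝓘(ℝ, E n).tangent ∞
      (tangentMapWithin 𝓘(ℝ, E n) 𝓘(ℝ, E n) ψ.symm ψ.target)
      (TotalSpace.proj ⁻¹' ψ.target) :=
    (contMDiffOn_symm_of_mem_maximalAtlas hψ).contMDiffOn_tangentMapWithin (by simp)
      ψ.open_target.uniqueMDiffOn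
  have hopen : IsOpen (TotalSpace.proj ⁻¹' ψ.target : Set (TangentBundle 𝓘(ℝ, E n) (E n))) :=
    ψ.open_target.preimage (FiberBundle.continuous_proj (E n) _)
  have h3 := (h2.contMDiffAt (hopen.mem_nhds (x := ⟨z w, a w⟩) hw)).comp w h1
  refine h3.congr_of_eventuallyEq ?_
  filter_upwards [hz.continuousAt.preimage_mem_nhds (ψ.open_target.mem_nhds hw)] with w' hw'
  simp only [Function.comp, tangentMapWithin, frameVec, frameMap]
  rw [mfderivWithin_of_isOpen ψ.open_target hw']
  rfl

/-- The tangent space of a submanifold in an adapted chart. -/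
lemma mem_tangentTo_iff (hψ : ψ ∈ 𝒜) (hD : ∀ x ∈ ψ.source, x ∈ D ↔ (split k (ψ x)).2 = 0) {x : X}
    (hx : x ∈ ψ.source) (hxD : x ∈ D) (w : E n) :
    w ∈ tangentTo (n := n) D x ↔ (split k (coframeMap ψ x w)).2 = 0 := by
  constructor
  · rintro ⟨γ, hγ0, hγD, hγ, hw⟩
    subst hγ0
    have hγd : HasDerivAt (ψ ∘ γ) (coframeMap ψ (γ 0) w) 0 := by
      have h1 := (mdifferentiableAt_chart hψ hx).hasMFDerivAt.comp (0 : ℝ) hγ.hasMFDerivAt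
      have h2 : HasFDerivAt (ψ ∘ γ) ((coframeMap ψ (γ 0)).comp
          (mfderiv 𝓘(ℝ, ℝ) 𝓘(ℝ, E n) γ 0 : ℝ →L[ℝ] E n)) 0 := h1.hasFDerivAt
      rw [← hw]
      exact h2.hasDerivAt
    have h3 : HasDerivAt (fun τ => (split k (ψ (γ τ))).2) (split k (coframeMap ψ (γ 0) w)).2 0 :=
      (((ContinuousLinearMap.snd ℝ (Tang n k) (Norm n k)) ∘L
        ((split (n := n) k : E n ≃L[ℝ] Tang n k × Norm n k) :
          E n →L[ℝ] Tang n k × Norm n k)).hasFDerivAt).comp_hasDerivAt (0 : ℝ) hγd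
    have h4 : (fun τ => (split k (ψ (γ τ))).2) =ᶠ[𝓝 0] fun _ => 0 := by
      filter_upwards [hγD, hγ.continuousAt.preimage_mem_nhds (ψ.open_source.mem_nhds hx)]
        with τ h5 h6 using (hD _ h6).1 h5
    exact h3.unique ((hasDerivAt_const (0 : ℝ) _).congr_of_eventuallyEq h4)
  · intro h
    set b := coframeMap ψ x w with hb
    have hz := ψ.map_source hx
    have hline : HasDerivAt (fun τ : ℝ => ψ x + τ • b) b 0 := by
      simpa using ((hasDerivAt_id (0 : ℝ)).smul_const b).const_add (ψ x)
    have h0 : ψ x + (0 : ℝ) • b = ψ x := by simp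
    have hsymm : MDifferentiableAt 𝓘(ℝ, E n) 𝓘(ℝ, E n) ψ.symm (ψ x + (0 : ℝ) • b) := by
      rw [h0]; exact mdifferentiableAt_chart_symm hψ hz
    have hcomp := hsymm.hasMFDerivAt.comp (0 : ℝ) hline.hasFDerivAt.hasMFDerivAt
    -- Conversely, a straight line in the adapted chart with vanishing normal part is a curve in
    -- `D`.
    refine ⟨fun τ => ψ.symm (ψ x + τ • b), by simp [ψ.left_inv hx], ?_,
      hcomp.mdifferentiableAt, ?_⟩
    · have : ∀ᶠ τ in 𝓝 (0 : ℝ), ψ x + τ • b ∈ ψ.target :=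
        hline.continuousAt.preimage_mem_nhds (ψ.open_target.mem_nhds (by rwa [h0]))
      filter_upwards [this] with τ hτ
      rw [hD _ (ψ.map_target hτ), ψ.right_inv hτ, map_add, map_smul]
      simp [h, (hD x hx).1 hxD]
    · have h1 : (mfderiv 𝓘(ℝ, ℝ) 𝓘(ℝ, E n) (fun τ : ℝ => ψ.symm (ψ x + τ • b)) 0 (1 : ℝ) : E n) =
          frameMap ψ (ψ x + (0 : ℝ) • b) b := by
        have h2 := hcomp.mfderiv
        have h3 : (mfderiv 𝓘(ℝ, ℝ) 𝓘(ℝ, E n) (fun τ : ℝ => ψ.symm (ψ x + τ • b)) 0 : ℝ →L[ℝ] E n) =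
          (frameMap ψ (ψ x + (0 : ℝ) • b)).comp (ContinuousLinearMap.toSpanSingleton ℝ b) := h2
        refine (congrArg (fun L : ℝ →L[ℝ] E n => L 1) h3).trans ?_
        simp
      rw [h1, h0, hb, frameMap_coframeMap hψ hx]

end NormalVectors

/-! ### The unit normal bundle in an adapted chart -/

section UnitNormal

variable {n : ℕ} {X : Type*} [TopologicalSpace X] [ChartedSpace (E n) X]
  [IsManifold 𝓘(ℝ, E n) ∞ X] {D : Set X} {k : ℕ} {p : X} {ψ : OpenPartialHomeomorph X (E n)}
  (g₀ : ContMDiffRiemannianMetric 𝓘(ℝ, E n) ∞ (E n) (fun x : X => TangentSpace 𝓘(ℝ, E n) x))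

local notation "𝒜" => IsManifold.maximalAtlas 𝓘(ℝ, E n) ∞ X

/-- The matrices of a Riemannian metric in a chart. -/
def gram (ψ : OpenPartialHomeomorph X (E n)) (z : E n) : Matrix (Fin (2 * n)) (Fin (2 * n)) ℝ :=
  coeff g₀.inner ψ z

lemma posDef_gram (hψ : ψ ∈ 𝒜) {z : E n} (hz : z ∈ ψ.target) : (gram g₀ ψ z).PosDef :=
  posDef_coeff hψ hz (fun u v => g₀.symm _ u v) (fun u hu => g₀.pos _ u hu)

lemma contDiffAt_gram_apply (hψ : ψ ∈ 𝒜) {z : E n} (hz : z ∈ ψ.target) (i j : Fin (2 * n)) :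
    ContDiffAt ℝ ∞ (fun z => gram g₀ ψ z i j) z := by
  have h1 : ∀ i : Fin (2 * n), ContMDiffAt 𝓘(ℝ, E n) 𝓘(ℝ, E n).tangent ∞
      (fun w : E n => frameVec ψ w (stdVec i)) z := fun i =>
    contMDiffAt_frameVec hψ contDiffAt_id contDiffAt_const hz
  have h2 : ContMDiffAt 𝓘(ℝ, E n) (𝓘(ℝ, E n).prod 𝓘(ℝ, E n →L[ℝ] E n →L[ℝ] ℝ)) ∞
      (fun w => TotalSpace.mk' (E n →L[ℝ] E n →L[ℝ] ℝ)
        (E := fun x : X => TangentSpace 𝓘(ℝ, E n) x →L[ℝ] TangentSpace 𝓘(ℝ, E n) x →L[ℝ] ℝ)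
        (ψ.symm w) (g₀.inner (ψ.symm w))) z :=
    (g₀.contMDiff _).comp z (contMDiffAt_chart_symm hψ hz)
  have h3 := ContMDiffAt.clm_bundle_apply₂ (F₁ := E n) (F₂ := E n) (F₃ := ℝ)
    (E₁ := fun x : X => TangentSpace 𝓘(ℝ, E n) x) (E₂ := fun x : X => TangentSpace 𝓘(ℝ, E n) x)
    (E₃ := fun _ : X => ℝ) h2 (h1 i) (h1 j)
  rw [contMDiffAt_totalSpace] at h3
  exact h3.2.contDiffAt

/-- The point of `D` with tangential coordinates `x`. -/
def slicePt (x : Tang n k) : E n := (split k).symm (x, 0)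

/-- The vector which is `g₀`-dual to the conormal vector `η`. -/
def nvec (ψ : OpenPartialHomeomorph X (E n)) (x : Tang n k) (η : Norm n k) : E n :=
  WithLp.toLp 2 ((gram g₀ ψ (slicePt x))⁻¹.mulVec ((split k).symm (0, η)).ofLp)

/-- The squared length of `nvec`. -/
def nvecSq (ψ : OpenPartialHomeomorph X (E n)) (x : Tang n k) (η : Norm n k) : ℝ :=
  inner ℝ (split k (nvec g₀ ψ x η)).2 η

/-- The unit normal vector which is dual to a multiple of the conormal vector `η`. -/
def unitNormal (ψ : OpenPartialHomeomorph X (E n)) (x : Tang n k) (η : Norm n k) :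
    TangentBundle 𝓘(ℝ, E n) X :=
  frameVec ψ (slicePt x) ((√(nvecSq g₀ ψ x η))⁻¹ • nvec g₀ ψ x η)

/-- The normal component of `nvec`. -/
def nvecNormal (ψ : OpenPartialHomeomorph X (E n)) (x : Tang n k) : Norm n k →L[ℝ] Norm n k :=
  LinearMap.toContinuousLinearMap
    { toFun := fun η => (split k (nvec g₀ ψ x η)).2
      map_add' := fun η η' => by
        have : ((0 : Tang n k), η + η') = (0, η) + (0, η') := by simp
        simp only [nvec]
        rw [this, map_add, WithLp.ofLp_add, Matrix.mulVec_add, WithLp.toLp_add, map_add]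
        rfl
      map_smul' := fun c η => by
        have : ((0 : Tang n k), c • η) = c • (0, η) := by simp
        simp only [nvec]
        rw [this, map_smul, WithLp.ofLp_smul, Matrix.mulVec_smul, WithLp.toLp_smul, map_smul]
        rfl }

lemma nvecNormal_apply (x : Tang n k) (η : Norm n k) :
    nvecNormal g₀ ψ x η = (split k (nvec g₀ ψ x η)).2 := rfl

lemma nvec_smul (x : Tang n k) (c : ℝ) (η : Norm n k) :
    nvec g₀ ψ x (c • η) = c • nvec g₀ ψ x η := by
  have : ((0 : Tang n k), c • η) = c • (0, η) := by simp
  simp only [nvec]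
  rw [this, map_smul, WithLp.ofLp_smul, Matrix.mulVec_smul, WithLp.toLp_smul]

lemma nvecSq_smul (x : Tang n k) (c : ℝ) (η : Norm n k) :
    nvecSq g₀ ψ x (c • η) = c ^ 2 * nvecSq g₀ ψ x η := by
  rw [nvecSq, nvec_smul, map_smul, Prod.smul_snd, inner_smul_left, inner_smul_right, nvecSq]
  simp; ring

lemma unitNormal_smul (x : Tang n k) {c : ℝ} (hc : 0 < c) (η : Norm n k) :
    unitNormal g₀ ψ x (c • η) = unitNormal g₀ ψ x η := by
  rw [unitNormal, unitNormal, nvecSq_smul, nvec_smul, Real.sqrt_mul (sq_nonneg c),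
    Real.sqrt_sq hc.le, smul_smul, mul_inv, mul_right_comm, inv_mul_cancel₀ hc.ne', one_mul]

variable {g₀} in
lemma gram_mulVec_nvec (hψ : ψ ∈ 𝒜) {x : Tang n k} (hx : slicePt x ∈ ψ.target) (η : Norm n k) :
    (gram g₀ ψ (slicePt x)).mulVec (nvec g₀ ψ x η).ofLp = ((split k).symm (0, η)).ofLp := by
  have hu : IsUnit (gram g₀ ψ (slicePt x)).det := (posDef_gram g₀ hψ hx).det_pos.ne'.isUnit
  rw [nvec, Matrix.mulVec_mulVec, Matrix.mul_nonsing_inv _ hu, Matrix.one_mulVec]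

-- `nvec` raises the index of the covector `(0, η)`. Pairing with it gives back the covector, so
-- `nvec` is orthogonal to the tangent space of `D`, and `nvecSq` is its squared length.
variable {g₀} in
lemma inner_frameMap_nvec (hψ : ψ ∈ 𝒜) {x : Tang n k} (hx : slicePt x ∈ ψ.target) (b : E n)
    (η : Norm n k) :
    bilinE g₀.inner (ψ.symm (slicePt x)) (frameMap ψ (slicePt x) b)
      (frameMap ψ (slicePt x) (nvec g₀ ψ x η)) = inner ℝ (split k b).2 η := by
  have h := bilinE_frameMap g₀.inner ψ (slicePt x) b (nvec g₀ ψ x η)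
  rw [h]
  change b.ofLp ⬝ᵥ (gram g₀ ψ (slicePt x)).mulVec _ = _
  rw [gram_mulVec_nvec hψ hx, inner_split (k := k)]
  simp

lemma nvec_eq_zero (hψ : ψ ∈ 𝒜) {x : Tang n k} (hx : slicePt x ∈ ψ.target) {η : Norm n k}
    (h : nvec g₀ ψ x η = 0) : η = 0 := by
  have h1 := gram_mulVec_nvec (g₀ := g₀) hψ hx η
  rw [h, WithLp.ofLp_zero, Matrix.mulVec_zero] at h1
  have h2 : (split k).symm (0, η) = 0 := by
    ext i; exact (congrFun h1 i).symm
  have h3 := congrArg (split k) h2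
  rw [ContinuousLinearEquiv.apply_symm_apply, map_zero] at h3
  exact congrArg Prod.snd h3

lemma nvecSq_pos (hψ : ψ ∈ 𝒜) {x : Tang n k} (hx : slicePt x ∈ ψ.target) {η : Norm n k}
    (hη : η ≠ 0) : 0 < nvecSq g₀ ψ x η := by
  rw [nvecSq, ← inner_frameMap_nvec hψ hx]
  refine g₀.pos _ _ fun h0 => hη (nvec_eq_zero g₀ hψ hx ?_)
  rw [← coframeMap_frameMap hψ hx (nvec g₀ ψ x η)]
  exact (congrArg (coframeMap ψ (ψ.symm (slicePt x))) h0).trans (map_zero _)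

/-- The quadratic form `⟨nvecNormal η, η⟩` is positive definite. -/
lemma injective_nvecNormal (hψ : ψ ∈ 𝒜) {x : Tang n k} (hx : slicePt x ∈ ψ.target) :
    Function.Injective (nvecNormal g₀ ψ x) := by
  rw [injective_iff_map_eq_zero]
  intro η h
  by_contra hη
  have := nvecSq_pos g₀ hψ hx hη
  rw [nvecSq, ← nvecNormal_apply, h, inner_zero_left] at this
  exact lt_irrefl _ this

lemma IsSliceChart.mem_iff (hψ : IsSliceChart D k p ψ) : ∀ x ∈ ψ.source,
    x ∈ D ↔ (split k (ψ x)).2 = 0 := fun x hx => by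
  rw [split_snd_eq_zero_iff]; exact hψ.2.2 x hx

lemma IsSliceChart.slicePt_mem (hψ : IsSliceChart D k p ψ) {x : Tang n k}
    (hx : slicePt x ∈ ψ.target) : ψ.symm (slicePt x) ∈ D := by
  rw [hψ.mem_iff _ (ψ.map_target hx), ψ.right_inv hx]
  simp [slicePt]

lemma coframeMap_unitNormal (hψ : ψ ∈ 𝒜) {x : Tang n k} (hx : slicePt x ∈ ψ.target)
    (η : Norm n k) : (split k (coframeMap ψ (ψ.symm (slicePt x)) (unitNormal g₀ ψ x η).snd)).2 =
      (√(nvecSq g₀ ψ x η))⁻¹ • nvecNormal g₀ ψ x η := by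
  have : coframeMap ψ (ψ.symm (slicePt x)) (unitNormal g₀ ψ x η).snd =
      (√(nvecSq g₀ ψ x η))⁻¹ • nvec g₀ ψ x η := coframeMap_frameMap hψ hx _
  rw [this, map_smul]
  rfl

lemma IsSliceChart.unitNormal_mem (hψ : IsSliceChart D k p ψ) {x : Tang n k}
    (hx : slicePt x ∈ ψ.target) {η : Norm n k} (hη : η ≠ 0) :
    unitNormal g₀ ψ x η ∈ normalSphere D g₀ := by
  have hq := nvecSq_pos g₀ hψ.1 hx hη
  have hq' := Real.sqrt_pos.2 hq
  refine ⟨hψ.slicePt_mem hx, ?_, fun w hw => ?_⟩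
  · change bilinE g₀.inner (ψ.symm (slicePt x)) (frameMap ψ (slicePt x) _)
      (frameMap ψ (slicePt x) _) = 1
    rw [map_smul, map_smul, map_smul, ContinuousLinearMap.smul_apply,
      inner_frameMap_nvec hψ.1 hx]
    change _ • _ • nvecSq g₀ ψ x η = _
    rw [smul_smul, ← mul_inv, Real.mul_self_sqrt hq.le, smul_eq_mul, inv_mul_cancel₀ hq.ne']
  · have hw' := (mem_tangentTo_iff hψ.1 hψ.mem_iff (ψ.map_target hx) (hψ.slicePt_mem hx) w).1 hw
    refine (g₀.symm _ _ _).trans ?_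
    change bilinE g₀.inner (ψ.symm (slicePt x)) w (frameMap ψ (slicePt x) _) = 0
    have h1 := frameMap_coframeMap hψ.1 (ψ.map_target hx) w
    rw [ψ.right_inv hx] at h1
    rw [map_smul, map_smul, ← h1, inner_frameMap_nvec hψ.1 hx, hw', inner_zero_left, smul_zero]

lemma slicePt_fst {y : E n} (h : (split k y).2 = 0) : slicePt (split k y).1 = y := by
  rw [slicePt, ← h]
  exact (split k).symm_apply_apply y

/-- Lowering the index of a normal vector gives a covector that annihilates the tangent space of
`D`, hence of the form `(0, η)`. Raising it again recovers the vector, and only the direction of `η`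
matters. -/
lemma IsSliceChart.exists_unitNormal (hψ : IsSliceChart D k p ψ)
    {v : TangentBundle 𝓘(ℝ, E n) X} (hv : v ∈ normalSphere D g₀) (hvs : v.proj ∈ ψ.source) :
    slicePt (split k (ψ v.proj)).1 = ψ v.proj ∧
      ∃ θ : Norm n k, ‖θ‖ = 1 ∧ unitNormal g₀ ψ (split k (ψ v.proj)).1 θ = v := by
  obtain ⟨q, u⟩ := v
  obtain ⟨hqD, hu1, hu2⟩ := hv
  simp only at hvs hqD hu1 hu2 ⊢
  have hz := slicePt_fst ((hψ.mem_iff q hvs).1 hqD)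
  refine ⟨hz, ?_⟩
  set x := (split k (ψ q)).1 with hxdef
  have hx : slicePt x ∈ ψ.target := by rw [hz]; exact ψ.map_source hvs
  have hq : ψ.symm (slicePt x) = q := by rw [hz, ψ.left_inv hvs]
  clear_value x
  subst hq
  set a := coframeMap ψ (ψ.symm (slicePt x)) u with ha
  have hfa : frameMap ψ (slicePt x) a = u := by
    have := frameMap_coframeMap hψ.1 (ψ.map_target hx) u
    rwa [ψ.right_inv hx] at this
  set c : E n := WithLp.toLp 2 ((gram g₀ ψ (slicePt x)).mulVec a.ofLp) with hc
  have hkey : ∀ b : E n, bilinE g₀.inner (ψ.symm (slicePt x)) (frameMap ψ (slicePt x) b) u =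
      b.ofLp ⬝ᵥ c.ofLp := fun b => by
    have := bilinE_frameMap g₀.inner ψ (slicePt x) b a
    rw [hfa] at this
    exact this
  -- The covector is tested on the tangent vector of `D` whose tangential coordinates are those of
  -- the covector itself.
  have hc1 : (split k c).1 = 0 := by
    set b : E n := (split k).symm ((split k c).1, 0) with hb
    have hsb : split k b = ((split k c).1, 0) := by rw [hb]; simp
    have h1 : frameMap ψ (slicePt x) b ∈ tangentTo (n := n) D (ψ.symm (slicePt x)) := by
      rw [mem_tangentTo_iff hψ.1 hψ.mem_iff (ψ.map_target hx) (hψ.slicePt_mem hx),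
        coframeMap_frameMap hψ.1 hx, hsb]
    have h2 := (g₀.symm _ _ _).trans (hu2 _ h1)
    have h3 := (hkey b).symm.trans h2
    rw [inner_split (k := k), hsb] at h3
    simpa using h3
  set η := (split k c).2 with hη
  have hcs : (split k).symm (0, η) = c := by
    rw [ContinuousLinearEquiv.symm_apply_eq, ← hc1, hη]
  have hna : nvec g₀ ψ x η = a := by
    have hu : IsUnit (gram g₀ ψ (slicePt x)).det := (posDef_gram g₀ hψ.1 hx).det_pos.ne'.isUnit
    rw [nvec, hcs, hc, Matrix.mulVec_mulVec, Matrix.nonsing_inv_mul _ hu, Matrix.one_mulVec]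
  have hsq : nvecSq g₀ ψ x η = 1 := by
    rw [nvecSq, ← inner_frameMap_nvec hψ.1 hx, hna, hfa]
    exact hu1
  have hη0 : η ≠ 0 := fun h0 => by
    rw [nvecSq, h0, inner_zero_right] at hsq
    exact zero_ne_one hsq
  refine ⟨‖η‖⁻¹ • η, norm_smul_inv_norm hη0, ?_⟩
  rw [unitNormal_smul _ _ (inv_pos.2 (norm_pos_iff.2 hη0)), unitNormal, hsq, hna, frameVec]
  simp only [Real.sqrt_one, inv_one, one_smul]
  exact congrArg _ hfa

/-- Equality of the normalized vectors gives `a θ = b θ'` with `a, b > 0`; as both directions are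
unit vectors, they coincide. -/
lemma unitNormal_injective (hψ : ψ ∈ 𝒜) {x x' : Tang n k} (hx : slicePt x ∈ ψ.target)
    (hx' : slicePt x' ∈ ψ.target) {θ θ' : Norm n k} (hθ : ‖θ‖ = 1) (hθ' : ‖θ'‖ = 1)
    (h : unitNormal g₀ ψ x θ = unitNormal g₀ ψ x' θ') : x = x' ∧ θ = θ' := by
  have hxx : x = x' := by
    have h1 : ψ.symm (slicePt x) = ψ.symm (slicePt x') := congrArg TotalSpace.proj h
    have h2 := ψ.symm.injOn hx hx' h1
    have h3 := (split k).symm.injective h2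
    exact congrArg Prod.fst h3
  subst hxx
  refine ⟨rfl, ?_⟩
  have hθ0 : θ ≠ 0 := fun h0 => by simp [h0] at hθ
  have hθ0' : θ' ≠ 0 := fun h0 => by simp [h0] at hθ'
  have hl := inv_pos.2 (Real.sqrt_pos.2 (nvecSq_pos g₀ hψ hx hθ0))
  have hl' := inv_pos.2 (Real.sqrt_pos.2 (nvecSq_pos g₀ hψ hx hθ0'))
  have h1 : frameMap ψ (slicePt x) ((√(nvecSq g₀ ψ x θ))⁻¹ • nvec g₀ ψ x θ) =
      frameMap ψ (slicePt x) ((√(nvecSq g₀ ψ x θ'))⁻¹ • nvec g₀ ψ x θ') :=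
    (TotalSpace.mk_inj (F := E n) (E := fun x : X => TangentSpace 𝓘(ℝ, E n) x)).1 h
  have h2 := congrArg (coframeMap ψ (ψ.symm (slicePt x))) h1
  rw [coframeMap_frameMap hψ hx, coframeMap_frameMap hψ hx, ← nvec_smul, ← nvec_smul] at h2
  set a := (√(nvecSq g₀ ψ x θ))⁻¹
  set b := (√(nvecSq g₀ ψ x θ'))⁻¹
  have h3 : a • θ = b • θ' := by
    rw [← sub_eq_zero]
    refine nvec_eq_zero g₀ hψ hx (k := k) ?_
    have h4 := (nvecNormal g₀ ψ x).map_sub (a • θ) (b • θ')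
    have : nvec g₀ ψ x (a • θ - b • θ') = nvec g₀ ψ x (a • θ) - nvec g₀ ψ x (b • θ') := by
      have : ((0 : Tang n k), a • θ - b • θ') = (0, a • θ) - (0, b • θ') := by simp
      simp only [nvec]
      rw [this, map_sub, WithLp.ofLp_sub, Matrix.mulVec_sub, WithLp.toLp_sub]
    rw [this, h2, sub_self]
  have h5 : a = b := by
    have := congrArg norm h3
    rwa [norm_smul, norm_smul, hθ, hθ', mul_one, mul_one, Real.norm_of_nonneg hl.le,
      Real.norm_of_nonneg hl'.le] at this
  rw [h5] at h3
  exact smul_right_injective _ hl'.ne' h3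

lemma contDiffAt_nvec (hψ : ψ ∈ 𝒜) {w : Tang n k × Norm n k} (hw : slicePt w.1 ∈ ψ.target) :
    ContDiffAt ℝ ∞ (fun w : Tang n k × Norm n k => nvec g₀ ψ w.1 w.2) w := by
  have h1 : ContDiff ℝ ∞ (fun w : Tang n k × Norm n k => (slicePt w.1 : E n)) :=
    (split k).symm.contDiff.comp (contDiff_fst.prodMk contDiff_const)
  have h2 : ContDiff ℝ ∞ (fun w : Tang n k × Norm n k => ((split k).symm (0, w.2) : E n)) :=
    (split k).symm.contDiff.comp (contDiff_const.prodMk contDiff_snd)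
  rw [contDiffAt_piLp]
  intro i
  have h3 : ∀ j, ContDiffAt ℝ ∞
      (fun w : Tang n k × Norm n k => (gram g₀ ψ (slicePt w.1))⁻¹ i j) w := fun j =>
    ContDiffAt.comp (g := fun z => (gram g₀ ψ z)⁻¹ i j) w
      (contDiffAt_inv_apply (fun a b => contDiffAt_gram_apply g₀ hψ hw a b)
        (posDef_gram g₀ hψ hw).det_pos.ne' i j) h1.contDiffAt
  have h4 : ∀ j, ContDiffAt ℝ ∞
      (fun w : Tang n k × Norm n k => ((split k).symm (0, w.2) : E n) j) w := fun j =>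
    (contDiff_piLp 2).1 h2 j |>.contDiffAt
  change ContDiffAt ℝ ∞ (fun w : Tang n k × Norm n k => ∑ j, (gram g₀ ψ (slicePt w.1))⁻¹ i j *
    ((split k).symm (0, w.2) : E n) j) w
  exact ContDiffAt.sum fun j _ => (h3 j).mul (h4 j)

lemma contMDiffAt_unitNormal (hψ : ψ ∈ 𝒜) {w : Tang n k × Norm n k}
    (hw : slicePt w.1 ∈ ψ.target) (hw2 : w.2 ≠ 0) :
    ContMDiffAt 𝓘(ℝ, Tang n k × Norm n k) 𝓘(ℝ, E n).tangent ∞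
      (fun w : Tang n k × Norm n k => unitNormal g₀ ψ w.1 w.2) w := by
  have h1 : ContDiff ℝ ∞ (fun w : Tang n k × Norm n k => (slicePt w.1 : E n)) :=
    (split k).symm.contDiff.comp (contDiff_fst.prodMk contDiff_const)
  have h2 := contDiffAt_nvec g₀ hψ hw
  have h3 : ContDiffAt ℝ ∞ (fun w : Tang n k × Norm n k => nvecSq g₀ ψ w.1 w.2) w :=
    ((contDiff_snd.contDiffAt.comp w ((split k).contDiff.contDiffAt.comp w h2))).inner ℝ
      contDiff_snd.contDiffAt
  have hq := nvecSq_pos g₀ hψ hw hw2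
  exact contMDiffAt_frameVec hψ h1.contDiffAt
    (((h3.sqrt hq.ne').inv (Real.sqrt_pos.2 hq).ne').smul h2) hw

end UnitNormal

/-! ### Polar tubes in an adapted chart -/

section Tube

variable {n : ℕ} {X : Type*} [TopologicalSpace X] [ChartedSpace (E n) X]
  [IsManifold 𝓘(ℝ, E n) ∞ X] {D : Set X} {k : ℕ} {p : X} {ψ : OpenPartialHomeomorph X (E n)}
  {g₀ : ContMDiffRiemannianMetric 𝓘(ℝ, E n) ∞ (E n) (fun x : X => TangentSpace 𝓘(ℝ, E n) x)}
  {ε : ℝ} {T : TangentBundle 𝓘(ℝ, E n) X → ℝ → X} {F : X → TangentBundle 𝓘(ℝ, E n) X × ℝ}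
  {U : Set X} {S : Set (TangentBundle 𝓘(ℝ, E n) X)}

local notation "𝒜" => IsManifold.maximalAtlas 𝓘(ℝ, E n) ∞ X

lemma IsPolarTube.mdifferentiableWithinAt (hT : IsPolarTube D S ε T F U)
    {v : TangentBundle 𝓘(ℝ, E n) X} (hv : v ∈ S) {r : ℝ} (hr : r ∈ Ico 0 ε) :
    MDifferentiableWithinAt 𝓘(ℝ, ℝ) 𝓘(ℝ, E n) (T v) (Ici 0) r := by
  have h1 : ContMDiffWithinAt 𝓘(ℝ, ℝ) (𝓘(ℝ, E n).tangent.prod 𝓘(ℝ, ℝ)) ∞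
      (fun ρ : ℝ => (v, ρ)) (Ico 0 ε) r :=
    contMDiffWithinAt_const.prodMk contMDiffWithinAt_id
  have h2 : ContMDiffWithinAt 𝓘(ℝ, ℝ) 𝓘(ℝ, E n) ∞ (T v) (Ico 0 ε) r :=
    ContMDiffWithinAt.comp (t := S ×ˢ Ico 0 ε) r (hT.smooth (v, r) ⟨hv, hr⟩) h1
      (fun ρ hρ => ⟨hv, hρ⟩)
  refine (h2.mdifferentiableWithinAt (by simp)).mono_of_mem_nhdsWithin ?_
  rw [← Ici_inter_Iio]
  exact inter_mem_nhdsWithin _ (Iio_mem_nhds hr.2)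

lemma IsPolarTube.mdifferentiableAt (hT : IsPolarTube D S ε T F U)
    {v : TangentBundle 𝓘(ℝ, E n) X} (hv : v ∈ S) {r : ℝ} (hr : r ∈ Ioo 0 ε) :
    MDifferentiableAt 𝓘(ℝ, ℝ) 𝓘(ℝ, E n) (T v) r :=
  (hT.mdifferentiableWithinAt hv ⟨hr.1.le, hr.2⟩).mdifferentiableAt (Ici_mem_nhds hr.1)

lemma radialVec_eq_mfderiv {v : TangentBundle 𝓘(ℝ, E n) X} {r : ℝ} (hr : 0 < r) :
    radialVec T v r = mfderiv 𝓘(ℝ, ℝ) 𝓘(ℝ, E n) (T v) r (1 : ℝ) := by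
  rw [radialVec, mfderivWithin_of_mem_nhds (Ici_mem_nhds hr)]

lemma IsPolarTube.hasDerivWithinAt_chart (hT : IsPolarTube D S ε T F U) (hψ : ψ ∈ 𝒜)
    {v : TangentBundle 𝓘(ℝ, E n) X} (hv : v ∈ S) {r : ℝ} (hr : r ∈ Ico 0 ε)
    (hs : T v r ∈ ψ.source) :
    HasDerivWithinAt (fun ρ => ψ (T v ρ)) (coframeMap ψ (T v r) (radialVec T v r)) (Ici 0) r := by
  have h1 := (mdifferentiableAt_chart hψ hs).hasMFDerivAt.comp_hasMFDerivWithinAt r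
    (hT.mdifferentiableWithinAt hv hr).hasMFDerivWithinAt
  have h2 : HasFDerivWithinAt (fun ρ => ψ (T v ρ)) ((coframeMap ψ (T v r)).comp
      (mfderivWithin 𝓘(ℝ, ℝ) 𝓘(ℝ, E n) (T v) (Ici 0) r : ℝ →L[ℝ] E n)) (Ici 0) r :=
    h1.hasFDerivWithinAt
  exact h2.hasDerivWithinAt

/-- A polar tube along `D`, in an adapted chart. -/
def tubeParam (g₀ : ContMDiffRiemannianMetric 𝓘(ℝ, E n) ∞ (E n)
      (fun x : X => TangentSpace 𝓘(ℝ, E n) x))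
    (T : TangentBundle 𝓘(ℝ, E n) X → ℝ → X) (ψ : OpenPartialHomeomorph X (E n))
    (q : (Tang n k × Norm n k) × ℝ) : Tang n k × Norm n k :=
  split k (ψ (T (unitNormal g₀ ψ q.1.1 q.1.2) q.2))

lemma contMDiffOn_tube (hT : IsPolarTube D (normalSphere D g₀) ε T F U)
    (hψ : IsSliceChart D k p ψ) :
    ContMDiffOn 𝓘(ℝ, (Tang n k × Norm n k) × ℝ) 𝓘(ℝ, E n) ∞
      (fun q : (Tang n k × Norm n k) × ℝ => T (unitNormal g₀ ψ q.1.1 q.1.2) q.2)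
      (polarDomain {x : Tang n k | slicePt x ∈ ψ.target} ε) := by
  rintro ⟨⟨x, η⟩, ρ⟩ ⟨⟨hx, hη⟩, hρ⟩
  have h1 : ContMDiffAt 𝓘(ℝ, (Tang n k × Norm n k) × ℝ) 𝓘(ℝ, E n).tangent ∞
      (fun q : (Tang n k × Norm n k) × ℝ => unitNormal g₀ ψ q.1.1 q.1.2) ((x, η), ρ) :=
    ContMDiffAt.comp (I' := 𝓘(ℝ, Tang n k × Norm n k))
      (g := fun w : Tang n k × Norm n k => unitNormal g₀ ψ w.1 w.2)
      (f := fun q : (Tang n k × Norm n k) × ℝ => q.1) ((x, η), ρ)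
      (contMDiffAt_unitNormal g₀ hψ.1 (w := (x, η)) hx hη) contDiffAt_fst.contMDiffAt
  have h2 : ContMDiffAt 𝓘(ℝ, (Tang n k × Norm n k) × ℝ) 𝓘(ℝ, ℝ) ∞
      (fun q : (Tang n k × Norm n k) × ℝ => q.2) ((x, η), ρ) := contDiffAt_snd.contMDiffAt
  exact ContMDiffWithinAt.comp (t := normalSphere D g₀ ×ˢ Ico 0 ε)
    (g := fun q : TangentBundle 𝓘(ℝ, E n) X × ℝ => T q.1 q.2)
    (f := fun q : (Tang n k × Norm n k) × ℝ => (unitNormal g₀ ψ q.1.1 q.1.2, q.2)) ((x, η), ρ)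
    (hT.smooth (unitNormal g₀ ψ x η, ρ) ⟨hψ.unitNormal_mem g₀ hx hη, hρ⟩)
    (h1.prodMk h2).contMDiffWithinAt
    (fun q hq => ⟨hψ.unitNormal_mem g₀ hq.1.1 hq.1.2, hq.2⟩)

lemma isOpen_slice (ψ : OpenPartialHomeomorph X (E n)) :
    IsOpen {x : Tang n k | slicePt x ∈ ψ.target} := by
  refine ψ.open_target.preimage ?_
  exact (split k).symm.continuous.comp (continuous_id.prodMk continuous_const)

/-- In an adapted chart, a polar tube is a polar parametrization. -/
theorem IsPolarTube.exists_isPolarParam (hT : IsPolarTube D (normalSphere D g₀) ε T F U)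
    (hψ : IsSliceChart D k p ψ) (hp : p ∈ D) :
    ∃ δ : ℝ, 0 < δ ∧ δ ≤ ε ∧
      (∀ x ∈ Metric.ball (split k (ψ p)).1 δ, slicePt x ∈ ψ.target ∧
        ∀ η : Norm n k, η ≠ 0 → ∀ ρ ∈ Ico 0 δ, T (unitNormal g₀ ψ x η) ρ ∈ ψ.source) ∧
      IsPolarParam (Metric.ball (split k (ψ p)).1 δ) δ (tubeParam g₀ T ψ)
        (nvecNormal g₀ ψ) := by
  set x₀ := (split k (ψ p)).1 with hx₀
  have hz₀ : slicePt x₀ = ψ p := slicePt_fst ((hψ.mem_iff p hψ.2.1).1 hp)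
  set N₀ := {x : Tang n k | slicePt x ∈ ψ.target} with hN₀
  have hx₀N : x₀ ∈ N₀ := by
    change slicePt x₀ ∈ ψ.target
    rw [hz₀]; exact ψ.map_source hψ.2.1
  have hM := contMDiffOn_tube hT hψ
  -- At `ρ = 0` and `x = x₀` every direction is sent to `p`. By compactness of the unit sphere the
  -- tube stays in the chart domain for all directions at once, for small `ρ` and `x` near `x₀`.
  have hev : ∀ᶠ q : Tang n k × ℝ in 𝓝 (x₀, 0), ∀ θ ∈ Metric.sphere (0 : Norm n k) 1,
      q.1 ∈ N₀ → q.2 ∈ Ico 0 ε → T (unitNormal g₀ ψ q.1 θ) q.2 ∈ ψ.source := by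
    refine (isCompact_sphere (0 : Norm n k) 1).eventually_forall_of_forall_eventually
      fun θ hθ => ?_
    have hθ0 : θ ≠ 0 := fun h => by simp [h] at hθ
    have hdom : ((x₀, θ), (0 : ℝ)) ∈ polarDomain N₀ ε := ⟨⟨hx₀N, hθ0⟩, le_rfl, hT.eps_pos⟩
    have hval : T (unitNormal g₀ ψ x₀ θ) 0 = p := by
      rw [hT.zero _ (hψ.unitNormal_mem g₀ hx₀N hθ0)]
      change ψ.symm (slicePt x₀) = p
      rw [hz₀, ψ.left_inv hψ.2.1]
    have h1 := (hM.continuousOn _ hdom).preimage_mem_nhdsWithin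
      (ψ.open_source.mem_nhds (by simp only [hval]; exact hψ.2.1))
    rw [mem_nhdsWithin_iff_eventually] at h1
    have hc : Continuous fun z : (Tang n k × ℝ) × Norm n k => ((z.1.1, z.2), z.1.2) := by fun_prop
    have h2 := (hc.tendsto ((x₀, 0), θ)).eventually h1
    have h3 : ∀ᶠ z : (Tang n k × ℝ) × Norm n k in 𝓝 ((x₀, 0), θ), z.2 ≠ 0 :=
      (continuous_snd.tendsto ((x₀, (0 : ℝ)), θ)).eventually (isOpen_ne.mem_nhds hθ0)
    filter_upwards [h2, h3] with z hz hz3 hN hε using hz ⟨⟨hN, hz3⟩, hε⟩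
  obtain ⟨δ₁, hδ₁, hb₁⟩ := Metric.eventually_nhds_iff_ball.1 hev
  obtain ⟨δ₂, hδ₂, hb₂⟩ := Metric.isOpen_iff.1 (isOpen_slice (k := k) ψ) x₀ hx₀N
  set δ := min (min δ₁ δ₂) ε with hδdef
  have hδ : 0 < δ := lt_min (lt_min hδ₁ hδ₂) hT.eps_pos
  have hδε : δ ≤ ε := min_le_right _ _
  have hδ1 : δ ≤ δ₁ := (min_le_left _ _).trans (min_le_left _ _)
  have hδ2 : δ ≤ δ₂ := (min_le_left _ _).trans (min_le_right _ _)
  have hN : ∀ x ∈ Metric.ball x₀ δ, slicePt x ∈ ψ.target := fun x hx =>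
    hb₂ (Metric.ball_subset_ball hδ2 hx)
  have hsrc : ∀ x ∈ Metric.ball x₀ δ, ∀ η : Norm n k, η ≠ 0 → ∀ ρ ∈ Ico 0 δ,
      T (unitNormal g₀ ψ x η) ρ ∈ ψ.source := by
    intro x hx η hη ρ hρ
    rw [← unitNormal_smul g₀ x (inv_pos.2 (norm_pos_iff.2 hη)) η]
    refine hb₁ (x, ρ) ?_ (‖η‖⁻¹ • η) (by simpa using norm_smul_inv_norm (𝕜 := ℝ) hη) (hN x hx)
      ⟨hρ.1, hρ.2.trans_le hδε⟩
    rw [Metric.mem_ball, Prod.dist_eq, max_lt_iff]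
    refine ⟨(Metric.mem_ball.1 hx).trans_le hδ1, ?_⟩
    rw [Real.dist_eq, sub_zero, abs_of_nonneg hρ.1]
    exact hρ.2.trans_le hδ1
  refine ⟨δ, hδ, hδε, fun x hx => ⟨hN x hx, hsrc x hx⟩, ?_⟩
  have hsub : polarDomain (V'' := Norm n k) (Metric.ball x₀ δ) δ ⊆ polarDomain N₀ ε := by
    rintro q ⟨⟨h1, h2⟩, h3⟩
    exact ⟨⟨hN _ h1, h2⟩, h3.1, h3.2.trans_le hδε⟩
  have hsmooth : ContDiffOn ℝ 2 (tubeParam g₀ T ψ) (polarDomain (Metric.ball x₀ δ) δ) := by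
    intro q hq
    have h1 := (hM.mono hsub) q hq
    have h2 : ContMDiffWithinAt 𝓘(ℝ, (Tang n k × Norm n k) × ℝ) 𝓘(ℝ, E n) ∞
        (fun q : (Tang n k × Norm n k) × ℝ => ψ (T (unitNormal g₀ ψ q.1.1 q.1.2) q.2))
        (polarDomain (Metric.ball x₀ δ) δ) q :=
      ContMDiffAt.comp_contMDiffWithinAt q
        (contMDiffAt_chart hψ.1 (hsrc _ hq.1.1 _ hq.1.2 _ hq.2)) h1
    have h3 := (split k).contDiff.contDiffAt.comp_contDiffWithinAt q h2.contDiffWithinAt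
    exact h3.of_le (by norm_cast)
  refine ⟨Metric.isOpen_ball, hδ, hsmooth, fun x hx η hη => ?_, fun x η r hr ρ => ?_,
    fun x hx => injective_nvecNormal g₀ hψ.1 (hN x hx), fun x hx η hη => ?_⟩
  · rw [tubeParam]
    simp only
    rw [hT.zero _ (hψ.unitNormal_mem g₀ (hN x hx) hη)]
    change split k (ψ (ψ.symm (slicePt x))) = _
    rw [ψ.right_inv (hN x hx), slicePt, ContinuousLinearEquiv.apply_symm_apply]
  · simp only [tubeParam, unitNormal_smul g₀ x hr η]
  · set v := unitNormal g₀ ψ x η with hv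
    have hvS : v ∈ normalSphere D g₀ := hψ.unitNormal_mem g₀ (hN x hx) hη
    have h0 : (0 : ℝ) ∈ Ico 0 ε := ⟨le_rfl, hT.eps_pos⟩
    have hs0 : T v 0 ∈ ψ.source := hsrc x hx η hη 0 ⟨le_rfl, hδ⟩
    have h1 := hT.hasDerivWithinAt_chart hψ.1 hvS h0 hs0
    have h2 : HasDerivWithinAt (fun ρ => tubeParam (k := k) g₀ T ψ ((x, η), ρ))
        (split k (coframeMap ψ (T v 0) (radialVec T v 0))) (Ici 0) 0 :=
      ((split (n := n) k : E n →L[ℝ] Tang n k × Norm n k).hasFDerivAt).comp_hasDerivWithinAt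
        (0 : ℝ) h1
    have hmem : (((x, η), (0 : ℝ)) : (Tang n k × Norm n k) × ℝ) ∈
        polarDomain (Metric.ball x₀ δ) δ := ⟨⟨hx, hη⟩, le_rfl, hδ⟩
    have h3 : HasDerivWithinAt (fun ρ => tubeParam (k := k) g₀ T ψ ((x, η), ρ))
        (fderivWithin ℝ (tubeParam g₀ T ψ) (polarDomain (Metric.ball x₀ δ) δ) ((x, η), 0) (0, 1))
        (Ico 0 δ) 0 := by
      refine HasFDerivWithinAt.comp_hasDerivWithinAt (f := fun ρ : ℝ => ((x, η), ρ)) (0 : ℝ)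
        ((hsmooth.differentiableOn two_ne_zero _ hmem).hasFDerivWithinAt) ?_
        (fun ρ hρ => ⟨⟨hx, hη⟩, hρ⟩)
      exact (hasDerivWithinAt_const (0 : ℝ) _ (x, η)).prodMk (hasDerivWithinAt_id (0 : ℝ) _)
    have h4 := (uniqueDiffOn_Ico (0 : ℝ) δ 0 ⟨le_rfl, hδ⟩).eq_deriv _ h3
      (h2.mono Ico_subset_Ici_self)
    rw [h4]
    -- Modulo the tangent space of `D` the initial velocity is `c v`, and the normal part of `v` is
    -- a positive multiple of `nvecNormal η`.
    obtain ⟨c, hc, hdir⟩ := hT.direction v hvS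
    have hT0 : T v 0 = ψ.symm (slicePt x) := hT.zero v hvS
    have h5 := (mem_tangentTo_iff hψ.1 hψ.mem_iff (ψ.map_target (hN x hx))
      (hψ.slicePt_mem (hN x hx)) _).1 hdir
    rw [map_sub, map_smul, map_sub, map_smul, Prod.snd_sub, sub_eq_zero] at h5
    have hl := inv_pos.2 (Real.sqrt_pos.2 (nvecSq_pos g₀ hψ.1 (hN x hx) hη))
    refine ⟨c * (√(nvecSq g₀ ψ x η))⁻¹, mul_pos hc hl, ?_⟩
    rw [hT0, h5, mul_smul, ← coframeMap_unitNormal g₀ hψ.1 (hN x hx)]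
    rfl

end Tube

/-! ### Integration in polar coordinates -/

section PolarIntegration

variable {n : ℕ} {X : Type*} [TopologicalSpace X] [T2Space X] [CompactSpace X]
  [ChartedSpace (E n) X] [IsManifold 𝓘(ℝ, E n) ∞ X] [MeasurableSpace X] [BorelSpace X]
  {D : Set X} {k : ℕ} {g : BilinField (n := n) X} {J : EndField (n := n) X}
  {ψ : OpenPartialHomeomorph X (E n)}

local notation "𝒜" => IsManifold.maximalAtlas 𝓘(ℝ, E n) ∞ X

lemma measurableSet_source_inter_preimage (ψ : OpenPartialHomeomorph X (E n)) {B : Set (E n)}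
    (hB : MeasurableSet B) : MeasurableSet (ψ.source ∩ ψ ⁻¹' B) := by
  have h1 : Measurable (fun x : ψ.source => ψ x) :=
    (continuousOn_iff_continuous_restrict.1 ψ.continuousOn).measurable
  have h2 := MeasurableSet.subtype_image ψ.open_source.measurableSet (h1 hB)
  have h3 : Subtype.val '' ((fun x : ψ.source => ψ x) ⁻¹' B) = ψ.source ∩ ψ ⁻¹' B := by
    ext x
    simp [and_comm]
  rwa [h3] at h2

/-- Change of variables for the Riemannian volume. -/
lemma lintegral_vol_image (hK : IsKahlerOff D g J) (hD : IsClosed D) (hψ : ψ ∈ 𝒜)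
    {P : Tang n k × Norm n k → X}
    {L : Tang n k × Norm n k → (Tang n k × Norm n k) →L[ℝ] (Tang n k × Norm n k)}
    {A : Set (Tang n k × Norm n k)} (hA : MeasurableSet A)
    (hP : ∀ w ∈ A, P w ∈ ψ.source ∧ P w ∉ D) (hinj : InjOn P A)
    (hL : ∀ w ∈ A, HasFDerivAt (fun w => split k (ψ (P w))) (L w) w) (H : X → ℝ≥0∞) :
    ∫⁻ x in P '' A, H x ∂(vol D g) =
      ∫⁻ w in A, ENNReal.ofReal |(L w).det| * (dens g ψ (ψ (P w)) * H (P w)) := by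
  set Ψ : Tang n k × Norm n k → Tang n k × Norm n k := fun w => split k (ψ (P w)) with hΨ
  have hΨinj : InjOn Ψ A := fun w hw w' hw' h =>
    hinj hw hw' (ψ.injOn (hP w hw).1 (hP w' hw').1 ((split k).injective h))
  have hL' : ∀ w ∈ A, HasFDerivWithinAt Ψ (L w) A w := fun w hw => (hL w hw).hasFDerivWithinAt
  have hΨm : MeasurableSet (Ψ '' A) := measurable_image_of_fderivWithin hA hL' hΨinj
  set B : Set (E n) := split k ⁻¹' (Ψ '' A) with hB
  have hBm : MeasurableSet B := (split k).continuous.measurable hΨm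
  have hPB : P '' A = ψ.source ∩ ψ ⁻¹' B := by
    ext x
    constructor
    · rintro ⟨w, hw, rfl⟩
      exact ⟨(hP w hw).1, mem_image_of_mem Ψ hw⟩
    · rintro ⟨hx, w, hw, hwx⟩
      exact ⟨w, hw, ψ.injOn (hP w hw).1 hx ((split k).injective hwx)⟩
  have hPm : MeasurableSet (P '' A) := hPB ▸ measurableSet_source_inter_preimage ψ hBm
  have hBdom : B ⊆ chartDom D ψ := by
    rintro y ⟨w, hw, hwy⟩
    have : y = ψ (P w) := ((split k).injective hwy).symm
    rw [this]
    refine ⟨ψ.map_source (hP w hw).1, ?_⟩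
    rw [mem_preimage, ψ.left_inv (hP w hw).1]
    exact (hP w hw).2
  have h1 : ∫⁻ x in P '' A, H x ∂(vol D g) =
      ∫⁻ x in ψ.source, (P '' A).indicator H x ∂(vol D g) := by
    rw [lintegral_indicator hPm, Measure.restrict_restrict hPm, inter_eq_left.2]
    rw [hPB]; exact inter_subset_left
  have h2 : ∫⁻ y in chartDom D ψ, dens g ψ y * (P '' A).indicator H (ψ.symm y) =
      ∫⁻ y in chartDom D ψ, B.indicator (fun y => dens g ψ y * H (ψ.symm y)) y := by
    refine setLIntegral_congr_fun (isOpen_chartDom hD ψ).measurableSet fun y hy => ?_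
    by_cases hyB : y ∈ B
    · have : ψ.symm y ∈ P '' A := by
        rw [hPB]; exact ⟨ψ.map_target hy.1, by rw [mem_preimage, ψ.right_inv hy.1]; exact hyB⟩
      simp only [indicator_of_mem hyB, indicator_of_mem this]
    · have : ψ.symm y ∉ P '' A := by
        rw [hPB]
        rintro ⟨_, h⟩
        rw [mem_preimage, ψ.right_inv hy.1] at h
        exact hyB h
      simp only [indicator_of_notMem hyB, indicator_of_notMem this, mul_zero]
  rw [h1, lintegral_vol_source hK hD hψ, h2, lintegral_indicator hBm,
    Measure.restrict_restrict hBm, inter_eq_left.2 hBdom]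
  have h3 : ∫⁻ y in B, dens g ψ y * H (ψ.symm y) =
      ∫⁻ z in Ψ '' A, dens g ψ ((split k).symm z) * H (ψ.symm ((split k).symm z)) := by
    have := (measurePreserving_split (n := n) (k := k)).setLIntegral_comp_preimage_emb
      (split k).toHomeomorph.measurableEmbedding
      (fun z => dens g ψ ((split k).symm z) * H (ψ.symm ((split k).symm z))) (Ψ '' A)
    rw [← this]
    simp only [ContinuousLinearEquiv.symm_apply_apply]
    rfl
  have : (volume : Measure (Tang n k × Norm n k)).IsAddHaarMeasure :=
    Measure.prod.instIsAddHaarMeasure _ _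
  rw [h3, lintegral_image_eq_lintegral_abs_det_fderiv_mul volume hA hL' hΨinj]
  refine setLIntegral_congr_fun hA fun w hw => ?_
  simp only [hΨ, ContinuousLinearEquiv.symm_apply_apply, ψ.left_inv (hP w hw).1]

lemma setLIntegral_two_sided {W : Type*} [MeasurableSpace W] {μ : Measure W} {A : Set W}
    (hA : MeasurableSet A) {a c : ℝ≥0∞} (ha : a ≠ ⊤) (hc : c ≠ ⊤) {j d w H : W → ℝ≥0∞}
    (h : ∀ x ∈ A, a * w x ≤ j x * d x ∧ j x * d x ≤ c * w x) :
    a * ∫⁻ x in A, w x * H x ∂μ ≤ ∫⁻ x in A, j x * (d x * H x) ∂μ ∧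
      ∫⁻ x in A, j x * (d x * H x) ∂μ ≤ c * ∫⁻ x in A, w x * H x ∂μ := by
  rw [← lintegral_const_mul' _ _ ha, ← lintegral_const_mul' _ _ hc]
  constructor
  · refine setLIntegral_mono' hA fun x hx => ?_
    rw [← mul_assoc, ← mul_assoc]
    exact mul_le_mul_left (h x hx).1 _
  · refine setLIntegral_mono' hA fun x hx => ?_
    rw [← mul_assoc, ← mul_assoc]
    exact mul_le_mul_left (h x hx).2 _

/-- Growth of a function along a curve, from a bound for its derivative. -/
lemma ofReal_le_add_lintegral {f f' e : ℝ → ℝ} {a b : ℝ} (hab : a ≤ b)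
    (hf : ∀ σ ∈ Icc a b, HasDerivAt f (f' σ) σ) (he : ContinuousOn e (Icc a b))
    (h : ∀ σ ∈ Icc a b, |f' σ| ≤ e σ) :
    ENNReal.ofReal (f a) ≤ ENNReal.ofReal (f b) + ∫⁻ σ in Ioo a b, ENNReal.ofReal (e σ) := by
  have hi : IntegrableOn e (Icc a b) := he.integrableOn_compact isCompact_Icc
  have h0 : ∀ σ ∈ Icc a b, 0 ≤ e σ := fun σ hσ => (abs_nonneg _).trans (h σ hσ)
  have h1 := intervalIntegral.sub_le_integral_of_hasDeriv_right_of_le (g := fun σ => -f σ)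
    (g' := fun σ => -f' σ) (φ := e) hab
    (fun σ hσ => (hf σ hσ).neg.continuousAt.continuousWithinAt)
    (fun σ hσ => (hf σ (Ioo_subset_Icc_self hσ)).neg.hasDerivWithinAt) hi
    (fun σ hσ => (neg_le_abs _).trans (h σ (Ioo_subset_Icc_self hσ)))
  have h2 : f a ≤ f b + ∫ σ in Icc a b, e σ := by
    rw [intervalIntegral.integral_of_le hab, ← integral_Icc_eq_integral_Ioc] at h1
    linarith
  have h3 : 0 ≤ ∫ σ in Icc a b, e σ := setIntegral_nonneg measurableSet_Icc h0
  calc ENNReal.ofReal (f a) ≤ ENNReal.ofReal (f b + ∫ σ in Icc a b, e σ) :=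
        ENNReal.ofReal_le_ofReal h2
    _ ≤ ENNReal.ofReal (f b) + ENNReal.ofReal (∫ σ in Icc a b, e σ) := ENNReal.ofReal_add_le
    _ = _ := by
        rw [ofReal_integral_eq_lintegral_ofReal hi
          ((ae_restrict_iff' measurableSet_Icc).2 (Eventually.of_forall h0)),
          setLIntegral_congr Ioo_ae_eq_Icc]

/-- For `s < 0` the power is decreasing and the two ends exchange their roles, hence the minimum and
the maximum. -/
lemma rpow_two_sided {c C : ℝ} (hc : 0 < c) (hC : 0 < C) (s : ℝ) : ∃ a A : ℝ, 0 < a ∧ 0 < A ∧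
    ∀ ρ r : ℝ, 0 < ρ → c * ρ ≤ r → r ≤ C * ρ → a * ρ ^ s ≤ r ^ s ∧ r ^ s ≤ A * ρ ^ s := by
  refine ⟨min (c ^ s) (C ^ s), max (c ^ s) (C ^ s), by positivity, by positivity,
    fun ρ r hρ h1 h2 => ?_⟩
  have hcρ : 0 < c * ρ := by positivity
  have hr : 0 < r := hcρ.trans_le h1
  have hρs : 0 ≤ ρ ^ s := by positivity
  have e1 : (c * ρ) ^ s = c ^ s * ρ ^ s := Real.mul_rpow hc.le hρ.le
  have e2 : (C * ρ) ^ s = C ^ s * ρ ^ s := Real.mul_rpow hC.le hρ.le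
  rcases le_total 0 s with hs | hs
  · have i1 := Real.rpow_le_rpow hcρ.le h1 hs
    have i2 := Real.rpow_le_rpow hr.le h2 hs
    rw [e1] at i1
    rw [e2] at i2
    exact ⟨(mul_le_mul_of_nonneg_right (min_le_left _ _) hρs).trans i1,
      i2.trans (mul_le_mul_of_nonneg_right (le_max_right _ _) hρs)⟩
  · have i1 := Real.rpow_le_rpow_of_nonpos hcρ h1 hs
    have i2 := Real.rpow_le_rpow_of_nonpos hr h2 hs
    rw [e1] at i1
    rw [e2] at i2
    exact ⟨(mul_le_mul_of_nonneg_right (min_le_right _ _) hρs).trans i2,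
      i1.trans (mul_le_mul_of_nonneg_right (le_max_left _ _) hρs)⟩

end PolarIntegration

/-! ### The `L²` norm near the singular set -/

section PolarCoordinates

variable {n : ℕ} {X : Type*} [TopologicalSpace X] [T2Space X] [CompactSpace X]
  [ChartedSpace (E n) X] [IsManifold 𝓘(ℝ, E n) ∞ X] [MeasurableSpace X] [BorelSpace X]
  {D : Set X} {k : ℕ} {g : BilinField (n := n) X} {J : EndField (n := n) X}
  {ψ : OpenPartialHomeomorph X (E n)}

local notation "𝒜" => IsManifold.maximalAtlas 𝓘(ℝ, E n) ∞ X

/-- Polar coordinates `P (x, ρ θ)`, for `x ∈ N` and `0 < ρ < δ`, on a part of `X \ D`: the volume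
form is comparable to `ρ ^ b dx dy`, and the radial curves have bounded speed. -/
structure IsPolarCoord (D : Set X) (g : BilinField (n := n) X) (ψ : OpenPartialHomeomorph X (E n))
    (P : Tang n k × Norm n k → X)
    (L : Tang n k × Norm n k → (Tang n k × Norm n k) →L[ℝ] (Tang n k × Norm n k))
    (N : Set (Tang n k)) (δ b : ℝ) (a c : ℝ≥0∞) : Prop where
  isOpen : IsOpen N
  mem_atlas : ψ ∈ 𝒜
  mem : ∀ w ∈ N ×ˢ shell (Norm n k) 0 δ, P w ∈ ψ.source ∧ P w ∉ D
  injOn : InjOn P (N ×ˢ shell (Norm n k) 0 δ)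
  continuousOn : ContinuousOn P (N ×ˢ shell (Norm n k) 0 δ)
  hasFDerivAt : ∀ w ∈ N ×ˢ shell (Norm n k) 0 δ,
    HasFDerivAt (fun w => split k (ψ (P w))) (L w) w
  ne_zero : a ≠ 0
  ne_top : a ≠ ⊤
  ne_top' : c ≠ ⊤
  bounds : ∀ w ∈ N ×ˢ shell (Norm n k) 0 δ,
    a * ENNReal.ofReal (‖w.2‖ ^ b) ≤ ENNReal.ofReal |(L w).det| * dens g ψ (ψ (P w)) ∧
      ENNReal.ofReal |(L w).det| * dens g ψ (ψ (P w)) ≤ c * ENNReal.ofReal (‖w.2‖ ^ b)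
  exponent : 0 < Module.finrank ℝ (Norm n k) → 0 ≤ b + (Module.finrank ℝ (Norm n k) - 1)
  curve : ∀ x ∈ N, ∀ θ : Norm n k, ‖θ‖ = 1 → ∃ γ : ℝ → X, ∀ ρ ∈ Ioo 0 δ, γ ρ = P (x, ρ • θ) ∧
    MDifferentiableAt 𝓘(ℝ, ℝ) 𝓘(ℝ, E n) γ ρ ∧ ∀ v : E n,
      v = mfderiv 𝓘(ℝ, ℝ) 𝓘(ℝ, E n) γ ρ (1 : ℝ) → bilinE g (γ ρ) v v ≤ 4

namespace IsPolarCoord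

variable {P : Tang n k × Norm n k → X}
  {L : Tang n k × Norm n k → (Tang n k × Norm n k) →L[ℝ] (Tang n k × Norm n k)}
  {N : Set (Tang n k)} {δ b : ℝ} {a c : ℝ≥0∞}

lemma measurableSet (hP : IsPolarCoord D g ψ P L N δ b a c) (r R : ℝ) :
    MeasurableSet (N ×ˢ shell (Norm n k) r R) :=
  (hP.isOpen.prod (isOpen_shell r R)).measurableSet

lemma two_sided (hP : IsPolarCoord D g ψ P L N δ b a c) (hK : IsKahlerOff D g J)
    (hD : IsClosed D) {A : Set (Tang n k × Norm n k)} (hA : MeasurableSet A)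
    (hAs : A ⊆ N ×ˢ shell (Norm n k) 0 δ) (H : X → ℝ≥0∞) :
    a * (∫⁻ w in A, ENNReal.ofReal (‖w.2‖ ^ b) * H (P w)) ≤ ∫⁻ x in P '' A, H x ∂(vol D g) ∧
      ∫⁻ x in P '' A, H x ∂(vol D g) ≤
        c * ∫⁻ w in A, ENNReal.ofReal (‖w.2‖ ^ b) * H (P w) := by
  rw [lintegral_vol_image hK hD hP.mem_atlas hA (fun w hw => hP.mem w (hAs hw))
    (hP.injOn.mono hAs) (fun w hw => hP.hasFDerivAt w (hAs hw))]
  exact setLIntegral_two_sided hA hP.ne_top hP.ne_top' fun w hw => hP.bounds w (hAs hw)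

lemma lintegral_le (hP : IsPolarCoord D g ψ P L N δ b a c) (hK : IsKahlerOff D g J)
    (hD : IsClosed D) {A : Set (Tang n k × Norm n k)} (hA : MeasurableSet A)
    (hAs : A ⊆ N ×ˢ shell (Norm n k) 0 δ) (H : X → ℝ≥0∞) :
    ∫⁻ w in A, ENNReal.ofReal (‖w.2‖ ^ b) * H (P w) ≤
      a⁻¹ * ∫⁻ x in P '' A, H x ∂(vol D g) := by
  have key : ∀ x y : ℝ≥0∞, a * x ≤ y → x ≤ a⁻¹ * y := fun x y h => by
    rw [mul_comm, ← div_eq_mul_inv,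
      ENNReal.le_div_iff_mul_le (Or.inl hP.ne_zero) (Or.inl hP.ne_top), mul_comm]
    exact h
  exact key _ _ (hP.two_sided hK hD hA hAs H).1

/-- The `L²` norm near the singular set is controlled by the `L²` norm away from it. -/
theorem lintegral_normSq_le (hP : IsPolarCoord D g ψ P L N δ b a c) (hK : IsKahlerOff D g J)
    (hD : IsClosed D) {τ : ℝ} (hτ : 0 < τ) (hτδ : 2 * τ ≤ δ) {m : ℕ} {φ : Form n X m}
    (hφ : φ.SmoothOff D) :
    ∫⁻ x in P '' (N ×ˢ shell (Norm n k) 0 τ), ENNReal.ofReal (φ.normSq g x) ∂(vol D g) ≤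
      c * a⁻¹ * (∫⁻ x in P '' (N ×ˢ shell (Norm n k) τ (2 * τ)),
        ENNReal.ofReal (φ.normSq g x) ∂(vol D g)) +
      c * a⁻¹ * 4 * ENNReal.ofReal τ * energy D g φ := by
  set A := N ×ˢ shell (Norm n k) 0 δ with hA
  have hAm : MeasurableSet A := hP.measurableSet 0 δ
  have hsub : ∀ r R : ℝ, 0 ≤ r → R ≤ δ → N ×ˢ shell (Norm n k) r R ⊆ A := fun r R hr hR =>
    prod_mono_right (shell_subset_shell hr hR)
  have hmaps : MapsTo P A Dᶜ := fun w hw => (hP.mem w hw).2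
  have hu := (hK.continuousOn_normSq hD hφ).comp hP.continuousOn hmaps
  have he := (hK.continuousOn_gradSq hD hφ).comp hP.continuousOn hmaps
  have hge : ContinuousOn (fun w => 4 * graphNormSq g φ (P w)) A :=
    continuousOn_const.mul (hu.add he)
  set f : Tang n k × Norm n k → ℝ≥0∞ :=
    A.indicator fun w => ENNReal.ofReal (φ.normSq g (P w)) with hf
  -- The factor `4` is the bound for the squared speed of the radial curves.
  set h : Tang n k × Norm n k → ℝ≥0∞ :=
    A.indicator fun w => ENNReal.ofReal (4 * graphNormSq g φ (P w)) with hh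
  have hfm : Measurable f := measurable_indicator_of_continuousOn hAm
    (ENNReal.continuous_ofReal.comp_continuousOn hu)
  have hhm : Measurable h := measurable_indicator_of_continuousOn hAm
    (ENNReal.continuous_ofReal.comp_continuousOn hge)
  have hmem : ∀ x ∈ N, ∀ θ : Norm n k, ‖θ‖ = 1 → ∀ ρ ∈ Ioo 0 δ, (x, ρ • θ) ∈ A := by
    intro x hx θ hθ ρ hρ
    refine ⟨hx, ?_⟩
    simp only [shell, mem_setOf_eq, norm_smul, hθ, mul_one, Real.norm_of_nonneg hρ.1.le]
    exact hρ
  have key := lintegral_prod_shell_transport hP.exponent hτ hP.isOpen.measurableSet hfm hhm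
    (fun x hx θ hθ ρ hρ => ?_)
  · have e1 : ∀ r R : ℝ, 0 ≤ r → R ≤ δ →
        ∫⁻ w in N ×ˢ shell (Norm n k) r R, ENNReal.ofReal (‖w.2‖ ^ b) * f w =
        ∫⁻ w in N ×ˢ shell (Norm n k) r R, ENNReal.ofReal (‖w.2‖ ^ b) *
          ENNReal.ofReal (φ.normSq g (P w)) := fun r R hr hR =>
      setLIntegral_congr_fun (hP.measurableSet r R) fun w hw => by
        simp only [hf, indicator_of_mem (hsub r R hr hR hw)]
    have e2 : ∫⁻ w in N ×ˢ shell (Norm n k) 0 (2 * τ), ENNReal.ofReal (‖w.2‖ ^ b) * h w =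
        ∫⁻ w in N ×ˢ shell (Norm n k) 0 (2 * τ), ENNReal.ofReal (‖w.2‖ ^ b) *
          ENNReal.ofReal (4 * graphNormSq g φ (P w)) :=
      setLIntegral_congr_fun (hP.measurableSet _ _) fun w hw => by
        simp only [hh, indicator_of_mem (hsub _ _ le_rfl hτδ hw)]
    rw [e1 0 τ le_rfl (by linarith), e1 τ _ hτ.le hτδ, e2] at key
    have i1 := (hP.two_sided hK hD (hP.measurableSet 0 τ) (hsub 0 τ le_rfl (by linarith))
      (fun x => ENNReal.ofReal (φ.normSq g x))).2
    have i2 := hP.lintegral_le hK hD (hP.measurableSet τ (2 * τ)) (hsub τ _ hτ.le hτδ)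
      (fun x => ENNReal.ofReal (φ.normSq g x))
    have i3 := hP.lintegral_le hK hD (hP.measurableSet 0 (2 * τ)) (hsub 0 _ le_rfl hτδ)
      (fun x => ENNReal.ofReal (4 * graphNormSq g φ x))
    have i4 : ∫⁻ x in P '' (N ×ˢ shell (Norm n k) 0 (2 * τ)),
        ENNReal.ofReal (4 * graphNormSq g φ x) ∂(vol D g) ≤ 4 * energy D g φ := by
      refine (setLIntegral_le_lintegral _ _).trans ?_
      rw [energy, ← lintegral_const_mul' _ _ (by norm_num)]
      refine lintegral_mono fun x => ?_
      rw [ENNReal.ofReal_mul (by norm_num)]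
      simp
    calc _ ≤ _ := i1
      _ ≤ c * (a⁻¹ * (∫⁻ x in P '' (N ×ˢ shell (Norm n k) τ (2 * τ)),
            ENNReal.ofReal (φ.normSq g x) ∂(vol D g)) +
            ENNReal.ofReal τ * (a⁻¹ * (4 * energy D g φ))) := by
          gcongr
          refine key.trans ?_
          gcongr
          refine i3.trans ?_
          gcongr
      _ = _ := by ring
  · obtain ⟨γ, hγ⟩ := hP.curve x hx θ hθ
    have hIcc : ∀ σ ∈ Icc ρ (ρ + τ), σ ∈ Ioo 0 δ := fun σ hσ =>
      ⟨hρ.1.trans_le hσ.1, hσ.2.trans_lt (by linarith [hρ.2])⟩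
    have hγD : ∀ σ ∈ Icc ρ (ρ + τ), γ σ ∉ D := fun σ hσ => by
      rw [(hγ σ (hIcc σ hσ)).1]
      exact hmaps (hmem x hx θ hθ σ (hIcc σ hσ))
    have hder : ∀ σ ∈ Icc ρ (ρ + τ), ∃ u', HasDerivAt (fun ρ => φ.normSq g (γ ρ)) u' σ ∧
        |u'| ≤ 4 * graphNormSq g φ (γ σ) := by
      intro σ hσ
      obtain ⟨h1, h2, h3⟩ := hγ σ (hIcc σ hσ)
      obtain ⟨u', h4, h5⟩ := hK.hasDerivAt_normSq_comp hD hφ h2 (hγD σ hσ) _ rfl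
      refine ⟨u', h4, h5.trans ?_⟩
      have h6 := h3 _ rfl
      have h7 := hK.gradSq_nonneg φ (hγD σ hσ)
      have h8 := hK.normSq_nonneg φ (hγD σ hσ)
      rw [graphNormSq]
      nlinarith [mul_le_mul_of_nonneg_right h6 h7]
    choose! u' hu' using hder
    have hcurve : ContinuousOn γ (Icc ρ (ρ + τ)) := fun σ hσ =>
      (hγ σ (hIcc σ hσ)).2.1.continuousAt.continuousWithinAt
    have hec : ContinuousOn (fun σ => 4 * graphNormSq g φ (γ σ)) (Icc ρ (ρ + τ)) :=
      continuousOn_const.mul (((hK.continuousOn_normSq hD hφ).comp hcurve hγD).add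
        ((hK.continuousOn_gradSq hD hφ).comp hcurve hγD))
    have hmain := ofReal_le_add_lintegral (by linarith) (fun σ hσ => (hu' σ hσ).1) hec
      (fun σ hσ => (hu' σ hσ).2)
    have e0 : ∀ σ ∈ Icc ρ (ρ + τ), f (x, σ • θ) = ENNReal.ofReal (φ.normSq g (γ σ)) :=
      fun σ hσ => by
        rw [hf, indicator_of_mem (hmem x hx θ hθ σ (hIcc σ hσ)), (hγ σ (hIcc σ hσ)).1]
    have e3 : ∫⁻ σ in Ioo ρ (ρ + τ), h (x, σ • θ) =
        ∫⁻ σ in Ioo ρ (ρ + τ), ENNReal.ofReal (4 * graphNormSq g φ (γ σ)) :=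
      setLIntegral_congr_fun measurableSet_Ioo fun σ hσ => by
        have hσ' := hIcc σ (Ioo_subset_Icc_self hσ)
        simp only [hh, indicator_of_mem (hmem x hx θ hθ σ hσ'), (hγ σ hσ').1]
    rw [e0 ρ ⟨le_rfl, by linarith⟩, e0 (ρ + τ) ⟨by linarith, le_rfl⟩, e3]
    exact hmain

end IsPolarCoord

end PolarCoordinates

/-! ### Polar coordinates obtained from a polar tube -/

section TubeCoordinates

variable {n : ℕ} {X : Type*} [TopologicalSpace X] [T2Space X] [CompactSpace X]
  [ChartedSpace (E n) X] [IsManifold 𝓘(ℝ, E n) ∞ X] [MeasurableSpace X] [BorelSpace X]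
  {D : Set X} {k : ℕ} {s t : ℝ} {g : BilinField (n := n) X} {J : EndField (n := n) X}
  {p : X} {g₀ : ContMDiffRiemannianMetric 𝓘(ℝ, E n) ∞ (E n) (fun x : X => TangentSpace 𝓘(ℝ, E n) x)}
  {ε : ℝ} {T : TangentBundle 𝓘(ℝ, E n) X → ℝ → X} {F : X → TangentBundle 𝓘(ℝ, E n) X × ℝ}
  {U : Set X}

local notation "𝒜" => IsManifold.maximalAtlas 𝓘(ℝ, E n) ∞ X

lemma sqrt_two_sided {d r s : ℝ} (hr : 0 ≤ r) (h : |d - r ^ s| ≤ 1 / 2 * r ^ s) :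
    1 / 2 * r ^ (s / 2) ≤ √d ∧ √d ≤ 2 * r ^ (s / 2) := by
  have h1 : (r ^ (s / 2)) ^ 2 = r ^ s := by
    rw [← Real.rpow_natCast, ← Real.rpow_mul hr]
    congr 1
    push_cast
    ring
  have h2 : 0 ≤ r ^ s := by positivity
  have h3 : 0 ≤ r ^ (s / 2) := by positivity
  rw [abs_le] at h
  constructor
  · apply Real.le_sqrt_of_sq_le
    rw [mul_pow, h1]
    linarith
  · rw [Real.sqrt_le_iff]
    refine ⟨by positivity, ?_⟩
    rw [mul_pow, h1]
    linarith

/-- The map `(x, y) ↦ T (v, ‖y‖)`, where `v` is the unit normal vector at `x` of direction `y`. -/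
def tubeCoord (g₀ : ContMDiffRiemannianMetric 𝓘(ℝ, E n) ∞ (E n)
      (fun x : X => TangentSpace 𝓘(ℝ, E n) x))
    (T : TangentBundle 𝓘(ℝ, E n) X → ℝ → X) (ψ : OpenPartialHomeomorph X (E n))
    (w : Tang n k × Norm n k) : X := T (unitNormal g₀ ψ w.1 w.2) ‖w.2‖

/-- A polar tube of a singular Kähler manifold provides polar coordinates near each point of the
singular set. -/
theorem exists_isPolarCoord (hX : IsSingularKahler D k s t g J)
    (hT : IsPolarTube D (normalSphere D g₀) ε T F U)
    (hlen : ∀ p ∈ D,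
      (fun x => Real.sqrt (g (T (F x).1 (F x).2)
          (radialVec T (F x).1 (F x).2) (radialVec T (F x).1 (F x).2)) - (F x).2 ^ t)
        =o[𝓝[Dᶜ] p] (fun x => (F x).2 ^ t)) (hp : p ∈ D) :
    ∃ (ψ : OpenPartialHomeomorph X (E n))
      (L : Tang n k × Norm n k → (Tang n k × Norm n k) →L[ℝ] (Tang n k × Norm n k))
      (N : Set (Tang n k)) (δ : ℝ) (a c : ℝ≥0∞), 0 < δ ∧ δ ≤ ε ∧
      IsPolarCoord D g ψ (tubeCoord g₀ T ψ) L N δ (s / 2) a c ∧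
      (∀ x ∈ N, ∀ y : Norm n k, y ≠ 0 → unitNormal g₀ ψ x y ∈ normalSphere D g₀) ∧
      ∃ N' ∈ 𝓝 p, ∀ v ∈ normalSphere D g₀, v.proj ∈ N' →
        ∃ x ∈ N, ∃ θ : Norm n k, ‖θ‖ = 1 ∧ unitNormal g₀ ψ x θ = v := by
  obtain ⟨ψ, hψ, hdet⟩ := hX.det_asymptotics p hp
  obtain ⟨δ₁, hδ₁, hδ₁ε, hmem, hZ⟩ := hT.exists_isPolarParam hψ hp
  set x₀ := (split k (ψ p)).1 with hx₀
  set Z := tubeParam (k := k) g₀ T ψ with hZdef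
  have hz₀ : slicePt x₀ = ψ p := slicePt_fst ((hψ.mem_iff p hψ.2.1).1 hp)
  -- The asymptotics are used with relative error `1/2` for the determinant and `1` for the length
  -- of `∂/∂r`.
  have hW1 := eventually_nhdsWithin_iff.1 (hdet.bound (show (0 : ℝ) < 1 / 2 by norm_num))
  have hW2 := eventually_nhdsWithin_iff.1 ((hlen p hp).bound zero_lt_one)
  -- Both asymptotic bounds are rephrased as one neighbourhood of `(x₀, 0)` in the split
  -- coordinates, so that `exists_bounds` guarantees that the points of the tube satisfy them.
  have hO : {w : Tang n k × Norm n k | ∀ x ∈ ψ.source, split k (ψ x) = w → x ∈ Dᶜ →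
      ‖(coeff g ψ (ψ x)).det - normalRadius k (ψ x) ^ s‖ ≤ 1 / 2 * ‖normalRadius k (ψ x) ^ s‖ ∧
      ‖Real.sqrt (g (T (F x).1 (F x).2) (radialVec T (F x).1 (F x).2)
        (radialVec T (F x).1 (F x).2)) - (F x).2 ^ t‖ ≤ 1 * ‖(F x).2 ^ t‖} ∈
      𝓝 (x₀, (0 : Norm n k)) := by
    have hc : ContinuousAt (fun w : Tang n k × Norm n k => ψ.symm ((split k).symm w))
        (x₀, 0) := by
      have h1 : (split (n := n) k).symm (x₀, 0) = ψ p := hz₀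
      refine ContinuousAt.comp (g := ψ.symm) ?_ (split k).symm.continuous.continuousAt
      rw [h1]
      exact ψ.continuousAt_symm (ψ.map_source hψ.2.1)
    have h2 : ψ.symm ((split (n := n) k).symm (x₀, 0)) = p := by
      have h1 : (split (n := n) k).symm (x₀, 0) = ψ p := hz₀
      rw [h1, ψ.left_inv hψ.2.1]
    rw [ContinuousAt, h2] at hc
    filter_upwards [hc.eventually hW1, hc.eventually hW2] with w h3 h4 x hx hxw hxD
    have h5 : ψ.symm ((split k).symm w) = x := by
      rw [← hxw, ContinuousLinearEquiv.symm_apply_apply, ψ.left_inv hx]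
    rw [h5] at h3 h4
    exact ⟨h3 hxD, h4 hxD⟩
  obtain ⟨c, C, δ₂, hc, hC, hδ₂, hδ₂₁, hball, hb⟩ :=
    hZ.exists_bounds (Metric.mem_ball_self hδ₁) hO
  obtain ⟨a, A, ha, hA, haA⟩ := rpow_two_sided hc hC (s / 2)
  -- The bound `δ ≤ 1` gives `ρ ^ t ≤ 1`, hence the bounded speed of the radial curves.
  set δ := min δ₂ 1 with hδ
  have hδ0 : 0 < δ := lt_min hδ₂ one_pos
  have hδ2 : δ ≤ δ₂ := min_le_left _ _
  have hN1 : Metric.ball x₀ δ ⊆ Metric.ball x₀ δ₂ := Metric.ball_subset_ball hδ2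
  have hNδ₁ : Metric.ball x₀ δ ⊆ Metric.ball x₀ δ₁ := hN1.trans hball
  have hNt : ∀ x ∈ Metric.ball x₀ δ, slicePt x ∈ ψ.target := fun x hx => (hmem x (hNδ₁ hx)).1
  have hvS : ∀ x ∈ Metric.ball x₀ δ, ∀ y : Norm n k, y ≠ 0 →
      unitNormal g₀ ψ x y ∈ normalSphere D g₀ := fun x hx y hy =>
    hψ.unitNormal_mem g₀ (hNt x hx) hy
  have hρε : ∀ {ρ : ℝ}, ρ ∈ Ioo 0 δ → ρ ∈ Ioo 0 ε := fun hρ =>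
    ⟨hρ.1, hρ.2.trans_le ((hδ2.trans hδ₂₁).trans hδ₁ε)⟩
  have hsrc : ∀ x ∈ Metric.ball x₀ δ, ∀ y : Norm n k, y ≠ 0 → ∀ ρ ∈ Ioo 0 δ,
      T (unitNormal g₀ ψ x y) ρ ∈ ψ.source := fun x hx y hy ρ hρ =>
    (hmem x (hNδ₁ hx)).2 y hy ρ ⟨hρ.1.le, hρ.2.trans_le (hδ2.trans hδ₂₁)⟩
  have hnotD : ∀ x ∈ Metric.ball x₀ δ, ∀ y : Norm n k, y ≠ 0 → ∀ ρ ∈ Ioo 0 δ,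
      T (unitNormal g₀ ψ x y) ρ ∉ D := fun x hx y hy ρ hρ =>
    ((hT.left_inv _ (hvS x hx y hy) ρ (hρε hρ)).1).2
  have hne : ∀ w ∈ Metric.ball x₀ δ ×ˢ shell (Norm n k) 0 δ, w.2 ≠ 0 := fun w hw h0 => by
    have := hw.2.1
    rw [h0, norm_zero] at this
    exact lt_irrefl _ this
  have hunit : ∀ w ∈ Metric.ball x₀ δ ×ˢ shell (Norm n k) 0 δ, ‖‖w.2‖⁻¹ • w.2‖ = 1 := fun w hw =>
    norm_smul_inv_norm (𝕜 := ℝ) (hne w hw)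
  have hpolar : ∀ w ∈ Metric.ball x₀ δ ×ˢ shell (Norm n k) 0 δ,
      w = (w.1, ‖w.2‖ • ‖w.2‖⁻¹ • w.2) := fun w hw => by
    rw [smul_inv_smul₀ (norm_ne_zero_iff.2 (hne w hw))]
  set q : Tang n k × Norm n k → (Tang n k × Norm n k) × ℝ :=
    fun w => ((w.1, ‖w.2‖⁻¹ • w.2), ‖w.2‖) with hq
  have hZq : ∀ w ∈ Metric.ball x₀ δ ×ˢ shell (Norm n k) 0 δ,
      Z (q w) = split k (ψ (tubeCoord g₀ T ψ w)) := fun w hw => by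
    simp only [hZdef, tubeParam, hq, tubeCoord]
    rw [unitNormal_smul g₀ _ (inv_pos.2 (norm_pos_iff.2 (hne w hw)))]
  have hbq : ∀ w ∈ Metric.ball x₀ δ ×ˢ shell (Norm n k) 0 δ, IsPolarParam.Bounds
      (Metric.ball x₀ δ₁) δ₁ Z _ c C (q w) := fun w hw =>
    hb w.1 (hN1 hw.1) _ (hunit w hw) ‖w.2‖ ⟨hw.2.1, hw.2.2.trans_le hδ2⟩
  refine ⟨ψ, fun w => polarDeriv Z (polarDomain (Metric.ball x₀ δ₁) δ₁) (q w), Metric.ball x₀ δ, δ,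
    ENNReal.ofReal (c * (1 / 2 * a)), ENNReal.ofReal (C * (2 * A)), hδ0,
    (hδ2.trans hδ₂₁).trans hδ₁ε, ?_, hvS, ?_⟩
  · refine ⟨Metric.isOpen_ball, hψ.1, fun w hw => ⟨hsrc _ hw.1 _ (hne w hw) _ hw.2,
      hnotD _ hw.1 _ (hne w hw) _ hw.2⟩, ?_, ?_, fun w hw => ?_, ?_, ENNReal.ofReal_ne_top,
      ENNReal.ofReal_ne_top, fun w hw => ?_, fun hpos => ?_, fun x hx θ hθ => ?_⟩
    · intro w hw w' hw' h
      -- The inverse `F` of the tube recovers the normal vector and the radius; by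
      -- `unitNormal_injective` the former determines the base point and the direction.
      have h1 := (hT.left_inv _ (hvS _ hw.1 _ (hne w hw)) _ (hρε hw.2)).2
      have h2 := (hT.left_inv _ (hvS _ hw'.1 _ (hne w' hw')) _ (hρε hw'.2)).2
      have h3 := h1.symm.trans ((congrArg F h).trans h2)
      have h4 := congrArg Prod.fst h3
      have h5 : ‖w.2‖ = ‖w'.2‖ := congrArg Prod.snd h3
      simp only at h4
      rw [← unitNormal_smul g₀ w.1 (inv_pos.2 (norm_pos_iff.2 (hne w hw))),
        ← unitNormal_smul g₀ w'.1 (inv_pos.2 (norm_pos_iff.2 (hne w' hw')))] at h4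
      obtain ⟨h6, h7⟩ := unitNormal_injective g₀ hψ.1 (hNt _ hw.1) (hNt _ hw'.1) (hunit w hw)
        (hunit w' hw') h4
      rw [hpolar w hw, hpolar w' hw', h6, h7, h5]
    · have h1 := (contMDiffOn_tube hT hψ).continuousOn
      have h2 : Continuous fun w : Tang n k × Norm n k => (w, ‖w.2‖) := by fun_prop
      exact h1.comp h2.continuousOn fun w hw =>
        ⟨⟨hNt _ hw.1, hne w hw⟩, (hρε hw.2).1.le, (hρε hw.2).2⟩
    · have h1 := hZ.hasFDerivAt_polarMap (hNδ₁ hw.1) (hunit w hw)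
        (ρ := ‖w.2‖) ⟨hw.2.1, hw.2.2.trans_le (hδ2.trans hδ₂₁)⟩
      have h2 := hpolar w hw
      rw [← h2] at h1
      exact h1
    · simp only [ne_eq, ENNReal.ofReal_eq_zero, not_le]
      positivity
    -- The Jacobian lies between `c` and `C`, the distance `r` to `D` in the chart is comparable to
    -- `ρ = ‖y‖`, and `√det g` lies between `r^(s/2) / 2` and `2 r^(s/2)`.
    · obtain ⟨b1, b2, b3, b4, b5⟩ := hbq w hw
      have h1 : ‖(coeff g ψ (ψ (tubeCoord g₀ T ψ w))).det -
          normalRadius k (ψ (tubeCoord g₀ T ψ w)) ^ s‖ ≤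
          1 / 2 * ‖normalRadius k (ψ (tubeCoord g₀ T ψ w)) ^ s‖ :=
        (b1 _ (hsrc _ hw.1 _ (hne w hw) _ hw.2) (hZq w hw).symm
        (hnotD _ hw.1 _ (hne w hw) _ hw.2)).1
      have hr : ‖(Z (q w)).2‖ = normalRadius k (ψ (tubeCoord g₀ T ψ w)) := by
        rw [hZq w hw, norm_split_snd]
      have hr0 : 0 ≤ normalRadius k (ψ (tubeCoord (k := k) g₀ T ψ w)) := Real.sqrt_nonneg _
      rw [hr] at b2 b3
      obtain ⟨e1, e2⟩ := haA _ _ hw.2.1 b2 b3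
      rw [Real.norm_eq_abs, Real.norm_of_nonneg (Real.rpow_nonneg hr0 _)] at h1
      obtain ⟨e3, e4⟩ := sqrt_two_sided hr0 h1
      have hw0 : 0 ≤ ‖w.2‖ ^ (s / 2) := Real.rpow_nonneg (norm_nonneg _) _
      rw [dens, ← ENNReal.ofReal_mul (by positivity), ← ENNReal.ofReal_mul (abs_nonneg _),
        ← ENNReal.ofReal_mul (by positivity)]
      constructor
      · refine ENNReal.ofReal_le_ofReal ?_
        rw [mul_assoc]
        refine mul_le_mul b4 (le_trans ?_ e3) (by positivity) (abs_nonneg _)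
        rw [mul_assoc]
        exact mul_le_mul_of_nonneg_left e1 (by norm_num)
      · refine ENNReal.ofReal_le_ofReal ?_
        rw [mul_assoc]
        refine mul_le_mul b5 (e4.trans ?_) (Real.sqrt_nonneg _) hC.le
        rw [mul_assoc]
        exact mul_le_mul_of_nonneg_left e2 (by norm_num)
    · rw [finrank_norm] at hpos ⊢
      have hk : k ≤ 2 * n := by omega
      have h1 : ((2 * n - k : ℕ) : ℝ) = 2 * n - k := by
        rw [Nat.cast_sub hk]; push_cast; ring
      have h2 : (1 : ℝ) ≤ ((2 * n - k : ℕ) : ℝ) := by exact_mod_cast hpos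
      have h3 := hX.exponents
      -- For the codimension `d = 2n - k ≥ 1` the condition on `s` gives `s/2 + d - 1 > t + (d -
      -- 1)/2 > 0`.
      have h4 := hX.t_pos
      rw [h1] at h2 ⊢
      linarith
    · have hθ0 : θ ≠ 0 := fun h => by simp [h] at hθ
      refine ⟨T (unitNormal g₀ ψ x θ), fun ρ hρ => ?_⟩
      have hv := hvS x hx θ hθ0
      refine ⟨?_, hT.mdifferentiableAt hv (hρε hρ), fun v hvd => ?_⟩
      · rw [tubeCoord]
        simp only
        rw [unitNormal_smul g₀ x hρ.1, norm_smul, hθ, mul_one, Real.norm_of_nonneg hρ.1.le]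
      · rw [← radialVec_eq_mfderiv hρ.1] at hvd
        have hF := (hT.left_inv _ hv ρ (hρε hρ)).2
        obtain ⟨b1, -⟩ := hb x (hN1 hx) θ hθ ρ ⟨hρ.1, hρ.2.trans_le hδ2⟩
        have h1 := (b1 _ (hsrc _ hx _ hθ0 _ hρ) rfl (hnotD _ hx _ hθ0 _ hρ)).2
        rw [hF] at h1
        simp only at h1
        have hρt : 0 ≤ ρ ^ t := Real.rpow_nonneg hρ.1.le _
        rw [Real.norm_eq_abs, Real.norm_of_nonneg hρt, one_mul, abs_le] at h1
        have h2 : ρ ^ t ≤ 1 := Real.rpow_le_one hρ.1.le (hρ.2.le.trans (min_le_right _ _)) hX.t_pos.le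
        -- The length of the radial vector is at most `2 ρ ^ t ≤ 2`, so its square is at most `4`.
        have h3 := (Real.sqrt_le_iff.1 (show _ ≤ (2 : ℝ) by linarith [h1.2])).2
        rw [hvd]
        refine le_trans (le_of_eq ?_) (h3.trans (by norm_num))
        rfl
  · refine ⟨ψ.source ∩ {x | (split k (ψ x)).1 ∈ Metric.ball x₀ δ}, ?_, ?_⟩
    · refine inter_mem (ψ.open_source.mem_nhds hψ.2.1) ?_
      have h1 : ContinuousAt (fun x => (split k (ψ x)).1) p :=
        (continuous_fst.comp (split k).continuous).continuousAt.comp (ψ.continuousAt hψ.2.1)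
      exact h1.preimage_mem_nhds (Metric.ball_mem_nhds _ hδ0)
    · rintro v hv ⟨hvs, hvb⟩
      obtain ⟨-, θ, hθ, h⟩ := hψ.exists_unitNormal g₀ hv hvs
      exact ⟨_, hvb, θ, hθ, h⟩

end TubeCoordinates

/-! ### The estimate on thin tubes and the compactness estimate on all of `X` -/

section GlobalCompactness

variable {n : ℕ} {X : Type*} [TopologicalSpace X] [T2Space X] [CompactSpace X]
  [ChartedSpace (E n) X] [IsManifold 𝓘(ℝ, E n) ∞ X] [MeasurableSpace X] [BorelSpace X]
  {D : Set X} {k : ℕ} {s t : ℝ} {g : BilinField (n := n) X} {J : EndField (n := n) X}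
  {g₀ : ContMDiffRiemannianMetric 𝓘(ℝ, E n) ∞ (E n) (fun x : X => TangentSpace 𝓘(ℝ, E n) x)}
  {S : Set (TangentBundle 𝓘(ℝ, E n) X)}
  {ε : ℝ} {T : TangentBundle 𝓘(ℝ, E n) X → ℝ → X} {F : X → TangentBundle 𝓘(ℝ, E n) X × ℝ}
  {U : Set X}

/-- The punctured part of a tube of radius `τ` lying over `N`. -/
def tubeOver (S : Set (TangentBundle 𝓘(ℝ, E n) X)) (T : TangentBundle 𝓘(ℝ, E n) X → ℝ → X)
    (N : Set X) (τ : ℝ) : Set X :=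
  {x | ∃ v ∈ S, v.proj ∈ N ∧ ∃ ρ ∈ Ioo 0 τ, T v ρ = x}

/-- The complement of a tube of radius `τ`. -/
def tubeCompl (S : Set (TangentBundle 𝓘(ℝ, E n) X)) (T : TangentBundle 𝓘(ℝ, E n) X → ℝ → X)
    (τ : ℝ) : Set X :=
  ((fun q : TangentBundle 𝓘(ℝ, E n) X × ℝ => T q.1 q.2) '' (S ×ˢ Ico 0 τ))ᶜ

lemma IsPolarTube.isClosed_tubeCompl (hT : IsPolarTube D S ε T F U) {τ : ℝ} (hτ : τ ∈ Ioc 0 ε) :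
    IsClosed (tubeCompl S T τ) := (hT.isOpen τ hτ).isClosed_compl

lemma IsPolarTube.tubeCompl_subset (hT : IsPolarTube D S ε T F U) {τ : ℝ} (hτ : 0 < τ) :
    tubeCompl S T τ ⊆ Dᶜ := by
  intro x hx hxD
  obtain ⟨⟨v, ρ⟩, ⟨hv, hρ⟩, hvx⟩ := hT.onto.symm ▸ hT.subset hxD
  simp only at hv hρ hvx
  rcases hρ.1.eq_or_lt with h | h
  · subst h
    exact hx ⟨(v, 0), ⟨hv, le_rfl, hτ⟩, hvx⟩
  · have := (hT.left_inv v hv ρ ⟨h, hρ.2⟩).1.2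
    rw [hvx] at this
    exact this hxD

/-- Through `F` a point off `D` determines its radius, so a point of radius at least `τ` is not in
the smaller tube. -/
lemma IsPolarTube.mem_tubeCompl (hT : IsPolarTube D S ε T F U) (hS : ∀ v ∈ S, v.proj ∈ D)
    {v : TangentBundle 𝓘(ℝ, E n) X} (hv : v ∈ S) {τ ρ : ℝ} (hτ : 0 < τ) (hτρ : τ ≤ ρ) (hρ : ρ < ε) :
    T v ρ ∈ tubeCompl S T τ := by
  rintro ⟨⟨v', ρ'⟩, ⟨hv', hρ'⟩, h⟩
  simp only at hv' hρ' h
  obtain ⟨h1, h2⟩ := hT.left_inv v hv ρ ⟨hτ.trans_le hτρ, hρ⟩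
  rcases hρ'.1.eq_or_lt with h0 | h0
  · subst h0
    rw [hT.zero v' hv'] at h
    exact h1.2 (h ▸ hS v' hv')
  · have h3 := (hT.left_inv v' hv' ρ' ⟨h0, hρ'.2.trans (hτρ.trans_lt hρ)⟩).2
    rw [h, h2] at h3
    have h4 : ρ = ρ' := congrArg Prod.snd h3
    linarith [hρ'.2]

lemma IsPolarTube.mem_of_notMem_tubeCompl (hT : IsPolarTube D S ε T F U)
    (hS : ∀ v ∈ S, v.proj ∈ D) {τ : ℝ} {x : X} (hx : x ∉ tubeCompl S T τ) (hxD : x ∉ D) :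
    x ∈ tubeOver S T D τ := by
  obtain ⟨⟨v, ρ⟩, ⟨hv, hρ⟩, h⟩ := not_not.1 hx
  simp only at hv hρ h
  refine ⟨v, hv, hS v hv, ρ, ⟨hρ.1.lt_of_ne fun h0 => hxD ?_, hρ.2⟩, h⟩
  subst h0
  rw [hT.zero v hv] at h
  exact h ▸ hS v hv

/-- The `L²` norm on a thin tube is controlled by the `L²` norm away from the singular set, up to a
small multiple of the energy. -/
theorem exists_tube_estimate (hX : IsSingularKahler D k s t g J)
    (hT : IsPolarTube D (normalSphere D g₀) ε T F U)
    (hlen : ∀ p ∈ D,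
      (fun x => Real.sqrt (g (T (F x).1 (F x).2)
          (radialVec T (F x).1 (F x).2) (radialVec T (F x).1 (F x).2)) - (F x).2 ^ t)
        =o[𝓝[Dᶜ] p] (fun x => (F x).2 ^ t)) (m : ℕ) :
    ∃ C : ℝ≥0∞, C ≠ ⊤ ∧ ∃ τ₀ : ℝ, 0 < τ₀ ∧ ∀ τ ∈ Ioo 0 τ₀, ∀ φ : Form n X m, φ.SmoothOff D →
      ∫⁻ x in tubeOver (normalSphere D g₀) T D τ, ENNReal.ofReal (φ.normSq g x) ∂(vol D g) ≤
        C * (∫⁻ x in tubeCompl (normalSphere D g₀) T τ,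
          ENNReal.ofReal (φ.normSq g x) ∂(vol D g)) +
        C * ENNReal.ofReal τ * energy D g φ := by
  -- The estimate is additive in the part of `D` below the tube, so it need only be shown near each
  -- point of `D`. The constant precedes `τ`, as `τ` will be chosen according to it.
  refine hX.isClosed.isCompact.induction_on
    (p := fun N : Set X => ∃ C : ℝ≥0∞, C ≠ ⊤ ∧ ∃ τ₀ : ℝ, 0 < τ₀ ∧
      ∀ τ ∈ Ioo 0 τ₀, ∀ φ : Form n X m, φ.SmoothOff D →
        ∫⁻ x in tubeOver (normalSphere D g₀) T N τ, ENNReal.ofReal (φ.normSq g x) ∂(vol D g) ≤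
          C * (∫⁻ x in tubeCompl (normalSphere D g₀) T τ,
            ENNReal.ofReal (φ.normSq g x) ∂(vol D g)) +
          C * ENNReal.ofReal τ * energy D g φ) ?_ ?_ ?_ ?_
  · refine ⟨0, ENNReal.zero_ne_top, 1, one_pos, fun τ _ φ _ => ?_⟩
    simp [tubeOver]
  · rintro N N' hN ⟨C, hC, τ₀, hτ₀, h⟩
    refine ⟨C, hC, τ₀, hτ₀, fun τ hτ φ hφ => (lintegral_mono_set ?_).trans (h τ hτ φ hφ)⟩
    rintro x ⟨v, hv, hvN, hx⟩
    exact ⟨v, hv, hN hvN, hx⟩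
  · rintro N N' ⟨C, hC, τ₀, hτ₀, h⟩ ⟨C', hC', τ₀', hτ₀', h'⟩
    refine ⟨C + C', ENNReal.add_ne_top.2 ⟨hC, hC'⟩, min τ₀ τ₀', lt_min hτ₀ hτ₀',
      fun τ hτ φ hφ => ?_⟩
    have hsub : tubeOver (normalSphere D g₀) T (N ∪ N') τ ⊆
        tubeOver (normalSphere D g₀) T N τ ∪ tubeOver (normalSphere D g₀) T N' τ := by
      rintro x ⟨v, hv, hvN | hvN, hx⟩
      · exact Or.inl ⟨v, hv, hvN, hx⟩
      · exact Or.inr ⟨v, hv, hvN, hx⟩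
    refine (lintegral_mono_set hsub).trans ((lintegral_union_le _ _ _).trans
      ((add_le_add (h τ ⟨hτ.1, hτ.2.trans_le (min_le_left _ _)⟩ φ hφ)
        (h' τ ⟨hτ.1, hτ.2.trans_le (min_le_right _ _)⟩ φ hφ)).trans (le_of_eq ?_)))
    ring
  · intro p hp
    obtain ⟨ψ, L, N, δ, a, c, hδ, hδε, hP, hvS, N', hN', hcov⟩ :=
      exists_isPolarCoord hX hT hlen hp
    refine ⟨N', mem_nhdsWithin_of_mem_nhds hN', c * a⁻¹ * 4, ?_, δ / 2, half_pos hδ,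
      fun τ hτ φ hφ => ?_⟩
    · exact ENNReal.mul_ne_top (ENNReal.mul_ne_top hP.ne_top' (ENNReal.inv_ne_top.2 hP.ne_zero))
        (by norm_num)
    have hτδ : 2 * τ ≤ δ := by linarith [hτ.2]
    have h1 := hP.lintegral_normSq_le hX.kahler hX.isClosed hτ.1 hτδ hφ
    have hsub : tubeOver (normalSphere D g₀) T N' τ ⊆
        tubeCoord g₀ T ψ '' (N ×ˢ shell (Norm n k) 0 τ) := by
      rintro x ⟨v, hv, hvN, ρ, hρ, rfl⟩
      obtain ⟨x, hx, θ, hθ, rfl⟩ := hcov v hv hvN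
      have hn : ‖ρ • θ‖ = ρ := by rw [norm_smul, hθ, mul_one, Real.norm_of_nonneg hρ.1.le]
      refine ⟨(x, ρ • θ), ⟨hx, ?_⟩, ?_⟩
      · simp only [shell, mem_setOf_eq, hn]
        exact hρ
      · simp only [tubeCoord, hn, unitNormal_smul g₀ x hρ.1]
    -- The outer shell has radii between `τ` and `2 τ ≤ δ ≤ ε`: it is inside the given tube but
    -- outside the tube of radius `τ`.
    have hsub' : tubeCoord g₀ T ψ '' (N ×ˢ shell (Norm n k) τ (2 * τ)) ⊆
        tubeCompl (normalSphere D g₀) T τ := by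
      rintro _ ⟨w, ⟨hw1, hw2⟩, rfl⟩
      have hw0 : w.2 ≠ 0 := fun h0 => by
        have h3 := hw2.1
        rw [h0, norm_zero] at h3
        exact lt_asymm h3 hτ.1
      exact hT.mem_tubeCompl (fun v hv => hv.1) (hvS _ hw1 _ hw0) hτ.1 hw2.1.le
        (hw2.2.trans_le (hτδ.trans hδε))
    refine (lintegral_mono_set hsub).trans (h1.trans ?_)
    have h4 : c * a⁻¹ ≤ c * a⁻¹ * 4 := le_mul_of_one_le_right' (by norm_num)
    exact add_le_add (mul_le_mul' h4 (lintegral_mono_set hsub')) le_rfl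

/-- The `L²` norm is controlled, up to a small multiple of the energy, by finitely many bounded
functionals. -/
theorem IsSingularKahler.normCompactOn_univ (hX : IsSingularKahler D k s t g J) (m : ℕ) :
    NormCompactOn D g m univ := by
  obtain ⟨g₀, ε, T, F, U, hT, -, hlen⟩ := hX.tube
  obtain ⟨C, hC, τ₀, hτ₀, hest⟩ := exists_tube_estimate hX hT hlen m
  set S := normalSphere D g₀ with hS
  intro η hη
  have hη2 : η / 2 ≠ 0 := by simpa using hη
  -- The choices are made in this order: `τ` with `C τ < η / 2`, and then the estimate on the
  -- compact complement of the tube with the parameter `η / (2 (C + 1))`. Together they contribute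
  -- `η` times the energy.
  have hsmall : ∀ᶠ τ : ℝ in 𝓝[>] 0, C * ENNReal.ofReal τ < η / 2 := by
    have h1 : Tendsto (fun τ : ℝ => C * ENNReal.ofReal τ) (𝓝 0) (𝓝 0) := by
      have h2 := ((ENNReal.continuous_const_mul hC).comp ENNReal.continuous_ofReal).tendsto 0
      simpa [Function.comp_def] using h2
    exact nhdsWithin_le_nhds (h1.eventually_lt_const (pos_iff_ne_zero.2 hη2))
  obtain ⟨τ, hτsmall, hτ⟩ :=
    (hsmall.and (Ioo_mem_nhdsGT (lt_min hτ₀ hT.eps_pos))).exists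
  have hτ₀' : τ ∈ Ioo 0 τ₀ := ⟨hτ.1, hτ.2.trans_le (min_le_left _ _)⟩
  have hτε : τ ∈ Ioc 0 ε := ⟨hτ.1, (hτ.2.trans_le (min_le_right _ _)).le⟩
  have hC1 : C + 1 ≠ ⊤ := ENNReal.add_ne_top.2 ⟨hC, ENNReal.one_ne_top⟩
  have hC0 : C + 1 ≠ 0 := by simp
  obtain ⟨L, A, hA, hL, hb⟩ := normCompactOn_of_isCompact (m := m) hX.kahler hX.isClosed
    (hT.isClosed_tubeCompl hτε).isCompact (hT.tubeCompl_subset hτ.1) (η / 2 / (C + 1))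
    (ENNReal.div_ne_zero.2 ⟨hη2, hC1⟩)
  refine ⟨L, (C + 1) * A, ENNReal.mul_ne_top hC1 hA, hL, fun φ hφ => ?_⟩
  have hD0 : ∫⁻ x in D, ENNReal.ofReal (φ.normSq g x) ∂(vol D g) = 0 :=
    setLIntegral_measure_zero _ _ (measure_eq_zero_iff_ae_notMem.2
      (ae_vol_notMem hX.kahler hX.isClosed))
  have hcover : (univ : Set X) ⊆ (tubeCompl S T τ ∪ tubeOver S T D τ) ∪ D := fun x _ => by
    by_cases hxD : x ∈ D
    · exact Or.inr hxD
    · by_cases hx : x ∈ tubeCompl S T τ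
      · exact Or.inl (Or.inl hx)
      · exact Or.inl (Or.inr (hT.mem_of_notMem_tubeCompl (fun v hv => hv.1) hx hxD))
  set I := ∫⁻ x in tubeCompl S T τ, ENNReal.ofReal (φ.normSq g x) ∂(vol D g) with hI
  set W := energy D g φ with hW
  set Q := (L.map fun ℓ => ‖ℓ φ‖ₑ ^ 2).sum
  calc ∫⁻ x in univ, ENNReal.ofReal (φ.normSq g x) ∂(vol D g)
      ≤ (I + ∫⁻ x in tubeOver S T D τ, ENNReal.ofReal (φ.normSq g x) ∂(vol D g)) +
          ∫⁻ x in D, ENNReal.ofReal (φ.normSq g x) ∂(vol D g) :=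
        (lintegral_mono_set hcover).trans ((lintegral_union_le _ _ _).trans
          (add_le_add (lintegral_union_le _ _ _) le_rfl))
    _ ≤ (I + (C * I + C * ENNReal.ofReal τ * W)) + 0 := by
        rw [hD0]
        gcongr
        exact hest τ hτ₀' φ hφ
    _ = (C + 1) * I + C * ENNReal.ofReal τ * W := by ring
    _ ≤ (C + 1) * (A * Q + η / 2 / (C + 1) * W) + η / 2 * W := by
        gcongr
        exact hb φ hφ
    _ = (C + 1) * A * Q + ((C + 1) * (η / 2 / (C + 1)) + η / 2) * W := by ring
    _ = (C + 1) * A * Q + η * W := by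
        rw [ENNReal.mul_div_cancel hC0 hC1, ENNReal.add_halves]

end GlobalCompactness

/-! ### The compact embedding -/

section Embedding

variable {n : ℕ} {X : Type*} [TopologicalSpace X] [T2Space X] [CompactSpace X]
  [ChartedSpace (E n) X] [IsManifold 𝓘(ℝ, E n) ∞ X]
  {D : Set X} {g : BilinField (n := n) X} {J : EndField (n := n) X} {m : ℕ}

local notation "𝒜" => IsManifold.maximalAtlas 𝓘(ℝ, E n) ∞ X

/-- A section of `T^*X ⊗ Λ^m` at a point, as a multilinear map on the model space. -/
def CoForm.multilinear (β : CoForm n X m) (x : X) :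
    MultilinearMap ℝ (fun _ : Fin (m + 1) => E n) ℂ :=
  LinearMap.uncurryLeft (M := fun _ : Fin (m + 1) => E n)
    { toFun := fun v : E n =>
        ((β x : E n →L[ℝ] (E n [⋀^Fin m]→L[ℝ] ℂ)) v).toAlternatingMap.toMultilinearMap
      map_add' := fun u v => by
        ext w
        exact congrArg (fun f : E n [⋀^Fin m]→L[ℝ] ℂ => f w)
          ((β x : E n →L[ℝ] (E n [⋀^Fin m]→L[ℝ] ℂ)).map_add u v)
      map_smul' := fun c v => by
        ext w
        exact congrArg (fun f : E n [⋀^Fin m]→L[ℝ] ℂ => f w)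
          ((β x : E n →L[ℝ] (E n [⋀^Fin m]→L[ℝ] ℂ)).map_smul c v) }

lemma CoForm.comp_apply (β : CoForm n X m) (ψ : OpenPartialHomeomorph X (E n)) (y : E n)
    (I : Fin (m + 1) → Fin (2 * n)) : β.comp ψ I y =
      β.multilinear (ψ.symm y) fun l => frameMap ψ y (stdVec (I l)) := rfl

lemma CoForm.comp_change (β : CoForm n X m) {ψ₁ ψ₂ : OpenPartialHomeomorph X (E n)} (h₁ : ψ₁ ∈ 𝒜)
    (h₂ : ψ₂ ∈ 𝒜) {y : E n} (hy : y ∈ ψ₁.target) (hy' : ψ₁.symm y ∈ ψ₂.source) :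
    (fun I => β.comp ψ₁ I y) = act (jac (ψ₂ ∘ ψ₁.symm) y).transpose
      (fun I => β.comp ψ₂ I (ψ₂ (ψ₁.symm y))) := by
  ext I
  simp only [CoForm.comp_apply, frameMap_change h₁ h₂ hy hy', fderiv_stdVec_eq_sum, act,
    Matrix.transpose_apply, ψ₂.left_inv hy', map_sum, map_smul]
  have h := (β.multilinear (ψ₁.symm y)).map_sum (fun l j =>
    jac (ψ₂ ∘ ψ₁.symm) y j (I l) • frameMap ψ₂ (ψ₂ (ψ₁.symm y)) (stdVec j))
  refine h.trans (Finset.sum_congr rfl fun J _ => ?_)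
  refine ((β.multilinear (ψ₁.symm y)).map_smul_univ _ _).trans ?_
  rw [Complex.real_smul]

lemma IsKahlerOff.coNormSq_symm (hK : IsKahlerOff D g J) (β : CoForm n X m)
    {ψ : OpenPartialHomeomorph X (E n)} (hψ : ψ ∈ 𝒜) {y : E n} (hy : y ∈ chartDom D ψ) :
    β.normSq g (ψ.symm y) = tensorNormSq (coeff g ψ y) (fun I => β.comp ψ I y) / m.factorial := by
  set x := ψ.symm y with hx
  have hxs : x ∈ (chartAt (E n) x).source := mem_chart_source _ _
  rw [CoForm.normSq, coeff_change g hψ (chartAt_mem x) hy.1 hxs,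
    CoForm.comp_change β hψ (chartAt_mem x) hy.1 hxs, tensorNormSq_change
      (hK.posDef_coeff (chartAt_mem x) (transition_mem_chartDom hy hxs))
      (isUnit_det_jac hψ (chartAt_mem x) hy.1 hxs)]

/-- The pointwise norm of `∇φ` is controlled by those of `∇φ - β` and `β`. -/
lemma IsKahlerOff.gradSq_le (hK : IsKahlerOff D g J) (φ : Form n X m) (β : CoForm n X m) {x : X}
    (hx : x ∉ D) : gradSq g φ x ≤ 2 * nablaSubNormSq g φ β x + 2 * β.normSq g x := by
  have hpos := hK.posDef_coeff (chartAt_mem (n := n) x) (chartAt_mem_chartDom hx)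
  have h := tensorNormSq_add_le hpos
    (fun I => nablaComp g φ (chartAt (E n) x) I (chartAt (E n) x x)
      - β.comp (chartAt (E n) x) I (chartAt (E n) x x))
    (fun I => β.comp (chartAt (E n) x) I (chartAt (E n) x x))
  simp only [gradSq, nablaSubNormSq, CoForm.normSq, mul_div_assoc', ← add_div]
  gcongr
  refine le_trans (le_of_eq ?_) h
  congr 1
  ext I
  simp

lemma IsKahlerOff.nablaSubNormSq_nonneg (hK : IsKahlerOff D g J) (φ : Form n X m)
    (β : CoForm n X m) {x : X} (hx : x ∉ D) : 0 ≤ nablaSubNormSq g φ β x :=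
  div_nonneg (tensorNormSq_nonneg (hK.posDef_coeff (chartAt_mem x) (chartAt_mem_chartDom hx)) _)
    (Nat.cast_nonneg _)

lemma IsKahlerOff.coNormSq_nonneg (hK : IsKahlerOff D g J) (β : CoForm n X m) {x : X}
    (hx : x ∉ D) : 0 ≤ β.normSq g x :=
  div_nonneg (tensorNormSq_nonneg (hK.posDef_coeff (chartAt_mem x) (chartAt_mem_chartDom hx)) _)
    (Nat.cast_nonneg _)

lemma nablaComp_sub {φ φ' : Form n X m} {ψ : OpenPartialHomeomorph X (E n)} {y : E n}
    (hφ : ∀ I, DifferentiableAt ℝ (φ.comp ψ I) y) (hφ' : ∀ I, DifferentiableAt ℝ (φ'.comp ψ I) y)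
    (I : Fin (m + 1) → Fin (2 * n)) :
    nablaComp g (φ - φ') ψ I y = nablaComp g φ ψ I y - nablaComp g φ' ψ I y := by
  have h1 : ∀ I, (φ - φ').comp ψ I = φ.comp ψ I - φ'.comp ψ I := fun I => rfl
  simp only [nablaComp, h1, pd, Pi.sub_apply, mul_sub, Finset.sum_sub_distrib]
  rw [fderiv_sub (hφ _) (hφ' _), ContinuousLinearMap.sub_apply]
  ring

lemma IsKahlerOff.graphNormSq_sub_le (hK : IsKahlerOff D g J) (hD : IsClosed D)
    {φ φ' : Form n X m} (hφ : φ.SmoothOff D) (hφ' : φ'.SmoothOff D) {x : X} (hx : x ∉ D) :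
    graphNormSq g (φ - φ') x ≤ 2 * graphNormSq g φ x + 2 * graphNormSq g φ' x := by
  have hy := chartAt_mem_chartDom (n := n) hx
  have hpos := hK.posDef_coeff (chartAt_mem (n := n) x) hy
  have h1 := hK.normSq_add_le φ (-φ') hx
  rw [normSq_neg, ← sub_eq_add_neg] at h1
  have h2 : gradSq g (φ - φ') x ≤ 2 * gradSq g φ x + 2 * gradSq g φ' x := by
    have h := tensorNormSq_add_le hpos
      (fun I => nablaComp g φ (chartAt (E n) x) I (chartAt (E n) x x))
      (-fun I => nablaComp g φ' (chartAt (E n) x) I (chartAt (E n) x x))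
    rw [tensorNormSq_neg] at h
    simp only [gradSq, mul_div_assoc', ← add_div]
    gcongr
    refine le_trans (le_of_eq ?_) h
    congr 1
    ext I
    rw [nablaComp_sub (fun I => (hφ.contDiffAt hD (chart_mem_atlas _ _) hy I).differentiableAt
      (by simp)) (fun I => (hφ'.contDiffAt hD (chart_mem_atlas _ _) hy I).differentiableAt
      (by simp))]
    simp [sub_eq_add_neg]
  simp only [graphNormSq]
  linarith

variable [MeasurableSpace X] [BorelSpace X]

lemma CoForm.MeasurableOff.aemeasurable_normSq (hK : IsKahlerOff D g J) (hD : IsClosed D)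
    {β : CoForm n X m} (hβ : β.MeasurableOff D) :
    AEMeasurable (fun x => ENNReal.ofReal (β.normSq g x)) (vol D g) :=
  aemeasurable_of_ae_eq_chart hK hD fun ψ hψ =>
    have hψ' : ψ ∈ 𝒜 := IsManifold.subset_maximalAtlas hψ
    ⟨_, (aemeasurable_tensorNormSq hK hD hψ' (A := fun y I => β.comp ψ I y)
      (hβ ψ hψ)).div_const _, fun _ hy => hK.coNormSq_symm β hψ' hy⟩

lemma Form.SmoothOff.measurableOff (hD : IsClosed D) {φ : Form n X m} (hφ : φ.SmoothOff D) :
    φ.MeasurableOff D := fun ψ hψ I =>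
  (hφ ψ hψ I).continuousOn.aestronglyMeasurable (isOpen_chartDom hD ψ).measurableSet

lemma aemeasurable_vol_of_continuousOn (hK : IsKahlerOff D g J) (hD : IsClosed D) {F : X → ℝ}
    (hF : ContinuousOn F Dᶜ) : AEMeasurable (fun x => ENNReal.ofReal (F x)) (vol D g) := by
  have h1 := measurable_indicator_of_continuousOn hD.isOpen_compl.measurableSet
    (ENNReal.continuous_ofReal.comp_continuousOn hF)
  refine h1.aemeasurable.congr ?_
  filter_upwards [ae_vol_notMem hK hD] with x hx
  rw [indicator_of_mem (show x ∈ Dᶜ from hx)]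
  rfl

lemma Form.SmoothOff.sub {φ φ' : Form n X m} (hφ : φ.SmoothOff D) (hφ' : φ'.SmoothOff D) :
    (φ - φ').SmoothOff D := fun ψ hψ I => (hφ ψ hψ I).sub (hφ' ψ hψ I)

lemma energy_sub_le (hK : IsKahlerOff D g J) (hD : IsClosed D) {φ φ' : Form n X m}
    (hφ : φ.SmoothOff D) (hφ' : φ'.SmoothOff D) :
    energy D g (φ - φ') ≤ 2 * energy D g φ + 2 * energy D g φ' := by
  have hm : AEMeasurable (fun x => ENNReal.ofReal (graphNormSq g φ x)) (vol D g) :=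
    aemeasurable_vol_of_continuousOn hK hD
      ((hK.continuousOn_normSq hD hφ).add (hK.continuousOn_gradSq hD hφ))
  rw [energy, energy, energy, ← lintegral_const_mul' _ _ (by simp),
    ← lintegral_const_mul' _ _ (by simp), ← lintegral_add_left' (hm.const_mul _)]
  refine lintegral_mono_ae ?_
  filter_upwards [ae_vol_notMem hK hD] with x hx
  exact ofReal_le_two_add_two (add_nonneg (hK.normSq_nonneg _ hx) (hK.gradSq_nonneg _ hx))
    (add_nonneg (hK.normSq_nonneg _ hx) (hK.gradSq_nonneg _ hx))
    (hK.graphNormSq_sub_le hD hφ hφ' hx)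

/-- The energy of an approximation of a Sobolev form. -/
lemma energy_le (hK : IsKahlerOff D g J) (hD : IsClosed D) {φ α : Form n X m} {β : CoForm n X m}
    (hφ : φ.SmoothOff D) (hα : α.MeasurableOff D) (hβ : β.MeasurableOff D) :
    energy D g φ ≤ (2 * (∫⁻ x, ENNReal.ofReal (α.normSq g x) ∂(vol D g)) +
        2 * ∫⁻ x, ENNReal.ofReal ((φ - α).normSq g x) ∂(vol D g)) +
      (2 * (∫⁻ x, ENNReal.ofReal (β.normSq g x) ∂(vol D g)) +
        2 * ∫⁻ x, ENNReal.ofReal (nablaSubNormSq g φ β x) ∂(vol D g)) := by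
  have h1 := lintegral_normSq_add_le hK hD (φ' := φ - α) hα
  rw [add_sub_cancel] at h1
  have h2 : ∫⁻ x, ENNReal.ofReal (gradSq g φ x) ∂(vol D g) ≤
      2 * (∫⁻ x, ENNReal.ofReal (β.normSq g x) ∂(vol D g)) +
        2 * ∫⁻ x, ENNReal.ofReal (nablaSubNormSq g φ β x) ∂(vol D g) := by
    rw [← lintegral_const_mul' _ _ (by simp), ← lintegral_const_mul' _ _ (by simp),
      ← lintegral_add_left' ((hβ.aemeasurable_normSq hK hD).const_mul _)]
    refine lintegral_mono_ae ?_
    filter_upwards [ae_vol_notMem hK hD] with x hx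
    refine ofReal_le_two_add_two (hK.coNormSq_nonneg _ hx) (hK.nablaSubNormSq_nonneg _ _ hx) ?_
    linarith [hK.gradSq_le φ β hx]
  refine le_trans ?_ (add_le_add h1 h2)
  rw [energy, ← lintegral_add_left'
    (aemeasurable_vol_of_continuousOn hK hD (hK.continuousOn_normSq hD hφ))]
  exact lintegral_mono fun x => ENNReal.ofReal_add_le

/-- A sequence of smooth forms of bounded energy has a Cauchy subsequence. -/
theorem NormCompactOn.exists_cauchy_subseq (h : NormCompactOn D g m univ)
    (hK : IsKahlerOff D g J) (hD : IsClosed D) {φ : ℕ → Form n X m} (hφ : ∀ j, (φ j).SmoothOff D)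
    {C : ℝ≥0∞} (hC : C ≠ ⊤) (hφC : ∀ j, energy D g (φ j) ≤ C) :
    ∃ σ : ℕ → ℕ, StrictMono σ ∧ ∀ ε : ℝ≥0∞, 0 < ε → ∃ N, ∀ i ≥ N, ∀ j ≥ N,
      ∫⁻ x, ENNReal.ofReal ((φ (σ i) - φ (σ j)).normSq g x) ∂(vol D g) ≤ ε := by
  -- The values `η = 1/(k+1)` suffice, so only countably many functionals occur in total.
  choose L A hA hL hb using fun k : ℕ => h ((k : ℝ≥0∞) + 1)⁻¹
    (ENNReal.inv_ne_zero.2 (ENNReal.add_ne_top.2 ⟨ENNReal.natCast_ne_top k, ENNReal.one_ne_top⟩))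
  set Λ : Set (Form n X m → ℂ) := ⋃ k, {ℓ | ℓ ∈ L k} with hΛ
  have hΛc : Λ.Countable := countable_iUnion fun k => (L k).finite_toSet.countable
  have : Countable Λ := hΛc.to_subtype
  have hbdd : ∀ ℓ : Λ, IsBddFunctional D g ℓ.1 := fun ℓ => by
    obtain ⟨k, hk⟩ := mem_iUnion.1 ℓ.2
    exact hL k _ hk
  have hball : ∀ ℓ : Λ, ∃ R : ℝ, ∀ j, ℓ.1 (φ j) ∈ Metric.closedBall (0 : ℂ) R := fun ℓ => by
    obtain ⟨-, B, hB, hℓ⟩ := hbdd ℓ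
    have hBC : B * C ≠ ⊤ := ENNReal.mul_ne_top hB hC
    refine ⟨√(B * C).toReal, fun j => ?_⟩
    have h1 : ‖ℓ.1 (φ j)‖ₑ ^ 2 ≤ B * C := (hℓ _ (hφ j)).trans (by gcongr; exact hφC j)
    have h2 := ENNReal.toReal_mono hBC h1
    rw [ENNReal.toReal_pow, toReal_enorm] at h2
    rw [mem_closedBall_zero_iff]
    exact Real.le_sqrt_of_sq_le h2
  choose R hR using hball
  -- Instead of a diagonal argument: a countable product of closed discs is compact and metrizable,
  -- so one subsequence makes all functionals converge.
  obtain ⟨z, -, σ, hσ, hz⟩ := (isCompact_univ_pi fun ℓ : Λ =>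
    isCompact_closedBall (0 : ℂ) (R ℓ)).tendsto_subseq
    (x := fun j (ℓ : Λ) => ℓ.1 (φ j)) (fun j ℓ _ => hR ℓ j)
  refine ⟨σ, hσ, fun ε hε => ?_⟩
  have hsmall : Tendsto (fun k : ℕ => ((k : ℝ≥0∞) + 1)⁻¹ * (2 * C + 2 * C)) atTop (𝓝 0) := by
    have h1 : Tendsto (fun k : ℕ => ((k : ℝ≥0∞) + 1)⁻¹) atTop (𝓝 0) := by
      have := ENNReal.tendsto_inv_nat_nhds_zero.comp (tendsto_add_atTop_nat 1)
      simpa [Function.comp_def] using this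
    have h2 := ENNReal.Tendsto.mul_const (b := 2 * C + 2 * C) h1 (Or.inr (by finiteness))
    rwa [zero_mul] at h2
  have hε2 : 0 < ε / 2 := ENNReal.half_pos hε.ne'
  obtain ⟨k, hk⟩ := (hsmall.eventually_lt_const hε2).exists
  have hlist : Tendsto (fun ij : ℕ × ℕ => A k * ((L k).map fun ℓ =>
      ‖ℓ (φ (σ ij.1)) - ℓ (φ (σ ij.2))‖ₑ ^ 2).sum) atTop (𝓝 0) := by
    have h1 : Tendsto (fun ij : ℕ × ℕ => ((L k).map fun ℓ =>
        ‖ℓ (φ (σ ij.1)) - ℓ (φ (σ ij.2))‖ₑ ^ 2).sum) atTop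
        (𝓝 ((L k).map fun _ => (0 : ℝ≥0∞)).sum) := by
      refine tendsto_list_sum (L k) fun ℓ hℓ => ?_
      have h2 : Tendsto (fun j => ℓ (φ (σ j))) atTop (𝓝 (z ⟨ℓ, mem_iUnion.2 ⟨k, hℓ⟩⟩)) :=
        (tendsto_pi_nhds.1 hz) ⟨ℓ, mem_iUnion.2 ⟨k, hℓ⟩⟩
      rw [← prod_atTop_atTop_eq]
      have h3 := (h2.comp tendsto_fst).sub (h2.comp (tendsto_snd (f := atTop (α := ℕ))))
      rw [sub_self] at h3
      have h4 := ((ENNReal.continuous_pow 2).tendsto _).comp h3.enorm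
      simpa [Function.comp_def] using h4
    have h5 := ENNReal.Tendsto.const_mul h1 (Or.inr (hA k))
    simpa using h5
  obtain ⟨N, hN⟩ := eventually_atTop_prod_self.1 (hlist.eventually_lt_const hε2)
  refine ⟨N, fun i hi j hj => ?_⟩
  have hsub := (hφ (σ i)).sub (hφ (σ j))
  have h1 := hb k _ hsub
  rw [Measure.restrict_univ] at h1
  have h2 : (L k).map (fun ℓ => ‖ℓ (φ (σ i) - φ (σ j))‖ₑ ^ 2) =
      (L k).map fun ℓ => ‖ℓ (φ (σ i)) - ℓ (φ (σ j))‖ₑ ^ 2 :=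
    List.map_congr_left fun ℓ hℓ => by rw [(hL k ℓ hℓ).1 _ _ (hφ _) (hφ _)]
  rw [h2] at h1
  refine h1.trans ?_
  rw [← ENNReal.add_halves ε]
  refine add_le_add (hN i j hi hj).le (le_trans ?_ hk.le)
  gcongr
  refine (energy_sub_le hK hD (hφ _) (hφ _)).trans ?_
  gcongr
  · exact hφC _
  · exact hφC _

lemma lintegral_le_sq_of_l2_le {f : X → ℝ} {c : ℝ≥0∞} (h : l2 D g f ≤ c) :
    ∫⁻ x, ENNReal.ofReal (f x) ∂(vol D g) ≤ c ^ 2 := by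
  have h1 := ENNReal.rpow_le_rpow h (zero_le_two (α := ℝ))
  rw [l2, ← ENNReal.rpow_mul, ENNReal.rpow_two] at h1
  simpa using h1

/-- Forms bounded in the Sobolev norm are close to smooth forms of bounded energy. -/
lemma exists_smooth_approx (hK : IsKahlerOff D g J) (hD : IsClosed D) {p q : ℕ}
    {α : Form n X (p + q)} (hα : α ∈ SobolevForms D g J p q) {C : ℝ≥0∞} (hC : C < ⊤)
    (hαC : sobolevNorm D g J p q α ≤ C) {e : ℝ≥0∞} (he : 0 < e) (he1 : e ≤ 1) :
    ∃ φ : Form n X (p + q), φ.SmoothOff D ∧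
      ∫⁻ x, ENNReal.ofReal ((φ - α).normSq g x) ∂(vol D g) ≤ e ^ 2 ∧
      energy D g φ ≤ 4 * (C + 1) ^ 2 + 4 * (C + 1) ^ 2 := by
  have h1 : l2Norm D g α ≤ C := le_self_add.trans hαC
  -- Enlarging the bound by `1` allows a derivative `β` to be chosen without the infimum being
  -- attained.
  have h2 : ⨅ (β : CoForm n X (p + q)) (_ : HasSobolevDeriv D g J p q α β),
      l2 D g (β.normSq g) < C + 1 :=
    (le_add_self.trans hαC).trans_lt (ENNReal.lt_add_right hC.ne one_ne_zero)
  obtain ⟨β, h3⟩ := iInf_lt_iff.1 h2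
  obtain ⟨⟨hβm, -, φ, hφ, hφα, hφβ⟩, hβ⟩ := iInf_lt_iff.1 h3
  obtain ⟨j, hj1, hj2⟩ := ((hφα.eventually_lt_const he).and
    (hφβ.eventually_lt_const one_pos)).exists
  have i1 := lintegral_le_sq_of_l2_le h1
  have i2 := lintegral_le_sq_of_l2_le hj1.le
  have i3 := lintegral_le_sq_of_l2_le hβ.le
  have i4 := lintegral_le_sq_of_l2_le hj2.le
  refine ⟨φ j, (hφ j).1, i2, (energy_le hK hD (hφ j).1 hα.1.1 hβm).trans ?_⟩
  have j1 : C ^ 2 ≤ (C + 1) ^ 2 := by gcongr; exact le_self_add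
  have j2 : e ^ 2 ≤ (C + 1) ^ 2 := by gcongr; exact he1.trans le_add_self
  have j4 : (1 : ℝ≥0∞) ^ 2 ≤ (C + 1) ^ 2 := by gcongr; exact le_add_self
  have h4 : (4 : ℝ≥0∞) * (C + 1) ^ 2 = 2 * (C + 1) ^ 2 + 2 * (C + 1) ^ 2 := by ring
  rw [h4]
  gcongr
  · exact i1.trans j1
  · exact i2.trans j2
  · exact i4.trans j4

/-- The compact embedding, for a metric satisfying a compactness estimate. -/
theorem NormCompactOn.exists_l2_subseq (hK : IsKahlerOff D g J) (hD : IsClosed D) {p q : ℕ}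
    (h : NormCompactOn D g (p + q) univ) {α : ℕ → Form n X (p + q)}
    (hα : ∀ j, α j ∈ SobolevForms D g J p q) {C : ℝ≥0∞} (hC : C < ⊤)
    (hαC : ∀ j, sobolevNorm D g J p q (α j) ≤ C) :
    ∃ α' ∈ L2Forms D g J p q, ∃ σ : ℕ → ℕ, StrictMono σ ∧
      Tendsto (fun j => l2Norm D g (α (σ j) - α')) atTop (𝓝 0) := by
  have he : ∀ j : ℕ, 0 < ((j : ℝ≥0∞) + 1)⁻¹ ∧ ((j : ℝ≥0∞) + 1)⁻¹ ≤ 1 := fun j =>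
    ⟨ENNReal.inv_pos.2 (ENNReal.add_ne_top.2 ⟨ENNReal.natCast_ne_top j, ENNReal.one_ne_top⟩),
      ENNReal.inv_le_one.2 le_add_self⟩
  choose φ hφ hφα hφe using fun j => exists_smooth_approx hK hD (hα j) hC (hαC j) (he j).1 (he j).2
  obtain ⟨σ, hσ, hc⟩ := h.exists_cauchy_subseq hK hD hφ
    (C := 4 * (C + 1) ^ 2 + 4 * (C + 1) ^ 2) (by have := hC.ne; finiteness) hφe
  have hsmall : Tendsto (fun j : ℕ => (((σ j : ℕ) : ℝ≥0∞) + 1)⁻¹ ^ 2) atTop (𝓝 0) := by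
    have h1 := ENNReal.tendsto_inv_nat_nhds_zero.comp
      ((tendsto_add_atTop_nat 1).comp hσ.tendsto_atTop)
    have h2 := ((ENNReal.continuous_pow 2).tendsto _).comp h1
    simpa [Function.comp_def] using h2
  obtain ⟨α', hα', hlim⟩ := exists_l2_limit hK hD (α := fun j => α (σ j)) (fun j => (hα _).1)
    fun ε hε => by
      have hε4 : 0 < ε / 2 / 2 := ENNReal.half_pos (ENNReal.half_pos hε.ne').ne'
      -- The inequality `‖a + b‖² ≤ 2 ‖a‖² + 2 ‖b‖²` is applied twice, and `2 (ε/4) + 2 (2 (ε/16) +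
      -- 2 (ε/16)) = ε`.
      have hε8 : 0 < ε / 2 / 2 / 2 / 2 := ENNReal.half_pos (ENNReal.half_pos hε4.ne').ne'
      obtain ⟨N, hN⟩ := hc _ hε4
      obtain ⟨N', hN'⟩ := eventually_atTop.1 (hsmall.eventually_lt_const hε8)
      refine ⟨max N N', fun i hi j hj => ?_⟩
      have e1 := hN i (le_trans (le_max_left _ _) hi) j (le_trans (le_max_left _ _) hj)
      have e2 := (hφα (σ i)).trans (hN' i (le_trans (le_max_right _ _) hi)).le
      have e3 := (hφα (σ j)).trans (hN' j (le_trans (le_max_right _ _) hj)).le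
      have m1 : ∀ i, (φ (σ i)).MeasurableOff D := fun i => (hφ _).measurableOff hD
      have m2 : ∀ i, (φ (σ i) - α (σ i)).MeasurableOff D := fun i => (m1 i).sub (hα _).1.1
      have hdec : α (σ i) - α (σ j) = (φ (σ i) - φ (σ j)) +
          ((φ (σ j) - α (σ j)) + -(φ (σ i) - α (σ i))) := by abel
      have k1 := lintegral_normSq_add_le hK hD (φ' := -(φ (σ i) - α (σ i))) (m2 j)
      simp only [normSq_neg] at k1
      have k2 := lintegral_normSq_add_le hK hD
        (φ' := (φ (σ j) - α (σ j)) + -(φ (σ i) - α (σ i))) ((m1 i).sub (m1 j))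
      rw [← hdec] at k2
      calc _ ≤ _ := k2
        _ ≤ 2 * (ε / 2 / 2) +
            2 * (2 * (ε / 2 / 2 / 2 / 2) + 2 * (ε / 2 / 2 / 2 / 2)) := by
          gcongr
          refine k1.trans ?_
          gcongr
        _ = ε := by
          have hh : ∀ x : ℝ≥0∞, 2 * (x / 2) = x := fun x =>
            ENNReal.mul_div_cancel two_ne_zero ENNReal.ofNat_ne_top
          rw [hh, hh, ENNReal.add_halves, hh, ENNReal.add_halves]
  exact ⟨α', hα', σ, hσ, hlim⟩

end Embedding

end SingularKahler

end

theorem mainTheorem10 {n : ℕ} {X : Type*} [TopologicalSpace X] [T2Space X] [CompactSpace X]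
    [ChartedSpace (SingularKahler.E n) X] [IsManifold 𝓘(ℝ, SingularKahler.E n) ∞ X]
    [MeasurableSpace X] [BorelSpace X]
    (D : Set X) (k : ℕ) (s t : ℝ)
    (g : SingularKahler.BilinField (n := n) X) (J : SingularKahler.EndField (n := n) X)
    (hX : SingularKahler.IsSingularKahler D k s t g J) (p q : ℕ) :
    SingularKahler.SobolevForms D g J p q ⊆ SingularKahler.L2Forms D g J p q ∧
    (∀ α ∈ SingularKahler.SobolevForms D g J p q,
      SingularKahler.l2Norm D g α ≤ SingularKahler.sobolevNorm D g J p q α) ∧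
    ∀ α : ℕ → SingularKahler.Form n X (p + q),
      (∀ j, α j ∈ SingularKahler.SobolevForms D g J p q) →
      (∃ C : ℝ≥0∞, C < ⊤ ∧ ∀ j, SingularKahler.sobolevNorm D g J p q (α j) ≤ C) →
      ∃ α' ∈ SingularKahler.L2Forms D g J p q, ∃ σ : ℕ → ℕ, StrictMono σ ∧
        Tendsto (fun j => SingularKahler.l2Norm D g (α (σ j) - α')) atTop (𝓝 0) := by
  -- The embedding is bounded with constant `1`, since the `L²` norm is a summand of the Sobolev
  -- norm.
  refine ⟨fun _ h => h.1, fun _ _ => le_self_add, fun α hα ⟨C, hC, hαC⟩ => ?_⟩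
  exact (hX.normCompactOn_univ (p + q)).exists_l2_subseq hX.kahler hX.isClosed hα hC hαC
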